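/- Fix $n,d\ge 0$. A decision tree over $x_1,\dots,x_n$ is a rooted binary tree whose internal nodes are labelled by variables and whose leaves are labelled by elements of $\{0,1\}$; on input $x\in\{0,1\}^n$ one descends from the root, going left or right at a node labelled $x_i$ according to whether $x_i=0$ or $x_i=1$, and outputs the label of the leaf reached. Let $\mathrm{DT}_d$ be the class of functions $f:\{0,1\}^n\to\{0,1\}$ computed by decision trees of depth at most $d$ (the depth is the largest number of edges on a path from the root to a leaf). For a probability distribution $\mathcal D$ on $\{0,1\}^n$, a function $f$ is $\varepsilon$-far from $\mathrm{DT}_d$ with respect to $\mathcal D$ if $\Pr_{x\sim\mathcal D}[g(x)\ne f(x)]>\varepsilon$ for every $g\in\mathrm{DT}_d$. **Theorem.** There is a randomized algorithm (one program for a randomized word RAM) that receives $n$, $d$ and $\lceil 1/\varepsilon\rceil$ as input, where $\varepsilon>0$, and has access to an unknown function $f:\{0,1\}^n\to\{0,1\}$ through black box queries (given $x$, return $f(x)$) and random example queries (return $(x,f(x))$ with a fresh independent $x\sim\mathcal D$, where $\mathcal D$ is an arbitrary unknown distribution on $\{0,1\}^n$), such that for all $n,d,\varepsilon,f,\mathcal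 D$: 1. if $f\in\mathrm{DT}_d$, the algorithm accepts with probability at least $2/3$; 2. if $f$ is $\varepsilon$-far from $\mathrm{DT}_d$ with respect to $\mathcal D$, the algorithm rejects with probability at least $2/3$; 3. on every random outcome, the algorithm makes at most $\tilde O(2^{2d}+2^d/\varepsilon)$ queries (of both kinds together) and halts within time $$2^{O(d^2)}+n\cdot\tilde O\bigl(2^{2d}+2^d/\varepsilon\bigr).$$ Here $\tilde O(X)$ means at most $C\,X\,(1+\log X)^{C}$ and $2^{O(d^2)}$ means at most $C\,2^{C d^2}$, for an absolute constant $C$. The machine has words of $O(\log n+d+\log(1+1/\varepsilon)+1)$ bits; arithmetic and comparisons of words, memory accesses with indirect addressing, tests, and fair coin tosses take one unit of time, and a query takes $n+1$ units. -/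

import Mathlib

namespace DTTest

/-- Decision trees over the variables `x_0, …, x_{n-1}`. -/
inductive DTree (n : ℕ) : Type
  | leaf (b : Bool) : DTree n
  | node (i : Fin n) (left right : DTree n) : DTree n

/-- The function computed by a tree: go left if the variable is `0`, right if it is `1`. -/
def DTree.eval {n : ℕ} : DTree n → (Fin n → Bool) → Bool
  | .leaf b, _ => b
  | .node i l r, x => if x i = true then r.eval x else l.eval x

/-- The largest number of edges on a path from the root to a leaf. -/
def DTree.depth {n : ℕ} : DTree n → ℕ
  | .leaf _ => 0
  | .node _ l r => max l.depth r.depth + 1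

/-- The Boolean functions on `{0,1}^n` computed by a decision tree of depth at most `d`. -/
def DT (n d : ℕ) : Set ((Fin n → Bool) → Bool) :=
  {f | ∃ T : DTree n, T.depth ≤ d ∧ ∀ x, T.eval x = f x}

/-- `f` is `ε`-far from the class `H` with respect to the distribution `D`:
`Pr_{x ∼ D}[g(x) ≠ f(x)] > ε` for every `g ∈ H`. -/
def IsFar {n : ℕ} (D : PMF (Fin n → Bool)) (ε : ℝ)
    (f : (Fin n → Bool) → Bool) (H : Set ((Fin n → Bool) → Bool)) : Prop :=
  ∀ g ∈ H, ENNReal.ofReal ε < D.toOuterMeasure {x | g x ≠ f x}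

/-! ### Randomized word RAM with a black box and a random example oracle

A machine has registers and a random access memory, all holding words of `w` bits, i.e. numbers
below `2 ^ w`.  Programs are finite texts and do not depend on any input parameter. -/

/-- Binary word operations; the results are reduced modulo `2 ^ w`, comparisons return `0` or `1`,
subtraction is truncated at `0`, and division by `0` gives `0`. -/
inductive Op : Type
  | add | sub | mul | div | mod | lt | eq

def Op.eval (w : ℕ) : Op → ℕ → ℕ → ℕ
  | .add, a, b => (a + b) % 2 ^ w
  | .sub, a, b => (a - b) % 2 ^ w
  | .mul, a, b => (a * b) % 2 ^ w
  | .div, a, b => (a / b) % 2 ^ w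
  | .mod, a, b => (a % b) % 2 ^ w
  | .lt, a, b => (if a < b then 1 else 0) % 2 ^ w
  | .eq, a, b => (if a = b then 1 else 0) % 2 ^ w

/-- Programs.  Arguments called `r, a, b, p` are names of registers. -/
inductive Prog : Type
  /-- do nothing -/
  | skip : Prog
  /-- `r := v` -/
  | const (r v : ℕ) : Prog
  /-- `r := a o b` -/
  | op (o : Op) (r a b : ℕ) : Prog
  /-- `r := memory[p]` -/
  | load (r p : ℕ) : Prog
  /-- `memory[p] := r` -/
  | store (p r : ℕ) : Prog
  /-- `r :=` a fresh fair random bit -/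
  | coin (r : ℕ) : Prog
  /-- black box query: `r := f(x)` for the `x ∈ {0,1}^n` stored in `memory[p], …, memory[p+n-1]` -/
  | query (p r : ℕ) : Prog
  /-- random example query: draw `x ∼ D`, write `x` to `memory[p], …, memory[p+n-1]` and set
  `r := f(x)` -/
  | sample (p r : ℕ) : Prog
  | seq (P Q : Prog) : Prog
  /-- if `r ≠ 0` then `P` else `Q` -/
  | ite (r : ℕ) (P Q : Prog) : Prog
  /-- while `r ≠ 0` do `P` -/
  | loop (r : ℕ) (P : Prog) : Prog

/-- A configuration of the machine: the stack of programs that remain to be executed, the contents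
of registers and memory, the elapsed time and the number of oracle queries made so far. -/
@[ext] structure Config : Type where
  ctrl : List Prog
  reg : ℕ → ℕ
  mem : ℕ → ℕ
  time : ℕ
  queries : ℕ

/-- The `n`-bit string stored from address `p` on (a cell holds the bit `0` iff it is `0`). -/
def readBits (n : ℕ) (mem : ℕ → ℕ) (p : ℕ) : Fin n → Bool :=
  fun i => decide (mem (p + i) ≠ 0)

/-- Write the `n`-bit string `x` into memory from address `p` on. -/
def writeBits {n : ℕ} (mem : ℕ → ℕ) (p : ℕ) (x : Fin n → Bool) : ℕ → ℕ :=
  fun j => if h : p ≤ j ∧ j < p + n then (x ⟨j - p, by omega⟩).toNat else mem j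

/-- Execution of one step.  A step takes one unit of time; an oracle query takes `n` further
units. A halted machine (empty control stack) stays as it is. -/
noncomputable def step {n : ℕ} (w : ℕ) (f : (Fin n → Bool) → Bool) (D : PMF (Fin n → Bool))
    (s : Config) : PMF Config :=
  match s.ctrl with
  | [] => PMF.pure s
  | .skip :: K =>
      PMF.pure { s with ctrl := K, time := s.time + 1 }
  | .const r v :: K =>
      PMF.pure { s with
        ctrl := K, time := s.time + 1, reg := Function.update s.reg r (v % 2 ^ w) }
  | .op o r a b :: K =>
      PMF.pure { s with
        ctrl := K, time := s.time + 1,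
        reg := Function.update s.reg r (o.eval w (s.reg a) (s.reg b)) }
  | .load r p :: K =>
      PMF.pure { s with
        ctrl := K, time := s.time + 1, reg := Function.update s.reg r (s.mem (s.reg p)) }
  | .store p r :: K =>
      PMF.pure { s with
        ctrl := K, time := s.time + 1, mem := Function.update s.mem (s.reg p) (s.reg r) }
  | .coin r :: K =>
      (PMF.uniformOfFintype Bool).map fun b => { s with
        ctrl := K, time := s.time + 1, reg := Function.update s.reg r b.toNat }
  | .query p r :: K =>
      PMF.pure { s with
        ctrl := K, time := s.time + 1 + n, queries := s.queries + 1,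
        reg := Function.update s.reg r (f (readBits n s.mem (s.reg p))).toNat }
  | .sample p r :: K =>
      D.map fun x => { s with
        ctrl := K, time := s.time + 1 + n, queries := s.queries + 1,
        reg := Function.update s.reg r (f x).toNat,
        mem := writeBits s.mem (s.reg p) x }
  | .seq P Q :: K =>
      PMF.pure { s with ctrl := P :: Q :: K, time := s.time + 1 }
  | .ite r P Q :: K =>
      PMF.pure { s with
        ctrl := (if s.reg r ≠ 0 then P else Q) :: K, time := s.time + 1 }
  | .loop r P :: K =>
      PMF.pure { s with
        ctrl := (if s.reg r ≠ 0 then P :: .loop r P :: K else K), time := s.time + 1 }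

/-- The initial configuration of the program `P`: register `0` holds `n`, register `1` holds `d`,
register `2` holds `m`; all other registers and all memory cells hold `0`. -/
def initConfig (P : Prog) (n d m : ℕ) : Config where
  ctrl := [P]
  reg := fun r => if r = 0 then n else if r = 1 then d else if r = 2 then m else 0
  mem := fun _ => 0
  time := 0
  queries := 0

/-- The distribution of the configuration after `t` steps from `s`. -/
noncomputable def run {n : ℕ} (w : ℕ) (f : (Fin n → Bool) → Bool) (D : PMF (Fin n → Bool))
    (s : Config) : ℕ → PMF Config
  | 0 => PMF.pure s
  | t + 1 => (run w f D s t).bind (step w f D)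

def Config.Halted (s : Config) : Prop := s.ctrl = []

/-- The machine halts and accepts: register `0` is nonzero at the end. -/
def Config.Accepts (s : Config) : Prop := s.Halted ∧ s.reg 0 ≠ 0

/-- The machine halts and rejects: register `0` is zero at the end. -/
def Config.Rejects (s : Config) : Prop := s.Halted ∧ s.reg 0 = 0

/-- The word length `c · (⌊log₂ n⌋ + d + ⌊log₂ m⌋ + O(1))`. -/
def wordLength (c n d m : ℕ) : ℕ := c * (Nat.size n + d + Nat.size m + 1)

/-- `C · X · (1 + log X)^C`: for a constant `C` and `X ≥ 1` this is the bound `Õ(X)`. -/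
noncomputable def softBound (C : ℕ) (X : ℝ) : ℝ := C * X * (1 + Real.log X) ^ C

/-- On parameters `n, d, ε` and oracles for `f` and `D`, the program `P`, run with words of `w`
bits and started on the input `n, d, ⌈1/ε⌉`, halts on every random outcome, within time `T` and
after at most `q` oracle queries, accepts with probability at least `2/3` if `f ∈ DT n d`, and
rejects with probability at least `2/3` if `f` is `ε`-far from `DT n d` with respect to `D`. -/
def TestsWithin (P : Prog) (w n d : ℕ) (ε : ℝ) (f : (Fin n → Bool) → Bool)
    (D : PMF (Fin n → Bool)) (q T : ℝ) : Prop :=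
  ∃ t : ℕ,
    (∀ s ∈ (run w f D (initConfig P n d ⌈1 / ε⌉₊) t).support,
      s.Halted ∧ (s.queries : ℝ) ≤ q ∧ (s.time : ℝ) ≤ T) ∧
    (f ∈ DT n d →
      2 / 3 ≤ (run w f D (initConfig P n d ⌈1 / ε⌉₊) t).toOuterMeasure {s | s.Accepts}) ∧
    (IsFar D ε f (DT n d) →
      2 / 3 ≤ (run w f D (initConfig P n d ⌈1 / ε⌉₊) t).toOuterMeasure {s | s.Rejects})

end DTTest

open scoped ENNReal

namespace DTTest

/-! ### Expectations -/

/-! The tester learns a skeleton of the tree and then checks it. The variables are thrown at random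
into $r = 8\cdot 4^d$ blocks by a map $B$. Uniform rows $y\in\{0,1\}^r$ are drawn and labelled by
$F(y)=f(y\circ B)$, and a backtracking search looks for a complete depth-$d$ tree over the blocks
that agrees with all labels; if none exists, the input is rejected. Otherwise each node $i$ with
block $l$ gets a witness, a sample row at which the tree changes when bit $l$ is flipped (any sample
row if there is none). This defines $h_i(z)=f(\text{hybrid})$, where the hybrid equals $z$ on block
$l$ and the witness row elsewhere. If $f$ is a small tree and everything went well, $h_i$ is a
coordinate or its negation, or else a constant, and $h_i(u)\oplus h_i(u\oplus x)$ with $u$ random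
reads off the coordinate at $x$, or zero. Each of $300(d+1)m$ rounds ($m=\lceil
1/\varepsilon\rceil$) draws an example $x\sim\mathcal D$, tests every node, walks down the learned
tree along the reads at $x$ and compares the leaf with $f(x)$.

Soundness does not use the learning phase: it holds for arbitrary functions $h_i$ and arbitrary
leaves. The node test asks that reads respect $(z_1\wedge z_2)\oplus z_3$. If it fails with
probability below $1/36$, the reads agree, at every single point and with error at most twice the
failure probability, with a function $g_i$ that is linear and multiplicative over the field with two
elements, hence a coordinate or zero (`collision_le`, `Corrects.linear`, `Corrects.mul`,
`coordinate_or_zero`). Walking along the $g_i$ is then a decision tree of depth at most $d$. Its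
distance from $f$ is at most the rejection probability of a round plus $2d$ times the failure bound
of a node (`disagreement_le`), so a far $f$ forces every round to reject with probability at least
$1/(150(d+1)m)$ (`roundReject_ge`), and the number of rounds boosts this to $2/3$ (`soundness`).

Completeness: a tree of depth $d$ has fewer than $2^d$ variables, so with probability at least $7/8$
they lie in different blocks (`injOn_probability`). Then $F$ is a depth-$d$ tree over the blocks.
Depth-$d$ trees are polynomials of degree at most $d$ over the field with two elements, and such a
polynomial, if nonzero, is nonzero at a fraction $2^{-d}$ of the points (`DegLT.density`). A union
bound over all candidate trees and all blocks shows that with probability at least $7/8$ every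
consistent tree computes $F$ exactly and every relevant block has a witness
(`goodSamples_probability`). In that event all reads are exact and all rounds accept
(`expect_rounds_of_good`); finally $(7/8)^2\ge 2/3$.

The machine is handled by a quantitative program logic. `Bounds` is a lower bound on an expected
reward, stated for every continuation, that tracks time and queries at the same time; `Spec` says
that a program simulates a given distribution. With reward $1$ it yields halting within the
resources on every random outcome, with an indicator reward the acceptance or rejection probability.
The search visits at most about $(2r)^d = 2^{O(d^2)}$ nodes and makes no queries; the queries are
$\tilde O(4^d)$ labels and $O(2^d)$ reads in each of $O(dm)$ rounds. -/

/-- The expectation of a nonnegative function. -/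
noncomputable def expect {α : Type} (A : PMF α) (φ : α → ℝ≥0∞) : ℝ≥0∞ := ∑' a, A a * φ a

section Expect
variable {α β : Type}

@[simp] theorem expect_pure (a : α) (φ : α → ℝ≥0∞) : expect (PMF.pure a) φ = φ a := by
  classical
  rw [expect, tsum_eq_single a]
  · simp
  · intro b hb
    simp [PMF.pure_apply, hb]

theorem expect_bind (A : PMF α) (B : α → PMF β) (φ : β → ℝ≥0∞) :
    expect (A.bind B) φ = expect A fun a => expect (B a) φ := by
  simp only [expect, PMF.bind_apply, ← ENNReal.tsum_mul_right, ← ENNReal.tsum_mul_left]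
  rw [ENNReal.tsum_comm]
  simp only [mul_assoc]

theorem expect_map (A : PMF α) (g : α → β) (φ : β → ℝ≥0∞) :
    expect (A.map g) φ = expect A fun a => φ (g a) := by
  rw [← PMF.bind_pure_comp, expect_bind]
  simp

theorem expect_mono (A : PMF α) {φ ψ : α → ℝ≥0∞} (h : ∀ a, φ a ≤ ψ a) :
    expect A φ ≤ expect A ψ :=
  ENNReal.tsum_le_tsum fun a => mul_le_mul_right (h a) _

@[simp] theorem expect_const (A : PMF α) (c : ℝ≥0∞) : (expect A fun _ => c) = c := by
  rw [expect, ENNReal.tsum_mul_right, A.tsum_coe, one_mul]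

theorem expect_add (A : PMF α) (φ ψ : α → ℝ≥0∞) :
    (expect A fun a => φ a + ψ a) = expect A φ + expect A ψ := by
  simp only [expect, mul_add, ENNReal.tsum_add]

theorem expect_mul_left (A : PMF α) (c : ℝ≥0∞) (φ : α → ℝ≥0∞) :
    (expect A fun a => c * φ a) = c * expect A φ := by
  simp only [expect, ← ENNReal.tsum_mul_left]
  exact tsum_congr fun a => by ring

theorem expect_comm (A : PMF α) (B : PMF β) (φ : α → β → ℝ≥0∞) :
    (expect A fun a => expect B fun b => φ a b) = expect B fun b => expect A fun a => φ a b := by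
  simp only [expect, ← ENNReal.tsum_mul_left]
  rw [ENNReal.tsum_comm]
  exact tsum_congr fun b => tsum_congr fun a => by ring

theorem expect_le_of_forall_le (A : PMF α) {φ : α → ℝ≥0∞} {c : ℝ≥0∞} (h : ∀ a, φ a ≤ c) :
    expect A φ ≤ c :=
  (expect_mono A h).trans (expect_const A c).le

theorem exists_le_of_expect (A : PMF α) {φ : α → ℝ≥0∞} {c : ℝ≥0∞} (h : expect A φ < c) :
    ∃ a, φ a < c := by
  by_contra! hc
  exact absurd ((expect_const A c).symm.le.trans (expect_mono A hc)) (not_le.2 h)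

theorem toOuterMeasure_eq_expect (A : PMF α) (s : Set α) [DecidablePred (· ∈ s)] :
    A.toOuterMeasure s = expect A fun a => if a ∈ s then 1 else 0 := by
  rw [PMF.toOuterMeasure_apply, expect]
  refine tsum_congr fun a => ?_
  by_cases h : a ∈ s <;> simp [h]

end Expect

/-! ### Running a program: values of configurations -/

/-- An oracle machine: word length, black box and example distribution. -/
structure Oracle (n : ℕ) where
  w : ℕ
  f : (Fin n → Bool) → Bool
  D : PMF (Fin n → Bool)

variable {n : ℕ} (M : Oracle n)

/-- The expected value of `G` after `k` steps. -/
noncomputable def valN (G : Config → ℝ≥0∞) : ℕ → Config → ℝ≥0∞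
  | 0, s => G s
  | k + 1, s => expect (step M.w M.f M.D s) (valN G k)

/-- `run` appends steps at the end, whereas `valN` unfolds the first step; this identity reconciles
the two. -/
theorem run_succ' (w : ℕ) (f : (Fin n → Bool) → Bool) (D : PMF (Fin n → Bool)) (s : Config)
    (t : ℕ) : run w f D s (t + 1) = (step w f D s).bind fun s' => run w f D s' t := by
  induction t with
  | zero => simp [run, PMF.pure_bind]
  | succ t ih => rw [run, ih, PMF.bind_bind]; rfl

theorem expect_run (G : Config → ℝ≥0∞) (k : ℕ) (s : Config) :
    expect (run M.w M.f M.D s k) G = valN M G k s := by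
  induction k generalizing s with
  | zero => simp [run, valN]
  | succ k ih =>
    rw [run_succ', expect_bind, valN]
    simp only [ih]

/-- `G` pays only at halted configurations. -/
def PaysAtHalt (G : Config → ℝ≥0∞) : Prop := ∀ s : Config, s.ctrl ≠ [] → G s = 0

theorem step_of_halted (s : Config) (h : s.ctrl = []) :
    step M.w M.f M.D s = PMF.pure s := by
  unfold step; rw [h]

/-- A reward paid only at halted configurations is never lost, since these are fixed by `step`.
Hence a program that halts early may be credited with its full time bound, and upper bounds on
running times compose. -/
theorem valN_le_succ {G : Config → ℝ≥0∞} (hG : PaysAtHalt G) (k : ℕ) (s : Config) :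
    valN M G k s ≤ valN M G (k + 1) s := by
  induction k generalizing s with
  | zero =>
    by_cases h : s.ctrl = []
    · simp [valN, step_of_halted M s h]
    · simp [valN, hG s h]
  | succ k ih => exact expect_mono _ ih

theorem valN_mono {G : Config → ℝ≥0∞} (hG : PaysAtHalt G) {k l : ℕ} (h : k ≤ l) (s : Config) :
    valN M G k s ≤ valN M G l s := by
  induction l, h using Nat.le_induction with
  | base => exact le_rfl
  | succ l _ ih => exact ih.trans (valN_le_succ M hG l s)

/-- The configuration `s` evolves deterministically into `s'` in `c` steps. -/
def DetSteps (c : ℕ) (s s' : Config) : Prop :=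
  ∀ (G : Config → ℝ≥0∞) (k : ℕ), valN M G (k + c) s = valN M G k s'

variable {M}

theorem DetSteps.trans {a b : ℕ} {s s' s'' : Config} (h : DetSteps M a s s')
    (h' : DetSteps M b s' s'') : DetSteps M (a + b) s s'' := fun G k => by
  rw [add_comm a b, ← add_assoc, h, h']

theorem DetSteps.single {s s' : Config} (h : step M.w M.f M.D s = PMF.pure s') :
    DetSteps M 1 s s' := fun G k => by
  rw [valN, h, expect_pure]

variable (M)

/-! ### Abstract states and the lower bound judgement -/

/-- Registers and memory.  Registers from `900` on are scratch and not part of the abstraction. -/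
structure St : Type where
  reg : ℕ → ℕ
  mem : ℕ → ℕ

def St.set (σ : St) (r v : ℕ) : St := ⟨Function.update σ.reg r v, σ.mem⟩
def St.put (σ : St) (a v : ℕ) : St := ⟨σ.reg, Function.update σ.mem a v⟩
def St.withMem (σ : St) (m : ℕ → ℕ) : St := ⟨σ.reg, m⟩

@[simp] theorem St.set_reg (σ : St) (r v ρ : ℕ) :
    (σ.set r v).reg ρ = if ρ = r then v else σ.reg ρ := by
  simp [St.set, Function.update_apply]
@[simp] theorem St.set_mem (σ : St) (r v : ℕ) : (σ.set r v).mem = σ.mem := rfl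
@[simp] theorem St.put_reg (σ : St) (a v : ℕ) : (σ.put a v).reg = σ.reg := rfl
@[simp] theorem St.put_mem (σ : St) (a v b : ℕ) :
    (σ.put a v).mem b = if b = a then v else σ.mem b := by
  simp [St.put, Function.update_apply]
@[simp] theorem St.withMem_reg (σ : St) (m : ℕ → ℕ) : (σ.withMem m).reg = σ.reg := rfl
@[simp] theorem St.withMem_mem (σ : St) (m : ℕ → ℕ) : (σ.withMem m).mem = m := rfl

def Rep (s : Config) (σ : St) : Prop := (∀ ρ < 900, s.reg ρ = σ.reg ρ) ∧ s.mem = σ.mem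

/-- If `P` is started in state `σ`, then the expectation of `Φ` at the end of its execution is at
least `v`; the execution takes time at most `T` and makes at most `q` queries. -/
def Bounds (P : Prog) (σ : St) (T q : ℕ) (Φ : St → ℝ≥0∞) (v : ℝ≥0∞) : Prop :=
  ∀ (s : Config) (K : List Prog) (k : ℕ) (G : Config → ℝ≥0∞), Rep s σ → s.ctrl = P :: K →
    PaysAtHalt G →
    (∀ s' σ', Rep s' σ' → s'.ctrl = K → s'.time ≤ s.time + T → s'.queries ≤ s.queries + q →
      Φ σ' ≤ valN M G k s') →
    v ≤ valN M G (k + T) s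

/-- From state `σ` the program `P` simulates the random choice of `a ∼ A`, ending in a state
related to `a` by `post`, in time at most `T` and with at most `q` queries. -/
def Spec {α : Type} (P : Prog) (σ : St) (T q : ℕ) (A : PMF α) (post : α → St → Prop) : Prop :=
  ∀ (Φ : St → ℝ≥0∞) (ψ : α → ℝ≥0∞), (∀ a σ', post a σ' → ψ a ≤ Φ σ') →
    Bounds M P σ T q Φ (expect A ψ)

/-- `Spec` for programs without random choices. -/
def Det (P : Prog) (σ : St) (T q : ℕ) (post : St → Prop) : Prop :=
  Spec M P σ T q (PMF.pure ()) fun _ => post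

variable {M}

theorem Bounds.weaken {P : Prog} {σ : St} {T q T' q' : ℕ} {Φ Φ' : St → ℝ≥0∞} {v v' : ℝ≥0∞}
    (h : Bounds M P σ T q Φ v) (hT : T ≤ T') (hq : q ≤ q') (hΦ : ∀ σ, Φ σ ≤ Φ' σ)
    (hv : v' ≤ v) : Bounds M P σ T' q' Φ' v' := by
  intro s K k G hr hs hG hK
  refine hv.trans ((h s K k G hr hs hG fun s' σ' h1 h2 h3 h4 => (hΦ σ').trans
    (hK s' σ' h1 h2 (by omega) (by omega))).trans (valN_mono M hG (by omega) s))

section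
variable {α β : Type} {P Q : Prog} {σ : St} {T q T' q' : ℕ}

theorem Spec.weaken {A : PMF α} {post post' : α → St → Prop} (h : Spec M P σ T q A post)
    (hT : T ≤ T') (hq : q ≤ q') (hp : ∀ a σ', post a σ' → post' a σ') :
    Spec M P σ T' q' A post' := fun Φ ψ hψ =>
  (h Φ ψ fun a σ' ha => hψ a σ' (hp a σ' ha)).weaken hT hq (fun _ => le_rfl) le_rfl

theorem Det.weaken {post post' : St → Prop} (h : Det M P σ T q post)
    (hT : T ≤ T') (hq : q ≤ q') (hp : ∀ σ', post σ' → post' σ') :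
    Det M P σ T' q' post' := Spec.weaken h hT hq fun _ => hp

theorem Spec.map {A : PMF α} {post : α → St → Prop} (h : Spec M P σ T q A post) (g : α → β)
    {post' : β → St → Prop} (hp : ∀ a σ', post a σ' → post' (g a) σ') :
    Spec M P σ T q (A.map g) post' := fun Φ ψ hψ => by
  rw [expect_map]
  exact h Φ (fun a => ψ (g a)) fun a σ' ha => hψ _ _ (hp a σ' ha)

theorem det_iff {post : St → Prop} :
    Det M P σ T q post ↔ ∀ (Φ : St → ℝ≥0∞) (v : ℝ≥0∞), (∀ σ', post σ' → v ≤ Φ σ') →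
      Bounds M P σ T q Φ v := by
  constructor
  · intro h Φ v hv
    have := h Φ (fun _ => v) fun _ => hv
    simpa using this
  · intro h Φ ψ hψ
    rw [expect_pure]
    exact h Φ _ (hψ ())

theorem rep_congr {s s' : Config} {σ : St} (h : Rep s σ) (hr : s'.reg = s.reg)
    (hm : s'.mem = s.mem) : Rep s' σ := by
  unfold Rep; rw [hr, hm]; exact h

theorem Bounds.seq {Φ Φ' : St → ℝ≥0∞} {v : ℝ≥0∞} (h : Bounds M P σ T q Φ v)
    (h' : ∀ σ', Bounds M Q σ' T' q' Φ' (Φ σ')) :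
    Bounds M (.seq P Q) σ (T + T' + 1) (q + q') Φ' v := by
  intro s K k G hr hs hG hK
  have h1 : DetSteps M 1 s { s with ctrl := P :: Q :: K, time := s.time + 1 } :=
    DetSteps.single (by unfold step; rw [hs])
  rw [show k + (T + T' + 1) = (k + T' + T) + 1 by ring, h1]
  refine h _ (Q :: K) (k + T') G (rep_congr hr rfl rfl) rfl hG fun s' σ' hr' hs' ht' hq' => ?_
  refine h' σ' s' K k G hr' hs' hG fun s'' σ'' hr'' hs'' ht'' hq'' => ?_
  refine hK s'' σ'' hr'' hs'' ?_ ?_ <;> simp only at * <;> omega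

/-- The intermediate state need not determine the outcome `a` it represents. The reward between the
two programs is therefore the supremum of the expected rewards over all outcomes compatible with the
state, and the second program achieves each of them. -/
theorem Spec.seq {A : PMF α} {B : α → PMF β} {post : α → St → Prop} {post' : β → St → Prop}
    (h : Spec M P σ T q A post) (h' : ∀ a σ', post a σ' → Spec M Q σ' T' q' (B a) post') :
    Spec M (.seq P Q) σ (T + T' + 1) (q + q') (A.bind B) post' := by
  classical
  intro Φ ψ hψ
  rw [expect_bind]
  refine Bounds.seq (Φ := fun σ' => ⨆ a : {a // post a σ'}, expect (B a) ψ)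
    (h _ _ fun a σ' ha => le_iSup (fun a : {a // post a σ'} => expect (B a.1) ψ) ⟨a, ha⟩) ?_
  intro σ' s K k G hr hs hG hK
  exact iSup_le fun a => h' a.1 σ' a.2 Φ ψ hψ s K k G hr hs hG hK

theorem Det.seq_spec {B : PMF β} {post : St → Prop} {post' : β → St → Prop}
    (h : Det M P σ T q post) (h' : ∀ σ', post σ' → Spec M Q σ' T' q' B post') :
    Spec M (.seq P Q) σ (T + T' + 1) (q + q') B post' := by
  have := Spec.seq (B := fun _ => B) h fun _ => h'
  rwa [PMF.pure_bind] at this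

theorem Spec.seq_det {A : PMF α} {post : α → St → Prop} {post' : α → St → Prop}
    (h : Spec M P σ T q A post) (h' : ∀ a σ', post a σ' → Det M Q σ' T' q' (post' a)) :
    Spec M (.seq P Q) σ (T + T' + 1) (q + q') A post' := by
  have := Spec.seq (B := PMF.pure) (post' := post') h fun a σ' ha => by
    intro Φ ψ hψ
    rw [expect_pure]
    exact det_iff.1 (h' a σ' ha) Φ _ (hψ a)
  rwa [PMF.bind_pure] at this

theorem spec_pure {a : α} {post : α → St → Prop} :
    Spec M P σ T q (PMF.pure a) post ↔ Det M P σ T q (post a) := by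
  rw [det_iff]
  constructor
  · intro h Φ v hv
    -- The supremum over the proposition `b = a` is `v` at `a` and `0` elsewhere.
    have := h Φ (fun b => ⨆ _ : b = a, v) fun b σ' hb => iSup_le fun e => hv σ' (e ▸ hb)
    simpa using this
  · intro h Φ ψ hψ
    rw [expect_pure]
    exact h Φ _ (hψ a)

end

/-! ### Expressions -/

/-- Arithmetic expressions over registers and memory. -/
inductive Expr : Type
  | var (a : ℕ)
  | const (v : ℕ)
  | bin (o : Op) (e₁ e₂ : Expr)
  | load (e : Expr)

instance : Add Expr := ⟨.bin .add⟩
instance : Sub Expr := ⟨.bin .sub⟩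
instance : Mul Expr := ⟨.bin .mul⟩
instance : Div Expr := ⟨.bin .div⟩
instance : Mod Expr := ⟨.bin .mod⟩

/-- The unbounded value of a word operation. -/
def Op.exact : Op → ℕ → ℕ → ℕ
  | .add, a, b => a + b
  | .sub, a, b => a - b
  | .mul, a, b => a * b
  | .div, a, b => a / b
  | .mod, a, b => a % b
  | .lt, a, b => if a < b then 1 else 0
  | .eq, a, b => if a = b then 1 else 0

/-- A bound for the value of a word operation. -/
def Op.bound : Op → ℕ → ℕ → ℕ
  | .lt, _, _ => 1
  | .eq, _, _ => 1
  | o, a, b => o.exact a b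

theorem Op.exact_le_bound (o : Op) (a b : ℕ) : o.exact a b ≤ o.bound a b := by
  cases o <;> simp only [Op.bound, Op.exact, le_refl] <;> split_ifs <;> omega

theorem Op.eval_eq (w : ℕ) (o : Op) (a b : ℕ) : o.eval w a b = o.exact a b % 2 ^ w := by
  cases o <;> rfl

namespace Expr

def eval (reg mem : ℕ → ℕ) : Expr → ℕ
  | var a => reg a
  | const v => v
  | bin o e₁ e₂ => o.exact (e₁.eval reg mem) (e₂.eval reg mem)
  | load e => mem (e.eval reg mem)

/-- The number of words. -/
def _root_.DTTest.wordCap (w : ℕ) : ℕ := 2 ^ w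

/-- No scratch registers are read and no operation overflows. -/
def Ok (w : ℕ) (reg mem : ℕ → ℕ) : Expr → Prop
  | var a => a < 900
  | const v => v < wordCap w
  | bin o e₁ e₂ => e₁.Ok w reg mem ∧ e₂.Ok w reg mem ∧
      o.bound (e₁.eval reg mem) (e₂.eval reg mem) < wordCap w
  | load e => e.Ok w reg mem

/-- The register that holds the value after execution of `e.code k`. -/
def res : Expr → ℕ → ℕ
  | var a, _ => a
  | _, k => k

/-- Code that evaluates `e`, using scratch registers from `k` on. -/
def code : Expr → ℕ → Prog
  | var _, _ => .skip
  | const v, k => .const k v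
  | bin o e₁ e₂, k =>
      .seq (e₁.code k) (.seq (e₂.code (k + 1)) (.op o k (e₁.res k) (e₂.res (k + 1))))
  | load e, k => .seq (e.code k) (.load k (e.res k))

def cost : Expr → ℕ
  | var _ => 1
  | const _ => 1
  | bin _ e₁ e₂ => e₁.cost + e₂.cost + 3
  | load e => e.cost + 2

theorem eval_congr (e : Expr) {w : ℕ} {reg reg' mem : ℕ → ℕ} (h : e.Ok w reg mem)
    (hr : ∀ ρ < 900, reg' ρ = reg ρ) :
    e.eval reg' mem = e.eval reg mem ∧ e.Ok w reg' mem := by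
  induction e with
  | var a => exact ⟨hr a h, h⟩
  | const v => exact ⟨rfl, h⟩
  | bin o e₁ e₂ h₁ h₂ =>
    obtain ⟨a, b, c⟩ := h
    obtain ⟨h₁, h₁'⟩ := h₁ a
    obtain ⟨h₂, h₂'⟩ := h₂ b
    refine ⟨by simp only [eval, h₁, h₂], h₁', h₂', by rwa [h₁, h₂]⟩
  | load e ih =>
    obtain ⟨ih, ih'⟩ := ih h
    exact ⟨by simp only [eval, ih], ih'⟩

theorem res_lt (e : Expr) {w : ℕ} {reg mem : ℕ → ℕ} (h : e.Ok w reg mem) {k : ℕ} (hk : 900 ≤ k) :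
    e.res k < k + 1 := by
  cases e <;> simp only [res, Ok] at * <;> omega

/-- The second operand is evaluated with scratch registers from `k + 1` on, so the first result
survives, whether it sits in register `k` or in a program variable below `900`. -/
theorem code_detSteps (e : Expr) (k : ℕ) (hk : 900 ≤ k) (s : Config) (K : List Prog)
    (hs : s.ctrl = e.code k :: K) (hOk : e.Ok M.w s.reg s.mem) :
    ∃ s', DetSteps M e.cost s s' ∧ s'.ctrl = K ∧ s'.mem = s.mem ∧ s'.queries = s.queries ∧
      s'.time = s.time + e.cost ∧ (∀ ρ < k, s'.reg ρ = s.reg ρ) ∧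
      s'.reg (e.res k) = e.eval s.reg s.mem := by
  induction e generalizing k s K with
  | var a =>
    refine ⟨{ s with ctrl := K, time := s.time + 1 },
      DetSteps.single (by unfold step; rw [hs]; rfl), rfl, rfl, rfl, rfl, fun _ _ => rfl, rfl⟩
  | const v =>
    refine ⟨{ s with ctrl := K, time := s.time + 1, reg := Function.update s.reg k (v % 2 ^ M.w) },
      DetSteps.single (by unfold step; rw [hs]; rfl), rfl, rfl, rfl, rfl, fun ρ hρ => ?_, ?_⟩
    · simp [Function.update_of_ne hρ.ne]
    · simpa [res, eval] using Nat.mod_eq_of_lt (show v < 2 ^ M.w from hOk)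
  | bin o e₁ e₂ h₁ h₂ =>
    obtain ⟨o₁, o₂, o₃⟩ := hOk
    have t₁ : DetSteps M 1 s { s with
        ctrl := e₁.code k :: .seq (e₂.code (k + 1)) (.op o k (e₁.res k) (e₂.res (k + 1))) :: K,
        time := s.time + 1 } := DetSteps.single (by unfold step; rw [hs]; rfl)
    obtain ⟨s₂, t₂, c₂, m₂, q₂, u₂, r₂, v₂⟩ := h₁ k hk { s with
        ctrl := e₁.code k :: .seq (e₂.code (k + 1)) (.op o k (e₁.res k) (e₂.res (k + 1))) :: K,
        time := s.time + 1 } _ rfl o₁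
    have t₃ : DetSteps M 1 s₂ { s₂ with
        ctrl := e₂.code (k + 1) :: .op o k (e₁.res k) (e₂.res (k + 1)) :: K,
        time := s₂.time + 1 } := DetSteps.single (by unfold step; rw [c₂])
    obtain ⟨w₂, o₂'⟩ := eval_congr e₂ (reg' := s₂.reg) o₂ fun ρ hρ => r₂ ρ (by omega)
    obtain ⟨s₄, t₄, c₄, m₄, q₄, u₄, r₄, v₄⟩ := h₂ (k + 1) (by omega)
      { s₂ with ctrl := e₂.code (k + 1) :: .op o k (e₁.res k) (e₂.res (k + 1)) :: K,
                time := s₂.time + 1 } _ rfl (by simpa [m₂] using o₂')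
    refine ⟨{ s₄ with
      ctrl := K, time := s₄.time + 1,
      reg := Function.update s₄.reg k (o.eval M.w (s₄.reg (e₁.res k)) (s₄.reg (e₂.res (k + 1)))) },
      ?_, rfl, ?_, ?_, ?_, ?_, ?_⟩
    · have := (((t₁.trans t₂).trans t₃).trans t₄).trans
        (DetSteps.single (s := s₄) (by unfold step; rw [c₄]))
      rwa [show 1 + e₁.cost + 1 + e₂.cost + 1 = (bin o e₁ e₂).cost by simp only [cost]; ring]
        at this
    · simp [m₄, m₂]
    · simp [q₄, q₂]
    · simp only [u₄, u₂, cost]; ring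
    · intro ρ hρ
      simp only [Function.update_of_ne hρ.ne]
      rw [r₄ ρ (by omega)]
      exact r₂ ρ hρ
    · dsimp only
      have hv : s₄.reg (e₁.res k) = e₁.eval s.reg s.mem := by
        rw [r₄ _ (res_lt e₁ o₁ hk)]; exact v₂
      have hv' : s₄.reg (e₂.res (k + 1)) = e₂.eval s.reg s.mem := by
        rw [v₄, ← w₂]; simp [m₂]
      rw [show (bin o e₁ e₂).res k = k from rfl, Function.update_self, hv, hv', Op.eval_eq]
      exact Nat.mod_eq_of_lt ((Op.exact_le_bound _ _ _).trans_lt o₃)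
  | load e ih =>
    have t₁ : DetSteps M 1 s { s with
        ctrl := e.code k :: .load k (e.res k) :: K,
        time := s.time + 1 } := DetSteps.single (by unfold step; rw [hs]; rfl)
    obtain ⟨s₂, t₂, c₂, m₂, q₂, u₂, r₂, v₂⟩ := ih k hk { s with
        ctrl := e.code k :: .load k (e.res k) :: K,
        time := s.time + 1 } _ rfl hOk
    refine ⟨{ s₂ with
      ctrl := K, time := s₂.time + 1,
      reg := Function.update s₂.reg k (s₂.mem (s₂.reg (e.res k))) }, ?_, rfl, ?_, ?_, ?_, ?_, ?_⟩
    · have := (t₁.trans t₂).trans (DetSteps.single (s := s₂) (by unfold step; rw [c₂]))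
      rwa [show 1 + e.cost + 1 = (load e).cost by simp only [cost]; ring] at this
    · simp [m₂]
    · simp [q₂]
    · simp only [u₂, cost]; ring
    · intro ρ hρ
      simp only [Function.update_of_ne hρ.ne]
      exact r₂ ρ hρ
    · dsimp only
      rw [show (load e).res k = k from rfl, Function.update_self, v₂, m₂]
      rfl

end Expr

section
variable (w : ℕ) (reg mem : ℕ → ℕ) (a b : Expr) (k : ℕ)

@[simp] theorem Expr.eval_var : (Expr.var k).eval reg mem = reg k := rfl
@[simp] theorem Expr.eval_const : (Expr.const k).eval reg mem = k := rfl
@[simp] theorem Expr.eval_load : (Expr.load a).eval reg mem = mem (a.eval reg mem) := rfl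
@[simp] theorem Expr.eval_add : (a + b).eval reg mem = a.eval reg mem + b.eval reg mem := rfl
@[simp] theorem Expr.eval_sub : (a - b).eval reg mem = a.eval reg mem - b.eval reg mem := rfl
@[simp] theorem Expr.eval_mul : (a * b).eval reg mem = a.eval reg mem * b.eval reg mem := rfl
@[simp] theorem Expr.eval_div : (a / b).eval reg mem = a.eval reg mem / b.eval reg mem := rfl
@[simp] theorem Expr.eval_mod : (a % b).eval reg mem = a.eval reg mem % b.eval reg mem := rfl
@[simp] theorem Expr.eval_lt : (Expr.bin .lt a b).eval reg mem =
    if a.eval reg mem < b.eval reg mem then 1 else 0 := rfl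
@[simp] theorem Expr.eval_eq : (Expr.bin .eq a b).eval reg mem =
    if a.eval reg mem = b.eval reg mem then 1 else 0 := rfl

@[simp] theorem Expr.ok_var : (Expr.var k).Ok w reg mem ↔ k < 900 := Iff.rfl
@[simp] theorem Expr.ok_const : (Expr.const k).Ok w reg mem ↔ k < wordCap w := Iff.rfl
@[simp] theorem Expr.ok_load : (Expr.load a).Ok w reg mem ↔ a.Ok w reg mem := Iff.rfl
@[simp] theorem Expr.ok_add : (a + b).Ok w reg mem ↔ a.Ok w reg mem ∧ b.Ok w reg mem ∧
    a.eval reg mem + b.eval reg mem < wordCap w := Iff.rfl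
@[simp] theorem Expr.ok_sub : (a - b).Ok w reg mem ↔ a.Ok w reg mem ∧ b.Ok w reg mem ∧
    a.eval reg mem - b.eval reg mem < wordCap w := Iff.rfl
@[simp] theorem Expr.ok_mul : (a * b).Ok w reg mem ↔ a.Ok w reg mem ∧ b.Ok w reg mem ∧
    a.eval reg mem * b.eval reg mem < wordCap w := Iff.rfl
@[simp] theorem Expr.ok_div : (a / b).Ok w reg mem ↔ a.Ok w reg mem ∧ b.Ok w reg mem ∧
    a.eval reg mem / b.eval reg mem < wordCap w := Iff.rfl
@[simp] theorem Expr.ok_mod : (a % b).Ok w reg mem ↔ a.Ok w reg mem ∧ b.Ok w reg mem ∧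
    a.eval reg mem % b.eval reg mem < wordCap w := Iff.rfl
@[simp] theorem Expr.ok_lt : (Expr.bin .lt a b).Ok w reg mem ↔ a.Ok w reg mem ∧ b.Ok w reg mem ∧
    1 < wordCap w := Iff.rfl
@[simp] theorem Expr.ok_eq : (Expr.bin .eq a b).Ok w reg mem ↔ a.Ok w reg mem ∧ b.Ok w reg mem ∧
    1 < wordCap w := Iff.rfl

@[simp] theorem Expr.cost_var : (Expr.var k).cost = 1 := rfl
@[simp] theorem Expr.cost_const : (Expr.const k).cost = 1 := rfl
@[simp] theorem Expr.cost_load : (Expr.load a).cost = a.cost + 2 := rfl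
@[simp] theorem Expr.cost_add : (a + b).cost = a.cost + b.cost + 3 := rfl
@[simp] theorem Expr.cost_sub : (a - b).cost = a.cost + b.cost + 3 := rfl
@[simp] theorem Expr.cost_mul : (a * b).cost = a.cost + b.cost + 3 := rfl
@[simp] theorem Expr.cost_div : (a / b).cost = a.cost + b.cost + 3 := rfl
@[simp] theorem Expr.cost_mod : (a % b).cost = a.cost + b.cost + 3 := rfl
@[simp] theorem Expr.cost_bin (o : Op) : (Expr.bin o a b).cost = a.cost + b.cost + 3 := rfl

end

abbrev St.eval (σ : St) (e : Expr) : ℕ := e.eval σ.reg σ.mem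

/-! ### Structured statements -/

/-- There is no register move, so the value is copied by adding the zero kept in register `900`. -/
def assign (r : ℕ) (e : Expr) : Prog :=
  .seq (e.code 901) (.seq (.const 900 0) (.op .add r (e.res 901) 900))

def storeAt (a e : Expr) : Prog :=
  .seq (a.code 901) (.seq (e.code 902) (.store (a.res 901) (e.res 902)))

def queryAt (a : Expr) (r : ℕ) : Prog := .seq (a.code 901) (.query (a.res 901) r)

def sampleAt (a : Expr) (r : ℕ) : Prog := .seq (a.code 901) (.sample (a.res 901) r)

def cond (e : Expr) (P Q : Prog) : Prog := .seq (e.code 901) (.ite (e.res 901) P Q)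

/-- A `loop` only inspects a register; the condition is recomputed at the end of each iteration. -/
def whileDo (e : Expr) (P : Prog) : Prog :=
  .seq (e.code 901) (.loop (e.res 901) (.seq P (e.code 901)))

end DTTest

/-! ### Proof rules for statements and loops -/

namespace DTTest
variable {n : ℕ} {M : Oracle n}

theorem Expr.run (e : Expr) {k : ℕ} (hk : 900 ≤ k) {s : Config} {σ : St} {K : List Prog}
    (hr : Rep s σ) (hs : s.ctrl = e.code k :: K) (hOk : e.Ok M.w σ.reg σ.mem) :
    ∃ s', DetSteps M e.cost s s' ∧ s'.ctrl = K ∧ Rep s' σ ∧ s'.queries = s.queries ∧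
      s'.time = s.time + e.cost ∧ (∀ ρ < k, s'.reg ρ = s.reg ρ) ∧ s'.reg (e.res k) = σ.eval e := by
  have hm := hr.2
  obtain ⟨h₁, h₂⟩ := e.eval_congr (reg' := s.reg) hOk hr.1
  obtain ⟨s', a, b, c, d, e', f, g⟩ := e.code_detSteps k hk s K hs (by rw [hm]; exact h₂)
  refine ⟨s', a, b, ⟨fun ρ hρ => ?_, c.trans hm⟩, d, e', f, ?_⟩
  · rw [f ρ (by omega), hr.1 ρ hρ]
  · rw [g, hm, h₁]

theorem DetSteps.seq {s : Config} {P Q : Prog} {K : List Prog} (hs : s.ctrl = .seq P Q :: K) :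
    DetSteps M 1 s { s with ctrl := P :: Q :: K, time := s.time + 1 } :=
  DetSteps.single (by unfold step; rw [hs])

theorem det_skip {σ : St} : Det M .skip σ 1 0 fun σ' => σ' = σ := by
  rw [det_iff]
  intro Φ v hv s K k G hr hs hG hK
  have h1 : DetSteps M 1 s { s with ctrl := K, time := s.time + 1 } :=
    DetSteps.single (by unfold step; rw [hs])
  rw [h1]
  exact (hv _ rfl).trans (hK _ σ (rep_congr hr rfl rfl) rfl le_rfl le_rfl)

theorem det_assign {σ : St} {r : ℕ} {e : Expr} (hr : r < 900) (hOk : e.Ok M.w σ.reg σ.mem)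
    (hlt : σ.eval e < wordCap M.w) :
    Det M (assign r e) σ (e.cost + 4) 0 fun σ' => σ' = σ.set r (σ.eval e) := by
  rw [det_iff]
  intro Φ v hv s K k G hrep hs hG hK
  obtain ⟨s₂, t₂, c₂, rep₂, q₂, u₂, r₂, v₂⟩ := e.run (k := 901) (by norm_num)
    (s := { s with ctrl := e.code 901 :: .seq (.const 900 0) (.op .add r (e.res 901) 900) :: K,
                   time := s.time + 1 }) (rep_congr hrep rfl rfl) rfl hOk
  have t₃ := DetSteps.seq (M := M) c₂
  have t₄ : DetSteps M 1 { s₂ with ctrl := .const 900 0 :: .op .add r (e.res 901) 900 :: K,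
                                   time := s₂.time + 1 }
      { s₂ with ctrl := .op .add r (e.res 901) 900 :: K, time := s₂.time + 1 + 1,
                reg := Function.update s₂.reg 900 (0 % 2 ^ M.w) } :=
    DetSteps.single (by unfold step; rfl)
  have t₅ : DetSteps M 1 { s₂ with ctrl := .op .add r (e.res 901) 900 :: K,
                                   time := s₂.time + 1 + 1,
                                   reg := Function.update s₂.reg 900 (0 % 2 ^ M.w) } _ :=
    DetSteps.single (by unfold step; rfl)
  have t := (((DetSteps.seq hs).trans t₂).trans t₃).trans (t₄.trans t₅)
  rw [show e.cost + 4 = 1 + e.cost + 1 + (1 + 1) by ring, t]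
  refine (hv _ rfl).trans (hK _ _ ⟨fun ρ hρ => ?_, ?_⟩ rfl ?_ ?_)
  · have hne : e.res 901 ≠ 900 := by
      cases e <;> simp only [Expr.res, Expr.Ok] at * <;> omega
    simp only [Function.update_apply, St.set_reg, if_neg hne, v₂]
    split_ifs with h
    · simpa [Op.eval] using Nat.mod_eq_of_lt (show σ.eval e < 2 ^ M.w from hlt)
    · omega
    · exact rep₂.1 ρ hρ
  · exact rep₂.2
  · simp only [u₂]; omega
  · simp [q₂]

theorem det_storeAt {σ : St} {a e : Expr} (ha : a.Ok M.w σ.reg σ.mem)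
    (hOk : e.Ok M.w σ.reg σ.mem) :
    Det M (storeAt a e) σ (a.cost + e.cost + 3) 0 fun σ' =>
      σ' = σ.put (σ.eval a) (σ.eval e) := by
  rw [det_iff]
  intro Φ v hv s K k G hrep hs hG hK
  obtain ⟨s₂, t₂, c₂, rep₂, q₂, u₂, r₂, v₂⟩ := a.run (k := 901) (by norm_num)
    (s := { s with ctrl := a.code 901 :: .seq (e.code 902) (.store (a.res 901) (e.res 902)) :: K,
                   time := s.time + 1 }) (rep_congr hrep rfl rfl) rfl ha
  have t₃ := DetSteps.seq (M := M) c₂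
  obtain ⟨s₄, t₄, c₄, rep₄, q₄, u₄, r₄, v₄⟩ := e.run (k := 902) (by norm_num)
    (s := { s₂ with ctrl := e.code 902 :: .store (a.res 901) (e.res 902) :: K,
                    time := s₂.time + 1 }) (rep_congr rep₂ rfl rfl) rfl hOk
  have t₅ := DetSteps.single (M := M) (s := s₄) (by unfold step; rw [c₄])
  have t := ((((DetSteps.seq hs).trans t₂).trans t₃).trans t₄).trans t₅
  rw [show a.cost + e.cost + 3 = 1 + a.cost + 1 + e.cost + 1 by ring, t]
  refine (hv _ rfl).trans (hK _ _ ⟨fun ρ hρ => ?_, ?_⟩ rfl ?_ ?_)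
  · simpa using rep₄.1 ρ hρ
  · have h901 : s₄.reg (a.res 901) = σ.eval a := by
      rw [r₄ _ (Expr.res_lt a ha (by norm_num))]; exact v₂
    simp only [h901, v₄, rep₄.2, St.put]
  · simp only [u₄, u₂]; omega
  · simp [q₄, q₂]

theorem det_queryAt {σ : St} {a : Expr} {r : ℕ} (ha : a.Ok M.w σ.reg σ.mem) :
    Det M (queryAt a r) σ (a.cost + 2 + n) 1 fun σ' =>
      σ' = σ.set r (M.f (readBits n σ.mem (σ.eval a))).toNat := by
  rw [det_iff]
  intro Φ v hv s K k G hrep hs hG hK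
  obtain ⟨s₂, t₂, c₂, rep₂, q₂, u₂, r₂, v₂⟩ := a.run (k := 901) (by norm_num)
    (s := { s with ctrl := a.code 901 :: .query (a.res 901) r :: K,
                   time := s.time + 1 }) (rep_congr hrep rfl rfl) rfl ha
  have t₅ := DetSteps.single (M := M) (s := s₂) (by unfold step; rw [c₂])
  have t := ((DetSteps.seq hs).trans t₂).trans t₅
  -- `T` bounds both the number of steps and the elapsed time. A query is one step but `n + 1` units
  -- of time; the missing `n` steps are supplied by monotonicity.
  refine le_trans ?_ (valN_mono M hG (show k + (1 + a.cost + 1) ≤ k + (a.cost + 2 + n) by omega) s)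
  rw [t]
  refine (hv _ rfl).trans (hK _ _ ⟨fun ρ hρ => ?_, ?_⟩ rfl ?_ ?_)
  · simp only [Function.update_apply, St.set_reg, v₂, rep₂.2, rep₂.1 ρ hρ]
  · exact rep₂.2
  · simp only [u₂]; omega
  · simp [q₂]

theorem spec_sampleAt {σ : St} {a : Expr} {r : ℕ} (ha : a.Ok M.w σ.reg σ.mem) :
    Spec M (sampleAt a r) σ (a.cost + 2 + n) 1 M.D fun x σ' =>
      σ' = (σ.withMem (writeBits σ.mem (σ.eval a) x)).set r (M.f x).toNat := by
  intro Φ ψ hψ s K k G hrep hs hG hK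
  obtain ⟨s₂, t₂, c₂, rep₂, q₂, u₂, r₂, v₂⟩ := a.run (k := 901) (by norm_num)
    (s := { s with ctrl := a.code 901 :: .sample (a.res 901) r :: K,
                   time := s.time + 1 }) (rep_congr hrep rfl rfl) rfl ha
  have t := (DetSteps.seq hs).trans t₂
  refine le_trans ?_
    (valN_mono M hG (show (k + 1) + (1 + a.cost) ≤ k + (a.cost + 2 + n) by omega) s)
  rw [t, valN]
  unfold step
  rw [c₂]
  simp only [expect_map]
  refine expect_mono _ fun x => (hψ x _ rfl).trans (hK _ _ ⟨fun ρ hρ => ?_, ?_⟩ rfl ?_ ?_)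
  · simp only [Function.update_apply, St.set_reg, St.withMem_reg, rep₂.1 ρ hρ]
  · simp only [v₂, rep₂.2, St.set_mem, St.withMem_mem]
  · simp only [u₂]; omega
  · simp [q₂]

theorem spec_coin {σ : St} {r : ℕ} :
    Spec M (.coin r) σ 1 0 (PMF.uniformOfFintype Bool) fun b σ' => σ' = σ.set r b.toNat := by
  intro Φ ψ hψ s K k G hrep hs hG hK
  rw [valN]
  unfold step
  rw [hs]
  simp only [expect_map]
  refine expect_mono _ fun x => (hψ x _ rfl).trans (hK _ _ ⟨fun ρ hρ => ?_, ?_⟩ rfl ?_ ?_)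
  · simp only [Function.update_apply, St.set_reg, hrep.1 ρ hρ]
  · exact hrep.2
  · simp
  · simp

theorem bounds_cond {σ : St} {e : Expr} {P Q : Prog} {T q : ℕ} {Φ : St → ℝ≥0∞} {v : ℝ≥0∞}
    (hOk : e.Ok M.w σ.reg σ.mem) (hP : σ.eval e ≠ 0 → Bounds M P σ T q Φ v)
    (hQ : σ.eval e = 0 → Bounds M Q σ T q Φ v) :
    Bounds M (cond e P Q) σ (T + e.cost + 2) q Φ v := by
  intro s K k G hrep hs hG hK
  obtain ⟨s₂, t₂, c₂, rep₂, q₂, u₂, r₂, v₂⟩ := e.run (k := 901) (by norm_num)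
    (s := { s with ctrl := e.code 901 :: .ite (e.res 901) P Q :: K,
                   time := s.time + 1 }) (rep_congr hrep rfl rfl) rfl hOk
  have t₃ := DetSteps.single (M := M) (s := s₂) (by unfold step; rw [c₂])
  have t := ((DetSteps.seq hs).trans t₂).trans t₃
  rw [show k + (T + e.cost + 2) = k + T + (1 + e.cost + 1) by ring, t]
  by_cases h : σ.eval e = 0
  · refine hQ h _ K k G (rep_congr rep₂ rfl rfl) (by simp [v₂, h]) hG
      fun s' σ' a b c d => hK s' σ' a b ?_ ?_ <;> simp only [u₂, q₂] at * <;> omega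
  · refine hP h _ K k G (rep_congr rep₂ rfl rfl) (by simp [v₂, h]) hG
      fun s' σ' a b c d => hK s' σ' a b ?_ ?_ <;> simp only [u₂, q₂] at * <;> omega

theorem Spec.cond {α : Type} {σ : St} {e : Expr} {P Q : Prog} {T q : ℕ} {A : PMF α}
    {post : α → St → Prop}
    (hOk : e.Ok M.w σ.reg σ.mem) (hP : σ.eval e ≠ 0 → Spec M P σ T q A post)
    (hQ : σ.eval e = 0 → Spec M Q σ T q A post) :
    Spec M (cond e P Q) σ (T + e.cost + 2) q A post := fun Φ ψ hψ =>
  bounds_cond hOk (fun h => hP h Φ ψ hψ) fun h => hQ h Φ ψ hψ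

theorem Det.cond {σ : St} {e : Expr} {P Q : Prog} {T q : ℕ} {post : St → Prop}
    (hOk : e.Ok M.w σ.reg σ.mem) (hP : σ.eval e ≠ 0 → Det M P σ T q post)
    (hQ : σ.eval e = 0 → Det M Q σ T q post) :
    Det M (cond e P Q) σ (T + e.cost + 2) q post := Spec.cond hOk hP hQ

/-- `Bounds` for a loop whose condition is about to be evaluated. -/
def LoopBounds (M : Oracle n) (e : Expr) (P : Prog) (σ : St) (T q : ℕ) (Φ : St → ℝ≥0∞)
    (v : ℝ≥0∞) : Prop :=
  ∀ (s : Config) (K : List Prog) (k : ℕ) (G : Config → ℝ≥0∞), Rep s σ →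
    s.ctrl = e.code 901 :: .loop (e.res 901) (.seq P (e.code 901)) :: K → PaysAtHalt G →
    (∀ s' σ', Rep s' σ' → s'.ctrl = K → s'.time ≤ s.time + T → s'.queries ≤ s.queries + q →
      Φ σ' ≤ valN M G k s') →
    v ≤ valN M G (k + T) s

theorem LoopBounds.weaken {e : Expr} {P : Prog} {σ : St} {T q T' q' : ℕ} {Φ : St → ℝ≥0∞}
    {v : ℝ≥0∞} (h : LoopBounds M e P σ T q Φ v) (hT : T ≤ T') (hq : q ≤ q') :
    LoopBounds M e P σ T' q' Φ v := by
  intro s K k G hr hs hG hK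
  exact (h s K k G hr hs hG fun s' σ' h1 h2 h3 h4 =>
    hK s' σ' h1 h2 (by omega) (by omega)).trans (valN_mono M hG (by omega) s)

theorem LoopBounds.whileDo {e : Expr} {P : Prog} {σ : St} {T q : ℕ} {Φ : St → ℝ≥0∞}
    {v : ℝ≥0∞} (h : LoopBounds M e P σ T q Φ v) : Bounds M (whileDo e P) σ (T + 1) q Φ v := by
  intro s K k G hr hs hG hK
  rw [← add_assoc, DetSteps.seq hs]
  refine h _ K k G (rep_congr hr rfl rfl) rfl hG fun s' σ' a b c d => hK s' σ' a b ?_ ?_ <;>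
    simp only at * <;> omega

theorem loopBounds_exit {σ : St} {e : Expr} {P : Prog} {Φ : St → ℝ≥0∞}
    (hOk : e.Ok M.w σ.reg σ.mem) (he : σ.eval e = 0) :
    LoopBounds M e P σ (e.cost + 1) 0 Φ (Φ σ) := by
  intro s K k G hrep hs hG hK
  obtain ⟨s₂, t₂, c₂, rep₂, q₂, u₂, r₂, v₂⟩ := e.run (k := 901) (by norm_num) hrep hs hOk
  have t := t₂.trans (DetSteps.single (M := M) (s := s₂) (by unfold step; rw [c₂]))
  rw [t]
  refine hK _ σ (rep_congr rep₂ rfl rfl) (by simp [v₂, he]) ?_ ?_ <;>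
    simp only [u₂, q₂] <;> omega

theorem loopBounds_step {σ : St} {e : Expr} {P : Prog} {T q T' q' : ℕ} {Φ Φ' : St → ℝ≥0∞}
    {v : ℝ≥0∞} (hOk : e.Ok M.w σ.reg σ.mem) (he : σ.eval e ≠ 0) (h : Bounds M P σ T q Φ v)
    (h' : ∀ σ', LoopBounds M e P σ' T' q' Φ' (Φ σ')) :
    LoopBounds M e P σ (T + e.cost + 2 + T') (q + q') Φ' v := by
  intro s K k G hrep hs hG hK
  obtain ⟨s₂, t₂, c₂, rep₂, q₂, u₂, r₂, v₂⟩ := e.run (k := 901) (by norm_num) hrep hs hOk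
  have t₃ : DetSteps M 1 s₂ { s₂ with
      ctrl := .seq P (e.code 901) :: .loop (e.res 901) (.seq P (e.code 901)) :: K,
      time := s₂.time + 1 } := DetSteps.single (by unfold step; rw [c₂]; simp [v₂, he])
  have t₄ := DetSteps.seq (M := M) (s := { s₂ with
      ctrl := .seq P (e.code 901) :: .loop (e.res 901) (.seq P (e.code 901)) :: K,
      time := s₂.time + 1 }) rfl
  have t := (t₂.trans t₃).trans t₄
  rw [show k + (T + e.cost + 2 + T') = k + T' + T + (e.cost + 1 + 1) by ring, t]
  refine h _ (e.code 901 :: .loop (e.res 901) (.seq P (e.code 901)) :: K) (k + T') G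
    (rep_congr rep₂ rfl rfl) rfl hG fun s' σ' hr' hs' ht' hq' => ?_
  refine h' σ' s' K k G hr' hs' hG fun s'' σ'' a b c d => hK s'' σ'' a b ?_ ?_
  · simp only [u₂] at *; omega
  · simp only [q₂] at *; omega

/-! ### Counting loops and blocks -/

/-- Compose the random maps `B k, …, B (k + j - 1)`. -/
noncomputable def iter {α : Type} (B : ℕ → α → PMF α) : ℕ → ℕ → α → PMF α
  | _, 0, a => PMF.pure a
  | k, j + 1, a => (B k a).bind (iter B (k + 1) j)

/-- `for i < (register b) do P` -/
def forLoop (i b : ℕ) (P : Prog) : Prog :=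
  .seq (assign i (.const 0)) (whileDo (.bin .lt (.var i) (.var b)) (.seq P (assign i (.var i + .const 1))))

/-- Induction on the number `j` of remaining iterations. The invariant relates the abstract value
after `k` iterations to the state in which the counter has already been raised to `k`, and the
intermediate reward is again a supremum over compatible abstract values. -/
theorem loopBounds_for {α : Type} {i b N T q : ℕ} {P : Prog} {B : ℕ → α → PMF α}
    {Inv : ℕ → α → St → Prop} (hi : i < 900) (hb : b < 900) (hN : N < wordCap M.w)
    (hw : 1 < wordCap M.w)
    (hInv : ∀ k a σ, Inv k a σ → σ.reg i = k ∧ σ.reg b = N)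
    (hP : ∀ k a σ, k < N → Inv k a σ → Spec M P σ T q (B k a) fun a' σ' =>
      σ'.reg i = k ∧ Inv (k + 1) a' (σ'.set i (k + 1)))
    (Φ : St → ℝ≥0∞) (ψ : α → ℝ≥0∞) (hψ : ∀ a σ', Inv N a σ' → ψ a ≤ Φ σ') (j k : ℕ)
    (hjk : k + j = N) (a : α) (σ : St) (h : Inv k a σ) :
    LoopBounds M (.bin .lt (.var i) (.var b)) (.seq P (assign i (.var i + .const 1))) σ
      (j * (T + 17) + 6) (j * q) Φ (expect (iter B k j a) ψ) := by
  induction j generalizing k a σ with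
  | zero =>
    obtain rfl : k = N := by omega
    obtain ⟨h1, h2⟩ := hInv k a σ h
    have := loopBounds_exit (M := M) (σ := σ) (e := .bin .lt (.var i) (.var b))
      (P := .seq P (assign i (.var i + .const 1))) (Φ := Φ)
      ⟨hi, hb, hw⟩
      (by simp [h1, h2])
    simp only [iter, expect_pure]
    intro s K k' G hr hs hG hK
    refine (hψ a σ h).trans (this.weaken ?_ ?_ s K k' G hr hs hG hK)
    · simp [Expr.cost]
    · simp
  | succ j ih =>
    obtain ⟨h1, h2⟩ := hInv k a σ h
    have hbody : Spec M (.seq P (assign i (.var i + .const 1))) σ (T + 10) q (B k a)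
        fun a' σ' => Inv (k + 1) a' σ' := by
      have := (hP k a σ (by omega) h).seq_det (Q := assign i (.var i + .const 1)) (T' := 9) (q' := 0)
        (post' := fun a' σ' => Inv (k + 1) a' σ') fun a' σ' ha => by
          have := det_assign (M := M) (σ := σ') (r := i) (e := .var i + .const 1) hi
            (by simp [ha.1]; omega) (by simp [ha.1]; omega)
          refine this.weaken (by simp) le_rfl ?_
          rintro σ'' rfl
          simpa [ha.1] using ha.2
      exact this.weaken (by omega) (by omega) fun _ _ h => h
    have hst := loopBounds_step (M := M) (σ := σ) (e := .bin .lt (.var i) (.var b))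
      (T' := j * (T + 17) + 6) (q' := j * q) (Φ' := Φ)
      ⟨hi, hb, hw⟩
      (by simp [h1, h2]; omega)
      (hbody (fun σ' => ⨆ a' : {a' // Inv (k + 1) a' σ'}, expect (iter B (k + 1) j a') ψ)
        (fun a' => expect (iter B (k + 1) j a') ψ)
        fun a' σ' ha => le_iSup (fun a' : {a' // Inv (k + 1) a' σ'} =>
          expect (iter B (k + 1) j a') ψ) ⟨a', ha⟩)
      (fun σ' s K k' G hr hs hG hK => iSup_le fun a' =>
        ih (k + 1) (by omega) a' σ' a'.2 s K k' G hr hs hG hK)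
    rw [iter, expect_bind]
    refine hst.weaken ?_ ?_
    · simp only [Expr.cost]; ring_nf; omega
    · rw [Nat.succ_mul]; omega

theorem Spec.forLoop {α : Type} {i b N T q : ℕ} {P : Prog} (B : ℕ → α → PMF α)
    (Inv : ℕ → α → St → Prop) (hi : i < 900) (hb : b < 900) (hN : N < wordCap M.w)
    (hw : 1 < wordCap M.w)
    (hInv : ∀ k a σ, Inv k a σ → σ.reg i = k ∧ σ.reg b = N)
    (hP : ∀ k a σ, k < N → Inv k a σ → Spec M P σ T q (B k a) fun a' σ' =>
      σ'.reg i = k ∧ Inv (k + 1) a' (σ'.set i (k + 1)))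
    {a : α} {σ : St} (h : Inv 0 a (σ.set i 0)) :
    Spec M (forLoop i b P) σ (N * (T + 17) + 13) (N * q) (iter B 0 N a) (Inv N) := by
  have h0 : Det M (assign i (.const 0)) σ 5 0 fun σ' => σ' = σ.set i 0 :=
    det_assign hi (show 0 < wordCap M.w by omega) (show 0 < wordCap M.w by omega)
  have := h0.seq_spec (Q := whileDo (.bin .lt (.var i) (.var b))
    (.seq P (assign i (.var i + .const 1)))) (T' := N * (T + 17) + 7) (q' := N * q)
    (post' := Inv N) (B := iter B 0 N a) (by
      rintro σ' rfl Φ ψ hψ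
      exact (loopBounds_for hi hb hN hw hInv hP Φ ψ hψ N 0 (by simp) a _ h).whileDo)
  exact this.weaken (by omega) (by omega) fun _ _ h => h

theorem iter_pure {α : Type} (k j : ℕ) (a : α) (g : ℕ → α → α) :
    ∃ a', iter (fun i a => PMF.pure (g i a)) k j a = PMF.pure a' := by
  induction j generalizing k a with
  | zero => exact ⟨a, rfl⟩
  | succ j ih => rw [iter, PMF.pure_bind]; exact ih _ _

theorem Det.forLoop {i b N T q : ℕ} {P : Prog} (Inv : ℕ → St → Prop) (hi : i < 900) (hb : b < 900)
    (hN : N < wordCap M.w) (hw : 1 < wordCap M.w)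
    (hInv : ∀ k σ, Inv k σ → σ.reg i = k ∧ σ.reg b = N)
    (hP : ∀ k σ, k < N → Inv k σ → Det M P σ T q fun σ' =>
      σ'.reg i = k ∧ Inv (k + 1) (σ'.set i (k + 1)))
    {σ : St} (h : Inv 0 (σ.set i 0)) :
    Det M (forLoop i b P) σ (N * (T + 17) + 13) (N * q) (Inv N) := by
  have := Spec.forLoop (M := M) (fun _ (a : Unit) => PMF.pure a) (fun k _ => Inv k) hi hb hN hw
    (fun k _ σ => hInv k σ) (fun k _ σ => hP k σ) (a := ()) h
  obtain ⟨a', ha⟩ := iter_pure 0 N () fun _ a => a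
  rw [ha] at this
  exact this

/-- Sequential composition of a list of programs. -/
def block : List Prog → Prog
  | [] => .skip
  | P :: Ps => .seq P (block Ps)

theorem det_nil {σ : St} {post : St → Prop} (h : post σ) : Det M (block []) σ 1 0 post :=
  det_skip.weaken le_rfl le_rfl fun _ e => e ▸ h

end DTTest

namespace DTTest
variable {n : ℕ} {M : Oracle n}

/-! ### Uniform distributions -/

theorem uniform_map_equiv {α β : Type} [Fintype α] [Nonempty α] [Fintype β] [Nonempty β]
    (e : α ≃ β) : (PMF.uniformOfFintype α).map e = PMF.uniformOfFintype β := by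
  classical
  ext b
  rw [PMF.map_apply, tsum_eq_single (e.symm b)]
  · simp [Fintype.card_congr e]
  · intro a ha
    rw [if_neg]
    rintro rfl
    simp at ha

theorem uniform_prod {α β : Type} [Fintype α] [Nonempty α] [Fintype β] [Nonempty β] :
    ((PMF.uniformOfFintype α).bind fun a => (PMF.uniformOfFintype β).map fun b => (a, b)) =
      PMF.uniformOfFintype (α × β) := by
  classical
  ext ⟨a, b⟩
  rw [PMF.bind_apply, tsum_eq_single a, PMF.map_apply, tsum_eq_single b]
  · simp only [PMF.uniformOfFintype_apply, if_true, Fintype.card_prod, Nat.cast_mul]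
    rw [ENNReal.mul_inv] <;> simp
  · intro b' hb
    simp [hb.symm]
  · intro a' ha
    simp [PMF.map_apply, ha.symm]

theorem uniform_bind_map_equiv {α β γ : Type} [Fintype α] [Nonempty α] [Fintype β] [Nonempty β]
    [Fintype γ] [Nonempty γ] (e : α × β ≃ γ) :
    ((PMF.uniformOfFintype α).bind fun a => (PMF.uniformOfFintype β).map fun b => e (a, b)) =
      PMF.uniformOfFintype γ := by
  rw [← uniform_map_equiv e, ← uniform_prod, PMF.map_bind]
  simp only [PMF.map_comp]
  rfl

/-- Overwrite the values `m p, …, m (p + j - 1)` by the vector `v`. -/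
def writeVec {δ : Type} {j : ℕ} (m : ℕ → δ) (p : ℕ) (v : Fin j → δ) : ℕ → δ :=
  fun i => if h : p ≤ i ∧ i < p + j then v ⟨i - p, by omega⟩ else m i

theorem writeVec_cons {δ : Type} {j : ℕ} (m : ℕ → δ) (p : ℕ) (b : δ) (v : Fin j → δ) :
    writeVec m p (Fin.cons b v : Fin (j + 1) → δ) = writeVec (Function.update m p b) (p + 1) v := by
  funext i
  unfold writeVec
  rcases lt_trichotomy i p with h | rfl | h
  · rw [dif_neg (by omega), dif_neg (by omega), Function.update_of_ne h.ne]
  · rw [dif_pos (by omega), dif_neg (by omega)]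
    simp
  · by_cases h' : i < p + (j + 1)
    · rw [dif_pos (by omega), dif_pos (by omega)]
      have : (⟨i - p, by omega⟩ : Fin (j + 1)) = Fin.succ ⟨i - (p + 1), by omega⟩ := by
        ext; simp; omega
      rw [this, Fin.cons_succ]
    · rw [dif_neg (by omega), dif_neg (by omega), Function.update_of_ne h.ne']

theorem uniform_fin_succ {γ : Type} [Fintype γ] [Nonempty γ] (j : ℕ) :
    ((PMF.uniformOfFintype γ).bind fun b =>
      (PMF.uniformOfFintype (Fin j → γ)).map fun v => (Fin.cons b v : Fin (j + 1) → γ)) =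
      PMF.uniformOfFintype (Fin (j + 1) → γ) :=
  uniform_bind_map_equiv (Fin.consEquiv fun _ : Fin (j + 1) => γ)

/-- Independent uniform choices written one after the other form a uniform vector. -/
theorem iter_writeVec {γ δ : Type} [Fintype γ] [Nonempty γ] (enc : γ → δ) (p k j : ℕ)
    (m : ℕ → δ) :
    iter (fun k m => (PMF.uniformOfFintype γ).map fun b => Function.update m (p + k) (enc b))
      k j m = (PMF.uniformOfFintype (Fin j → γ)).map fun x => writeVec m (p + k) (enc ∘ x) := by
  induction j generalizing k m with
  | zero =>
    have h0 : ∀ x : Fin 0 → γ, writeVec m (p + k) (enc ∘ x) = m := fun x => by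
      funext i; unfold writeVec; rw [dif_neg (by omega)]
    simp only [h0, iter]
    exact (PMF.map_const _ _).symm
  | succ j ih =>
    rw [iter, PMF.bind_map, ← uniform_fin_succ, PMF.map_bind]
    congr 1
    funext b
    simp only [Function.comp_apply, ih, PMF.map_comp]
    congr 1
    funext x
    have : enc ∘ (Fin.cons b x : Fin (j + 1) → γ) = Fin.cons (enc b) (enc ∘ x) := by
      funext i
      refine Fin.cases ?_ (fun i => ?_) i <;> simp
    simp only [Function.comp_apply, this, writeVec_cons, add_assoc]

/-- Reading a number bit by bit from fair coins gives a uniform number. -/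
theorem iter_binary (k j acc : ℕ) :
    iter (fun _ acc => (PMF.uniformOfFintype Bool).map fun b => 2 * acc + b.toNat) k j acc =
      (PMF.uniformOfFintype (Fin (2 ^ j))).map fun v : Fin (2 ^ j) => acc * 2 ^ j + (v : ℕ) := by
  induction j generalizing k acc with
  | zero =>
    have : ∀ v : Fin (2 ^ 0), acc * 2 ^ 0 + (v : ℕ) = acc := fun v => by
      have := v.2; simp at this ⊢
    simp only [this, iter]
    exact (PMF.map_const _ _).symm
  | succ j ih =>
    let e : Bool × Fin (2 ^ j) ≃ Fin (2 ^ (j + 1)) :=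
      (finTwoEquiv.symm.prodCongr (Equiv.refl _)).trans
        (finProdFinEquiv.trans (finCongr (by rw [pow_succ]; ring)))
    rw [iter, PMF.bind_map, ← uniform_bind_map_equiv e, PMF.map_bind]
    congr 1
    funext b
    simp only [Function.comp_apply, ih, PMF.map_comp]
    congr 1
    funext v
    have he : (e (b, v) : ℕ) = v + 2 ^ j * b.toNat := by
      cases b <;> simp [e, finProdFinEquiv, finTwoEquiv]
    simp only [Function.comp_apply, he]
    ring

/-! ### Straight-line code -/

/-- The registers below `k` agree. -/
def Same (k : ℕ) (σ σ' : St) : Prop := ∀ ρ < k, σ'.reg ρ = σ.reg ρ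

theorem Same.trans {k l : ℕ} {σ σ' σ'' : St} (h : Same k σ σ') (h' : Same l σ' σ'')
    (hkl : k ≤ l) : Same k σ σ'' := fun ρ hρ =>
  (h' ρ (by omega)).trans (h ρ hρ)

theorem Same.mono {k l : ℕ} {σ σ' : St} (h : Same l σ σ') (hkl : k ≤ l) : Same k σ σ' :=
  fun ρ hρ => h ρ (by omega)

theorem Same.set {k : ℕ} {σ σ' : St} (h : Same k σ σ') {r : ℕ} (v : ℕ) (hr : k ≤ r) :
    Same k σ (σ'.set r v) := fun ρ hρ => by
  rw [St.set_reg, if_neg (by omega)]; exact h ρ hρ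

theorem Same.refl (k : ℕ) (σ : St) : Same k σ σ := fun _ _ => rfl

section
variable {α β : Type} {P : Prog} {Ps : List Prog} {σ : St} {T q T' q' r : ℕ} {A : PMF α}
  {post : α → St → Prop} {e a : Expr}

theorem Spec.assign_cons (hr : r < 900) (hOk : e.Ok M.w σ.reg σ.mem)
    (hlt : e.eval σ.reg σ.mem < wordCap M.w)
    (h : Spec M (block Ps) (σ.set r (e.eval σ.reg σ.mem)) T q A post) :
    Spec M (block (assign r e :: Ps)) σ (T + e.cost + 5) q A post :=
  ((det_assign hr hOk hlt).seq_spec (by rintro _ rfl; exact h)).weaken (by omega) (by omega)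
    fun _ _ h => h

theorem Spec.store_cons (ha : a.Ok M.w σ.reg σ.mem) (hOk : e.Ok M.w σ.reg σ.mem)
    (h : Spec M (block Ps) (σ.put (a.eval σ.reg σ.mem) (e.eval σ.reg σ.mem)) T q A post) :
    Spec M (block (storeAt a e :: Ps)) σ (T + a.cost + e.cost + 4) q A post :=
  ((det_storeAt ha hOk).seq_spec (by rintro _ rfl; exact h)).weaken (by omega) (by omega)
    fun _ _ h => h

theorem Spec.query_cons (ha : a.Ok M.w σ.reg σ.mem)
    (h : Spec M (block Ps) (σ.set r (M.f (readBits n σ.mem (a.eval σ.reg σ.mem))).toNat)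
      T q A post) :
    Spec M (block (queryAt a r :: Ps)) σ (T + a.cost + 3 + n) (q + 1) A post :=
  ((det_queryAt ha).seq_spec (by rintro _ rfl; exact h)).weaken (by omega) (by omega)
    fun _ _ h => h

theorem Spec.cons_det {post' : St → Prop} (h : Det M P σ T q post')
    (h' : ∀ σ', post' σ' → Spec M (block Ps) σ' T' q' A post) :
    Spec M (block (P :: Ps)) σ (T + T' + 1) (q + q') A post := h.seq_spec h'

theorem Spec.cons {B : α → PMF β} {post' : β → St → Prop} (h : Spec M P σ T q A post)
    (h' : ∀ a σ', post a σ' → Spec M (block Ps) σ' T' q' (B a) post') :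
    Spec M (block (P :: Ps)) σ (T + T' + 1) (q + q') (A.bind B) post' := h.seq h'

theorem Spec.nil {x : α} (h : post x σ) : Spec M (block []) σ 1 0 (PMF.pure x) post :=
  spec_pure.2 (det_nil h)

end

/-- An outcome can be pulled back along `g` even if `g` is not injective: the reward of a value is
the supremum over its fibre. This turns a description of the final memory into one of the random
object written there. -/
theorem Spec.of_map {α β : Type} {P : Prog} {σ : St} {T q : ℕ} {A : PMF α} {g : α → β}
    {post : β → St → Prop} {post' : α → St → Prop} (h : Spec M P σ T q (A.map g) post)
    (hp : ∀ a σ', post (g a) σ' → post' a σ') : Spec M P σ T q A post' := by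
  intro Φ ψ hψ
  refine (h Φ (fun b => ⨆ x : {x // g x = b}, ψ x) fun b σ' hb => iSup_le fun x =>
    hψ _ _ (hp _ _ (by rw [x.2]; exact hb))).weaken le_rfl le_rfl (fun _ => le_rfl) ?_
  rw [expect_map]
  exact expect_mono _ fun x => le_iSup_of_le ⟨x, rfl⟩ le_rfl

/-! ### Random bits -/

/-- Fill the cells from `reg 60` on with `reg 61` random bits. -/
def fillRandom : Prog :=
  forLoop 82 61 (block [.coin 83, storeAt (.var 60 + .var 82) (.var 83)])

theorem spec_fillRandom {σ : St} {k : ℕ} (hk : σ.reg 61 = k)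
    (hcap : σ.reg 60 + k + 1 < wordCap M.w) :
    Spec M fillRandom σ (k * 35 + 13) 0 (PMF.uniformOfFintype (Fin k → Bool))
      fun x σ' => Same 82 σ σ' ∧ σ'.mem = writeBits σ.mem (σ.reg 60) x := by
  have h := Spec.forLoop (M := M) (i := 82) (b := 61) (N := k) (T := 18) (q := 0)
    (P := block [.coin 83, storeAt (.var 60 + .var 82) (.var 83)])
    (fun j m => (PMF.uniformOfFintype Bool).map fun b =>
      Function.update m (σ.reg 60 + j) b.toNat)
    (fun j m σ' => Same 82 σ σ' ∧ σ'.reg 82 = j ∧ σ'.mem = m) (by norm_num) (by norm_num)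
    (by omega) (by omega) (fun j m σ' h => ⟨h.2.1, (h.1 61 (by norm_num)).trans hk⟩)
    (fun j m σ' hj h => by
      obtain ⟨h1, h2, h3⟩ := h
      have h60 := h1 60 (by norm_num)
      rw [← PMF.bind_pure_comp]
      refine (Spec.cons spec_coin (T' := 13) (q' := 0) ?_).weaken (by norm_num) le_rfl
        fun _ _ h => h
      rintro b _ rfl
      refine (Spec.store_cons (by simp [h60, h2]; omega) (by simp) (Spec.nil ?_)).weaken
        (by simp) le_rfl fun _ _ h => h
      simp only [Expr.eval_add, Expr.eval_var, St.set_reg]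
      norm_num [h60, h2]
      refine ⟨fun ρ hρ => ?_, ?_⟩
      · simp only [St.set_reg, St.put_reg]
        rw [if_neg (by omega), if_neg (by omega)]; exact h1 ρ hρ
      · simp [St.put, St.set, h3])
    (a := σ.mem) (σ := σ) ⟨(Same.refl _ _).set _ (by norm_num), by simp, rfl⟩
  rw [iter_writeVec] at h
  exact (h.of_map fun x σ' hx => (⟨hx.1, hx.2.2⟩ :
    Same 82 σ σ' ∧ σ'.mem = writeBits σ.mem (σ.reg 60) x)).weaken (by omega) (by omega)
    fun _ _ h => h

end DTTest

/-! ### The programs of the tester and what they compute -/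

namespace DTTest
variable {n : ℕ} {M : Oracle n}

/-! ### Parameters and memory layout -/

/-- The number of blocks into which the variables are partitioned. -/
def numBlocks (d : ℕ) : ℕ := 2 ^ (2 * d + 3)

/-- The number of samples for learning the tree. -/
def numSamples (d : ℕ) : ℕ := 2 ^ d * 2 ^ d * (2 * d + 8)

/-- The number of rounds of the final test. -/
def numRounds (d m : ℕ) : ℕ := 300 * (d + 1) * m

theorem numBlocks_pos (d : ℕ) : 0 < numBlocks d := by unfold numBlocks; positivity

/-- The constant registers.  The memory holds, in this order, eight vectors of length `n`
(registers `10` to `16` point to all but the first), the partition (register `17`), the tree (`18`),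
the witness rows (`19`), the sample labels (`20`) and the sample rows (`21`). -/
structure Env (n d m : ℕ) (σ : St) : Prop where
  r0 : σ.reg 0 = n
  r1 : σ.reg 1 = d
  r2 : σ.reg 2 = m
  r3 : σ.reg 3 = 2 ^ d
  r4 : σ.reg 4 = numBlocks d
  r5 : σ.reg 5 = numSamples d
  r6 : σ.reg 6 = numRounds d m
  r10 : σ.reg 10 = n
  r11 : σ.reg 11 = 2 * n
  r12 : σ.reg 12 = 3 * n
  r13 : σ.reg 13 = 4 * n
  r14 : σ.reg 14 = 5 * n
  r15 : σ.reg 15 = 6 * n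
  r16 : σ.reg 16 = 7 * n
  r17 : σ.reg 17 = 8 * n
  r18 : σ.reg 18 = 9 * n
  r19 : σ.reg 19 = 9 * n + 2 * 2 ^ d
  r20 : σ.reg 20 = 9 * n + 3 * 2 ^ d
  r21 : σ.reg 21 = 9 * n + 3 * 2 ^ d + numSamples d
  r22 : σ.reg 22 = 2 * d + 3

theorem Env.of_same {d m k : ℕ} {σ σ' : St} (h : Env n d m σ) (hs : Same k σ σ') (hk : 23 ≤ k) :
    Env n d m σ' := by
  have e : ∀ ρ < 23, σ'.reg ρ = σ.reg ρ := fun ρ hρ => hs ρ (by omega)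
  constructor <;> rw [e _ (by norm_num)]
  exacts [h.r0, h.r1, h.r2, h.r3, h.r4, h.r5, h.r6, h.r10, h.r11, h.r12, h.r13, h.r14, h.r15,
    h.r16, h.r17, h.r18, h.r19, h.r20, h.r21, h.r22]

/-- All quantities of the algorithm fit into a word. -/
def Fits (M : Oracle n) (d m : ℕ) : Prop :=
  9 * n + 3 * 2 ^ d + numSamples d + numSamples d * numBlocks d + numBlocks d + numRounds d m +
    64 * (d + 1) + 100 < wordCap M.w

/-! ### Queries on hybrid inputs -/

/-- The input that agrees with `z` on the block `l` and is constant, given by `y`, on the other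
blocks of the partition `B`. -/
def hybrid {r : ℕ} (B : Fin n → Fin r) (l : ℕ) (y : Fin r → Bool) (z : Fin n → Bool) :
    Fin n → Bool := fun t => if (B t : ℕ) = l then z t else y (B t)

/-- Query the hybrid of the row at `reg 65` and the vector at `reg 66` with block `reg 64`. -/
def hybridQuery : Prog := block [
  forLoop 80 0 (cond (.bin .eq (.load (.var 17 + .var 80)) (.var 64))
    (storeAt (.var 16 + .var 80) (.load (.var 66 + .var 80)))
    (storeAt (.var 16 + .var 80) (.load (.var 65 + .load (.var 17 + .var 80))))),
  queryAt (.var 16) 81]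

/-- The memory holds the partition `B`. -/
def HasPartition {d : ℕ} (B : Fin n → Fin (numBlocks d)) (σ : St) : Prop :=
  ∀ t : Fin n, σ.mem (8 * n + t) = B t

theorem det_hybridQuery {d m : ℕ} {σ : St} {B : Fin n → Fin (numBlocks d)} (hE : Env n d m σ)
    (hF : Fits M d m) (hB : HasPartition B σ) (hrow : 8 * n ≤ σ.reg 65)
    (hrow' : σ.reg 65 + numBlocks d < wordCap M.w) (hp : σ.reg 66 + n ≤ 7 * n) :
    Det M hybridQuery σ (60 * n + 40) 1 fun σ' => Same 80 σ σ' ∧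
      (∀ a, a < 7 * n ∨ 8 * n ≤ a → σ'.mem a = σ.mem a) ∧
      σ'.reg 81 = (M.f (hybrid B (σ.reg 64) (readBits (numBlocks d) σ.mem (σ.reg 65))
        (readBits n σ.mem (σ.reg 66)))).toNat := by
  unfold Fits at hF
  have hloop := Det.forLoop (M := M) (i := 80) (b := 0) (N := n) (T := 34) (q := 0)
    (P := cond (.bin .eq (.load (.var 17 + .var 80)) (.var 64))
      (storeAt (.var 16 + .var 80) (.load (.var 66 + .var 80)))
      (storeAt (.var 16 + .var 80) (.load (.var 65 + .load (.var 17 + .var 80)))))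
    (fun k σ' => Same 80 σ σ' ∧ σ'.reg 80 = k ∧
      (∀ a, a < 7 * n ∨ 8 * n ≤ a → σ'.mem a = σ.mem a) ∧
      ∀ t : Fin n, (t : ℕ) < k → decide (σ'.mem (7 * n + t) ≠ 0) =
        hybrid B (σ.reg 64) (readBits (numBlocks d) σ.mem (σ.reg 65))
          (readBits n σ.mem (σ.reg 66)) t)
    (by norm_num) (by norm_num) (by omega) (by omega)
    (fun k σ' h => ⟨h.2.1, (h.1 0 (by norm_num)).trans hE.r0⟩)
    (fun k σ' hk h => by
      obtain ⟨h1, h2, h3, h4⟩ := h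
      have e16 := (h1 16 (by norm_num)).trans hE.r16
      have e17 := (h1 17 (by norm_num)).trans hE.r17
      have e64 := h1 64 (by norm_num)
      have e65 := h1 65 (by norm_num)
      have e66 := h1 66 (by norm_num)
      have hBk : σ'.mem (8 * n + k) = B ⟨k, hk⟩ := (h3 _ (by omega)).trans (hB ⟨k, hk⟩)
      have hlt := (B ⟨k, hk⟩).2
      -- Both branches store one cell of the hybrid vector; it suffices that the stored word `v`
      -- encodes the right bit.
      have key : ∀ v, decide (v ≠ 0) = hybrid B (σ.reg 64)
            (readBits (numBlocks d) σ.mem (σ.reg 65)) (readBits n σ.mem (σ.reg 66)) ⟨k, hk⟩ →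
          (σ'.put (7 * n + k) v).reg 80 = k ∧
          Same 80 σ ((σ'.put (7 * n + k) v).set 80 (k + 1)) ∧
          ((σ'.put (7 * n + k) v).set 80 (k + 1)).reg 80 = k + 1 ∧
          (∀ a, a < 7 * n ∨ 8 * n ≤ a →
            ((σ'.put (7 * n + k) v).set 80 (k + 1)).mem a = σ.mem a) ∧
          ∀ t : Fin n, (t : ℕ) < k + 1 →
            decide (((σ'.put (7 * n + k) v).set 80 (k + 1)).mem (7 * n + t) ≠ 0) =
            hybrid B (σ.reg 64) (readBits (numBlocks d) σ.mem (σ.reg 65))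
            (readBits n σ.mem (σ.reg 66)) t := by
        intro v hv
        refine ⟨h2, Same.set (fun ρ hρ => h1 ρ hρ) _ le_rfl, by simp, fun a ha => ?_,
          fun t ht => ?_⟩
        · rw [St.set_mem, St.put_mem, if_neg (by omega)]; exact h3 a ha
        · rw [St.set_mem, St.put_mem]
          split_ifs with h
          · rw [hv]; congr 1; ext; simp; omega
          · exact h4 t (by omega)
      refine (Det.cond (T := 21) (q := 0) ?_ (fun hc => ?_) fun hc => ?_).weaken (by simp) le_rfl
        fun _ h => h
      · simp only [Expr.ok_eq, Expr.ok_load, Expr.ok_add, Expr.ok_var, Expr.eval_var, e17, h2]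
        refine ⟨⟨by norm_num, by norm_num, by omega⟩, by norm_num, by omega⟩
      · refine (det_storeAt ?_ ?_).weaken (by simp) le_rfl ?_
        · simp [e16, h2]; omega
        · simp [e66, h2]; omega
        · rintro _ rfl
          simp only [St.eval, Expr.eval_add, Expr.eval_var, Expr.eval_load, e16, e66, h2]
          apply key
          simp only [St.eval, Expr.eval_eq, Expr.eval_add, Expr.eval_var, Expr.eval_load, e17, h2,
            hBk, e64] at hc
          rw [hybrid, if_pos (by by_contra h; simp [h] at hc), readBits,
            h3 _ (by omega)]
      · refine (det_storeAt ?_ ?_).weaken (by simp) le_rfl ?_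
        · simp [e16, h2]; omega
        · simp [e17, e65, h2, hBk]; omega
        · rintro _ rfl
          simp only [St.eval, Expr.eval_add, Expr.eval_var, Expr.eval_load, e16, e17, e65, h2, hBk]
          apply key
          simp only [St.eval, Expr.eval_eq, Expr.eval_add, Expr.eval_var, Expr.eval_load, e17, h2,
            hBk, e64] at hc
          rw [hybrid, if_neg (by intro h; simp [h] at hc), readBits, h3 _ (by omega)])
    (σ := σ) ⟨(Same.refl _ _).set _ (by norm_num), by simp, fun _ _ => rfl, by simp⟩
  refine (Spec.cons_det hloop fun σ' h => ?_).weaken (T := n * 51 + 13 + (n + 9) + 1) (q := 0 + 1)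
    (by omega) le_rfl fun _ _ h => h
  obtain ⟨h1, h2, h3, h4⟩ := h
  have e16 := (h1 16 (by norm_num)).trans hE.r16
  refine (Spec.query_cons (by simp) (Spec.nil ?_)).weaken (by simp; omega) le_rfl fun _ _ h => h
  have : readBits n σ'.mem (7 * n) = hybrid B (σ.reg 64)
      (readBits (numBlocks d) σ.mem (σ.reg 65)) (readBits n σ.mem (σ.reg 66)) :=
    funext fun t => h4 t t.2
  simp only [Expr.eval_var, e16, this]
  exact ⟨h1.set _ (by norm_num), h3, by simp⟩

end DTTest

/-! ### Self-corrected reads of a block -/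

namespace DTTest
variable {n : ℕ} {M : Oracle n}

theorem readBits_congr {k : ℕ} {m m' : ℕ → ℕ} {p : ℕ} (h : ∀ t < k, m' (p + t) = m (p + t)) :
    readBits k m' p = readBits k m p := funext fun t => by
  rw [readBits, readBits, h t t.2]

theorem writeBits_apply {k : ℕ} (m : ℕ → ℕ) (p : ℕ) (x : Fin k → Bool) (t : Fin k) :
    writeBits m p x (p + t) = (x t).toNat := by
  rw [writeBits, dif_pos ⟨by omega, by omega⟩]
  congr 2
  ext; simp

theorem writeBits_of_not {k : ℕ} (m : ℕ → ℕ) (p : ℕ) (x : Fin k → Bool) {a : ℕ}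
    (h : ¬ (p ≤ a ∧ a < p + k)) : writeBits m p x a = m a := by
  rw [writeBits, dif_neg h]

theorem writeBits_le_one {k : ℕ} (m : ℕ → ℕ) (p : ℕ) (x : Fin k → Bool) {a : ℕ}
    (h : p ≤ a ∧ a < p + k) : writeBits m p x a ≤ 1 := by
  rw [writeBits, dif_pos h]
  exact Bool.toNat_le _

@[simp] theorem readBits_writeBits {k : ℕ} (m : ℕ → ℕ) (p : ℕ) (x : Fin k → Bool) :
    readBits k (writeBits m p x) p = x := funext fun t => by
  rw [readBits, writeBits_apply]
  cases x t <;> simp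

theorem toNat_xor_eq (a b : Bool) : (a.toNat + b.toNat) % 2 = (a ^^ b).toNat := by
  cases a <;> cases b <;> rfl

/-- The pointwise exclusive or. -/
def xorVec (u p : Fin n → Bool) : Fin n → Bool := fun t => u t ^^ p t

/-- The self-corrected value of `h` at `p`, computed from a random shift. -/
noncomputable def readPMF (h : (Fin n → Bool) → Bool) (p : Fin n → Bool) : PMF Bool :=
  (PMF.uniformOfFintype (Fin n → Bool)).map fun u => h u ^^ h (xorVec u p)

/-- The black box restricted to the block `l`, with the other blocks fixed by `y`. -/
def blockFun {r : ℕ} (f : (Fin n → Bool) → Bool) (B : Fin n → Fin r) (l : ℕ) (y : Fin r → Bool) :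
    (Fin n → Bool) → Bool := fun z => f (hybrid B l y z)

/-- Write the exclusive or of the vectors at `reg 14` and `reg 69` to `reg 15`. -/
def xorLoop : Prog :=
  forLoop 79 0 (storeAt (.var 15 + .var 79)
    ((.load (.var 14 + .var 79) + .load (.var 69 + .var 79)) % .const 2))

/-- Read the bit of the vector at `reg 69` selected by block `reg 64` in the row `reg 65`. -/
def readBlock : Prog := block [
  assign 60 (.var 14),
  assign 61 (.var 0),
  fillRandom,
  xorLoop,
  assign 66 (.var 14),
  hybridQuery,
  assign 71 (.var 81),
  assign 66 (.var 15),
  hybridQuery,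
  assign 71 ((.var 71 + .var 81) % .const 2)]

theorem det_xorLoop {d m : ℕ} {σ : St} (hE : Env n d m σ) (hF : Fits M d m)
    (hu : ∀ t < n, σ.mem (5 * n + t) ≤ 1) (hp : σ.reg 69 + n ≤ 5 * n)
    (hp' : ∀ t < n, σ.mem (σ.reg 69 + t) ≤ 1) :
    Det M xorLoop σ (60 * n + 20) 0 fun σ' => Same 79 σ σ' ∧
      (∀ a, a < 6 * n ∨ 7 * n ≤ a → σ'.mem a = σ.mem a) ∧
      readBits n σ'.mem (6 * n) = xorVec (readBits n σ.mem (5 * n)) (readBits n σ.mem (σ.reg 69)) := by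
  unfold Fits at hF
  refine (Det.forLoop (M := M) (N := n) (T := 34) (q := 0)
    (fun k σ' => Same 79 σ σ' ∧ σ'.reg 79 = k ∧
      (∀ a, a < 6 * n ∨ 7 * n ≤ a → σ'.mem a = σ.mem a) ∧
      ∀ t < k, σ'.mem (6 * n + t) = (σ.mem (5 * n + t) + σ.mem (σ.reg 69 + t)) % 2)
    (by norm_num) (by norm_num) (by omega) (by omega)
    (fun k σ' h => ⟨h.2.1, (h.1 0 (by norm_num)).trans hE.r0⟩)
    (fun k σ' hk h => ?_) ⟨(Same.refl _ _).set _ (by norm_num), by simp, fun _ _ => rfl,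
      by simp⟩).weaken (by omega) (by omega) ?_
  · obtain ⟨h1, h2, h3, h4⟩ := h
    have e14 := (h1 14 (by norm_num)).trans hE.r14
    have e15 := (h1 15 (by norm_num)).trans hE.r15
    have e69 := h1 69 (by norm_num)
    have m1 := h3 (5 * n + k) (by omega)
    have m2 := h3 (σ.reg 69 + k) (by omega)
    have b1 := hu k hk
    have b2 := hp' k hk
    refine (det_storeAt ?_ ?_).weaken (by simp) le_rfl ?_
    · simp [e15, h2]; omega
    · simp [e14, e69, h2, m1, m2]; omega
    · rintro _ rfl
      simp only [St.eval, Expr.eval_add, Expr.eval_mod, Expr.eval_const, Expr.eval_var,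
        Expr.eval_load, e14, e15, e69, h2, m1, m2]
      refine ⟨h2, Same.set (fun ρ hρ => h1 ρ hρ) _ le_rfl, by simp, fun a ha => ?_, fun t ht => ?_⟩
      · rw [St.set_mem, St.put_mem, if_neg (by omega)]; exact h3 a ha
      · rw [St.set_mem, St.put_mem]
        split_ifs with h
        · obtain rfl : t = k := by omega
          rfl
        · exact h4 t (by omega)
  · rintro σ' ⟨h1, h2, h3, h4⟩
    refine ⟨h1, h3, funext fun t => ?_⟩
    have b1 := hu t t.2
    have b2 := hp' t t.2
    simp only [readBits, xorVec, h4 t t.2]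
    interval_cases σ.mem (5 * n + t) <;> interval_cases σ.mem (σ.reg 69 + t) <;> rfl

/-- The two queries are at the hybrids of the random shift and of its exclusive or with the point.
The vectors in the cells from `5 * n` to `8 * n` (shift, shifted point, hybrid) are scratch, and
this is why points to be read have to lie below `5 * n`. -/
theorem spec_readBlock {d m : ℕ} {σ : St} {B : Fin n → Fin (numBlocks d)} (hE : Env n d m σ)
    (hF : Fits M d m) (hB : HasPartition B σ) (hrow : 8 * n ≤ σ.reg 65)
    (hrow' : σ.reg 65 + numBlocks d < wordCap M.w) (hp : σ.reg 69 + n ≤ 5 * n)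
    (hp' : ∀ t < n, σ.mem (σ.reg 69 + t) ≤ 1) :
    Spec M readBlock σ (300 * n + 200) 2
      (readPMF (blockFun M.f B (σ.reg 64) (readBits (numBlocks d) σ.mem (σ.reg 65)))
        (readBits n σ.mem (σ.reg 69)))
      fun b σ' => Same 60 σ σ' ∧ σ'.reg 64 = σ.reg 64 ∧ σ'.reg 65 = σ.reg 65 ∧
        σ'.reg 71 = b.toNat ∧ ∀ a, a < 5 * n ∨ 8 * n ≤ a → σ'.mem a = σ.mem a := by
  have hF' := hF
  unfold Fits at hF'
  let h := blockFun M.f B (σ.reg 64) (readBits (numBlocks d) σ.mem (σ.reg 65))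
  let p := readBits n σ.mem (σ.reg 69)
  refine Spec.map (A := PMF.uniformOfFintype (Fin n → Bool))
    (post := fun u σ' => Same 60 σ σ' ∧ σ'.reg 64 = σ.reg 64 ∧ σ'.reg 65 = σ.reg 65 ∧
      σ'.reg 71 = (h u ^^ h (xorVec u p)).toNat ∧
      ∀ a, a < 5 * n ∨ 8 * n ≤ a → σ'.mem a = σ.mem a) ?_ _ fun u σ' hu => hu
  unfold readBlock
  refine (Spec.assign_cons (T := 300 * n + 188) (by norm_num) (by simp)
    (by simp [hE.r14]; omega) ?_).weaken (by simp) le_rfl fun _ _ h => h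
  refine (Spec.assign_cons (T := 300 * n + 182) (by norm_num) (by simp)
    (by simp [hE.r0]; omega) ?_).weaken (by simp) le_rfl fun _ _ h => h
  simp only [Expr.eval_var, St.set_reg, St.set_mem]
  norm_num only [if_false, hE.r0, hE.r14]
  refine (Spec.seq_det (T := n * 35 + 13) (q := 0) (T' := 240 * n + 160) (q' := 2)
    (spec_fillRandom (k := n) (by simp) (by simp; omega)) ?_).weaken (by omega)
    (by omega) fun _ _ h => h
  rintro u σ₁ ⟨s₁, m₁⟩
  simp only [St.set_mem, St.set_reg] at m₁
  norm_num at m₁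
  have S₁ : ∀ ρ < 79, ρ ≠ 60 → ρ ≠ 61 → σ₁.reg ρ = σ.reg ρ := fun ρ hρ h1 h2 => by
    rw [s₁ ρ (by omega), St.set_reg, St.set_reg, if_neg h2, if_neg h1]
  have E₁ : Env n d m σ₁ := hE.of_same (k := 60) (fun ρ hρ => S₁ ρ (by omega) (by omega) (by omega))
    (by norm_num)
  have M₁ : ∀ a, a < 5 * n ∨ 6 * n ≤ a → σ₁.mem a = σ.mem a := fun a ha => by
    rw [m₁, writeBits_of_not _ _ _ (by omega)]
  have U₁ : readBits n σ₁.mem (5 * n) = u := by rw [m₁, readBits_writeBits]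
  refine (Spec.cons_det (T' := 170 * n + 130) (q' := 2) (det_xorLoop E₁ hF (fun t ht => ?_) ?_
    fun t ht => ?_) ?_).weaken (by omega) (by omega) fun _ _ h => h
  · rw [m₁]; exact writeBits_le_one _ _ _ (by omega)
  · rw [S₁ 69 (by norm_num) (by norm_num) (by norm_num)]; exact hp
  · rw [S₁ 69 (by norm_num) (by norm_num) (by norm_num), M₁ _ (by omega)]; exact hp' t ht
  rintro σ₂ ⟨s₂, m₂, v₂⟩
  rw [U₁, S₁ 69 (by norm_num) (by norm_num) (by norm_num),
    readBits_congr (m := σ.mem) fun t ht => M₁ _ (by omega)] at v₂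
  have S₂ : ∀ ρ < 79, ρ ≠ 60 → ρ ≠ 61 → σ₂.reg ρ = σ.reg ρ := fun ρ hρ h1 h2 => by
    rw [s₂ ρ hρ, S₁ ρ hρ h1 h2]
  have E₂ : Env n d m σ₂ := E₁.of_same s₂ (by norm_num)
  have M₂ : ∀ a, a < 5 * n ∨ 7 * n ≤ a → σ₂.mem a = σ.mem a := fun a ha => by
    rw [m₂ a (by omega), M₁ a (by omega)]
  have U₂ : readBits n σ₂.mem (5 * n) = u := by
    rw [← U₁]; exact readBits_congr fun t ht => m₂ _ (by omega)
  refine (Spec.assign_cons (T := 170 * n + 124) (by norm_num) (by simp)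
    (by simp [E₂.r14]; omega) ?_).weaken (by simp) le_rfl fun _ _ h => h
  simp only [Expr.eval_var, E₂.r14]
  have E₃ : Env n d m (σ₂.set 66 (5 * n)) := E₂.of_same ((Same.refl 60 _).set _ (by norm_num))
    (by norm_num)
  have r64 := S₂ 64 (by norm_num) (by norm_num) (by norm_num)
  have r65 := S₂ 65 (by norm_num) (by norm_num) (by norm_num)
  have rowEq : ∀ m' : ℕ → ℕ, (∀ a, a < 5 * n ∨ 8 * n ≤ a → m' a = σ.mem a) →
      readBits (numBlocks d) m' (σ.reg 65) = readBits (numBlocks d) σ.mem (σ.reg 65) :=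
    fun m' hm' => readBits_congr fun t ht => hm' _ (by omega)
  refine (Spec.cons_det (T' := 110 * n + 80) (q' := 1) (det_hybridQuery (B := B) E₃ hF
    (fun t => ?_) ?_ ?_ ?_) ?_).weaken (by omega) (by omega) fun _ _ h => h
  · rw [St.set_mem, M₂ _ (by omega)]; exact hB t
  · simpa [r65] using hrow
  · simpa [r65] using hrow'
  · simp; omega
  rintro σ₃ ⟨s₃, m₃, v₃⟩
  simp only [St.set_mem, St.set_reg] at m₃ v₃
  norm_num only [if_false, if_true, r64, r65] at v₃
  rw [U₂, rowEq _ fun a ha => M₂ a (by omega)] at v₃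
  have S₃ : ∀ ρ < 79, ρ ≠ 60 → ρ ≠ 61 → ρ ≠ 66 → σ₃.reg ρ = σ.reg ρ := fun ρ hρ h1 h2 h3 => by
    rw [s₃ ρ (by omega), St.set_reg, if_neg h3, S₂ ρ hρ h1 h2]
  have E₄ : Env n d m σ₃ := E₃.of_same s₃ (by norm_num)
  have M₃ : ∀ a, a < 5 * n ∨ 8 * n ≤ a → σ₃.mem a = σ.mem a := fun a ha => by
    rw [m₃ a (by omega), M₂ a (by omega)]
  have U₃ : readBits n σ₃.mem (6 * n) = xorVec u p := by
    rw [← v₂]; exact readBits_congr fun t ht => m₃ _ (by omega)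
  refine (Spec.assign_cons (T := 110 * n + 74) (by norm_num) (by simp)
    (by simp [v₃]; have := Bool.toNat_le (M.f (hybrid B (σ.reg 64)
      (readBits (numBlocks d) σ.mem (σ.reg 65)) u)); omega) ?_).weaken (by simp) le_rfl
    fun _ _ h => h
  refine (Spec.assign_cons (T := 110 * n + 68) (by norm_num) (by simp)
    (by simp [E₄.r15]; omega) ?_).weaken (by simp) le_rfl fun _ _ h => h
  simp only [Expr.eval_var, v₃, St.set_reg]
  norm_num only [if_false, E₄.r15]
  have E₅ : Env n d m ((σ₃.set 71 (M.f (hybrid B (σ.reg 64)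
      (readBits (numBlocks d) σ.mem (σ.reg 65)) u)).toNat).set 66 (6 * n)) :=
    E₄.of_same (((Same.refl 60 _).set _ (by norm_num)).set _ (by norm_num)) (by norm_num)
  have r64 := S₃ 64 (by norm_num) (by norm_num) (by norm_num) (by norm_num)
  have r65 := S₃ 65 (by norm_num) (by norm_num) (by norm_num) (by norm_num)
  refine (Spec.cons_det (T' := 25) (q' := 0) (det_hybridQuery (B := B) E₅ hF
    (fun t => ?_) ?_ ?_ ?_) ?_).weaken (by omega) (by omega) fun _ _ h => h
  · rw [St.set_mem, St.set_mem, M₃ _ (by omega)]; exact hB t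
  · simpa [r65] using hrow
  · simpa [r65] using hrow'
  · simp; omega
  rintro σ₄ ⟨s₄, m₄, v₄⟩
  simp only [St.set_mem, St.set_reg] at m₄ v₄
  norm_num only [if_false, if_true, r64, r65] at v₄
  rw [U₃, rowEq _ M₃] at v₄
  have v₅ := s₄ 71 (by norm_num)
  simp only [St.set_reg] at v₅
  norm_num only [if_false, if_true] at v₅
  have l1 := Bool.toNat_le (M.f (hybrid B (σ.reg 64)
      (readBits (numBlocks d) σ.mem (σ.reg 65)) u))
  have l2 := Bool.toNat_le (M.f (hybrid B (σ.reg 64)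
      (readBits (numBlocks d) σ.mem (σ.reg 65)) (xorVec u p)))
  refine (Spec.assign_cons (T := 1) (by norm_num) (by simp [v₄, v₅]; omega)
    (by simp [v₄, v₅]; omega) (Spec.nil ?_)).weaken (by simp) le_rfl fun _ _ h => h
  simp only [Expr.eval_mod, Expr.eval_add, Expr.eval_var, Expr.eval_const, v₄, v₅, toNat_xor_eq]
  have S₄ : ∀ ρ < 79, ρ ≠ 60 → ρ ≠ 61 → ρ ≠ 66 → ρ ≠ 71 → σ₄.reg ρ = σ.reg ρ :=
    fun ρ hρ h1 h2 h3 h4 => by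
      rw [s₄ ρ (by omega), St.set_reg, St.set_reg, if_neg h3, if_neg h4, S₃ ρ hρ h1 h2 h3]
  refine ⟨Same.set (fun ρ hρ => S₄ ρ (by omega) (by omega) (by omega) (by omega) (by omega)) _
    (by norm_num), ?_, ?_, by simp [h, p, blockFun], fun a ha => ?_⟩
  · simp [S₄]
  · simp [S₄]
  · rw [St.set_mem, m₄ a (by omega), M₃ a ha]

end DTTest

namespace DTTest
variable {n : ℕ} {M : Oracle n}

/-! ### Testing a block for being a dictator -/

/-- The pointwise operation `(u ∧ v) ⊕ p`. -/
def combineVec (u v p : Fin n → Bool) : Fin n → Bool := fun t => (u t && v t) ^^ p t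

/-- One random test of `h`: self-corrected reads have to commute with `combineVec`. -/
noncomputable def testPMF (h : (Fin n → Bool) → Bool) : PMF Bool :=
  (PMF.uniformOfFintype (Fin n → Bool)).bind fun z₁ =>
  (PMF.uniformOfFintype (Fin n → Bool)).bind fun z₂ =>
  (PMF.uniformOfFintype (Fin n → Bool)).bind fun z₃ =>
  (readPMF h z₁).bind fun a₁ => (readPMF h z₂).bind fun a₂ => (readPMF h z₃).bind fun a₃ =>
  (readPMF h (combineVec z₁ z₂ z₃)).map fun a₄ => a₄ == ((a₁ && a₂) ^^ a₃)

/-- Fill the vector at the address in register `k` with random bits. -/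
def randomVec (k : ℕ) : Prog := block [assign 60 (.var k), assign 61 (.var 0), fillRandom]

/-- Read the bit of the vector at the address in register `k` into register `r`. -/
def readInto (k r : ℕ) : Prog := block [assign 69 (.var k), readBlock, assign r (.var 71)]

theorem spec_randomVec {σ : St} {k : ℕ} (hk : k < 60) (hn : σ.reg 0 = n)
    (hcap : σ.reg k + n + 1 < wordCap M.w) :
    Spec M (randomVec k) σ (40 * n + 40) 0 (PMF.uniformOfFintype (Fin n → Bool))
      fun x σ' => (∀ ρ < 80, ρ ≠ 60 → ρ ≠ 61 → σ'.reg ρ = σ.reg ρ) ∧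
        σ'.mem = writeBits σ.mem (σ.reg k) x := by
  refine (Spec.assign_cons (T := n * 35 + 25) (by norm_num) (by simp; omega) (by simp; omega)
    ?_).weaken (by simp; omega) le_rfl fun _ _ h => h
  refine (Spec.assign_cons (T := n * 35 + 15) (by norm_num) (by simp) (by simp [hn]; omega)
    ?_).weaken (by simp) le_rfl fun _ _ h => h
  simp only [Expr.eval_var, St.set_reg]
  norm_num only [if_false, hn]
  refine (Spec.seq_det (T := n * 35 + 13) (T' := 1) (q' := 0) (spec_fillRandom (k := n) (by simp)
    (by simp; omega)) fun u σ' hu => det_nil ?_).weaken (by omega) (by omega) fun _ _ h => h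
  obtain ⟨h1, h2⟩ := hu
  refine ⟨fun ρ hρ h3 h4 => ?_, ?_⟩
  · rw [h1 ρ (by omega), St.set_reg, St.set_reg, if_neg h4, if_neg h3]
  · simpa using h2

theorem spec_readInto {d m : ℕ} {σ : St} {B : Fin n → Fin (numBlocks d)} {k r : ℕ}
    (hk : k < 60) (hr : r < 60) (hE : Env n d m σ)
    (hF : Fits M d m) (hB : HasPartition B σ) (hrow : 8 * n ≤ σ.reg 65)
    (hrow' : σ.reg 65 + numBlocks d < wordCap M.w) (hp : σ.reg k + n ≤ 5 * n)
    (hp' : ∀ t < n, σ.mem (σ.reg k + t) ≤ 1) :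
    Spec M (readInto k r) σ (300 * n + 220) 2
      (readPMF (blockFun M.f B (σ.reg 64) (readBits (numBlocks d) σ.mem (σ.reg 65)))
        (readBits n σ.mem (σ.reg k)))
      fun b σ' => (∀ ρ < 60, ρ ≠ r → σ'.reg ρ = σ.reg ρ) ∧ σ'.reg 64 = σ.reg 64 ∧
        σ'.reg 65 = σ.reg 65 ∧ σ'.reg r = b.toNat ∧
        ∀ a, a < 5 * n ∨ 8 * n ≤ a → σ'.mem a = σ.mem a := by
  have hF' := hF
  unfold Fits at hF'
  refine (Spec.assign_cons (T := 300 * n + 214) (by norm_num) (by simp; omega) (by simp; omega)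
    ?_).weaken (by simp) le_rfl fun _ _ h => h
  have hs := spec_readBlock (B := B) (σ := σ.set 69 (σ.reg k))
    (hE.of_same ((Same.refl 60 _).set _ (by norm_num)) (by norm_num)) hF hB (by simpa using hrow)
    (by simpa using hrow') (by simpa using hp) (by simpa using hp')
  simp only [St.set_reg, St.set_mem] at hs
  norm_num at hs
  refine (Spec.seq_det (T' := 7) (q' := 0) hs fun b σ' hb => ?_).weaken (by omega)
    (by omega) fun _ _ h => h
  obtain ⟨h1, h2, h3, h4, h5⟩ := hb
  refine (Spec.assign_cons (T := 1) (by omega) (by simp) (by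
    have := Bool.toNat_le b; simp [h4]; omega) (Spec.nil ?_)).weaken (by simp) le_rfl
    fun _ _ h => h
  have e64 : (64 : ℕ) ≠ r := by omega
  have e65 : (65 : ℕ) ≠ r := by omega
  refine ⟨fun ρ hρ hne => ?_, by simp [e64, h2], by simp [e65, h3], by simp [h4], h5⟩
  rw [St.set_reg, if_neg hne, h1 ρ hρ, St.set_reg, if_neg (by omega)]

/-- Write `combineVec` of the vectors at registers `10`, `11`, `12` to register `13`. -/
def combineLoop : Prog :=
  forLoop 79 0 (storeAt (.var 13 + .var 79)
    ((.load (.var 10 + .var 79) * .load (.var 11 + .var 79) + .load (.var 12 + .var 79)) %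
      .const 2))

theorem det_combineLoop {d m : ℕ} {σ : St} (hE : Env n d m σ) (hF : Fits M d m)
    (hz : ∀ t < 3 * n, σ.mem (n + t) ≤ 1) :
    Det M combineLoop σ (70 * n + 20) 0 fun σ' => Same 79 σ σ' ∧
      (∀ a, a < 4 * n ∨ 5 * n ≤ a → σ'.mem a = σ.mem a) ∧
      (∀ t < n, σ'.mem (4 * n + t) ≤ 1) ∧
      readBits n σ'.mem (4 * n) = combineVec (readBits n σ.mem n) (readBits n σ.mem (2 * n))
        (readBits n σ.mem (3 * n)) := by
  unfold Fits at hF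
  refine (Det.forLoop (M := M) (N := n) (T := 44) (q := 0)
    (fun k σ' => Same 79 σ σ' ∧ σ'.reg 79 = k ∧
      (∀ a, a < 4 * n ∨ 5 * n ≤ a → σ'.mem a = σ.mem a) ∧
      ∀ t < k, σ'.mem (4 * n + t) =
        (σ.mem (n + t) * σ.mem (2 * n + t) + σ.mem (3 * n + t)) % 2)
    (by norm_num) (by norm_num) (by omega) (by omega)
    (fun k σ' h => ⟨h.2.1, (h.1 0 (by norm_num)).trans hE.r0⟩)
    (fun k σ' hk h => ?_) ⟨(Same.refl _ _).set _ (by norm_num), by simp, fun _ _ => rfl,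
      by simp⟩).weaken (by omega) (by omega) ?_
  · obtain ⟨h1, h2, h3, h4⟩ := h
    have e10 := (h1 10 (by norm_num)).trans hE.r10
    have e11 := (h1 11 (by norm_num)).trans hE.r11
    have e12 := (h1 12 (by norm_num)).trans hE.r12
    have e13 := (h1 13 (by norm_num)).trans hE.r13
    have m1 := h3 (n + k) (by omega)
    have m2 := h3 (2 * n + k) (by omega)
    have m3 := h3 (3 * n + k) (by omega)
    have b1 := hz k (by omega)
    have b2 := hz (n + k) (by omega)
    rw [← add_assoc, ← two_mul] at b2
    have b3 := hz (2 * n + k) (by omega)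
    rw [show n + (2 * n + k) = 3 * n + k by ring] at b3
    have b4 : σ.mem (n + k) * σ.mem (2 * n + k) ≤ 1 * 1 := Nat.mul_le_mul b1 b2
    refine (det_storeAt ?_ ?_).weaken (by simp) le_rfl ?_
    · simp [e13, h2]; omega
    · simp [e10, e11, e12, h2, m1, m2, m3]; omega
    · rintro _ rfl
      simp only [St.eval, Expr.eval_add, Expr.eval_mul, Expr.eval_mod, Expr.eval_const,
        Expr.eval_var, Expr.eval_load, e10, e11, e12, e13, h2, m1, m2, m3]
      refine ⟨h2, Same.set (fun ρ hρ => h1 ρ hρ) _ le_rfl, by simp, fun a ha => ?_, fun t ht => ?_⟩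
      · rw [St.set_mem, St.put_mem, if_neg (by omega)]; exact h3 a ha
      · rw [St.set_mem, St.put_mem]
        split_ifs with h
        · obtain rfl : t = k := by omega
          rfl
        · exact h4 t (by omega)
  · rintro σ' ⟨h1, h2, h3, h4⟩
    refine ⟨h1, h3, fun t ht => ?_, funext fun t => ?_⟩
    · rw [h4 t ht]; omega
    · have b1 := hz t (by omega)
      have b2 := hz (n + t) (by omega)
      rw [← add_assoc, ← two_mul] at b2
      have b3 := hz (2 * n + t) (by omega)
      rw [show n + (2 * n + t) = 3 * n + t by ring] at b3
      simp only [readBits, combineVec, h4 t t.2]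
      interval_cases σ.mem (n + t) <;> interval_cases σ.mem (2 * n + t) <;>
        interval_cases σ.mem (3 * n + t) <;> rfl

/-- The data computed by the learning phase: partition, tree with leaves, and witness rows. -/
structure Learned (M : Oracle n) {d : ℕ} (B : Fin n → Fin (numBlocks d)) (mem : ℕ → ℕ) : Prop where
  part : ∀ t : Fin n, mem (8 * n + t) = B t
  label : ∀ i < 2 ^ d, mem (9 * n + i) < numBlocks d
  leaf : ∀ i < 2 * 2 ^ d, 2 ^ d ≤ i → mem (9 * n + i) ≤ 1
  row : ∀ i < 2 ^ d, 9 * n ≤ mem (9 * n + 2 * 2 ^ d + i)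
  row' : ∀ i < 2 ^ d, mem (9 * n + 2 * 2 ^ d + i) + numBlocks d < wordCap M.w

/-- The restriction of the black box that belongs to the node `i` of the tree. -/
def nodeFun (M : Oracle n) {d : ℕ} (B : Fin n → Fin (numBlocks d)) (mem : ℕ → ℕ) (i : ℕ) :
    (Fin n → Bool) → Bool :=
  blockFun M.f B (mem (9 * n + i)) (readBits (numBlocks d) mem (mem (9 * n + 2 * 2 ^ d + i)))

/-- Label, row pointer and row of a node all lie at or above `8 * n`, hence outside everything that
the testing phase overwrites. -/
theorem nodeFun_congr {d : ℕ} {B : Fin n → Fin (numBlocks d)} {mem mem' : ℕ → ℕ}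
    (h : Learned M B mem) (hm : ∀ a, 8 * n ≤ a → mem' a = mem a) {i : ℕ} (hi : i < 2 ^ d) :
    nodeFun M B mem' i = nodeFun M B mem i := by
  have := h.row i hi
  unfold nodeFun
  rw [hm _ (by omega), hm (9 * n + 2 * 2 ^ d + i) (by omega),
    readBits_congr fun t ht => hm _ (by omega)]

theorem Learned.congr {d : ℕ} {B : Fin n → Fin (numBlocks d)} {mem mem' : ℕ → ℕ}
    (h : Learned M B mem) (hm : ∀ a, 8 * n ≤ a → mem' a = mem a) : Learned M B mem' := by
  constructor
  · intro t; rw [hm _ (by omega)]; exact h.part t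
  · intro i hi; rw [hm _ (by omega)]; exact h.label i hi
  · intro i hi hi'; rw [hm _ (by omega)]; exact h.leaf i hi hi'
  · intro i hi; rw [hm _ (by omega)]; exact h.row i hi
  · intro i hi; rw [hm _ (by omega)]; exact h.row' i hi

/-- Test the node in register `41`; set register `30` to `1` in case of failure. -/
def testNode : Prog := block [
  assign 64 (.load (.var 18 + .var 41)),
  assign 65 (.load (.var 19 + .var 41)),
  randomVec 10, randomVec 11, randomVec 12, combineLoop,
  readInto 10 51, readInto 11 52, readInto 12 53, readInto 13 54,
  cond (.bin .eq ((.var 51 * .var 52 + .var 53) % .const 2) (.var 54)) .skip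
    (assign 30 (.const 1))]

theorem spec_testNode {d m : ℕ} {σ : St} {B : Fin n → Fin (numBlocks d)} (hE : Env n d m σ)
    (hF : Fits M d m) (hL : Learned M B σ.mem) (hi : σ.reg 41 < 2 ^ d) :
    Spec M testNode σ (2000 * n + 2000) 8 (testPMF (nodeFun M B σ.mem (σ.reg 41)))
      fun b σ' => (∀ ρ < 50, ρ ≠ 30 → σ'.reg ρ = σ.reg ρ) ∧
        σ'.reg 30 = (if b then σ.reg 30 else 1) ∧
        ∀ a, a < n ∨ 8 * n ≤ a → σ'.mem a = σ.mem a := by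
  have hF' := hF
  unfold Fits at hF'
  have hlab := hL.label _ hi
  have hrow := hL.row _ hi
  have hrow' := hL.row' _ hi
  set l := σ.mem (9 * n + σ.reg 41) with hl
  set row := σ.mem (9 * n + 2 * 2 ^ d + σ.reg 41) with hro
  refine (Spec.assign_cons (T := 2000 * n + 1950) (by norm_num) (by simp [hE.r18]; omega)
    (by simp [hE.r18]; omega) ?_).weaken (by simp) le_rfl fun _ _ h => h
  refine (Spec.assign_cons (T := 2000 * n + 1900) (by norm_num) (by simp [hE.r19]; omega)
    (by simp [hE.r19]; omega) ?_).weaken (by simp) le_rfl fun _ _ h => h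
  simp only [Expr.eval_load, Expr.eval_add, Expr.eval_var, St.set_reg, St.set_mem]
  norm_num only [if_false, hE.r18, hE.r19, ← hl, ← hro]
  -- the states that occur during the test
  let Good : St → Prop := fun σ' => (∀ ρ < 50, σ'.reg ρ = σ.reg ρ) ∧ σ'.reg 64 = l ∧
    σ'.reg 65 = row ∧ ∀ a, a < n ∨ 8 * n ≤ a → σ'.mem a = σ.mem a
  have hG₀ : Good ((σ.set 64 l).set 65 row) := by
    refine ⟨fun ρ hρ => ?_, by simp, by simp, fun _ _ => rfl⟩
    rw [St.set_reg, St.set_reg, if_neg (by omega), if_neg (by omega)]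
  have env : ∀ σ', Good σ' → Env n d m σ' := fun σ' h =>
    hE.of_same (k := 50) h.1 (by norm_num)
  have rand : ∀ σ' k, Good σ' → k < 60 → n ≤ σ'.reg k → σ'.reg k + n ≤ 8 * n →
      Spec M (randomVec k) σ' (40 * n + 40) 0 (PMF.uniformOfFintype (Fin n → Bool))
        fun x σ'' => Good σ'' ∧ σ''.mem = writeBits σ'.mem (σ'.reg k) x := by
    intro σ' k h hk h1 h2
    refine (spec_randomVec hk (env σ' h).r0 (by omega)).weaken le_rfl le_rfl ?_
    rintro x σ'' ⟨h3, h4⟩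
    obtain ⟨g1, g2, g3, g4⟩ := h
    refine ⟨⟨fun ρ hρ => ?_, ?_, ?_, fun a ha => ?_⟩, h4⟩
    · rw [h3 ρ (by omega) (by omega) (by omega), g1 ρ hρ]
    · rw [h3 _ (by norm_num) (by norm_num) (by norm_num), g2]
    · rw [h3 _ (by norm_num) (by norm_num) (by norm_num), g3]
    · rw [h4, writeBits_of_not _ _ _ (by omega), g4 a ha]
  have read : ∀ σ' k r, Good σ' → k < 60 → 50 ≤ r → r < 60 → σ'.reg k + n ≤ 5 * n →
      (∀ t < n, σ'.mem (σ'.reg k + t) ≤ 1) →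
      Spec M (readInto k r) σ' (300 * n + 220) 2
        (readPMF (nodeFun M B σ.mem (σ.reg 41)) (readBits n σ'.mem (σ'.reg k)))
        fun b σ'' => Good σ'' ∧ (∀ ρ < 60, ρ ≠ r → σ''.reg ρ = σ'.reg ρ) ∧ σ''.reg r = b.toNat ∧
          ∀ a < 5 * n, σ''.mem a = σ'.mem a := by
    intro σ' k r h hk hr hr' h1 h2
    have e := env σ' h
    obtain ⟨g1, g2, g3, g4⟩ := h
    have hs := spec_readInto (B := B) hk hr' e hF (fun t => by
      rw [g4 _ (by omega)]; exact hL.part t) (by omega) (by omega) h1 h2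
    rw [g2, g3, readBits_congr (m := σ.mem) (p := row) fun t ht => g4 _ (by omega)] at hs
    refine hs.weaken le_rfl le_rfl ?_
    rintro b σ'' ⟨h3, h4, h5, h6, h7⟩
    refine ⟨⟨fun ρ hρ => ?_, h4, h5, fun a ha => ?_⟩, h3, h6, fun a ha => h7 a (Or.inl ha)⟩
    · rw [h3 ρ (by omega) (by omega), g1 ρ hρ]
    · rw [h7 a (by omega), g4 a ha]
  refine (Spec.cons (T' := 1900 * n + 1850) (q' := 8) (rand _ 10 hG₀ (by norm_num)
    (by rw [(env _ hG₀).r10]) (by rw [(env _ hG₀).r10]; omega)) ?_).weaken (by omega) (by omega)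
    fun _ _ h => h
  rintro z₁ σ₁ ⟨G₁, m₁⟩
  rw [(env _ hG₀).r10] at m₁
  refine (Spec.cons (T' := 1850 * n + 1800) (q' := 8) (rand _ 11 G₁ (by norm_num)
    (by rw [(env _ G₁).r11]; omega) (by rw [(env _ G₁).r11]; omega)) ?_).weaken (by omega)
    (by omega) fun _ _ h => h
  rintro z₂ σ₂ ⟨G₂, m₂⟩
  rw [(env _ G₁).r11] at m₂
  refine (Spec.cons (T' := 1800 * n + 1750) (q' := 8) (rand _ 12 G₂ (by norm_num)
    (by rw [(env _ G₂).r12]; omega) (by rw [(env _ G₂).r12]; omega)) ?_).weaken (by omega)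
    (by omega) fun _ _ h => h
  rintro z₃ σ₃ ⟨G₃, m₃⟩
  rw [(env _ G₂).r12] at m₃
  have v₁ : readBits n σ₃.mem n = z₁ := by
    rw [← readBits_writeBits ((σ.set 64 l).set 65 row).mem n z₁, ← m₁]
    refine readBits_congr fun t ht => ?_
    rw [m₃, writeBits_of_not _ _ _ (by omega), m₂, writeBits_of_not _ _ _ (by omega)]
  have v₂ : readBits n σ₃.mem (2 * n) = z₂ := by
    rw [← readBits_writeBits σ₁.mem (2 * n) z₂, ← m₂]
    refine readBits_congr fun t ht => ?_
    rw [m₃, writeBits_of_not _ _ _ (by omega)]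
  have v₃ : readBits n σ₃.mem (3 * n) = z₃ := by rw [m₃, readBits_writeBits]
  have hbit : ∀ t < 3 * n, σ₃.mem (n + t) ≤ 1 := fun t ht => by
    by_cases c3 : 3 * n ≤ n + t
    · rw [m₃]; exact writeBits_le_one _ _ _ (by omega)
    rw [m₃, writeBits_of_not _ _ _ (by omega)]
    by_cases c2 : 2 * n ≤ n + t
    · rw [m₂]; exact writeBits_le_one _ _ _ (by omega)
    rw [m₂, writeBits_of_not _ _ _ (by omega), m₁]
    exact writeBits_le_one _ _ _ (by omega)
  refine (Spec.cons_det (T' := 1700 * n + 1700) (q' := 8) (det_combineLoop (env _ G₃) hF hbit)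
    ?_).weaken (by omega) (by omega) fun _ _ h => h
  rintro σ₄ ⟨s₄, m₄, b₄, v₄⟩
  rw [v₁, v₂, v₃] at v₄
  have G₄ : Good σ₄ := by
    obtain ⟨g1, g2, g3, g4⟩ := G₃
    refine ⟨fun ρ hρ => ?_, ?_, ?_, fun a ha => ?_⟩
    · rw [s₄ ρ (by omega), g1 ρ hρ]
    · rw [s₄ _ (by norm_num), g2]
    · rw [s₄ _ (by norm_num), g3]
    · rw [m₄ a (by omega), g4 a ha]
  have bit₄ : ∀ t < 4 * n, σ₄.mem (n + t) ≤ 1 := fun t ht => by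
    by_cases c : t < 3 * n
    · rw [m₄ _ (by omega)]; exact hbit t c
    · have := b₄ (t - 3 * n) (by omega)
      rwa [show 4 * n + (t - 3 * n) = n + t by omega] at this
  have w₁ : readBits n σ₄.mem n = z₁ := by
    rw [← v₁]; exact readBits_congr fun t ht => m₄ _ (by omega)
  have w₂ : readBits n σ₄.mem (2 * n) = z₂ := by
    rw [← v₂]; exact readBits_congr fun t ht => m₄ _ (by omega)
  have w₃ : readBits n σ₄.mem (3 * n) = z₃ := by
    rw [← v₃]; exact readBits_congr fun t ht => m₄ _ (by omega)
  have r1 := read σ₄ 10 51 G₄ (by norm_num) (by norm_num) (by norm_num)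
    (by rw [(env _ G₄).r10]; omega) (by
      rw [(env _ G₄).r10]; exact fun t ht => bit₄ t (by omega))
  rw [(env _ G₄).r10, w₁] at r1
  refine (Spec.cons (T' := 1300 * n + 1400) (q' := 6) r1 ?_).weaken (by omega) (by omega)
    fun _ _ h => h
  rintro a₁ σ₅ ⟨G₅, k₅, x₅, y₅⟩
  have r2 := read σ₅ 11 52 G₅ (by norm_num) (by norm_num) (by norm_num)
    (by rw [(env _ G₅).r11]; omega) (by
      rw [(env _ G₅).r11]; intro t ht; rw [y₅ _ (by omega)]
      have := bit₄ (n + t) (by omega)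
      rwa [← add_assoc, ← two_mul] at this)
  rw [(env _ G₅).r11, readBits_congr (m := σ₄.mem) (fun t ht => y₅ _ (by omega)), w₂] at r2
  refine (Spec.cons (T' := 980 * n + 1100) (q' := 4) r2 ?_).weaken (by omega) (by omega)
    fun _ _ h => h
  rintro a₂ σ₆ ⟨G₆, k₆, x₆, y₆⟩
  have y₆' : ∀ a < 5 * n, σ₆.mem a = σ₄.mem a := fun a ha => (y₆ a ha).trans (y₅ a ha)
  have r3 := read σ₆ 12 53 G₆ (by norm_num) (by norm_num) (by norm_num)
    (by rw [(env _ G₆).r12]; omega) (by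
      rw [(env _ G₆).r12]; intro t ht; rw [y₆' _ (by omega)]
      have := bit₄ (2 * n + t) (by omega)
      rwa [show n + (2 * n + t) = 3 * n + t by ring] at this)
  rw [(env _ G₆).r12, readBits_congr (m := σ₄.mem) (fun t ht => y₆' _ (by omega)), w₃] at r3
  refine (Spec.cons (T' := 660 * n + 800) (q' := 2) r3 ?_).weaken (by omega) (by omega)
    fun _ _ h => h
  rintro a₃ σ₇ ⟨G₇, k₇, x₇, y₇⟩
  have y₇' : ∀ a < 5 * n, σ₇.mem a = σ₄.mem a := fun a ha => (y₇ a ha).trans (y₆' a ha)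
  have r4 := read σ₇ 13 54 G₇ (by norm_num) (by norm_num) (by norm_num)
    (by rw [(env _ G₇).r13]; omega) (by
      rw [(env _ G₇).r13]; intro t ht; rw [y₇' _ (by omega)]
      have := bit₄ (3 * n + t) (by omega)
      rwa [show n + (3 * n + t) = 4 * n + t by ring] at this)
  rw [(env _ G₇).r13, readBits_congr (m := σ₄.mem) (fun t ht => y₇' _ (by omega)), v₄] at r4
  refine (Spec.seq_det (T' := 100) (q' := 0) (post' := fun a₄ σ' =>
    (∀ ρ < 50, ρ ≠ 30 → σ'.reg ρ = σ.reg ρ) ∧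
    σ'.reg 30 = (if a₄ == ((a₁ && a₂) ^^ a₃) then σ.reg 30 else 1) ∧
    ∀ a, a < n ∨ 8 * n ≤ a → σ'.mem a = σ.mem a) r4 ?_ |>.map _ fun _ _ h => h).weaken
    (by omega) (by omega) fun _ _ h => h
  rintro a₄ σ₈ ⟨G₈, k₈, x₈, y₈⟩
  have e51 : σ₈.reg 51 = a₁.toNat := by
    rw [k₈ _ (by norm_num) (by norm_num), k₇ _ (by norm_num) (by norm_num),
      k₆ _ (by norm_num) (by norm_num), x₅]
  have e52 : σ₈.reg 52 = a₂.toNat := by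
    rw [k₈ _ (by norm_num) (by norm_num), k₇ _ (by norm_num) (by norm_num), x₆]
  have e53 : σ₈.reg 53 = a₃.toNat := by rw [k₈ _ (by norm_num) (by norm_num), x₇]
  -- On bits, product and sum modulo two are conjunction and exclusive or, so the word comparison
  -- performs the Boolean test.
  have key : ((a₁.toNat * a₂.toNat + a₃.toNat) % 2 = a₄.toNat) ↔
      (a₄ == ((a₁ && a₂) ^^ a₃)) = true := by
    cases a₁ <;> cases a₂ <;> cases a₃ <;> cases a₄ <;> simp
  have l1 := Bool.toNat_le a₁
  have l2 := Bool.toNat_le a₂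
  have l3 := Bool.toNat_le a₃
  have l4 : a₁.toNat * a₂.toNat ≤ 1 * 1 := Nat.mul_le_mul l1 l2
  obtain ⟨g1, g2, g3, g4⟩ := G₈
  refine (Spec.cons_det (T' := 1) (q' := 0) (Det.cond (T := 10) (q := 0) (post := fun σ' =>
    (∀ ρ < 50, ρ ≠ 30 → σ'.reg ρ = σ.reg ρ) ∧
    σ'.reg 30 = (if a₄ == ((a₁ && a₂) ^^ a₃) then σ.reg 30 else 1) ∧
    ∀ a, a < n ∨ 8 * n ≤ a → σ'.mem a = σ.mem a) ?_ (fun hc => ?_) fun hc => ?_)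
    fun σ' h => det_nil h).weaken (by simp) (by omega) fun _ _ h => h
  · simp only [Expr.ok_eq, Expr.ok_mod, Expr.ok_add, Expr.ok_mul, Expr.ok_var, Expr.ok_const,
      Expr.eval_add, Expr.eval_mul, Expr.eval_var, Expr.eval_const, e51, e52, e53]
    refine ⟨⟨⟨⟨?_, ?_, ?_⟩, ?_, ?_⟩, ?_, ?_⟩, ?_, ?_⟩ <;> omega
  · simp only [St.eval, Expr.eval_eq, Expr.eval_mod, Expr.eval_add, Expr.eval_mul, Expr.eval_var,
      Expr.eval_const, e51, e52, e53, x₈, key] at hc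
    refine det_skip.weaken (by norm_num) le_rfl ?_
    rintro _ rfl
    rw [if_pos (by by_contra h; simp [h] at hc)]
    exact ⟨fun ρ hρ _ => g1 ρ hρ, g1 30 (by norm_num), g4⟩
  · simp only [St.eval, Expr.eval_eq, Expr.eval_mod, Expr.eval_add, Expr.eval_mul, Expr.eval_var,
      Expr.eval_const, e51, e52, e53, x₈, key] at hc
    refine (det_assign (by norm_num) (by simp; omega) (by simp; omega)).weaken (by simp) le_rfl ?_
    rintro _ rfl
    rw [if_neg (by intro h; simp [h] at hc)]
    refine ⟨fun ρ hρ hne => ?_, by simp, g4⟩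
    rw [St.set_reg, if_neg hne, g1 ρ hρ]

end DTTest

namespace DTTest
variable {n : ℕ} {M : Oracle n}

/-! ### The rounds of the final test -/

/-- Walk down `k` levels from node `j` along the self-corrected values at `x`. -/
noncomputable def walkPMF (h : ℕ → (Fin n → Bool) → Bool) (x : Fin n → Bool) (k j : ℕ) : PMF ℕ :=
  iter (fun _ j => (readPMF (h j) x).map fun b => 2 * j + b.toNat) 0 k j

/-- Test all nodes below `k`. -/
noncomputable def testsPMF (h : ℕ → (Fin n → Bool) → Bool) (k : ℕ) : PMF Bool :=
  iter (fun i ok => (testPMF (h i)).map fun b => ok && b) 0 k true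

/-- A round: test all nodes and compare the leaf that a random example reaches with its label. -/
noncomputable def roundPMF (f : (Fin n → Bool) → Bool) (D : PMF (Fin n → Bool)) (d : ℕ)
    (h : ℕ → (Fin n → Bool) → Bool) (leaf : ℕ → ℕ) : PMF Bool :=
  D.bind fun x => (testsPMF h (2 ^ d)).bind fun ok =>
    (walkPMF h x d 1).map fun j => ok && decide (leaf j = (f x).toNat)

/-- Perform `k` rounds. -/
noncomputable def roundsPMF (f : (Fin n → Bool) → Bool) (D : PMF (Fin n → Bool)) (d : ℕ)
    (h : ℕ → (Fin n → Bool) → Bool) (leaf : ℕ → ℕ) (k : ℕ) : PMF Bool :=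
  iter (fun _ ok => (roundPMF f D d h leaf).map fun b => ok && b) 0 k true

def testLoop : Prog := forLoop 41 3 testNode

def walkStep : Prog := block [
  assign 64 (.load (.var 18 + .var 42)),
  assign 65 (.load (.var 19 + .var 42)),
  assign 69 (.const 0),
  readBlock,
  assign 42 (.const 2 * .var 42 + .var 71)]

def walkLoop : Prog := forLoop 43 1 walkStep

/-- One round; failures set register `30` to `1`. -/
def roundProg : Prog := block [
  sampleAt (.const 0) 40,
  testLoop,
  assign 42 (.const 1),
  walkLoop,
  cond (.bin .eq (.load (.var 18 + .var 42)) (.var 40)) .skip (assign 30 (.const 1))]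

def roundsLoop : Prog := forLoop 31 6 roundProg

theorem iter_congr {α : Type} {B B' : ℕ → α → PMF α} (k j : ℕ)
    (h : ∀ i a, k ≤ i → i < k + j → B i a = B' i a) (a : α) : iter B k j a = iter B' k j a := by
  induction j generalizing k a with
  | zero => rfl
  | succ j ih =>
    rw [iter, iter, h k a le_rfl (by omega)]
    congr 1
    funext a'
    exact ih (k + 1) (fun i a h1 h2 => h i a (by omega) (by omega)) a'

theorem testsPMF_congr {h h' : ℕ → (Fin n → Bool) → Bool} {k : ℕ} (hh : ∀ i < k, h i = h' i) :
    testsPMF h k = testsPMF h' k :=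
  iter_congr _ _ (fun i a _ hi => by rw [hh i (by omega)]) _

theorem walkPMF_congr {h h' : ℕ → (Fin n → Bool) → Bool} {d : ℕ} {x : Fin n → Bool}
    (hh : ∀ i < 2 ^ d, h i = h' i) : walkPMF h x d 1 = walkPMF h' x d 1 := by
  -- A read only happens with at least one level left, that is at a node below `2 ^ d`; values of
  -- the node functions beyond that play no role.
  have key : ∀ k i j, i + k = d → j < 2 * 2 ^ i →
      iter (fun _ j => (readPMF (h j) x).map fun b => 2 * j + b.toNat) i k j =
      iter (fun _ j => (readPMF (h' j) x).map fun b => 2 * j + b.toNat) i k j := by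
    intro k
    induction k with
    | zero => intros; rfl
    | succ k ih =>
      intro i j hik hj
      have hpow : 2 * 2 ^ i ≤ 2 ^ d := by
        rw [← pow_succ']; exact Nat.pow_le_pow_right (by norm_num) (by omega)
      rw [iter, iter, hh _ (by omega), PMF.bind_map, PMF.bind_map]
      congr 1
      funext b
      have := Bool.toNat_le b
      exact ih (i + 1) _ (by omega) (by dsimp only; rw [pow_succ]; omega)
  exact key d 0 1 (by omega) (by norm_num)

theorem loop_time_le {N A B : ℕ} (h : A + 17 ≤ B) : N * (A + 17) + 13 ≤ N * B + 20 :=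
  Nat.add_le_add (Nat.mul_le_mul_left _ h) (by norm_num)

theorem spec_testLoop {d m : ℕ} {σ : St} {B : Fin n → Fin (numBlocks d)} (hE : Env n d m σ)
    (hF : Fits M d m) (hL : Learned M B σ.mem) :
    Spec M testLoop σ (2 ^ d * (2000 * n + 2020) + 20) (2 ^ d * 8)
      (testsPMF (nodeFun M B σ.mem) (2 ^ d))
      fun ok σ' => (∀ ρ < 41, ρ ≠ 30 → σ'.reg ρ = σ.reg ρ) ∧
        σ'.reg 30 = (if ok then σ.reg 30 else 1) ∧
        ∀ a, a < n ∨ 8 * n ≤ a → σ'.mem a = σ.mem a := by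
  have hF' := hF
  unfold Fits at hF'
  refine (Spec.forLoop (M := M) (N := 2 ^ d) (T := 2000 * n + 2000) (q := 8)
    (fun i ok => (testPMF (nodeFun M B σ.mem i)).map fun b => ok && b)
    (fun k ok σ' => (∀ ρ < 41, ρ ≠ 30 → σ'.reg ρ = σ.reg ρ) ∧ σ'.reg 41 = k ∧
      σ'.reg 30 = (if ok then σ.reg 30 else 1) ∧
        ∀ a, a < n ∨ 8 * n ≤ a → σ'.mem a = σ.mem a)
    (by norm_num) (by norm_num) (by omega) (by omega)
    (fun k ok σ' h => ⟨h.2.1, (h.1 3 (by norm_num) (by norm_num)).trans hE.r3⟩)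
    (fun k ok σ' hk h => ?_) (a := true) ⟨fun ρ hρ _ => by
      rw [St.set_reg, if_neg (by omega)], by simp, by simp, fun _ _ => rfl⟩).weaken ?_ le_rfl
      fun ok σ' h => ⟨h.1, h.2.2.1, h.2.2.2⟩
  · obtain ⟨h1, h2, h3, h4⟩ := h
    have hE' : Env n d m σ' := hE.of_same (k := 30) (fun ρ hρ => h1 ρ (by omega) (by omega))
      (by norm_num)
    have hs := spec_testNode hE' hF (hL.congr fun a ha => h4 a (Or.inr ha)) (by omega)
    rw [h2, nodeFun_congr hL (fun a ha => h4 a (Or.inr ha)) hk] at hs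
    refine hs.map _ fun b σ'' hb => ?_
    obtain ⟨g1, g2, g3⟩ := hb
    refine ⟨by rw [g1 41 (by norm_num) (by norm_num), h2], fun ρ hρ hne => ?_, by simp, ?_,
      fun a ha => ?_⟩
    · rw [St.set_reg, if_neg (by omega), g1 ρ (by omega) hne, h1 ρ hρ hne]
    · rw [St.set_reg, if_neg (by norm_num), g2, h3]
      cases ok <;> cases b <;> simp
    · rw [St.set_mem, g3 a ha, h4 a ha]
  · exact loop_time_le (by omega)

theorem spec_walkStep {d m j : ℕ} {σ : St} {B : Fin n → Fin (numBlocks d)} (hE : Env n d m σ)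
    (hF : Fits M d m) (hL : Learned M B σ.mem) (hx : ∀ t < n, σ.mem t ≤ 1)
    (h42 : σ.reg 42 = j) (hj : j < 2 ^ d) :
    Spec M walkStep σ (300 * n + 290) 2
      (readPMF (nodeFun M B σ.mem j) (readBits n σ.mem 0))
      fun b σ' => (∀ ρ < 60, ρ ≠ 42 → σ'.reg ρ = σ.reg ρ) ∧ σ'.reg 42 = 2 * j + b.toNat ∧
        ∀ a, a < n ∨ 8 * n ≤ a → σ'.mem a = σ.mem a := by
  have hF' := hF
  unfold Fits at hF'
  have hlab := hL.label j hj
  have hrow := hL.row j hj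
  have hrow' := hL.row' j hj
  refine (Spec.assign_cons (T := 300 * n + 270) (by norm_num) (by simp [hE.r18, h42]; omega)
    (by simp [hE.r18, h42]; omega) ?_).weaken (by simp) le_rfl fun _ _ h => h
  refine (Spec.assign_cons (T := 300 * n + 250) (by norm_num) (by simp [hE.r19, h42]; omega)
    (by simp [hE.r19, h42]; omega) ?_).weaken (by simp) le_rfl fun _ _ h => h
  refine (Spec.assign_cons (T := 300 * n + 240) (by norm_num) (by simp; omega)
    (by simp; omega) ?_).weaken (by simp) le_rfl fun _ _ h => h
  simp only [Expr.eval_load, Expr.eval_add, Expr.eval_var, Expr.eval_const, St.set_reg, St.set_mem]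
  norm_num only [if_false, hE.r18, hE.r19, h42]
  unfold nodeFun
  set l := σ.mem (9 * n + j)
  set row := σ.mem (9 * n + 2 * 2 ^ d + j)
  let τ := ((σ.set 64 l).set 65 row).set 69 0
  have t64 : τ.reg 64 = l := by simp [τ]
  have t65 : τ.reg 65 = row := by simp [τ]
  have t69 : τ.reg 69 = 0 := by simp [τ]
  have tS : Same 60 σ τ := ((((Same.refl 60 _).set _ (by norm_num)).set _ (by norm_num)).set _
    (by norm_num))
  have hs := spec_readBlock (B := B) (σ := τ) (hE.of_same tS (by norm_num)) hF
    (fun t => hL.part t) (by rw [t65]; omega) (by rw [t65]; exact hrow') (by rw [t69]; omega)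
    (by intro t ht; rw [t69, zero_add]; exact hx t ht)
  rw [t64, t65, t69] at hs
  refine (Spec.seq_det (T' := 25) (q' := 0) (post' := fun b σ' =>
    (∀ ρ < 60, ρ ≠ 42 → σ'.reg ρ = σ.reg ρ) ∧ σ'.reg 42 = 2 * j + b.toNat ∧
      ∀ a, a < n ∨ 8 * n ≤ a → σ'.mem a = σ.mem a) hs ?_).weaken (by omega) (by omega)
      fun _ _ h => h
  rintro b σ₁ ⟨g1, g2, g3, g4, g5⟩
  have gj : σ₁.reg 42 = j := by rw [g1 42 (by norm_num), tS 42 (by norm_num), h42]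
  have lb := Bool.toNat_le b
  refine (Spec.assign_cons (T := 1) (by norm_num) (by simp [gj, g4]; omega)
    (by simp [gj, g4]; omega) (Spec.nil ?_)).weaken (by simp) le_rfl fun _ _ h => h
  simp only [Expr.eval_mul, Expr.eval_add, Expr.eval_var, Expr.eval_const, gj, g4]
  refine ⟨fun ρ hρ hne => ?_, by simp, fun a ha => ?_⟩
  · rw [St.set_reg, if_neg hne, g1 ρ hρ, tS ρ hρ]
  · exact g5 a (by omega)

theorem spec_walkLoop {d m : ℕ} {σ : St} {B : Fin n → Fin (numBlocks d)} (hE : Env n d m σ)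
    (hF : Fits M d m) (hL : Learned M B σ.mem) (hx : ∀ t < n, σ.mem t ≤ 1)
    (h42 : σ.reg 42 = 1) :
    Spec M walkLoop σ (d * (300 * n + 320) + 20) (d * 2)
      (walkPMF (nodeFun M B σ.mem) (readBits n σ.mem 0) d 1)
      fun j σ' => (∀ ρ < 42, σ'.reg ρ = σ.reg ρ) ∧ σ'.reg 42 = j ∧ 2 ^ d ≤ j ∧ j < 2 * 2 ^ d ∧
        ∀ a, 8 * n ≤ a → σ'.mem a = σ.mem a := by
  have hF' := hF
  unfold Fits at hF'
  have hloop := Spec.forLoop (M := M) (i := 43) (b := 1) (P := walkStep) (N := d)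
    (T := 300 * n + 290) (q := 2) (a := 1) (σ := σ)
    (fun _ j => (readPMF (nodeFun M B σ.mem j) (readBits n σ.mem 0)).map fun b => 2 * j + b.toNat)
    (fun k j σ' => (∀ ρ < 42, σ'.reg ρ = σ.reg ρ) ∧ σ'.reg 43 = k ∧ σ'.reg 42 = j ∧ 2 ^ k ≤ j ∧
      j < 2 * 2 ^ k ∧ (∀ a, a < n ∨ 8 * n ≤ a → σ'.mem a = σ.mem a))
    (by norm_num) (by norm_num) (by omega) (by omega)
    (fun k j σ' h => ⟨h.2.1, (h.1 1 (by norm_num)).trans hE.r1⟩) ?_ ?_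
  · exact hloop.weaken (loop_time_le (by omega)) le_rfl fun j σ' h =>
      ⟨h.1, h.2.2.1, h.2.2.2.1, h.2.2.2.2.1, fun a ha => h.2.2.2.2.2 a (Or.inr ha)⟩
  · intro k j σ' hk h
    obtain ⟨h1, h2, h3, h4, h5, h6⟩ := h
    have hpow : 2 * 2 ^ k ≤ 2 ^ d := by
      rw [← pow_succ']; exact Nat.pow_le_pow_right (by norm_num) hk
    have hj : j < 2 ^ d := by omega
    have hs := spec_walkStep (hE.of_same (k := 42) h1 (by norm_num)) hF
      (hL.congr fun a ha => h6 a (Or.inr ha)) (fun t ht => by rw [h6 t (Or.inl ht)]; exact hx t ht)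
      h3 hj
    rw [nodeFun_congr hL (fun a ha => h6 a (Or.inr ha)) hj,
      readBits_congr (m := σ.mem) (fun t ht => h6 _ (by omega))] at hs
    refine hs.map _ fun b σ'' hb => ?_
    obtain ⟨g1, g2, g3⟩ := hb
    have lb := Bool.toNat_le b
    refine ⟨by rw [g1 43 (by norm_num) (by norm_num), h2], fun ρ hρ => ?_, by simp, by simp [g2],
      by rw [pow_succ]; omega, by rw [pow_succ]; omega, fun a ha => ?_⟩
    · rw [St.set_reg, if_neg (by omega), g1 ρ (by omega) (by omega), h1 ρ hρ]
    · rw [St.set_mem, g3 a ha, h6 a ha]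
  · exact ⟨fun ρ hρ => by rw [St.set_reg, if_neg (by omega)], by simp, by simpa using h42, by simp,
      by simp, fun _ _ => rfl⟩

theorem spec_roundProg {d m : ℕ} {σ : St} {B : Fin n → Fin (numBlocks d)} (hE : Env n d m σ)
    (hF : Fits M d m) (hL : Learned M B σ.mem) :
    Spec M roundProg σ (2 ^ d * (2000 * n + 2020) + d * (300 * n + 320) + n + 200)
      (1 + 2 ^ d * 8 + d * 2)
      (roundPMF M.f M.D d (nodeFun M B σ.mem) fun j => σ.mem (9 * n + j))
      fun ok σ' => (∀ ρ < 40, ρ ≠ 30 → σ'.reg ρ = σ.reg ρ) ∧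
        σ'.reg 30 = (if ok then σ.reg 30 else 1) ∧
        ∀ a, 8 * n ≤ a → σ'.mem a = σ.mem a := by
  have hF' := hF
  unfold Fits at hF'
  refine (Spec.cons (T' := 2 ^ d * (2000 * n + 2020) + d * (300 * n + 320) + 150)
    (q' := 2 ^ d * 8 + d * 2) (spec_sampleAt (by simp; omega)) ?_).weaken (by simp; omega)
    (by omega) fun _ _ h => h
  rintro x σ₁ hσ₁
  simp only [St.eval, Expr.eval_const] at hσ₁
  have R₁ : ∀ ρ < 40, σ₁.reg ρ = σ.reg ρ := fun ρ hρ => by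
    rw [hσ₁, St.set_reg, if_neg (by omega)]; rfl
  have v₁ : σ₁.reg 40 = (M.f x).toNat := by simp [hσ₁]
  have m₁ : σ₁.mem = writeBits σ.mem 0 x := by simp [hσ₁]
  have M₁ : ∀ a, 8 * n ≤ a → σ₁.mem a = σ.mem a := fun a ha => by
    by_cases h0 : n = 0
    · subst h0; rw [m₁, writeBits_of_not _ _ _ (by omega)]
    · rw [m₁, writeBits_of_not _ _ _ (by omega)]
  have E₁ : Env n d m σ₁ := hE.of_same R₁ (by norm_num)
  have hts := spec_testLoop E₁ hF (hL.congr M₁)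
  rw [testsPMF_congr fun i hi => nodeFun_congr hL M₁ hi] at hts
  refine (Spec.cons (T' := d * (300 * n + 320) + 100) (q' := d * 2) hts ?_).weaken (by omega)
    (by omega) fun _ _ h => h
  rintro ok σ₂ ⟨s₂, f₂, m₂⟩
  have R₂ : ∀ ρ < 40, ρ ≠ 30 → σ₂.reg ρ = σ.reg ρ := fun ρ hρ hne => by
    rw [s₂ ρ (by omega) hne, R₁ ρ hρ]
  have E₂ : Env n d m σ₂ := hE.of_same (k := 30) (fun ρ hρ => R₂ ρ (by omega) (by omega))
    (by norm_num)
  have M₂ : ∀ a, 8 * n ≤ a → σ₂.mem a = σ.mem a := fun a ha => by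
    rw [m₂ a (Or.inr ha), M₁ a ha]
  refine (Spec.assign_cons (T := d * (300 * n + 320) + 90) (by norm_num) (by simp; omega)
    (by simp; omega) ?_).weaken (by simp) le_rfl fun _ _ h => h
  simp only [Expr.eval_const]
  have hws := spec_walkLoop (B := B) (E₂.of_same (σ' := σ₂.set 42 1) ((Same.refl 40 _).set _
    (by norm_num)) (by norm_num)) hF (hL.congr M₂) (fun t ht => by
      rw [St.set_mem, m₂ t (Or.inl ht), m₁]; exact writeBits_le_one _ _ _ (by omega)) (by simp)
  rw [St.set_mem, readBits_congr (m := σ₁.mem) (fun t ht => m₂ _ (Or.inl (by omega))), m₁,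
    readBits_writeBits] at hws
  have hcg := walkPMF_congr (h := nodeFun M B σ₂.mem) (h' := nodeFun M B σ.mem) (d := d) (x := x)
    fun i hi => nodeFun_congr hL M₂ hi
  rw [hcg] at hws
  refine (Spec.seq_det (T' := 50) (q' := 0) (post' := fun j σ' =>
    (∀ ρ < 40, ρ ≠ 30 → σ'.reg ρ = σ.reg ρ) ∧
    σ'.reg 30 = (if ok && decide (σ.mem (9 * n + j) = (M.f x).toNat) then σ.reg 30 else 1) ∧
    ∀ a, 8 * n ≤ a → σ'.mem a = σ.mem a) hws ?_ |>.map _ fun _ _ h => h).weaken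
    (by omega) (by omega) fun _ _ h => h
  rintro j σ₃ ⟨s₃, h42, j1, j2, m₃⟩
  have R₃ : ∀ ρ < 41, σ₃.reg ρ = σ₂.reg ρ := fun ρ hρ => by
    rw [s₃ ρ (by omega), St.set_reg, if_neg (by omega)]
  have M₃ : ∀ a, 8 * n ≤ a → σ₃.mem a = σ.mem a := fun a ha => by
    rw [m₃ a ha]; exact M₂ a ha
  have e18 : σ₃.reg 18 = 9 * n := by rw [R₃ _ (by norm_num), E₂.r18]
  have e40 : σ₃.reg 40 = (M.f x).toNat := by
    rw [R₃ _ (by norm_num), s₂ _ (by norm_num) (by norm_num), v₁]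
  have e30 : σ₃.reg 30 = if ok then σ.reg 30 else 1 := by
    rw [R₃ _ (by norm_num), f₂, R₁ _ (by norm_num)]
  have hleaf := M₃ (9 * n + j) (by omega)
  refine (Spec.cons_det (T' := 1) (q' := 0) (Det.cond (T := 10) (q := 0) (post := fun σ' =>
    (∀ ρ < 40, ρ ≠ 30 → σ'.reg ρ = σ.reg ρ) ∧
    σ'.reg 30 = (if ok && decide (σ.mem (9 * n + j) = (M.f x).toNat) then σ.reg 30 else 1) ∧
    ∀ a, 8 * n ≤ a → σ'.mem a = σ.mem a) ?_ (fun hc => ?_) fun hc => ?_)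
    fun σ' h => det_nil h).weaken (by simp) (by omega) fun _ _ h => h
  · simp [e18, h42]; omega
  · simp only [St.eval, Expr.eval_eq, Expr.eval_load, Expr.eval_add, Expr.eval_var, e18, h42, e40,
      hleaf] at hc
    refine det_skip.weaken (by norm_num) le_rfl ?_
    rintro _ rfl
    refine ⟨fun ρ hρ hne => by rw [R₃ ρ (by omega), R₂ ρ hρ hne], ?_, M₃⟩
    have : σ.mem (9 * n + j) = (M.f x).toNat := by by_contra h; simp [h] at hc
    rw [e30, this]; simp
  · simp only [St.eval, Expr.eval_eq, Expr.eval_load, Expr.eval_add, Expr.eval_var, e18, h42, e40,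
      hleaf] at hc
    refine (det_assign (by norm_num) (by simp; omega) (by simp; omega)).weaken (by simp) le_rfl ?_
    rintro _ rfl
    have : ¬ σ.mem (9 * n + j) = (M.f x).toNat := by intro h; simp [h] at hc
    refine ⟨fun ρ hρ hne => ?_, by simp [this], M₃⟩
    rw [St.set_reg, if_neg hne, R₃ ρ (by omega), R₂ ρ hρ hne]

theorem spec_roundsLoop {d m : ℕ} {σ : St} {B : Fin n → Fin (numBlocks d)} (hE : Env n d m σ)
    (hF : Fits M d m) (hL : Learned M B σ.mem) (h30 : σ.reg 30 = 0) :
    Spec M roundsLoop σ (numRounds d m *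
        (2 ^ d * (2000 * n + 2020) + d * (300 * n + 320) + n + 220) + 20)
      (numRounds d m * (1 + 2 ^ d * 8 + d * 2))
      (roundsPMF M.f M.D d (nodeFun M B σ.mem) (fun j => σ.mem (9 * n + j)) (numRounds d m))
      fun ok σ' => σ'.reg 30 = (!ok).toNat := by
  have hF' := hF
  unfold Fits at hF'
  refine (Spec.forLoop (M := M) (N := numRounds d m) (q := 1 + 2 ^ d * 8 + d * 2)
    (T := 2 ^ d * (2000 * n + 2020) + d * (300 * n + 320) + n + 200)
    (fun i ok => (roundPMF M.f M.D d (nodeFun M B σ.mem) fun j => σ.mem (9 * n + j)).map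
      fun b => ok && b)
    (fun k ok σ' => (∀ ρ < 31, ρ ≠ 30 → σ'.reg ρ = σ.reg ρ) ∧ σ'.reg 31 = k ∧
      σ'.reg 30 = (!ok).toNat ∧
        ∀ a, 8 * n ≤ a → σ'.mem a = σ.mem a)
    (by norm_num) (by norm_num) (by omega) (by omega)
    (fun k ok σ' h => ⟨h.2.1, (h.1 6 (by norm_num) (by norm_num)).trans hE.r6⟩)
    (fun k ok σ' hk h => ?_) (a := true) ⟨fun ρ hρ _ => by
      rw [St.set_reg, if_neg (by omega)], by simp, by simp [h30], fun _ _ => rfl⟩).weaken ?_ le_rfl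
      fun ok σ' h => h.2.2.1
  · obtain ⟨h1, h2, h3, h4⟩ := h
    have hE' : Env n d m σ' := hE.of_same (k := 30) (fun ρ hρ => h1 ρ (by omega) (by omega))
      (by norm_num)
    have hs := spec_roundProg hE' hF (hL.congr h4)
    have hcg : (roundPMF M.f M.D d (nodeFun M B σ'.mem) fun j => σ'.mem (9 * n + j)) =
        roundPMF M.f M.D d (nodeFun M B σ.mem) fun j => σ.mem (9 * n + j) := by
      unfold roundPMF
      rw [testsPMF_congr fun i hi => nodeFun_congr hL h4 hi]
      have e : ∀ j, σ'.mem (9 * n + j) = σ.mem (9 * n + j) := fun j => h4 _ (by omega)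
      simp only [walkPMF_congr fun i hi => nodeFun_congr hL h4 hi, e]
    rw [hcg] at hs
    refine hs.map _ fun b σ'' hb => ?_
    obtain ⟨g1, g2, g3⟩ := hb
    refine ⟨by rw [g1 31 (by norm_num) (by norm_num), h2], fun ρ hρ hne => ?_, by simp, ?_,
      fun a ha => ?_⟩
    · rw [St.set_reg, if_neg (by omega), g1 ρ (by omega) hne, h1 ρ hρ hne]
    · rw [St.set_reg, if_neg (by norm_num), g2, h3]
      cases ok <;> cases b <;> simp
    · rw [St.set_mem, g3 a ha, h4 a ha]
  · exact loop_time_le (by omega)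

end DTTest

namespace DTTest
variable {n : ℕ} {M : Oracle n}

/-! ### Complete trees in heap order -/

/-- The node reached after `k` steps from the root of a tree in heap order. -/
def treeWalk (tree : ℕ → ℕ) (y : ℕ → Bool) : ℕ → ℕ
  | 0 => 1
  | k + 1 => 2 * treeWalk tree y k + (y (tree (treeWalk tree y k))).toNat

theorem treeWalk_bounds (tree : ℕ → ℕ) (y : ℕ → Bool) (k : ℕ) :
    2 ^ k ≤ treeWalk tree y k ∧ treeWalk tree y k < 2 * 2 ^ k := by
  induction k with
  | zero => simp [treeWalk]
  | succ k ih =>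
    have := Bool.toNat_le (y (tree (treeWalk tree y k)))
    rw [treeWalk, pow_succ]
    omega

theorem treeWalk_congr {tree tree' : ℕ → ℕ} {y : ℕ → Bool} {k : ℕ}
    (h : ∀ j < k, tree' (treeWalk tree y j) = tree (treeWalk tree y j)) :
    treeWalk tree' y k = treeWalk tree y k := by
  induction k with
  | zero => rfl
  | succ k ih => rw [treeWalk, treeWalk, ih fun j hj => h j (by omega), h k (by omega)]

theorem treeWalk_congr_lt {tree tree' : ℕ → ℕ} {y : ℕ → Bool} {k : ℕ}
    (h : ∀ c < 2 ^ k, tree' c = tree c) : treeWalk tree' y k = treeWalk tree y k := by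
  refine treeWalk_congr fun j hj => h _ ?_
  have h1 := (treeWalk_bounds tree y j).2
  have h2 : 2 ^ (j + 1) ≤ 2 ^ k := Nat.pow_le_pow_right (by norm_num) hj
  rw [pow_succ] at h2
  omega

/-- The node `c` belongs to the subtree with root `i`. -/
def InSub (i c : ℕ) : Prop := ∃ e, c / 2 ^ e = i

theorem InSub.le {i c : ℕ} (h : InSub i c) : i ≤ c := by
  obtain ⟨e, rfl⟩ := h
  exact Nat.div_le_self _ _

theorem InSub.refl (i : ℕ) : InSub i i := ⟨0, by simp⟩

theorem InSub.of_child {i c b : ℕ} (hb : b < 2) (h : InSub (2 * i + b) c) : InSub i c := by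
  obtain ⟨e, he⟩ := h
  exact ⟨e + 1, by rw [pow_succ, ← Nat.div_div_eq_div_mul, he]; omega⟩

/-- The ancestors of `c` are its iterated halves. Halving a number that is at most `2 * i + 1` gives
at most `i < 2 * i`, so the chain cannot contain both siblings at different heights, and at equal
heights they would coincide. -/
theorem InSub.disjoint {i c : ℕ} (hi : 1 ≤ i) (h : InSub (2 * i) c) (h' : InSub (2 * i + 1) c) :
    False := by
  have key : ∀ e t, c / 2 ^ e ≤ 2 * i + 1 → c / 2 ^ (e + (t + 1)) < 2 * i := by
    intro e t h
    rw [pow_add, ← Nat.div_div_eq_div_mul, pow_succ', ← Nat.div_div_eq_div_mul]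
    exact (Nat.div_le_self _ _).trans_lt (by omega)
  obtain ⟨e, he⟩ := h
  obtain ⟨e', he'⟩ := h'
  rcases lt_trichotomy e e' with hlt | rfl | hlt
  · obtain ⟨t, rfl⟩ := Nat.exists_eq_add_of_lt hlt
    have := key e t (by omega)
    rw [← add_assoc] at this
    omega
  · omega
  · obtain ⟨t, rfl⟩ := Nat.exists_eq_add_of_lt hlt
    have := key e' t (by omega)
    rw [← add_assoc] at this
    omega

theorem inSub_treeWalk (tree : ℕ → ℕ) (y : ℕ → Bool) (k j : ℕ) :
    InSub (treeWalk tree y k) (treeWalk tree y (k + j)) := by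
  refine ⟨j, ?_⟩
  induction j with
  | zero => simp
  | succ j ih =>
    have := Bool.toNat_le (y (tree (treeWalk tree y (k + j))))
    rw [pow_succ', ← Nat.div_div_eq_div_mul, ← add_assoc, treeWalk]
    rw [show (2 * treeWalk tree y (k + j) + (y (tree (treeWalk tree y (k + j)))).toNat) / 2 =
      treeWalk tree y (k + j) by omega]
    exact ih

/-- The samples in `A` are classified by some tree of depth `k` with labels below `r`. -/
def Separable (Y : ℕ → ℕ → Bool) (L : ℕ → ℕ) (r : ℕ) : ℕ → (ℕ → Prop) → Prop
  | 0, A => ∃ v, ∀ s, A s → L s = v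
  | k + 1, A => ∃ l < r, Separable Y L r k (fun s => A s ∧ Y s l = false) ∧
      Separable Y L r k (fun s => A s ∧ Y s l = true)

/-! ### Walking down the tree along a row of the memory -/

/-- The row at address `row`, with the value of block `l` overridden by `c`. -/
def rowVal (mem : ℕ → ℕ) (row l c : ℕ) : ℕ → Bool :=
  fun j => if j = l then decide (c ≠ 0) else decide (mem (row + j) ≠ 0)

def walkRowStep : Prog := block [
  cond (.bin .eq (.load (.var 18 + .var 87)) (.var 73)) (assign 86 (.var 74))
    (assign 86 (.load (.var 72 + .load (.var 18 + .var 87)))),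
  assign 87 (.const 2 * .var 87 + .var 86)]

/-- Walk down the tree along the row at `reg 72` with block `reg 73` overridden by `reg 74`. -/
def walkRow : Prog := block [assign 87 (.const 1), forLoop 85 1 walkRowStep]

/-- A label equal to register `73` is never looked up in the row, so that label may lie outside the
range of blocks. The search relies on this for nodes whose labels are exhausted. -/
theorem det_walkRow {d m : ℕ} {σ : St} (hE : Env n d m σ) (hF : Fits M d m)
    (hlab : ∀ i < 2 ^ d, σ.mem (9 * n + i) = σ.reg 73 ∨ σ.mem (9 * n + i) < numBlocks d)
    (hc : σ.reg 74 ≤ 1) (hrow : σ.reg 72 + numBlocks d < wordCap M.w)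
    (hbit : ∀ j < numBlocks d, σ.mem (σ.reg 72 + j) ≤ 1) :
    Det M walkRow σ (d * 80 + 40) 0 fun σ' => Same 85 σ σ' ∧ σ'.mem = σ.mem ∧
      σ'.reg 87 = treeWalk (fun i => σ.mem (9 * n + i))
        (rowVal σ.mem (σ.reg 72) (σ.reg 73) (σ.reg 74)) d := by
  have hF' := hF
  unfold Fits at hF'
  set tree := fun i => σ.mem (9 * n + i) with htree
  set y := rowVal σ.mem (σ.reg 72) (σ.reg 73) (σ.reg 74) with hy
  refine (Spec.assign_cons (T := d * 80 + 30) (by norm_num) (by simp; omega) (by simp; omega)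
    ?_).weaken (by simp) le_rfl fun _ _ h => h
  have hloop := Det.forLoop (M := M) (i := 85) (b := 1) (P := walkRowStep) (N := d)
    (T := 60) (q := 0) (σ := σ.set 87 1)
    (fun k σ' => Same 85 σ σ' ∧ σ'.reg 85 = k ∧ σ'.mem = σ.mem ∧ σ'.reg 87 = treeWalk tree y k)
    (by norm_num) (by norm_num) (by omega) (by omega)
    (fun k σ' h => ⟨h.2.1, (h.1 1 (by norm_num)).trans hE.r1⟩) ?_ ?_
  · exact (Spec.cons_det (T' := 1) (q' := 0) hloop fun σ' h =>
      det_nil ⟨h.1, h.2.2.1, h.2.2.2⟩).weaken (by omega) (by omega) fun _ _ h => h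
  · rintro k σ' hk ⟨h1, h2, h3, h4⟩
    have hb := treeWalk_bounds tree y k
    have hpow : 2 * 2 ^ k ≤ 2 ^ d := by
      rw [← pow_succ']; exact Nat.pow_le_pow_right (by norm_num) hk
    have e18 := (h1 18 (by norm_num)).trans hE.r18
    have e72 := h1 72 (by norm_num)
    have e73 := h1 73 (by norm_num)
    have e74 := h1 74 (by norm_num)
    have hl := hlab (treeWalk tree y k) (by omega)
    change tree (treeWalk tree y k) = _ ∨ tree (treeWalk tree y k) < _ at hl
    have emem : σ'.mem (9 * n + treeWalk tree y k) = tree (treeWalk tree y k) := by rw [h3]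
    refine (Spec.cons_det (T' := 20) (q' := 0) (Det.cond (T := 20) (q := 0) (post := fun σ'' =>
      σ'' = σ'.set 86 (y (tree (treeWalk tree y k))).toNat) ?_ (fun hc' => ?_) fun hc' => ?_)
      ?_).weaken (by simp) (by omega) fun _ _ h => h
    · simp [e18, h4]; omega
    · refine (det_assign (by norm_num) (by simp) (by simp [e74]; omega)).weaken (by simp) le_rfl ?_
      rintro _ rfl
      simp only [St.eval, Expr.eval_eq, Expr.eval_load, Expr.eval_add, Expr.eval_var, e18, h4, e73,
        emem] at hc'
      have h : tree (treeWalk tree y k) = σ.reg 73 := by by_contra h; simp [h] at hc'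
      simp only [St.eval, Expr.eval_var, e74]
      congr 1
      rw [hy, rowVal, if_pos h]
      interval_cases σ.reg 74 <;> rfl
    · simp only [St.eval, Expr.eval_eq, Expr.eval_load, Expr.eval_add, Expr.eval_var, e18, h4, e73,
        emem] at hc'
      have h : ¬ tree (treeWalk tree y k) = σ.reg 73 := by intro h; simp [h] at hc'
      have hlt : tree (treeWalk tree y k) < numBlocks d := hl.resolve_left h
      have hb' := hbit _ hlt
      have em2 : σ'.mem (σ.reg 72 + tree (treeWalk tree y k)) =
        σ.mem (σ.reg 72 + tree (treeWalk tree y k)) := by rw [h3]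
      refine (det_assign (by norm_num) (by simp [e18, e72, h4, emem]; omega)
        (by simp [e18, e72, h4, emem, em2]; omega)).weaken (by simp) le_rfl ?_
      rintro _ rfl
      simp only [St.eval, Expr.eval_load, Expr.eval_add, Expr.eval_var, e18, e72, h4, emem, em2]
      congr 1
      rw [hy, rowVal, if_neg h]
      interval_cases σ.mem (σ.reg 72 + tree (treeWalk tree y k)) <;> rfl
    · rintro _ rfl
      have := Bool.toNat_le (y (tree (treeWalk tree y k)))
      refine (Spec.assign_cons (T := 1) (by norm_num) (by simp [h4]; omega) (by simp [h4]; omega)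
        (Spec.nil ?_)).weaken (by simp) le_rfl fun _ _ h => h
      refine ⟨by simp [h2], fun ρ hρ => ?_, by simp, by simp [h3], by simp [h4, treeWalk]⟩
      rw [St.set_reg, if_neg (by omega), St.set_reg, if_neg (by omega), St.set_reg,
        if_neg (by omega), h1 ρ hρ]
  · refine ⟨fun ρ hρ => ?_, by simp, by simp, by simp [treeWalk]⟩
    rw [St.set_reg, if_neg (by omega), St.set_reg, if_neg (by omega)]

end DTTest

namespace DTTest
variable {n : ℕ} {M : Oracle n}

/-! ### Checking a leaf -/

/-- The address of the sample row `s`. -/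
def rowAddr (n d s : ℕ) : ℕ := 9 * n + 3 * 2 ^ d + numSamples d + s * numBlocks d

/-- The sample row `s`. -/
def sampleRow (n d : ℕ) (mem : ℕ → ℕ) (s : ℕ) : ℕ → Bool :=
  -- The overridden index `numBlocks d` is no block: it is the label left at exhausted nodes during
  -- the search, and it gets the value `0` instead of reading past the row.
  rowVal mem (rowAddr n d s) (numBlocks d) 0

/-- The label of the sample row `s`. -/
def sampleLabel (n d : ℕ) (mem : ℕ → ℕ) (s : ℕ) : ℕ := mem (9 * n + 3 * 2 ^ d + s)

/-- The memory holds bits as samples. -/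
structure HasSamples (n d : ℕ) (mem : ℕ → ℕ) : Prop where
  bit : ∀ s < numSamples d, ∀ j < numBlocks d, mem (rowAddr n d s + j) ≤ 1
  label : ∀ s < numSamples d, sampleLabel n d mem s ≤ 1

theorem rowAddr_lt {d m s : ℕ} (hF : Fits M d m) (hs : s < numSamples d) :
    rowAddr n d s + numBlocks d < wordCap M.w := by
  unfold Fits at hF
  unfold rowAddr
  have : (s + 1) * numBlocks d ≤ numSamples d * numBlocks d := Nat.mul_le_mul_right _ hs
  rw [add_mul] at this
  omega

theorem HasSamples.congr {d : ℕ} {mem mem' : ℕ → ℕ} (h : HasSamples n d mem)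
    (he : ∀ a, 9 * n + 3 * 2 ^ d ≤ a → mem' a = mem a) : HasSamples n d mem' := by
  refine ⟨fun s hs j hj => ?_, fun s hs => ?_⟩
  · rw [he _ (by unfold rowAddr; omega)]; exact h.bit s hs j hj
  · rw [sampleLabel, he _ (by omega)]; exact h.label s hs

theorem sampleRow_congr {d : ℕ} {mem mem' : ℕ → ℕ}
    (he : ∀ a, 9 * n + 3 * 2 ^ d ≤ a → mem' a = mem a) : sampleRow n d mem' = sampleRow n d mem := by
  funext s j
  unfold sampleRow rowVal
  rw [he _ (by unfold rowAddr; omega)]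

theorem sampleLabel_congr {d : ℕ} {mem mem' : ℕ → ℕ}
    (he : ∀ a, 9 * n + 3 * 2 ^ d ≤ a → mem' a = mem a) :
    sampleLabel n d mem' = sampleLabel n d mem := by
  funext s
  unfold sampleLabel
  rw [he _ (by omega)]

/-- Registers `50` and `51` record whether a sample with label `0`, respectively `1`, has reached
the leaf. -/
def leafCheckStep : Prog := block [
  assign 72 (.var 21 + .var 52 * .var 4),
  walkRow,
  cond (.bin .eq (.var 87) (.var 40))
    (cond (.load (.var 20 + .var 52)) (assign 51 (.const 1)) (assign 50 (.const 1))) .skip]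

/-- Check that all samples reaching the leaf `reg 40` have the same label and store it; `reg 41`
becomes `2` if so and `1` if not. -/
def leafCheck : Prog := block [
  assign 50 (.const 0), assign 51 (.const 0), assign 73 (.var 4), assign 74 (.const 0),
  forLoop 52 5 leafCheckStep,
  storeAt (.var 18 + .var 40) (.var 51),
  -- The product is `1` exactly when both labels occurred, so the mode becomes `1` (failure) in that
  -- case and `2` (success) otherwise. The stored leaf value, register `51`, is right whenever at
  -- most one label occurred.
  assign 41 (.const 2 - .var 50 * .var 51)]

/-- The time of `leafCheck`. -/
def leafCheckTime (d : ℕ) : ℕ := numSamples d * (d * 80 + 120) + 100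

theorem det_leafCheck {d m i : ℕ} {σ : St} (hE : Env n d m σ) (hF : Fits M d m)
    (hD : HasSamples n d σ.mem) (hlab : ∀ c < 2 ^ d, σ.mem (9 * n + c) ≤ numBlocks d)
    (hi : σ.reg 40 = i) (hi' : i < 2 * 2 ^ d) :
    Det M leafCheck σ (leafCheckTime d) 0 fun σ' => Same 41 σ σ' ∧ σ'.reg 42 = σ.reg 42 ∧
      ∃ v ≤ 1, σ'.mem = Function.update σ.mem (9 * n + i) v ∧
        (σ'.reg 41 = 2 ∧ (∀ s < numSamples d,
            treeWalk (fun c => σ.mem (9 * n + c)) (sampleRow n d σ.mem s) d = i →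
              sampleLabel n d σ.mem s = v) ∨
          σ'.reg 41 = 1 ∧ ¬ ∃ v, ∀ s < numSamples d,
            treeWalk (fun c => σ.mem (9 * n + c)) (sampleRow n d σ.mem s) d = i →
              sampleLabel n d σ.mem s = v) := by
  have hF' := hF
  unfold Fits at hF'
  have hr := numBlocks_pos d
  set tree := fun i => σ.mem (9 * n + i) with htree
  set hit : ℕ → ℕ → ℕ → Prop := fun k v s => s < k ∧ treeWalk tree (sampleRow n d σ.mem s) d = i ∧
    sampleLabel n d σ.mem s = v with hhit
  have hloop := Det.forLoop (M := M) (i := 52) (b := 5) (P := leafCheckStep) (N := numSamples d)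
    (T := d * 80 + 100) (q := 0)
    (σ := (((σ.set 50 0).set 51 0).set 73 (numBlocks d)).set 74 0)
    (fun k σ' => Same 43 σ σ' ∧ σ'.reg 52 = k ∧ σ'.mem = σ.mem ∧ σ'.reg 73 = numBlocks d ∧
      σ'.reg 74 = 0 ∧ σ'.reg 50 ≤ 1 ∧ σ'.reg 51 ≤ 1 ∧ (σ'.reg 50 = 1 ↔ ∃ s, hit k 0 s) ∧
      (σ'.reg 51 = 1 ↔ ∃ s, hit k 1 s))
    (by norm_num) (by norm_num) (by omega) (by omega)
    (fun k σ' h => ⟨h.2.1, (h.1 5 (by norm_num)).trans hE.r5⟩) ?_ ?_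
  · refine (Spec.assign_cons (by norm_num) (by simp; omega) (by simp; omega)
      (Spec.assign_cons (by norm_num) (by simp; omega) (by simp; omega)
      (Spec.assign_cons (r := 73) (by norm_num) (by simp) (by simp [hE.r4]; omega)
      (Spec.assign_cons (T := numSamples d * (d * 80 + 100 + 17) + 13 + 30 + 10) (by norm_num) (by simp; omega)
        (by simp; omega) ?_)))).weaken (by
          have : numSamples d * (d * 80 + 100 + 17) ≤ numSamples d * (d * 80 + 120) :=
            Nat.mul_le_mul_left _ (by omega)
          simp [leafCheckTime]; omega) le_rfl fun _ _ h => h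
    simp only [Expr.eval_const, Expr.eval_var, St.set_reg, hE.r4]
    norm_num
    refine (Spec.cons_det (T' := 30) (q' := 0) hloop ?_).weaken (by omega) (by omega) fun _ _ h => h
    rintro σ' ⟨h1, h2, h3, h4, h5, h6, h7, h8, h9⟩
    have e18 := (h1 18 (by norm_num)).trans hE.r18
    have e40 := (h1 40 (by norm_num)).trans hi
    have hmul : σ'.reg 50 * σ'.reg 51 ≤ 1 := by
      interval_cases σ'.reg 50 <;> interval_cases σ'.reg 51 <;> norm_num
    refine (Spec.store_cons (T := 20) (by simp [e18, e40]; omega) (by simp)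
      ?_).weaken (by simp) le_rfl fun _ _ h => h
    refine (Spec.assign_cons (r := 41) (T := 1) (by norm_num) (by simp; omega) (by simp; omega)
        (Spec.nil ?_)).weaken (by simp) le_rfl fun _ _ h => h
    refine ⟨fun ρ hρ => ?_, ?_, σ'.reg 51, h7, ?_, ?_⟩
    · rw [St.set_reg, if_neg (by omega), St.put_reg, h1 ρ (by omega)]
    · simp [h1 42 (by norm_num)]
    · funext a
      simp [e18, e40, h3, Function.update_apply]
    · simp only [Expr.eval_sub, Expr.eval_const, Expr.eval_mul, Expr.eval_var, St.set_reg,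
        St.put_reg, if_true]
      have hL : ∀ s < numSamples d, sampleLabel n d σ.mem s = 0 ∨ sampleLabel n d σ.mem s = 1 :=
        fun s hs => by have := hD.label s hs; omega
      by_cases h50 : σ'.reg 50 = 1
      · by_cases h51 : σ'.reg 51 = 1
        · right
          refine ⟨by rw [h50, h51], ?_⟩
          obtain ⟨s, hs, hs', hs''⟩ := h8.1 h50
          obtain ⟨t, ht, ht', ht''⟩ := h9.1 h51
          by_contra hne
          push Not at hne
          obtain ⟨u, hu⟩ := hne
          have e1 := hu s hs hs'
          have e2 := hu t ht ht'
          omega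
        · left
          have h0 : σ'.reg 51 = 0 := by omega
          refine ⟨by rw [h50, h0], fun s hs hs' => ?_⟩
          rw [h0]
          refine (hL s hs).resolve_right fun h => h51 (h9.2 ⟨s, hs, hs', h⟩)
      · left
        have h0 : σ'.reg 50 = 0 := by omega
        refine ⟨by rw [h0]; simp, fun s hs hs' => ?_⟩
        have h1' := (hL s hs).resolve_left fun h => h50 (h8.2 ⟨s, hs, hs', h⟩)
        rw [h1', eq_comm]
        exact h9.2 ⟨s, hs, hs', h1'⟩
  · rintro k σ' hk ⟨h1, h2, h3, h4, h5, h6, h7, h8, h9⟩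
    have hE' : Env n d m σ' := hE.of_same h1 (by norm_num)
    have hraddr := rowAddr_lt hF hk
    have hra : 9 * n + 3 * 2 ^ d + numSamples d + k * numBlocks d = rowAddr n d k := rfl
    refine (Spec.assign_cons (T := d * 80 + 75) (by norm_num) (by
      simp [hE'.r21, hE'.r4, h2, hra]; omega) (by simp [hE'.r21, hE'.r4, h2, hra]; omega)
      ?_).weaken (by simp; ) le_rfl fun _ _ h => h
    simp only [Expr.eval_add, Expr.eval_mul, Expr.eval_var, hE'.r21, hE'.r4, h2, hra]
    refine (Spec.cons_det (T' := 30) (q' := 0) (det_walkRow (d := d) (m := m) ?_ hF ?_ ?_ ?_ ?_)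
      ?_).weaken (by omega) (by omega) fun _ _ h => h
    · exact hE'.of_same (k := 43) ((Same.refl _ _).set _ (by norm_num)) (by norm_num)
    · intro c hc
      simp [h3, h4]
      have := hlab c hc
      omega
    · simp [h5]
    · simpa using hraddr
    · simpa [h3] using hD.bit k hk
    rintro σ'' ⟨g1, g2, g3⟩
    simp only [St.set_mem, St.set_reg, h3, if_true] at g2 g3
    norm_num [h4, h5] at g3
    change σ''.reg 87 = treeWalk tree (sampleRow n d σ.mem k) d at g3
    have f40 : σ''.reg 40 = i := by rw [g1 40 (by norm_num)]; simp [h1 40 (by norm_num), hi]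
    have f20 : σ''.reg 20 = 9 * n + 3 * 2 ^ d := by
      rw [g1 20 (by norm_num)]; simp [hE'.r20]
    have f52 : σ''.reg 52 = k := by rw [g1 52 (by norm_num)]; simp [h2]
    have f73 : σ''.reg 73 = numBlocks d := by rw [g1 73 (by norm_num)]; simp [h4]
    have f74 : σ''.reg 74 = 0 := by rw [g1 74 (by norm_num)]; simp [h5]
    have f50 : σ''.reg 50 = σ'.reg 50 := by rw [g1 50 (by norm_num)]; simp
    have f51 : σ''.reg 51 = σ'.reg 51 := by rw [g1 51 (by norm_num)]; simp
    have hS : Same 43 σ σ'' := fun ρ hρ => by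
      rw [g1 ρ (by omega), St.set_reg, if_neg (by omega), h1 ρ hρ]
    have hsucc : ∀ v, (∃ s, hit (k + 1) v s) ↔ (∃ s, hit k v s) ∨
        (treeWalk tree (sampleRow n d σ.mem k) d = i ∧ sampleLabel n d σ.mem k = v) := by
      intro v
      constructor
      · rintro ⟨s, hs, hs'⟩
        rcases Nat.lt_succ_iff_lt_or_eq.1 hs with h | rfl
        · exact Or.inl ⟨s, h, hs'⟩
        · exact Or.inr hs'
      · rintro (⟨s, hs, hs'⟩ | h)
        · exact ⟨s, by omega, hs'⟩
        · exact ⟨k, by omega, h⟩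
    have emem : σ''.mem (9 * n + 3 * 2 ^ d + k) = sampleLabel n d σ.mem k := by rw [g2]; rfl
    have hlabk := hD.label k hk
    refine (Spec.cons_det (T' := 1) (q' := 0) (Det.cond (T := 20) (q := 0) (by
      simp; omega) (fun hc => ?_) fun hc => ?_) fun σ' h =>
        det_nil h).weaken (by simp) (by omega) fun _ _ h => h
    · have hc' : treeWalk tree (sampleRow n d σ.mem k) d = i := by
        by_contra hne
        simp [g3, f40, hne] at hc
      refine (Det.cond (T := 10) (q := 0) (by simp [f20, f52]; omega) (fun hl => ?_)
        fun hl => ?_).weaken (by simp) le_rfl fun _ h => h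
      · simp only [St.eval, Expr.eval_load, Expr.eval_add, Expr.eval_var, f20, f52, emem] at hl
        refine (det_assign (by norm_num) (by simp; omega) (by simp; omega)).weaken (by simp)
          le_rfl ?_
        rintro _ rfl
        have hl1 : sampleLabel n d σ.mem k = 1 := by omega
        refine ⟨by simp [f52], (hS.set _ (by norm_num)).set _ (by norm_num), by simp, by simp [g2],
          by simp [f73], by simp [f74], by simp [f50, h6], by simp, ?_, ?_⟩
        · rw [hsucc, ← h8, hl1]; simp [f50]
        · rw [hsucc, ← h9, hl1]; simp [hc']
      · simp only [St.eval, Expr.eval_load, Expr.eval_add, Expr.eval_var, f20, f52, emem] at hl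
        refine (det_assign (by norm_num) (by simp; omega) (by simp; omega)).weaken (by simp)
          le_rfl ?_
        rintro _ rfl
        refine ⟨by simp [f52], (hS.set _ (by norm_num)).set _ (by norm_num), by simp, by simp [g2],
          by simp [f73], by simp [f74], by simp, by simp [f51, h7], ?_, ?_⟩
        · rw [hsucc, ← h8, hl]; simp [hc']
        · rw [hsucc, ← h9, hl]; simp [f51]
    · have hc' : treeWalk tree (sampleRow n d σ.mem k) d ≠ i := by
        intro hne
        simp [g3, f40, hne] at hc
      refine det_skip.weaken (by norm_num) le_rfl ?_
      rintro _ rfl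
      refine ⟨f52, hS.set _ (by norm_num), by simp, by simp [g2], by simp [f73], by simp [f74],
        by simp [f50, h6], by simp [f51, h7], ?_, ?_⟩
      · rw [hsucc, ← h8]; simp [hc', f50]
      · rw [hsucc, ← h9]; simp [hc', f51]
  · refine ⟨fun ρ hρ => ?_, ?_⟩
    · simp only [St.set_reg]
      rw [if_neg (by omega), if_neg (by omega), if_neg (by omega), if_neg (by omega),
        if_neg (by omega)]
    · simp [hhit]

end DTTest

namespace DTTest
variable {n : ℕ} {M : Oracle n}

/-! ### Searching for a consistent tree -/

def searchDown : Prog := cond (.bin .lt (.var 40) (.var 3))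
  (block [storeAt (.var 18 + .var 40) (.const 0), assign 40 (.const 2 * .var 40)]) leafCheck

/-- A failure of either child rules out the current label of the parent: the label is raised and the
search restarts at the left child. If no label is left, the mode stays `1` and the parent itself has
failed. -/
def searchFail : Prog := cond (.bin .eq (.var 40) (.const 1)) (assign 42 (.const 0)) (block [
  assign 40 (.var 40 / .const 2),
  storeAt (.var 18 + .var 40) (.load (.var 18 + .var 40) + .const 1),
  cond (.bin .lt (.load (.var 18 + .var 40)) (.var 4))
    (block [assign 40 (.const 2 * .var 40), assign 41 (.const 0)]) .skip])

/-- The parity of the heap index tells the children apart: after a success on the left the right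
sibling is searched, after a success on the right the parent has succeeded. -/
def searchSuccess : Prog := cond (.bin .eq (.var 40) (.const 1)) (assign 42 (.const 0))
  (cond (.var 40 % .const 2) (assign 40 (.var 40 / .const 2))
    (block [assign 40 (.var 40 + .const 1), assign 41 (.const 0)]))

/-- One step of the backtracking search at node `reg 40`; the mode `reg 41` is `0` when the
subtree of the node has to be searched, `1` after a failure and `2` after a success there. -/
def searchStep : Prog := cond (.bin .eq (.var 41) (.const 0)) searchDown
  (cond (.bin .eq (.var 41) (.const 1)) searchFail searchSuccess)

/-- Backtracking search for a tree that is consistent with the samples. -/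
def search : Prog := block [assign 40 (.const 1), assign 41 (.const 0), assign 42 (.const 1),
  whileDo (.var 42) searchStep]

/-- The invariant of the search started in state `σ₀`. -/
structure SearchInv (n d : ℕ) (σ₀ σ : St) : Prop where
  same : Same 40 σ₀ σ
  run : σ.reg 42 = 1
  -- The cell `9 * n` belongs to the unused heap index `0`; it is never written.
  frame : ∀ a, a ≤ 9 * n ∨ 9 * n + 2 * 2 ^ d ≤ a → σ.mem a = σ₀.mem a
  -- Equality is possible: a node whose labels were all tried keeps the value `numBlocks d`.
  lab : ∀ c < 2 ^ d, σ.mem (9 * n + c) ≤ numBlocks d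
  leaf : ∀ c, 2 ^ d ≤ c → c < 2 * 2 ^ d → σ.mem (9 * n + c) ≤ 1

theorem Det.loopBounds {σ : St} {e : Expr} {P : Prog} {T T' : ℕ} {Φ : St → ℝ≥0∞} {v : ℝ≥0∞}
    {post : St → Prop} (hOk : e.Ok M.w σ.reg σ.mem) (he : σ.eval e ≠ 0) (h : Det M P σ T 0 post)
    (h' : ∀ σ', post σ' → LoopBounds M e P σ' T' 0 Φ v) :
    LoopBounds M e P σ (T + e.cost + 2 + T') 0 Φ v := by
  classical
  -- The intermediate reward is `v` on states satisfying `post` and `0` elsewhere, where nothing is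
  -- left to prove.
  refine loopBounds_step (q := 0) (q' := 0) (T' := T') hOk he
    (det_iff.1 h (fun σ' => if post σ' then v else 0) v fun σ' hp => by simp [hp]) fun σ' => ?_
  split_ifs with hp
  · exact h' σ' hp
  · exact fun _ _ _ _ _ _ _ _ => zero_le

/-- One step of the search from a state satisfying the invariant. -/
theorem SearchInv.step {d T T' : ℕ} {σ₀ σ : St} {Φ : St → ℝ≥0∞} {v : ℝ≥0∞} {post : St → Prop}
    (hI : SearchInv n d σ₀ σ) (h : Det M searchStep σ T 0 post)
    (h' : ∀ σ', post σ' → LoopBounds M (.var 42) searchStep σ' T' 0 Φ v) :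
    LoopBounds M (.var 42) searchStep σ (T' + T + 3) 0 Φ v :=
  (Det.loopBounds (by simp) (by simp [St.eval, hI.run]) h h').weaken (by simp; omega) le_rfl

section
variable {d m i : ℕ} {σ₀ σ : St}

theorem SearchInv.env (hI : SearchInv n d σ₀ σ) (hE : Env n d m σ₀) : Env n d m σ :=
  hE.of_same hI.same (by norm_num)

theorem det_searchDown_inner (hE : Env n d m σ₀) (hF : Fits M d m) (hI : SearchInv n d σ₀ σ)
    (h40 : σ.reg 40 = i) (h41 : σ.reg 41 = 0) (hi : 1 ≤ i) (hid : i < 2 ^ d) :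
    Det M searchStep σ 60 0 fun σ' => SearchInv n d σ₀ σ' ∧ σ'.reg 40 = 2 * i ∧ σ'.reg 41 = 0 ∧
      σ'.mem = Function.update σ.mem (9 * n + i) 0 := by
  have hE' := hI.env hE
  have hF' := hF
  unfold Fits at hF'
  refine (Det.cond (T := 40) (q := 0) (by simp; omega) (fun _ => ?_) fun hc => ?_).weaken
    (by simp) le_rfl fun _ h => h
  swap
  · simp [St.eval, h41] at hc
  refine (Det.cond (T := 30) (q := 0) (by simp; omega) (fun _ => ?_) fun hc => ?_).weaken
    (by simp) le_rfl fun _ h => h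
  swap
  · simp [St.eval, h40, hE'.r3, hid] at hc
  refine (Spec.store_cons (T := 15) (by simp [hE'.r18, h40]; omega) (by simp; omega)
      ?_).weaken (by simp) le_rfl fun _ _ h => h
  refine (Spec.assign_cons (T := 1) (by norm_num) (by simp [h40]; omega) (by simp [h40]; omega)
    (Spec.nil ?_)).weaken (by simp) le_rfl fun _ _ h => h
  have hmem : ((σ.put (9 * n + i) 0).set 40 (2 * i)).mem = Function.update σ.mem (9 * n + i) 0 := by
    funext a; simp [Function.update_apply]
  simp only [Expr.eval_add, Expr.eval_var, Expr.eval_const, Expr.eval_mul, hE'.r18, h40, St.put_reg]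
  refine ⟨⟨fun ρ hρ => ?_, by simp [hI.run], fun a ha => ?_, fun c hc => ?_,
    fun c hc hc' => ?_⟩, by simp, by simp [h41], hmem⟩
  · rw [St.set_reg, if_neg (by omega), St.put_reg, hI.same ρ hρ]
  · rw [hmem, Function.update_of_ne (by omega), hI.frame a ha]
  · rw [hmem, Function.update_apply]
    have := hI.lab c hc
    split_ifs <;> omega
  · rw [hmem, Function.update_of_ne (by omega)]
    exact hI.leaf c hc hc'

theorem det_searchDown_leaf (hE : Env n d m σ₀) (hF : Fits M d m) (hD : HasSamples n d σ₀.mem)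
    (hI : SearchInv n d σ₀ σ)
    (h40 : σ.reg 40 = i) (h41 : σ.reg 41 = 0) (hi : 2 ^ d ≤ i) (hid : i < 2 * 2 ^ d) :
    Det M searchStep σ (leafCheckTime d + 40) 0 fun σ' => SearchInv n d σ₀ σ' ∧ σ'.reg 40 = i ∧
      ∃ v ≤ 1, σ'.mem = Function.update σ.mem (9 * n + i) v ∧
        (σ'.reg 41 = 2 ∧ (∀ s < numSamples d,
            treeWalk (fun c => σ.mem (9 * n + c)) (sampleRow n d σ₀.mem s) d = i →
              sampleLabel n d σ₀.mem s = v) ∨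
          σ'.reg 41 = 1 ∧ ¬ ∃ v, ∀ s < numSamples d,
            treeWalk (fun c => σ.mem (9 * n + c)) (sampleRow n d σ₀.mem s) d = i →
              sampleLabel n d σ₀.mem s = v) := by
  have hE' := hI.env hE
  have hF' := hF
  unfold Fits at hF'
  have hfr : ∀ a, 9 * n + 3 * 2 ^ d ≤ a → σ.mem a = σ₀.mem a := fun a ha =>
    hI.frame a (by omega)
  refine (Det.cond (T := leafCheckTime d + 15) (q := 0) (by simp; omega) (fun _ => ?_)
    fun hc => ?_).weaken (by simp) le_rfl fun _ h => h
  swap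
  · simp [St.eval, h41] at hc
  refine (Det.cond (T := leafCheckTime d) (q := 0) (by simp; omega) (fun hc => ?_)
    fun _ => ?_).weaken (by simp) le_rfl fun _ h => h
  · simp [St.eval, h40, hE'.r3] at hc
    omega
  refine (det_leafCheck hE' hF (hD.congr hfr) hI.lab h40 hid).weaken le_rfl le_rfl ?_
  rintro σ' ⟨h1, h2, v, hv, h3, h4⟩
  rw [sampleRow_congr hfr, sampleLabel_congr hfr] at h4
  refine ⟨⟨hI.same.trans h1 (by norm_num), h2.trans hI.run, fun a ha => ?_, fun c hc => ?_,
    fun c hc hc' => ?_⟩, (h1 40 (by norm_num)).trans h40, v, hv, h3, h4⟩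
  · rw [h3, Function.update_of_ne (by omega), hI.frame a ha]
  · rw [h3, Function.update_of_ne (by omega)]
    exact hI.lab c hc
  · rw [h3, Function.update_apply]
    have := hI.leaf c hc hc'
    split_ifs <;> omega

theorem det_searchFail (hE : Env n d m σ₀) (hF : Fits M d m) (hI : SearchInv n d σ₀ σ) {b l : ℕ}
    (hb : b ≤ 1) (h40 : σ.reg 40 = 2 * i + b) (h41 : σ.reg 41 = 1) (hi : 1 ≤ i) (hid : i < 2 ^ d)
    (hl : σ.mem (9 * n + i) = l) (hl' : l < numBlocks d) :
    Det M searchStep σ 150 0 fun σ' => SearchInv n d σ₀ σ' ∧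
      σ'.mem = Function.update σ.mem (9 * n + i) (l + 1) ∧
      (l + 1 < numBlocks d ∧ σ'.reg 40 = 2 * i ∧ σ'.reg 41 = 0 ∨
        l + 1 = numBlocks d ∧ σ'.reg 40 = i ∧ σ'.reg 41 = 1) := by
  have hE' := hI.env hE
  have hF' := hF
  unfold Fits at hF'
  refine (Det.cond (T := 140) (q := 0) (by simp; omega) (fun hc => ?_) fun _ => ?_).weaken
    (by simp) le_rfl fun _ h => h
  · simp [St.eval, h41] at hc
  refine (Det.cond (T := 120) (q := 0) (by simp; omega) (fun _ => ?_) fun hc => ?_).weaken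
    (by simp) le_rfl fun _ h => h
  swap
  · simp [St.eval, h41] at hc
  refine (Det.cond (T := 110) (q := 0) (by simp; omega) (fun hc => ?_) fun _ => ?_).weaken
    (by simp) le_rfl fun _ h => h
  · simp [St.eval, h40] at hc
    omega
  refine (Spec.assign_cons (T := 90) (by norm_num) (by simp [h40]; omega) (by simp [h40]; omega)
    ?_).weaken (by simp) le_rfl fun _ _ h => h
  simp only [Expr.eval_div, Expr.eval_var, Expr.eval_const, h40]
  rw [show (2 * i + b) / 2 = i by omega]
  refine (Spec.store_cons (T := 60) (by simp [hE'.r18]; omega) (by simp [hE'.r18, hl]; omega)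
      ?_).weaken (by simp) le_rfl fun _ _ h => h
  simp only [Expr.eval_add, Expr.eval_load, Expr.eval_var, Expr.eval_const, St.set_reg, if_true,
    St.set_mem]
  norm_num [hE'.r18, hl]
  have hmem : ((σ.set 40 i).put (9 * n + i) (l + 1)).mem =
      Function.update σ.mem (9 * n + i) (l + 1) := by
    funext a; simp [Function.update_apply]
  have hI' : ∀ σ', Same 40 ((σ.set 40 i).put (9 * n + i) (l + 1)) σ' → σ'.reg 42 = σ.reg 42 →
      σ'.mem = Function.update σ.mem (9 * n + i) (l + 1) → SearchInv n d σ₀ σ' := by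
    intro σ' hs h42 hm
    refine ⟨fun ρ hρ => ?_, h42.trans hI.run, fun a ha => ?_, fun c hc => ?_,
      fun c hc hc' => ?_⟩
    · rw [hs ρ hρ, St.put_reg, St.set_reg, if_neg (by omega), hI.same ρ hρ]
    · rw [hm, Function.update_of_ne (by omega), hI.frame a ha]
    · rw [hm, Function.update_apply]
      have := hI.lab c hc
      split_ifs <;> omega
    · rw [hm, Function.update_of_ne (by omega)]
      exact hI.leaf c hc hc'
  refine (Spec.cons_det (T' := 1) (q' := 0) (Det.cond (T := 25) (q := 0) (by simp [hE'.r18]; omega)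
    (fun hc => ?_) fun hc => ?_) fun σ' h => det_nil h).weaken (by simp) le_rfl fun _ _ h => h
  · simp [St.eval, hE'.r18, hE'.r4] at hc
    refine (Spec.assign_cons (T := 8) (by norm_num) (by simp; omega) (by simp; omega)
      ?_).weaken (by simp) le_rfl fun _ _ h => h
    refine (Spec.assign_cons (T := 1) (by norm_num) (by simp; omega) (by simp; omega)
        (Spec.nil ?_)).weaken (by simp) le_rfl fun _ _ h => h
    exact ⟨hI' _ (((Same.refl _ _).set _ (by norm_num)).set _ (by norm_num)) (by simp) hmem, hmem,
      Or.inl ⟨hc, by simp, by simp⟩⟩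
  · simp [St.eval, hE'.r18, hE'.r4] at hc
    refine det_skip.weaken (by norm_num) le_rfl ?_
    rintro _ rfl
    exact ⟨hI' _ (Same.refl _ _) (by simp) hmem, hmem, Or.inr ⟨by omega, by simp, by simp [h41]⟩⟩

theorem det_searchSuccess (hF : Fits M d m) (hI : SearchInv n d σ₀ σ) {b : ℕ}
    (hb : b ≤ 1) (h40 : σ.reg 40 = 2 * i + b) (h41 : σ.reg 41 = 2) (hi : 1 ≤ i) (hid : i < 2 ^ d) :
    Det M searchStep σ 60 0 fun σ' => SearchInv n d σ₀ σ' ∧ σ'.mem = σ.mem ∧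
      (b = 0 ∧ σ'.reg 40 = 2 * i + 1 ∧ σ'.reg 41 = 0 ∨ b = 1 ∧ σ'.reg 40 = i ∧ σ'.reg 41 = 2) := by
  have hF' := hF
  unfold Fits at hF'
  refine (Det.cond (T := 50) (q := 0) (by simp; omega) (fun hc => ?_) fun _ => ?_).weaken
    (by simp) le_rfl fun _ h => h
  · simp [St.eval, h41] at hc
  refine (Det.cond (T := 40) (q := 0) (by simp; omega) (fun hc => ?_) fun _ => ?_).weaken
    (by simp) le_rfl fun _ h => h
  · simp [St.eval, h41] at hc
  refine (Det.cond (T := 30) (q := 0) (by simp; omega) (fun hc => ?_) fun _ => ?_).weaken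
    (by simp) le_rfl fun _ h => h
  · simp [St.eval, h40] at hc
    omega
  refine (Det.cond (T := 20) (q := 0) (by simp [h40]; omega) (fun hc => ?_) fun hc => ?_).weaken
    (by simp) le_rfl fun _ h => h
  · simp [St.eval, h40] at hc
    refine (det_assign (by norm_num) (by simp [h40]; omega) (by simp [h40]; omega)).weaken (by simp)
      le_rfl ?_
    rintro _ rfl
    refine ⟨⟨hI.same.set _ (by norm_num), by simp [hI.run], fun a ha => hI.frame a ha, hI.lab,
      hI.leaf⟩, rfl,
      Or.inr ⟨by omega, ?_, by simp [h41]⟩⟩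
    simp [St.eval, h40]
    omega
  · simp [St.eval, h40] at hc
    refine (Spec.assign_cons (T := 8) (by norm_num) (by simp [h40]; omega) (by simp [h40]; omega)
      ?_).weaken (by simp) le_rfl fun _ _ h => h
    refine (Spec.assign_cons (T := 1) (by norm_num) (by simp; omega) (by simp; omega)
        (Spec.nil ?_)).weaken (by simp) le_rfl fun _ _ h => h
    refine ⟨⟨(hI.same.set _ (by norm_num)).set _ (by norm_num), by simp [hI.run],
      fun a ha => hI.frame a ha, hI.lab,
      hI.leaf⟩, rfl, Or.inl ⟨by omega, ?_, by simp⟩⟩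
    simp [h40]
    omega

theorem det_searchRoot (hF : Fits M d m) (h40 : σ.reg 40 = 1) (h41 : σ.reg 41 = 1 ∨ σ.reg 41 = 2) :
    Det M searchStep σ 60 0 fun σ' => σ' = σ.set 42 0 := by
  have hF' := hF
  unfold Fits at hF'
  have hend : ∀ P, Det M (cond (.bin .eq (.var 40) (.const 1)) (assign 42 (.const 0)) P) σ 30 0
      fun σ' => σ' = σ.set 42 0 := fun P => by
    refine (Det.cond (T := 5) (q := 0) (by simp; omega) (fun hc => ?_) fun hc => ?_).weaken
      (by simp) le_rfl fun _ h => h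
    · exact (det_assign (by norm_num) (by simp; omega) (by simp; omega)).weaken (by simp) le_rfl
        fun _ h => h
    · simp [St.eval, h40] at hc
  refine (Det.cond (T := 45) (q := 0) (by simp; omega) (fun hc => ?_) fun _ => ?_).weaken
    (by simp) le_rfl fun _ h => h
  · rcases h41 with h | h <;> simp [St.eval, h] at hc
  refine (Det.cond (T := 30) (q := 0) (by simp; omega) (fun hc => ?_) fun _ => ?_).weaken
    (by simp) le_rfl fun _ h => h
  · exact hend _
  · exact hend _

end
end DTTest

/-! ### Correctness and running time of the backtracking search -/

namespace DTTest
variable {n : ℕ} {M : Oracle n}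

theorem treeWalk_succ_iff (tree : ℕ → ℕ) (y : ℕ → Bool) (e i : ℕ) (b : Bool) :
    treeWalk tree y (e + 1) = 2 * i + b.toNat ↔ treeWalk tree y e = i ∧ y (tree i) = b := by
  rw [treeWalk]
  have h1 := Bool.toNat_le (y (tree (treeWalk tree y e)))
  have h2 := Bool.toNat_le b
  constructor
  · intro h
    have hw : treeWalk tree y e = i := by omega
    refine ⟨hw, ?_⟩
    rw [hw] at h
    have : (y (tree i)).toNat = b.toNat := by omega
    revert this
    cases y (tree i) <;> cases b <;> simp
  · rintro ⟨rfl, rfl⟩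
    rfl

/-- The time of the search below a node of height `k`. -/
def searchTime (d : ℕ) : ℕ → ℕ
  | 0 => leafCheckTime d + 50
  | k + 1 => numBlocks d * (2 * searchTime d k + 300) + 100

theorem InSub.cases {i c : ℕ} (h : InSub i c) :
    c = i ∨ InSub (2 * i) c ∨ InSub (2 * i + 1) c := by
  obtain ⟨e, he⟩ := h
  rcases e with _ | e
  · left; simpa using he
  · right
    rw [pow_succ, ← Nat.div_div_eq_div_mul] at he
    rcases Nat.mod_two_eq_zero_or_one (c / 2 ^ e) with h | h
    · exact Or.inl ⟨e, by omega⟩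
    · exact Or.inr ⟨e, by omega⟩

theorem inSub_one {c : ℕ} (h : 1 ≤ c) : InSub 1 c := by
  induction c using Nat.strong_induction_on with
  | _ c ih =>
    rcases h.lt_or_eq with h | rfl
    · obtain ⟨e, he⟩ := ih (c / 2) (by omega) (by omega)
      exact ⟨e + 1, by rw [pow_succ', ← Nat.div_div_eq_div_mul, he]⟩
    · exact InSub.refl 1

/-- The trees in the memory after the search below node `i` at depth `e` in state `σ`. -/
def SearchResult (n d k e i : ℕ) (σ₀ σ σ' : St) : Prop :=
  (∀ a, (∀ c, InSub i c → a ≠ 9 * n + c) → σ'.mem a = σ.mem a) ∧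
  (σ'.reg 41 = 2 ∧ (∀ s < numSamples d,
      treeWalk (fun c => σ'.mem (9 * n + c)) (sampleRow n d σ₀.mem s) e = i →
      σ'.mem (9 * n + treeWalk (fun c => σ'.mem (9 * n + c)) (sampleRow n d σ₀.mem s) d) =
        sampleLabel n d σ₀.mem s) ∧
      (∀ c < 2 ^ d, InSub i c → σ'.mem (9 * n + c) < numBlocks d) ∨
    σ'.reg 41 = 1 ∧ ¬ Separable (sampleRow n d σ₀.mem) (sampleLabel n d σ₀.mem) (numBlocks d) k
      fun s => s < numSamples d ∧
        treeWalk (fun c => σ.mem (9 * n + c)) (sampleRow n d σ₀.mem s) e = i)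

/-- The loop has no recursion stack, so a recursive call is expressed by its continuation: if the
loop is bounded from every state in which the search below `i` may end, then it is bounded from the
state in which that search begins, with `searchTime d k` added. Induction on the height `k` turns
the two searches below the children into two uses of the hypothesis. -/
theorem loopBounds_search {d m : ℕ} {σ₀ : St} {Φ : St → ℝ≥0∞} {v : ℝ≥0∞} (hE : Env n d m σ₀)
    (hF : Fits M d m) (hD : HasSamples n d σ₀.mem) (k : ℕ) : ∀ (e i : ℕ) (σ : St) (T' : ℕ),
    e + k = d → SearchInv n d σ₀ σ → σ.reg 40 = i → σ.reg 41 = 0 → 2 ^ e ≤ i → i < 2 * 2 ^ e →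
    (∀ σ', SearchInv n d σ₀ σ' → σ'.reg 40 = i → SearchResult n d k e i σ₀ σ σ' →
      LoopBounds M (.var 42) searchStep σ' T' 0 Φ v) →
    LoopBounds M (.var 42) searchStep σ (T' + searchTime d k) 0 Φ v := by
  induction k with
  | zero =>
    intro e i σ T' he hI h40 h41 hi hi' hcont
    obtain rfl : e = d := he
    refine (hI.step (T' := T') (det_searchDown_leaf hE hF hD hI h40 h41 hi hi') ?_).weaken
      (by simp [searchTime]; omega) le_rfl
    rintro σ' ⟨hI', h40', w, hw, hm, h⟩
    refine hcont σ' hI' h40' ⟨fun a ha => ?_, ?_⟩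
    · rw [hm, Function.update_of_ne (ha i (InSub.refl i))]
    · have hwalk : ∀ y, treeWalk (fun c => σ'.mem (9 * n + c)) y e =
          treeWalk (fun c => σ.mem (9 * n + c)) y e := fun y => treeWalk_congr_lt fun c hc => by
        rw [hm, Function.update_of_ne (by omega)]
      rcases h with ⟨h2, h⟩ | ⟨h1, h⟩
      · refine Or.inl ⟨h2, fun s hs hw => ?_, fun c hc hc' => absurd hc'.le (by omega)⟩
        rw [hw, hm, Function.update_self]
        rw [hwalk] at hw
        exact (h s hs hw).symm
      · refine Or.inr ⟨h1, fun ⟨v, hv⟩ => h ⟨v, fun s hs hw => hv s ⟨hs, hw⟩⟩⟩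
  | succ k ih =>
    intro e i σ T' he hI h40 h41 hi hi' hcont
    have h2e : 2 * 2 ^ e ≤ 2 ^ d := by
      rw [← pow_succ']; exact Nat.pow_le_pow_right (by norm_num) (by omega)
    have hi1 : 1 ≤ i := Nat.one_le_two_pow.trans hi
    have hp1 : 2 ^ (e + 1) = 2 * 2 ^ e := pow_succ' _ _
    have hr := numBlocks_pos d
    set Y := sampleRow n d σ₀.mem with hY
    set L := sampleLabel n d σ₀.mem with hL
    have hST : searchTime d (k + 1) = numBlocks d * (2 * searchTime d k + 300) + 100 := rfl
    set A : ℕ → Prop := fun s => s < numSamples d ∧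
      treeWalk (fun c => σ.mem (9 * n + c)) (Y s) e = i with hA
    -- A label is bad if it cannot be completed at node `i` for the samples that arrive there.
    set Bad : ℕ → Prop := fun l => ¬ (Separable Y L (numBlocks d) k (fun s => A s ∧ Y s l = false) ∧
      Separable Y L (numBlocks d) k (fun s => A s ∧ Y s l = true)) with hBad
    -- As long as only the subtree of `i` was modified, the samples arriving at a child are those
    -- arriving at `i` whose bit at the current label of `i` has the right value.
    have hset : ∀ (σ₁ : St) (b : Bool),
        (∀ a, (∀ c, InSub i c → a ≠ 9 * n + c) → σ₁.mem a = σ.mem a) →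
        (fun s => s < numSamples d ∧ treeWalk (fun c => σ₁.mem (9 * n + c)) (Y s) (e + 1) =
          2 * i + b.toNat) = fun s => A s ∧ Y s (σ₁.mem (9 * n + i)) = b := by
      intro σ₁ b hfr
      funext s
      rw [treeWalk_succ_iff, hA, ← and_assoc]
      rw [treeWalk_congr_lt (tree := fun c => σ.mem (9 * n + c)) fun c hc => hfr _ fun c' hc' => by
        have := hc'.le; omega]
    -- Inner induction on the number `j` of labels not yet refuted, starting at the left child with
    -- label `l`; each label costs at most two subtree searches and a constant.
    have key : ∀ j l (σ₁ : St), l + j = numBlocks d → 1 ≤ j → SearchInv n d σ₀ σ₁ →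
        σ₁.reg 40 = 2 * i → σ₁.reg 41 = 0 → σ₁.mem (9 * n + i) = l →
        (∀ a, (∀ c, InSub i c → a ≠ 9 * n + c) → σ₁.mem a = σ.mem a) → (∀ l' < l, Bad l') →
        LoopBounds M (.var 42) searchStep σ₁ (T' + j * (2 * searchTime d k + 300)) 0 Φ v := by
      intro j
      induction j with
      | zero => intro l σ₁ _ h; omega
      | succ j ihj =>
        intro l σ₁ hlj _ hI₁ h40₁ h41₁ hl hfr hbad
        -- Common treatment of a failure in either child: the label `l` is bad, and either the next
        -- label is tried or all labels are bad and the node is not separable.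
        have adv : ∀ (σ' : St) (b : Bool), SearchInv n d σ₀ σ' → σ'.reg 40 = 2 * i + b.toNat →
            σ'.reg 41 = 1 → σ'.mem (9 * n + i) = l →
            (∀ a, (∀ c, InSub i c → a ≠ 9 * n + c) → σ'.mem a = σ.mem a) → Bad l →
            LoopBounds M (.var 42) searchStep σ'
              (T' + j * (2 * searchTime d k + 300) + 150 + 3) 0 Φ v := by
          intro σ' b hI' h40' h41' hl' hfr' hb
          have hbad' : ∀ l' < l + 1, Bad l' := fun l' h => by
            rcases Nat.lt_succ_iff_lt_or_eq.1 h with h | rfl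
            · exact hbad l' h
            · exact hb
          refine hI'.step (det_searchFail hE hF hI' (Bool.toNat_le b) h40' h41' hi1 (by omega) hl'
            (by omega)) ?_
          rintro σ'' ⟨hI'', hm, h⟩
          have hfr'' : ∀ a, (∀ c, InSub i c → a ≠ 9 * n + c) → σ''.mem a = σ.mem a := fun a ha => by
            rw [hm, Function.update_of_ne (ha i (InSub.refl i)), hfr' a ha]
          rcases h with ⟨hlt, g1, g2⟩ | ⟨hlt, g1, g2⟩
          · exact ihj (l + 1) σ'' (by omega) (by omega) hI'' g1 g2
              (by rw [hm, Function.update_self]) hfr'' hbad'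
          · refine (hcont σ'' hI'' g1 ⟨hfr'', Or.inr ⟨g2, ?_⟩⟩).weaken (by omega) le_rfl
            rintro ⟨l', h1, h2⟩
            exact hbad' l' (by omega) h2
        have hnot : ∀ b : ℕ, b < 2 → ∀ c, InSub (2 * i + b) c → i ≠ c := fun b _ c hc => by
          have := hc.le; omega
        refine (ih (e + 1) (2 * i) σ₁ (T' + j * (2 * searchTime d k + 300) + 300 + searchTime d k)
          (by omega) hI₁ h40₁ h41₁ (by omega) (by omega) ?_).weaken (by
            rw [Nat.add_mul, one_mul]; omega) le_rfl
        rintro σ₂ hI₂ h40₂ ⟨hfr₂, h₂⟩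
        have hl₂ : σ₂.mem (9 * n + i) = l := by
          rw [hfr₂ _ fun c hc => by have := hnot 0 (by norm_num) c hc; omega, hl]
        have hfr₂' : ∀ a, (∀ c, InSub i c → a ≠ 9 * n + c) → σ₂.mem a = σ.mem a := fun a ha => by
          rw [hfr₂ a fun c hc => ha c (InSub.of_child (b := 0) (by norm_num) hc), hfr a ha]
        rcases h₂ with ⟨h41₂, hcons₂, hlab₂⟩ | ⟨h41₂, hsep⟩
        swap
        · refine (adv σ₂ false hI₂ h40₂ h41₂ hl₂ hfr₂' fun hs => hsep ?_).weaken (by omega) le_rfl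
          have := hset σ₁ false hfr
          simp only [Bool.toNat_false, add_zero] at this
          rw [this, hl]
          exact hs.1
        refine (hI₂.step (T' := T' + j * (2 * searchTime d k + 300) + 200 + searchTime d k)
          (det_searchSuccess hF hI₂ (b := 0) (by norm_num) h40₂ h41₂ hi1
          (by omega)) ?_).weaken (by omega) le_rfl
        rintro σ₃ ⟨hI₃, hm₃, ⟨-, h40₃, h41₃⟩ | ⟨h, -⟩⟩
        swap
        · omega
        refine (ih (e + 1) (2 * i + 1) σ₃ (T' + j * (2 * searchTime d k + 300) + 200)
          (by omega) hI₃ h40₃ h41₃ (by omega) (by omega) ?_)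
        rintro σ₄ hI₄ h40₄ ⟨hfr₄, h₄⟩
        have hl₄ : σ₄.mem (9 * n + i) = l := by
          rw [hfr₄ _ fun c hc => by have := hnot 1 (by norm_num) c hc; omega, hm₃, hl₂]
        have hfr₄' : ∀ a, (∀ c, InSub i c → a ≠ 9 * n + c) → σ₄.mem a = σ.mem a := fun a ha => by
          rw [hfr₄ a fun c hc => ha c (InSub.of_child (b := 1) (by norm_num) hc), hm₃, hfr₂' a ha]
        rcases h₄ with ⟨h41₄, hcons₄, hlab₄⟩ | ⟨h41₄, hsep⟩
        swap
        · refine (adv σ₄ true hI₄ h40₄ h41₄ hl₄ hfr₄' fun hs => hsep ?_).weaken (by omega) le_rfl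
          have := hset σ₃ true fun a ha => by rw [hm₃, hfr₂' a ha]
          simp only [Bool.toNat_true] at this
          rw [this, hm₃, hl₂]
          exact hs.2
        refine (hI₄.step (T' := T') (det_searchSuccess hF hI₄ (b := 1) le_rfl h40₄ h41₄ hi1
          (by omega)) ?_).weaken (by omega) le_rfl
        rintro σ₅ ⟨hI₅, hm₅, ⟨h, -⟩ | ⟨-, h40₅, h41₅⟩⟩
        · omega
        refine hcont σ₅ hI₅ h40₅ ⟨fun a ha => by rw [hm₅, hfr₄' a ha], Or.inl ⟨h41₅, ?_, ?_⟩⟩ <;> rw [hm₅] <;>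
          rw [hm₃] at hfr₄
        swap
        · intro c hc hc'
          rcases hc'.cases with rfl | h | h
          · omega
          · rw [hfr₄ _ fun c' hc' h' => InSub.disjoint hi1 h (by rwa [show c = c' by omega])]
            exact hlab₂ c hc h
          · exact hlab₄ c hc h
        intro s hs hw
        -- The search on the right writes only into the right subtree.
        have heq : ∀ c, (InSub (2 * i + 1) c → False) → σ₄.mem (9 * n + c) = σ₂.mem (9 * n + c) :=
          fun c hc => hfr₄ _ fun c' hc' h => hc (by rwa [show c = c' by omega])
        rcases hb : Y s (σ₄.mem (9 * n + i)) with _ | _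
        · have hw4 : treeWalk (fun c => σ₄.mem (9 * n + c)) (Y s) (e + 1) = 2 * i :=
            (treeWalk_succ_iff _ _ _ _ false).2 ⟨hw, hb⟩
          have hw2 : treeWalk (fun c => σ₂.mem (9 * n + c)) (Y s) (e + 1) = 2 * i := by
            rw [← hw4]
            refine (treeWalk_congr_lt fun c hc => heq c fun h => ?_).symm
            have := h.le
            omega
          -- A sample that turns left at `i` never visits the right subtree, so the later search on
          -- the right does not affect its classification: above the children the indices are too
          -- small, below them the two subtrees are disjoint.
          have hsub : ∀ j, InSub (2 * i + 1)
              (treeWalk (fun c => σ₂.mem (9 * n + c)) (Y s) j) → False := by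
            intro j hj
            rcases le_total (e + 1) j with h | h
            · obtain ⟨t, rfl⟩ := Nat.exists_eq_add_of_le h
              refine InSub.disjoint hi1 ?_ hj
              have := inSub_treeWalk (fun c => σ₂.mem (9 * n + c)) (Y s) (e + 1) t
              rwa [hw2] at this
            · have h1 := hj.le
              rcases h.lt_or_eq with h | rfl
              · have h2 := (treeWalk_bounds (fun c => σ₂.mem (9 * n + c)) (Y s) j).2
                have h3 : 2 ^ j ≤ 2 ^ e := Nat.pow_le_pow_right (by norm_num) (by omega)
                omega
              · omega
          rw [treeWalk_congr (tree := fun c => σ₂.mem (9 * n + c)) fun j _ => heq _ (hsub j),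
            heq _ (hsub d)]
          exact hcons₂ s hs hw2
        · exact hcons₄ s hs ((treeWalk_succ_iff _ _ _ _ true).2 ⟨hw, hb⟩)
    refine (hI.step (T' := T' + numBlocks d * (2 * searchTime d k + 300))
      (det_searchDown_inner hE hF hI h40 h41 hi1 (by omega)) ?_).weaken (by
        simp only [searchTime]; omega) le_rfl
    rintro σ' ⟨hI', h40', h41', hm⟩
    refine key (numBlocks d) 0 σ' (by omega) hr hI' h40' h41' (by rw [hm, Function.update_self])
      (fun a ha => by rw [hm, Function.update_of_ne (ha i (InSub.refl i))]) fun l' h => by omega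

/-- The search ends with a tree consistent with the samples if there is one. -/
theorem det_search {d m : ℕ} {σ : St} (hE : Env n d m σ) (hF : Fits M d m)
    (hD : HasSamples n d σ.mem) (hlab : ∀ c < 2 * 2 ^ d, σ.mem (9 * n + c) = 0) :
    Det M search σ (searchTime d d + 150) 0 fun σ' => Same 40 σ σ' ∧
      (∀ a, a ≤ 9 * n ∨ 9 * n + 2 * 2 ^ d ≤ a → σ'.mem a = σ.mem a) ∧
      (∀ c, 2 ^ d ≤ c → c < 2 * 2 ^ d → σ'.mem (9 * n + c) ≤ 1) ∧
      (σ'.reg 41 = 2 ∧ (∀ s < numSamples d, σ'.mem (9 * n +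
          treeWalk (fun c => σ'.mem (9 * n + c)) (sampleRow n d σ.mem s) d) =
            sampleLabel n d σ.mem s) ∧ (∀ c < 2 ^ d, σ'.mem (9 * n + c) < numBlocks d) ∨
        σ'.reg 41 = 1 ∧ ¬ Separable (sampleRow n d σ.mem) (sampleLabel n d σ.mem) (numBlocks d) d
          fun s => s < numSamples d) := by
  have hF' := hF
  unfold Fits at hF'
  refine (Spec.assign_cons (T := searchTime d d + 95) (by norm_num) (by simp; omega)
    (by simp; omega) ?_).weaken (by simp) le_rfl fun _ _ h => h
  refine (Spec.assign_cons (T := searchTime d d + 85) (by norm_num) (by simp; omega)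
    (by simp; omega) ?_).weaken (by simp) le_rfl fun _ _ h => h
  refine (Spec.assign_cons (T := searchTime d d + 79) (by norm_num) (by simp; omega)
    (by simp; omega) ?_).weaken (by simp) le_rfl fun _ _ h => h
  refine (Spec.cons_det (T := searchTime d d + 75) (T' := 1) (q' := 0) ?_ fun σ' h =>
    det_nil h).weaken (by omega) le_rfl fun _ _ h => h
  refine det_iff.2 fun Φ v hv => ?_
  simp only [Expr.eval_const]
  set σ₁ := ((σ.set 40 1).set 41 0).set 42 1 with hσ₁
  have hsame : Same 40 σ σ₁ :=
    (((Same.refl _ _).set _ (by norm_num)).set _ (by norm_num)).set _ (by norm_num)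
  have hfin : ∀ σ' : St, σ'.reg 42 = 0 → v ≤ Φ σ' →
      LoopBounds M (.var 42) searchStep σ' 2 0 Φ v := fun σ' h42 hv' s K k G h1 h2 h3 h4 =>
    hv'.trans (((loopBounds_exit (by simp) (by simpa using h42)).weaken (by simp) le_rfl)
      s K k G h1 h2 h3 h4)
  refine (LoopBounds.whileDo ?_).weaken (T := 2 + 65 + searchTime d d + 1) (by omega) le_rfl
    (fun _ => le_rfl) le_rfl
  refine loopBounds_search hE hF hD d 0 1 σ₁ (2 + 65) (by omega)
    ⟨hsame, by simp [hσ₁], fun _ _ => rfl, fun c hc => by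
      change σ.mem _ ≤ _; rw [hlab c (by omega)]; omega, fun c hc hc' => by
      change σ.mem _ ≤ _; rw [hlab c (by omega)]; omega⟩
    (by simp [hσ₁]) (by simp [hσ₁]) (by simp) (by simp) fun σ' hI h40 ⟨hfr, h⟩ => ?_
  refine (hI.step (T := 60) (T' := 2) (det_searchRoot hF h40 (by
    rcases h with h | h <;> simp [h.1])) ?_).weaken (by omega) le_rfl
  rintro _ rfl
  refine hfin _ (by simp) (hv _ ⟨hI.same.set _ (by norm_num), hI.frame, hI.leaf, ?_⟩)
  rcases h with ⟨h1, h2, h3⟩ | ⟨h1, h2⟩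
  · refine Or.inl ⟨by simp [h1], fun s hs => h2 s hs rfl, fun c hc => ?_⟩
    rcases Nat.eq_zero_or_pos c with rfl | h
    -- The heap index `0` lies in no subtree; its cell still holds the initial `0`, which is a legal
    -- label.
    · change σ'.mem _ < _
      rw [hI.frame _ (Or.inl (by omega)), hlab 0 (by positivity)]
      exact numBlocks_pos d
    · exact h3 c hc (inSub_one h)
  · refine Or.inr ⟨by simp [h1], fun hs => h2 ?_⟩
    simpa [treeWalk] using hs

end DTTest

namespace DTTest
variable {n : ℕ} {M : Oracle n}

/-! ### Setting up the constant registers -/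

def setupConstants : Prog := block [
  assign 4 (.const 8 * .var 3 * .var 3),
  assign 5 (.var 3 * .var 3 * (.const 2 * .var 1 + .const 8)),
  assign 6 (.const 300 * (.var 1 + .const 1) * .var 2),
  assign 10 (.var 0),
  assign 11 (.const 2 * .var 0),
  assign 12 (.const 3 * .var 0),
  assign 13 (.const 4 * .var 0),
  assign 14 (.const 5 * .var 0),
  assign 15 (.const 6 * .var 0),
  assign 16 (.const 7 * .var 0),
  assign 17 (.const 8 * .var 0),
  assign 18 (.const 9 * .var 0),
  assign 19 (.var 18 + .const 2 * .var 3),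
  assign 20 (.var 18 + .const 3 * .var 3),
  assign 21 (.var 20 + .var 5),
  assign 22 (.const 2 * .var 1 + .const 3)]

def setup : Prog := block [
  assign 3 (.const 1), forLoop 40 1 (assign 3 (.const 2 * .var 3)), setupConstants]

theorem Det.assign_cons {r T q : ℕ} {σ : St} {e : Expr} {Ps : List Prog} {post : St → Prop}
    (hr : r < 900) (hOk : e.Ok M.w σ.reg σ.mem) (v : ℕ) (hv : e.eval σ.reg σ.mem = v)
    (hlt : v < wordCap M.w) (h : Det M (block Ps) (σ.set r v) T q post) :
    Det M (block (assign r e :: Ps)) σ (T + e.cost + 5) q post := by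
  subst hv
  exact Spec.assign_cons hr hOk hlt h

theorem numBlocks_eq (d : ℕ) : numBlocks d = 8 * 2 ^ d * 2 ^ d := by
  rw [numBlocks, pow_add, two_mul, pow_add]
  ring

/-- The bound on `300 * (d + 1)` is separate because it is an intermediate product, which for `m =
0` would not be controlled by the number of rounds. -/
theorem det_setupConstants {d m : ℕ} {σ : St} (hF : Fits M d m) (hw : 1000 < wordCap M.w)
    (h0 : σ.reg 0 = n) (h1 : σ.reg 1 = d) (h2 : σ.reg 2 = m) (h3 : σ.reg 3 = 2 ^ d)
    (hR : 300 * (d + 1) < wordCap M.w) :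
    Det M setupConstants σ 500 0 fun σ' => Env n d m σ' ∧ σ'.mem = σ.mem := by
  unfold Fits at hF
  have hr := numBlocks_eq d
  have hS : numSamples d = 2 ^ d * 2 ^ d * (2 * d + 8) := rfl
  have hm : numRounds d m = 300 * (d + 1) * m := rfl
  have hD : 2 ^ d * 2 ^ d < wordCap M.w := by
    have : 2 ^ d * 2 ^ d * 1 ≤ 2 ^ d * 2 ^ d * (2 * d + 8) := Nat.mul_le_mul_left _ (by omega)
    omega
  have h8 : 8 * 2 ^ d < wordCap M.w := by
    have : 8 * 2 ^ d * 1 ≤ 8 * 2 ^ d * 2 ^ d := Nat.mul_le_mul_left _ Nat.one_le_two_pow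
    omega
  refine (Det.assign_cons (T := 460) (by norm_num) (by simp [h3]; omega) (numBlocks d)
    (by simp [h3, hr]) (by omega) ?_).weaken (by simp) le_rfl fun _ h => h
  refine (Det.assign_cons (T := 430) (by norm_num) (by simp [h3, h1]; omega) (numSamples d)
    (by simp [h3, h1, hS]) (by omega) ?_).weaken (by simp) le_rfl fun _ h => h
  refine (Det.assign_cons (T := 330) (by norm_num) (by simp [h1, h2]; omega) (numRounds d m)
    (by simp [h1, h2, hm]) (by omega) ?_).weaken (by simp) le_rfl fun _ h => h
  refine (Det.assign_cons (T := 310) (by norm_num) (by simp) n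
    (by simp [h0]) (by omega) ?_).weaken (by simp) le_rfl fun _ h => h
  refine (Det.assign_cons (T := 290) (by norm_num) (by simp [h0]; omega) (2 * n)
    (by simp [h0]) (by omega) ?_).weaken (by simp) le_rfl fun _ h => h
  refine (Det.assign_cons (T := 270) (by norm_num) (by simp [h0]; omega) (3 * n)
    (by simp [h0]) (by omega) ?_).weaken (by simp) le_rfl fun _ h => h
  refine (Det.assign_cons (T := 250) (by norm_num) (by simp [h0]; omega) (4 * n)
    (by simp [h0]) (by omega) ?_).weaken (by simp) le_rfl fun _ h => h
  refine (Det.assign_cons (T := 230) (by norm_num) (by simp [h0]; omega) (5 * n)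
    (by simp [h0]) (by omega) ?_).weaken (by simp) le_rfl fun _ h => h
  refine (Det.assign_cons (T := 210) (by norm_num) (by simp [h0]; omega) (6 * n)
    (by simp [h0]) (by omega) ?_).weaken (by simp) le_rfl fun _ h => h
  refine (Det.assign_cons (T := 190) (by norm_num) (by simp [h0]; omega) (7 * n)
    (by simp [h0]) (by omega) ?_).weaken (by simp) le_rfl fun _ h => h
  refine (Det.assign_cons (T := 170) (by norm_num) (by simp [h0]; omega) (8 * n)
    (by simp [h0]) (by omega) ?_).weaken (by simp) le_rfl fun _ h => h
  refine (Det.assign_cons (T := 150) (by norm_num) (by simp [h0]; omega) (9 * n)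
    (by simp [h0]) (by omega) ?_).weaken (by simp) le_rfl fun _ h => h
  refine (Det.assign_cons (T := 130) (by norm_num) (by simp [h3]; omega) (9 * n + 2 * 2 ^ d)
    (by simp [h3]) (by omega) ?_).weaken (by simp) le_rfl fun _ h => h
  refine (Det.assign_cons (T := 110) (by norm_num) (by simp [h3]; omega) (9 * n + 3 * 2 ^ d)
    (by simp [h3]) (by omega) ?_).weaken (by simp) le_rfl fun _ h => h
  refine (Det.assign_cons (T := 90) (by norm_num) (by simp; omega)
    (9 * n + 3 * 2 ^ d + numSamples d) (by simp) (by omega) ?_).weaken (by simp) le_rfl fun _ h => h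
  refine (Det.assign_cons (T := 1) (by norm_num) (by simp [h1]; omega) (2 * d + 3)
    (by simp [h1]) (by omega) (det_nil ?_)).weaken (by simp) le_rfl fun _ h => h
  exact ⟨by constructor <;> simp [h0, h1, h2, h3], rfl⟩

theorem det_setup {d m : ℕ} {σ : St} (hF : Fits M d m) (hw : 1000 < wordCap M.w)
    (h0 : σ.reg 0 = n) (h1 : σ.reg 1 = d) (h2 : σ.reg 2 = m) (hR : 300 * (d + 1) < wordCap M.w) :
    Det M setup σ (30 * d + 550) 0 fun σ' => Env n d m σ' ∧ σ'.mem = σ.mem := by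
  have hF' := hF
  unfold Fits at hF'
  have hloop := Det.forLoop (M := M) (i := 40) (b := 1) (P := assign 3 (.const 2 * .var 3)) (N := d)
    (T := 10) (q := 0) (σ := σ.set 3 1)
    (fun k σ' => Same 3 σ σ' ∧ σ'.reg 40 = k ∧ σ'.reg 3 = 2 ^ k ∧ σ'.mem = σ.mem)
    (by norm_num) (by norm_num) (by omega) (by omega)
    (fun k σ' h => ⟨h.2.1, (h.1 1 (by norm_num)).trans h1⟩) ?_ ?_
  · refine (Det.assign_cons (T := 30 * d + 540) (by norm_num) (by simp; omega) 1 rfl (by omega)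
      ?_).weaken (by simp) le_rfl fun _ h => h
    refine (Spec.cons_det (T' := 505) (q' := 0) hloop ?_).weaken (by omega) (by omega) fun _ _ h => h
    rintro σ' ⟨g1, g2, g3, g4⟩
    refine (Spec.cons_det (T' := 1) (q' := 0) (det_setupConstants hF hw
      ((g1 0 (by norm_num)).trans h0) ((g1 1 (by norm_num)).trans h1)
      ((g1 2 (by norm_num)).trans h2) g3 hR) fun σ'' h => det_nil ⟨h.1, h.2.trans g4⟩).weaken
      (by omega) (by omega) fun _ _ h => h
  · rintro k σ' hk ⟨g1, g2, g3, g4⟩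
    have : 2 * 2 ^ k ≤ 2 ^ d := by
      rw [← pow_succ']; exact Nat.pow_le_pow_right (by norm_num) hk
    refine (det_assign (by norm_num) (by simp [g3]; omega) (by simp [g3]; omega)).weaken
      (by simp) le_rfl ?_
    rintro _ rfl
    exact ⟨by simp [g2], (g1.set _ (by norm_num)).set _ (by norm_num), by simp,
      by simp [St.eval, g3, pow_succ'], by simp [g4]⟩
  · exact ⟨(Same.refl _ _).set _ (by norm_num) |>.set _ (by norm_num), by simp, by simp, rfl⟩

/-! ### The random partition -/

instance (d : ℕ) : NeZero (numBlocks d) := ⟨(numBlocks_pos d).ne'⟩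

/-- The number of blocks is a power of two, so `2 * d + 3` fair coins read as binary digits give an
exactly uniform block. -/
def partitionStep : Prog := block [
  assign 41 (.const 0),
  forLoop 42 22 (block [.coin 43, assign 41 (.const 2 * .var 41 + .var 43)]),
  storeAt (.var 17 + .var 40) (.var 41)]

/-- Choose a random partition of the variables. -/
def partition : Prog := forLoop 40 0 partitionStep

theorem spec_partitionStep {d m k : ℕ} {σ : St} (hE : Env n d m σ) (hF : Fits M d m)
    (h40 : σ.reg 40 = k) (hk : k < n) :
    Spec M partitionStep σ (80 * d + 160) 0 (PMF.uniformOfFintype (Fin (numBlocks d)))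
      fun v σ' => Same 41 σ σ' ∧ σ'.mem = Function.update σ.mem (8 * n + k) (v : ℕ) := by
  have hF' := hF
  unfold Fits at hF'
  have hloop := Spec.forLoop (M := M) (i := 42) (b := 22) (N := 2 * d + 3) (T := 20) (q := 0)
    (P := block [.coin 43, assign 41 (.const 2 * .var 41 + .var 43)])
    (fun _ acc => (PMF.uniformOfFintype Bool).map fun b => 2 * acc + b.toNat)
    (fun j acc σ' => Same 41 σ σ' ∧ σ'.reg 42 = j ∧ σ'.mem = σ.mem ∧ σ'.reg 41 = acc ∧ acc < 2 ^ j)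
    (by norm_num) (by norm_num) (by omega) (by omega)
    (fun j acc σ' h => ⟨h.2.1, (h.1 22 (by norm_num)).trans hE.r22⟩) ?_
    (a := 0) (σ := σ.set 41 0) ⟨fun ρ hρ => ?_, by simp, rfl, by simp, by simp⟩
  · rw [iter_binary] at hloop
    refine (Spec.assign_cons (T := 80 * d + 150) (by norm_num) (by simp; omega) (by simp; omega)
      ?_).weaken (by simp) le_rfl fun _ _ h => h
    refine Spec.of_map (g := fun v : Fin (2 ^ (2 * d + 3)) => 0 * 2 ^ (2 * d + 3) + (v : ℕ))
      (post := fun v σ' => Same 41 σ σ' ∧ σ'.mem = Function.update σ.mem (8 * n + k) v) ?_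
      fun v σ' h => by simpa using h
    refine (Spec.seq_det (T' := 12) (q' := 0) hloop fun v σ' h => ?_).weaken (by omega) (by omega)
      fun _ _ h => h
    obtain ⟨g1, g2, g3, g4, g5⟩ := h
    have e17 := (g1 17 (by norm_num)).trans hE.r17
    have e40 := (g1 40 (by norm_num)).trans h40
    refine (Spec.store_cons (T := 1) (by simp [e17, e40]; omega) (by simp)
      (Spec.nil ⟨fun ρ hρ => ?_, ?_⟩)).weaken (by simp) le_rfl fun _ _ h => h
    · exact g1 ρ hρ
    · funext a
      simp [e17, e40, g3, g4, Function.update_apply]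
  · rintro j acc σ' hj ⟨g1, g2, g3, g4, g5⟩
    have hlt : 2 * 2 ^ j ≤ numBlocks d := by
      rw [← pow_succ', numBlocks]; exact Nat.pow_le_pow_right (by norm_num) (by omega)
    rw [← PMF.bind_pure_comp]
    refine (Spec.cons spec_coin (T' := 15) (q' := 0) ?_).weaken (by norm_num) le_rfl
      fun _ _ h => h
    rintro b _ rfl
    have hb := Bool.toNat_le b
    refine (Spec.assign_cons (T := 1) (by norm_num) (by simp [g4]; omega) (by simp [g4]; omega)
      (Spec.nil ?_)).weaken (by simp) le_rfl fun _ _ h => h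
    refine ⟨by simp [g2], fun ρ hρ => ?_, by simp, by simp [g3], by simp [g4], ?_⟩
    · simp only [St.set_reg]
      rw [if_neg (by omega), if_neg (by omega), if_neg (by omega), g1 ρ hρ]
    · simp only
      rw [pow_succ]
      omega
  · simp only [St.set_reg]
    rw [if_neg (by omega), if_neg (by omega)]

theorem spec_partition {d m : ℕ} {σ : St} (hE : Env n d m σ) (hF : Fits M d m) :
    Spec M partition σ (n * (80 * d + 180) + 13) 0
      (PMF.uniformOfFintype (Fin n → Fin (numBlocks d)))
      fun B σ' => Same 40 σ σ' ∧ HasPartition B σ' ∧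
        ∀ a, a < 8 * n ∨ 9 * n ≤ a → σ'.mem a = σ.mem a := by
  have hF' := hF
  unfold Fits at hF'
  have h := Spec.forLoop (M := M) (i := 40) (b := 0) (N := n) (T := 80 * d + 160) (q := 0)
    (P := partitionStep)
    (fun j m => (PMF.uniformOfFintype (Fin (numBlocks d))).map fun b : Fin (numBlocks d) =>
      Function.update m (8 * n + j) (b : ℕ))
    (fun j m σ' => Same 40 σ σ' ∧ σ'.reg 40 = j ∧ σ'.mem = m) (by norm_num) (by norm_num)
    (by omega) (by omega) (fun j m σ' h => ⟨h.2.1, (h.1 0 (by norm_num)).trans hE.r0⟩)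
    (fun j m σ' hj h => by
      obtain ⟨h1, h2, h3⟩ := h
      refine (spec_partitionStep (hE.of_same h1 (by norm_num)) hF h2 hj).map _ fun b σ'' h => ?_
      obtain ⟨g1, g2⟩ := h
      refine ⟨(g1 40 (by norm_num)).trans h2, fun ρ hρ => ?_, by simp, ?_⟩
      · rw [St.set_reg, if_neg (by omega), g1 ρ (by omega), h1 ρ hρ]
      · rw [St.set_mem, g2, h3])
    (a := σ.mem) (σ := σ) ⟨(Same.refl _ _).set _ (by norm_num), by simp, rfl⟩
  rw [iter_writeVec (fun b : Fin (numBlocks d) => (b : ℕ))] at h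
  refine (h.of_map fun B σ' hx => ⟨hx.1, fun t => ?_, fun a ha => ?_⟩).weaken (by
    have : n * (80 * d + 160 + 17) ≤ n * (80 * d + 180) := Nat.mul_le_mul_left _ (by omega)
    omega) (by omega) fun _ _ h => h
  · rw [hx.2.2, writeVec, dif_pos ⟨by omega, by omega⟩]
    simp only [Function.comp_apply]
    congr 2
    ext
    simp
  · rw [hx.2.2, writeVec, dif_neg (by omega)]

/-! ### The samples -/

/-- The block index is set to `numBlocks d`, which matches no variable. The hybrid query then
evaluates the black box at the row composed with the partition, and the vector in register `66` is
irrelevant. -/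
def sampleStep : Prog := block [
  assign 60 (.var 21 + .var 40 * .var 4), assign 61 (.var 4), fillRandom,
  assign 64 (.var 4), assign 65 (.var 60), assign 66 (.const 0), hybridQuery,
  storeAt (.var 20 + .var 40) (.var 81)]

/-- Draw the labelled sample rows for learning the tree. -/
def drawSamples : Prog := forLoop 40 5 sampleStep

/-- The memory holds the partition `B` and the labelled sample rows `Y`. -/
structure Ready (M : Oracle n) (d m : ℕ) (B : Fin n → Fin (numBlocks d))
    (Y : Fin (numSamples d) → Fin (numBlocks d) → Bool) (σ : St) : Prop where
  env : Env n d m σ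
  part : HasPartition B σ
  row : ∀ (s : Fin (numSamples d)) (j : Fin (numBlocks d)), σ.mem (rowAddr n d s + j) = (Y s j).toNat
  label : ∀ s : Fin (numSamples d), σ.mem (9 * n + 3 * 2 ^ d + s) = (M.f fun t => Y s (B t)).toNat
  zero : ∀ c < 2 * 2 ^ d, σ.mem (9 * n + c) = 0

theorem spec_sampleStep {d m k : ℕ} {σ : St} {B : Fin n → Fin (numBlocks d)} (hE : Env n d m σ)
    (hF : Fits M d m) (hB : HasPartition B σ) (h40 : σ.reg 40 = k) (hk : k < numSamples d) :
    Spec M sampleStep σ (numBlocks d * 35 + 60 * n + 200) 1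
      (PMF.uniformOfFintype (Fin (numBlocks d) → Bool))
      fun y σ' => Same 41 σ σ' ∧ (∀ j, σ'.mem (rowAddr n d k + Fin.val j) = (y j).toNat) ∧
        σ'.mem (9 * n + 3 * 2 ^ d + k) = (M.f fun t => y (B t)).toNat ∧
        ∀ a, 8 * n ≤ a → (a < rowAddr n d k ∨ rowAddr n d k + numBlocks d ≤ a) →
          a ≠ 9 * n + 3 * 2 ^ d + k → σ'.mem a = σ.mem a := by
  have hF' := hF
  unfold Fits at hF'
  have hra := rowAddr_lt hF hk
  have hra' : rowAddr n d k + numBlocks d + 1 < wordCap M.w := by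
    have : (k + 1) * numBlocks d ≤ numSamples d * numBlocks d := Nat.mul_le_mul_right _ hk
    rw [add_mul] at this
    unfold rowAddr
    omega
  have hrow : 9 * n + 3 * 2 ^ d + numSamples d + k * numBlocks d = rowAddr n d k := rfl
  refine (Spec.assign_cons (T := numBlocks d * 35 + 60 * n + 185) (by norm_num)
    (by simp [hE.r21, hE.r4, h40, hrow]; omega) (by simp [hE.r21, hE.r4, h40, hrow]; omega)
    ?_).weaken (by simp) le_rfl fun _ _ h => h
  refine (Spec.assign_cons (T := numBlocks d * 35 + 60 * n + 175) (by norm_num)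
    (by simp) (by simp [hE.r4]; omega) ?_).weaken (by simp) le_rfl fun _ _ h => h
  simp only [Expr.eval_add, Expr.eval_mul, Expr.eval_var, St.set_reg, hE.r21, hE.r4, h40, hrow]
  norm_num only [if_false, hE.r4]
  refine (Spec.seq_det (T := numBlocks d * 35 + 13) (T' := 60 * n + 150) (q' := 1)
    (spec_fillRandom (k := numBlocks d) (by simp)
    (by simp; omega)) fun y σ' hy => ?_).weaken (by omega) (by omega) fun _ _ h => h
  obtain ⟨h1, h2⟩ := hy
  simp only [St.set_reg, St.set_mem] at h2
  norm_num only [if_true, if_false] at h2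
  have hS : Same 60 σ σ' := fun ρ hρ => by
    rw [h1 ρ (by omega), St.set_reg, if_neg (by omega), St.set_reg, if_neg (by omega)]
  have hE' : Env n d m σ' := hE.of_same hS (by norm_num)
  have e60 : σ'.reg 60 = rowAddr n d k := by rw [h1 60 (by norm_num)]; simp
  refine (Spec.assign_cons (T := 60 * n + 140) (by norm_num)
    (by simp) (by simp [hE'.r4]; omega) ?_).weaken (by simp) le_rfl fun _ _ h => h
  refine (Spec.assign_cons (T := 60 * n + 130) (by norm_num)
    (by simp) (by simp [e60]; omega) ?_).weaken (by simp) le_rfl fun _ _ h => h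
  refine (Spec.assign_cons (T := 60 * n + 120) (by norm_num)
    (by simp; omega) (by simp; omega) ?_).weaken (by simp) le_rfl fun _ _ h => h
  simp only [Expr.eval_const, Expr.eval_var, St.set_reg, hE'.r4]
  norm_num only [if_false, e60]
  have hq := det_hybridQuery (M := M) (B := B)
    (σ := ((σ'.set 64 (numBlocks d)).set 65 (rowAddr n d k)).set 66 0)
    (hE'.of_same (k := 60) ((((Same.refl _ _).set _ (by norm_num)).set _ (by norm_num)).set _
      (by norm_num)) (by norm_num)) hF (fun t => by
        simp only [St.set_mem, h2]
        rw [writeBits_of_not _ _ _ (by unfold rowAddr; omega), hB t])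
      (by simp; unfold rowAddr; omega) (by simpa using hra) (by simp; omega)
  refine (Spec.cons_det (T' := 50) (q' := 0) hq ?_).weaken (by omega) (by omega) fun _ _ h => h
  rintro σ'' ⟨g1, g2, g3⟩
  have hS'' : Same 60 σ σ'' := fun ρ hρ => by
    rw [g1 ρ (by omega), St.set_reg, if_neg (by omega), St.set_reg, if_neg (by omega), St.set_reg,
      if_neg (by omega), hS ρ hρ]
  have e20 := (hS'' 20 (by norm_num)).trans hE.r20
  have e40 := (hS'' 40 (by norm_num)).trans h40
  have e81 : σ''.reg 81 = (M.f fun t => y (B t)).toNat := by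
    rw [g3]
    simp only [St.set_reg, St.set_mem, h2]
    norm_num only [if_true, if_false, readBits_writeBits]
    congr 2
    funext t
    rw [hybrid, if_neg (B t).2.ne]
  refine (Spec.store_cons (T := 1) (by simp [e20, e40]; omega) (by simp)
    (Spec.nil ⟨?_, fun j => ?_, ?_, fun a h1 h2' h3 => ?_⟩)).weaken (by simp) le_rfl fun _ _ h => h
  · exact fun ρ hρ => hS'' ρ (by omega)
  · have hne : rowAddr n d k + j ≠ 9 * n + 3 * 2 ^ d + k := by unfold rowAddr; omega
    simp only [Expr.eval_add, Expr.eval_var, e20, e40, St.put_mem, if_neg hne]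
    rw [g2 _ (Or.inr (by unfold rowAddr; omega))]
    simp only [St.set_mem, h2, writeBits_apply]
  · simp [e20, e40, e81]
  · simp only [Expr.eval_add, Expr.eval_var, e20, e40, St.put_mem, if_neg h3]
    rw [g2 _ (Or.inr h1)]
    simp only [St.set_mem, h2]
    rw [writeBits_of_not _ _ _ (by omega)]

theorem spec_drawSamples {d m : ℕ} {σ : St} {B : Fin n → Fin (numBlocks d)} (hE : Env n d m σ)
    (hF : Fits M d m) (hB : HasPartition B σ) (hz : ∀ c < 2 * 2 ^ d, σ.mem (9 * n + c) = 0) :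
    Spec M drawSamples σ (numSamples d * (numBlocks d * 35 + 60 * n + 220) + 13) (numSamples d)
      (PMF.uniformOfFintype (Fin (numSamples d) → Fin (numBlocks d) → Bool))
      fun Y σ' => Ready M d m B Y σ' := by
  have hF' := hF
  unfold Fits at hF'
  have h := Spec.forLoop (M := M) (i := 40) (b := 5) (N := numSamples d)
    (T := numBlocks d * 35 + 60 * n + 200) (q := 1) (P := sampleStep)
    -- The abstract state is the list of rows drawn so far, so that the final distribution is
    -- uniform on all arrays of rows.
    (fun j (a : ℕ → Fin (numBlocks d) → Bool) =>
      (PMF.uniformOfFintype (Fin (numBlocks d) → Bool)).map fun y => Function.update a (0 + j) (id y))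
    (fun k a σ' => Same 40 σ σ' ∧ σ'.reg 40 = k ∧
      (∀ c, 8 * n ≤ c → c < 9 * n + 3 * 2 ^ d → σ'.mem c = σ.mem c) ∧
      ∀ s < k, (∀ j, σ'.mem (rowAddr n d s + Fin.val j) = (a s j).toNat) ∧
        σ'.mem (9 * n + 3 * 2 ^ d + s) = (M.f fun t => a s (B t)).toNat)
    (by norm_num) (by norm_num)
    (by omega) (by omega) (fun j m σ' h => ⟨h.2.1, (h.1 5 (by norm_num)).trans hE.r5⟩)
    (fun k a σ' hk h => by
      obtain ⟨h1, h2, h3, h4⟩ := h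
      refine (spec_sampleStep (hE.of_same h1 (by norm_num)) hF (fun t => by
        rw [h3 _ (by omega) (by omega), hB t]) h2 hk).map _ fun y σ'' h => ?_
      obtain ⟨g1, g2, g3, g4⟩ := h
      refine ⟨(g1 40 (by norm_num)).trans h2, fun ρ hρ => ?_, by simp, fun c hc hc' => ?_,
        fun s hs => ?_⟩
      · rw [St.set_reg, if_neg (by omega), g1 ρ (by omega), h1 ρ hρ]
      · rw [St.set_mem, g4 _ hc (by unfold rowAddr; omega) (by omega), h3 c hc hc']
      · simp only [St.set_mem, zero_add, id_eq]
        rcases Nat.lt_succ_iff_lt_or_eq.1 hs with hlt | rfl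
        · have hmul : (s + 1) * numBlocks d ≤ k * numBlocks d := Nat.mul_le_mul_right _ hlt
          rw [add_mul, one_mul] at hmul
          rw [Function.update_of_ne hlt.ne, g4 _ (by omega) (by unfold rowAddr; omega) (by omega)]
          refine ⟨fun j => ?_, (h4 s hlt).2⟩
          have := j.2
          rw [g4 _ (by unfold rowAddr; omega) (by unfold rowAddr; omega) (by unfold rowAddr; omega)]
          exact (h4 s hlt).1 j
        · rw [Function.update_self]
          exact ⟨g2, g3⟩)
    (a := fun _ _ => false) (σ := σ) ⟨(Same.refl _ _).set _ (by norm_num), by simp,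
      fun _ _ _ => rfl, fun s hs => by omega⟩
  rw [iter_writeVec id] at h
  have hY : ∀ (Y : Fin (numSamples d) → Fin (numBlocks d) → Bool) (s : Fin (numSamples d)),
      writeVec (fun _ _ => false) (0 + 0) (id ∘ Y) (s : ℕ) = Y s := fun Y s => by
    rw [writeVec, dif_pos ⟨by omega, by omega⟩]
    simp
  refine (h.of_map fun Y σ' hx => ?_).weaken (by
    exact Nat.add_le_add_right (Nat.mul_le_mul_left _ (by omega)) 13) (by simp) fun _ _ h => h
  obtain ⟨g1, g2, g3, g4⟩ := hx
  refine ⟨hE.of_same g1 (by norm_num), fun t => by rw [g3 _ (by omega) (by omega), hB t],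
    fun s j => ?_, fun s => ?_, fun c hc => by rw [g3 _ (by omega) (by omega), hz c hc]⟩
  · rw [(g4 s s.2).1 j, hY]
  · rw [(g4 s s.2).2, hY]

end DTTest

namespace DTTest
variable {n : ℕ} {M : Oracle n}

/-! ### Witnesses -/

theorem treeWalk_congr_val {tree : ℕ → ℕ} {y y' : ℕ → Bool} {k : ℕ}
    (h : ∀ c < 2 ^ k, y' (tree c) = y (tree c)) : treeWalk tree y' k = treeWalk tree y k := by
  induction k with
  | zero => rfl
  | succ k ih =>
    have hb := (treeWalk_bounds tree y k).2
    rw [treeWalk, treeWalk, ih fun c hc => h c (by rw [pow_succ]; omega), h _ (by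
      rw [pow_succ]; omega)]

/-- Extend a row by `0`. -/
def extend {r : ℕ} (y : Fin r → Bool) : ℕ → Bool := fun j => if h : j < r then y ⟨j, h⟩ else false

/-- The label of the leaf that the row `y` reaches. -/
def treeValue (d : ℕ) (tree : ℕ → ℕ) (y : ℕ → Bool) : ℕ := tree (treeWalk tree y d)

/-- The value of the tree at the row `y` depends on the block `l`. -/
def Sensitive (d : ℕ) (tree : ℕ → ℕ) (y : ℕ → Bool) (l : ℕ) : Prop :=
  treeValue d tree (Function.update y l false) ≠ treeValue d tree (Function.update y l true)

/-- The tree is evaluated twice on a sample row, with the block of the node forced to `0` and to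
`1`; a difference makes the row a witness. No query is needed, since the learned tree stands in for
the black box. -/
def witnessStep : Prog := block [
  assign 72 (.var 21 + .var 44 * .var 4), assign 73 (.load (.var 18 + .var 43)),
  assign 74 (.const 0), walkRow, assign 75 (.load (.var 18 + .var 87)),
  assign 74 (.const 1), walkRow,
  cond (.bin .eq (.var 75) (.load (.var 18 + .var 87))) .skip (storeAt (.var 19 + .var 43) (.var 72))]

/-- Store for each node a row at which the tree is sensitive to the block of the node. -/
def findWitnesses : Prog := forLoop 43 3 (block [storeAt (.var 19 + .var 43) (.var 21),
  forLoop 44 5 witnessStep])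

/-- The memory holds the partition, the sample rows and a complete tree. -/
structure HasTree {d : ℕ} (n m : ℕ) (B : Fin n → Fin (numBlocks d))
    (Y : Fin (numSamples d) → Fin (numBlocks d) → Bool) (σ : St) : Prop where
  env : Env n d m σ
  part : HasPartition B σ
  row : ∀ (s : Fin (numSamples d)) (j : Fin (numBlocks d)),
    σ.mem (rowAddr n d s + j) = (Y s j).toNat
  label : ∀ c < 2 ^ d, σ.mem (9 * n + c) < numBlocks d
  leaf : ∀ c, 2 ^ d ≤ c → c < 2 * 2 ^ d → σ.mem (9 * n + c) ≤ 1

variable {d m : ℕ} {B : Fin n → Fin (numBlocks d)}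
  {Y : Fin (numSamples d) → Fin (numBlocks d) → Bool} {σ : St}

theorem HasTree.treeWalk_rowVal (h : HasTree n m B Y σ) (s : Fin (numSamples d)) (l : ℕ) (c : Bool) :
    treeWalk (fun i => σ.mem (9 * n + i)) (rowVal σ.mem (rowAddr n d s) l c.toNat) d =
      treeWalk (fun i => σ.mem (9 * n + i)) (Function.update (extend (Y s)) l c) d := by
  refine treeWalk_congr_val fun i hi => ?_
  have hl := h.label i hi
  have := h.row s ⟨_, hl⟩
  simp only at this ⊢
  rw [rowVal, Function.update_apply, this, extend, dif_pos hl]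
  cases c <;> cases Y s ⟨_, hl⟩ <;> simp

theorem HasTree.congr {σ' : St} (h : HasTree n m B Y σ) (hs : Same 40 σ σ')
    (hm : ∀ a, a < 9 * n + 2 * 2 ^ d ∨ 9 * n + 3 * 2 ^ d ≤ a → σ'.mem a = σ.mem a) :
    HasTree n m B Y σ' := by
  refine ⟨h.env.of_same hs (by norm_num), fun t => ?_, fun s j => ?_, fun c hc => ?_,
    fun c hc hc' => ?_⟩
  · rw [hm _ (by omega), h.part t]
  · rw [hm _ (by unfold rowAddr; omega), h.row s j]
  · rw [hm _ (by omega)]; exact h.label c hc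
  · rw [hm _ (by omega)]; exact h.leaf c hc hc'

theorem det_witnessStep {i : ℕ} {k : Fin (numSamples d)} (hF : Fits M d m) (hT : HasTree n m B Y σ)
    (h43 : σ.reg 43 = i) (hi : i < 2 ^ d) (h44 : σ.reg 44 = k) :
    Det M witnessStep σ (d * 160 + 200) 0 fun σ' => Same 45 σ σ' ∧
      ((¬ Sensitive d (fun i => σ.mem (9 * n + i)) (extend (Y k)) (σ.mem (9 * n + i)) ∧
          σ'.mem = σ.mem) ∨
        Sensitive d (fun i => σ.mem (9 * n + i)) (extend (Y k)) (σ.mem (9 * n + i)) ∧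
          σ'.mem = Function.update σ.mem (9 * n + 2 * 2 ^ d + i) (rowAddr n d k)) := by
  have hF' := hF
  unfold Fits at hF'
  have hE := hT.env
  have hra := rowAddr_lt hF k.2
  have hl := hT.label i hi
  have hrow : 9 * n + 3 * 2 ^ d + numSamples d + k * numBlocks d = rowAddr n d k := rfl
  set tree := fun i => σ.mem (9 * n + i) with htree
  set l := σ.mem (9 * n + i) with hl'
  have hbits : ∀ j < numBlocks d, σ.mem (rowAddr n d k + j) ≤ 1 := fun j hj => by
    have := hT.row k ⟨j, hj⟩
    simp only at this
    rw [this]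
    exact Bool.toNat_le _
  have hwalk : ∀ (σ' : St) (c : Bool), Same 45 σ σ' → σ'.mem = σ.mem → σ'.reg 72 = rowAddr n d k →
      σ'.reg 73 = l → σ'.reg 74 = c.toNat → Det M walkRow σ' (d * 80 + 40) 0 fun σ'' =>
        Same 85 σ' σ'' ∧ σ''.mem = σ.mem ∧
          σ''.reg 87 = treeWalk tree (Function.update (extend (Y k)) l c) d := by
    intro σ' c hS hm h72 h73 h74
    refine (det_walkRow (m := m) (d := d) (hE.of_same hS (by norm_num)) hF (fun c hc => Or.inr ?_)
      ?_ ?_ ?_).weaken le_rfl le_rfl fun σ'' h => ⟨h.1, h.2.1.trans hm, ?_⟩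
    · rw [hm]; exact hT.label c hc
    · rw [h74]; exact Bool.toNat_le c
    · rw [h72]; exact hra
    · rw [h72, hm]; exact hbits
    · rw [h.2.2, hm, h72, h73, h74, hT.treeWalk_rowVal]
  have hw0 := treeWalk_bounds tree (Function.update (extend (Y k)) l false) d
  have hw1 := treeWalk_bounds tree (Function.update (extend (Y k)) l true) d
  have hleaf : ∀ c, 2 ^ d ≤ c → c < 2 * 2 ^ d → tree c ≤ 1 := hT.leaf
  refine (Det.assign_cons (T := d * 160 + 175) (by norm_num)
    (by simp [hE.r21, hE.r4, h44, hrow]; omega) (rowAddr n d k)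
    (by simp [hE.r21, hE.r4, h44, hrow]) (by omega) ?_).weaken (by simp) le_rfl fun _ h => h
  refine (Det.assign_cons (T := d * 160 + 160) (by norm_num)
    (by simp [hE.r18, h43]; omega) l
    (by simp [hE.r18, h43, hl']) (by omega) ?_).weaken (by simp) le_rfl fun _ h => h
  refine (Det.assign_cons (T := d * 160 + 154) (by norm_num)
    (by simp; omega) 0 (by simp) (by omega) ?_).weaken (by simp) le_rfl fun _ h => h
  refine (Spec.cons_det (T' := d * 80 + 113) (q' := 0) (hwalk _ false
    ((((Same.refl _ _).set _ (by norm_num)).set _ (by norm_num)).set _ (by norm_num)) rfl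
    (by simp) (by simp) (by simp)) ?_).weaken (by omega) (by omega) fun _ _ h => h
  rintro σ₁ ⟨g1, g2, g3⟩
  have e1 : ∀ ρ < 72, σ₁.reg ρ = σ.reg ρ := fun ρ hρ => by
    rw [g1 ρ (by omega)]
    simp only [St.set_reg]
    rw [if_neg (by omega), if_neg (by omega), if_neg (by omega)]
  have e18 := (e1 18 (by norm_num)).trans hE.r18
  have em : ∀ c, σ₁.mem (9 * n + c) = tree c := fun c => by rw [g2]
  have hv0 := hleaf _ hw0.1 hw0.2
  have hv1 := hleaf _ hw1.1 hw1.2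
  refine (Det.assign_cons (T := d * 80 + 100) (by norm_num)
    (by simp [e18, g3]; omega) (treeValue d tree (Function.update (extend (Y k)) l false))
    (by simp [e18, g3, em, treeValue]) (by unfold treeValue; omega) ?_).weaken (by simp) le_rfl
      fun _ h => h
  refine (Det.assign_cons (T := d * 80 + 90) (by norm_num)
    (by simp; omega) 1 (by simp) (by omega) ?_).weaken (by simp) le_rfl fun _ h => h
  refine (Spec.cons_det (T' := 45) (q' := 0) (hwalk _ true (fun ρ hρ => ?_) ?_ ?_ ?_ ?_)
    ?_).weaken (by omega) (by omega) fun _ _ h => h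
  · simp only [St.set_reg]
    rw [if_neg (by omega), if_neg (by omega), e1 ρ (by omega)]
  · exact g2
  · simp [g1 72 (by norm_num)]
  · simp [g1 73 (by norm_num)]
  · simp
  rintro σ₂ ⟨f1, f2, f3⟩
  have e2 : ∀ ρ < 72, σ₂.reg ρ = σ.reg ρ := fun ρ hρ => by
    rw [f1 ρ (by omega)]
    simp only [St.set_reg]
    rw [if_neg (by omega), if_neg (by omega), e1 ρ hρ]
  have d18 := (e2 18 (by norm_num)).trans hE.r18
  have d19 := (e2 19 (by norm_num)).trans hE.r19
  have d43 := (e2 43 (by norm_num)).trans h43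
  have d72 : σ₂.reg 72 = rowAddr n d k := by rw [f1 72 (by norm_num)]; simp [g1 72 (by norm_num)]
  have d75 : σ₂.reg 75 = treeValue d tree (Function.update (extend (Y k)) l false) := by
    rw [f1 75 (by norm_num)]; simp
  have em2 : ∀ c, σ₂.mem (9 * n + c) = tree c := fun c => by rw [f2]
  have hS : Same 45 σ σ₂ := fun ρ hρ => e2 ρ (by omega)
  refine (Spec.cons_det (T' := 1) (q' := 0) (Det.cond (T := 20) (q := 0)
    (by simp [d18, f3]; omega) (fun hc => ?_) fun hc => ?_) fun σ' h => det_nil h).weaken (by simp)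
      le_rfl fun _ _ h => h
  · simp only [St.eval, Expr.eval_eq, Expr.eval_load, Expr.eval_add, Expr.eval_var, d18, f3, d75,
      em2] at hc
    refine det_skip.weaken (by norm_num) le_rfl ?_
    rintro _ rfl
    refine ⟨hS, Or.inl ⟨fun hs => ?_, f2⟩⟩
    exact hc (if_neg hs)
  · simp only [St.eval, Expr.eval_eq, Expr.eval_load, Expr.eval_add, Expr.eval_var, d18, f3, d75,
      em2] at hc
    refine (det_storeAt (by simp [d19, d43]; omega) (by simp)).weaken (by simp) le_rfl ?_
    rintro _ rfl
    refine ⟨hS, Or.inr ⟨fun hs => ?_, ?_⟩⟩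
    · change treeValue d tree _ = tree _ at hs
      rw [if_pos hs] at hc
      omega
    · funext a
      simp [St.eval, d19, d43, d72, f2, Function.update_apply]

/-- The witness rows belong to samples at which the tree is sensitive. -/
def HasWitness {d : ℕ} (n : ℕ) (Y : Fin (numSamples d) → Fin (numBlocks d) → Bool) (mem : ℕ → ℕ)
    (i : ℕ) (k : ℕ) : Prop :=
  ∃ w : Fin (numSamples d), mem (9 * n + 2 * 2 ^ d + i) = rowAddr n d w ∧
    ((∃ s : Fin (numSamples d), (s : ℕ) < k ∧
        Sensitive d (fun i => mem (9 * n + i)) (extend (Y s)) (mem (9 * n + i))) →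
      Sensitive d (fun i => mem (9 * n + i)) (extend (Y w)) (mem (9 * n + i)))

theorem Sensitive.congr {tree tree' : ℕ → ℕ} {y : ℕ → Bool} {l : ℕ}
    (h : Sensitive d tree y l) (he : ∀ c < 2 * 2 ^ d, tree' c = tree c) :
    Sensitive d tree' y l := by
  unfold Sensitive treeValue at *
  rwa [treeWalk_congr_lt fun c hc => he c (by omega), treeWalk_congr_lt fun c hc => he c (by omega),
    he _ (treeWalk_bounds _ _ _).2, he _ (treeWalk_bounds _ _ _).2]

theorem HasWitness.congr {mem mem' : ℕ → ℕ} {i k : ℕ} (h : HasWitness n Y mem i k) (hi : i < 2 ^ d)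
    (hm : ∀ a, 9 * n ≤ a → a < 9 * n + 2 * 2 ^ d → mem' a = mem a)
    (he : mem' (9 * n + 2 * 2 ^ d + i) = mem (9 * n + 2 * 2 ^ d + i)) :
    HasWitness n Y mem' i k := by
  obtain ⟨w, hw, hw'⟩ := h
  have e : ∀ c < 2 * 2 ^ d, mem' (9 * n + c) = mem (9 * n + c) := fun c hc =>
    hm _ (by omega) (by omega)
  refine ⟨w, he.trans hw, fun ⟨s, hs, hs'⟩ => ?_⟩
  rw [e i (by omega)] at hs' ⊢
  exact (hw' ⟨s, hs, hs'.congr fun c hc => (e c hc).symm⟩).congr e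

theorem numSamples_pos (d : ℕ) : 0 < numSamples d := by unfold numSamples; positivity

theorem det_nodeWitness {i : ℕ} (hF : Fits M d m) (hT : HasTree n m B Y σ)
    (h43 : σ.reg 43 = i) (hi : i < 2 ^ d) :
    Det M (block [storeAt (.var 19 + .var 43) (.var 21), forLoop 44 5 witnessStep]) σ
      (numSamples d * (d * 160 + 220) + 30) 0 fun σ' => Same 44 σ σ' ∧
        (∀ a, a ≠ 9 * n + 2 * 2 ^ d + i → σ'.mem a = σ.mem a) ∧
        HasWitness n Y σ'.mem i (numSamples d) := by
  have hF' := hF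
  unfold Fits at hF'
  have hE := hT.env
  have hloop := Det.forLoop (M := M) (i := 44) (b := 5) (P := witnessStep) (N := numSamples d)
    (T := d * 160 + 200) (q := 0)
    (σ := σ.put (9 * n + 2 * 2 ^ d + i) (9 * n + 3 * 2 ^ d + numSamples d))
    (fun k σ' => Same 44 σ σ' ∧ σ'.reg 44 = k ∧
      (∀ a, a ≠ 9 * n + 2 * 2 ^ d + i → σ'.mem a = σ.mem a) ∧ HasWitness n Y σ'.mem i k)
    (by norm_num) (by norm_num) (by omega) (by omega)
    (fun k σ' h => ⟨h.2.1, (h.1 5 (by norm_num)).trans hE.r5⟩) ?_ ?_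
  · have hloop' := hloop.weaken (T' := numSamples d * (d * 160 + 220) + 13) (q' := 0)
      (Nat.add_le_add_right (Nat.mul_le_mul_left _ (by omega)) 13) (by simp) fun _ h => h
    refine (Spec.store_cons (T := numSamples d * (d * 160 + 220) + 13 + 2)
      (by simp [hE.r19, h43]; omega) (by simp) ?_).weaken (by simp) le_rfl fun _ _ h => h
    simp only [Expr.eval_add, Expr.eval_var, hE.r19, h43, hE.r21]
    exact (Spec.cons_det (T' := 1) (q' := 0) hloop' fun σ' h =>
      det_nil ⟨h.1, h.2.2.1, h.2.2.2⟩).weaken (by omega) (by omega) fun _ _ h => h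
  · rintro k σ' hk ⟨h1, h2, h3, h4⟩
    have hT' : HasTree n m B Y σ' := hT.congr (h1.mono (by norm_num)) fun a ha => h3 a (by omega)
    refine (det_witnessStep (k := ⟨k, hk⟩) hF hT' ((h1 43 (by norm_num)).trans h43) hi h2).weaken
      le_rfl le_rfl ?_
    rintro σ'' ⟨g1, g2⟩
    refine ⟨(g1 44 (by norm_num)).trans h2, fun ρ hρ => ?_, by simp, fun a ha => ?_, ?_⟩
    · rw [St.set_reg, if_neg (by omega), g1 ρ (by omega), h1 ρ hρ]
    · rw [St.set_mem]
      rcases g2 with ⟨-, g2⟩ | ⟨-, g2⟩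
      · rw [g2, h3 a ha]
      · rw [g2, Function.update_of_ne ha, h3 a ha]
    · rw [St.set_mem]
      rcases g2 with ⟨hs, g2⟩ | ⟨hs, g2⟩
      · rw [g2]
        obtain ⟨w, hw, hw'⟩ := h4
        refine ⟨w, hw, fun ⟨s, hs1, hs2⟩ => hw' ⟨s, ?_, hs2⟩⟩
        rcases Nat.lt_succ_iff_lt_or_eq.1 hs1 with h | h
        · exact h
        · exact absurd hs2 (by rwa [show s = ⟨k, hk⟩ from Fin.ext h])
      · have e : ∀ c < 2 * 2 ^ d, σ''.mem (9 * n + c) = σ'.mem (9 * n + c) := fun c hc => by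
          rw [g2, Function.update_of_ne (by omega)]
        refine ⟨⟨k, hk⟩, by rw [g2, Function.update_self], fun _ => ?_⟩
        rw [e i (by omega)]
        exact hs.congr e
  -- The first sample row serves as default witness, so that every node points to a legitimate row
  -- even if no sample is sensitive.
  · refine ⟨fun ρ hρ => ?_, by simp, fun a ha => ?_, ⟨0, numSamples_pos d⟩, ?_,
      fun ⟨s, hs, _⟩ => by omega⟩
    · rw [St.set_reg, if_neg (by omega), St.put_reg]
    · simp [ha]
    · simp [rowAddr]

theorem det_findWitnesses (hF : Fits M d m) (hT : HasTree n m B Y σ) :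
    Det M findWitnesses σ (2 ^ d * (numSamples d * (d * 160 + 220) + 60) + 13) 0 fun σ' =>
      Same 40 σ σ' ∧
        (∀ a, a < 9 * n + 2 * 2 ^ d ∨ 9 * n + 3 * 2 ^ d ≤ a → σ'.mem a = σ.mem a) ∧
        ∀ i < 2 ^ d, HasWitness n Y σ'.mem i (numSamples d) := by
  have hF' := hF
  unfold Fits at hF'
  have hE := hT.env
  have hloop := Det.forLoop (M := M) (i := 43) (b := 3)
    (P := block [storeAt (.var 19 + .var 43) (.var 21), forLoop 44 5 witnessStep]) (N := 2 ^ d)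
    (T := numSamples d * (d * 160 + 220) + 30) (q := 0) (σ := σ)
    (fun k σ' => Same 40 σ σ' ∧ σ'.reg 43 = k ∧
      (∀ a, a < 9 * n + 2 * 2 ^ d ∨ 9 * n + 3 * 2 ^ d ≤ a → σ'.mem a = σ.mem a) ∧
      ∀ i < k, HasWitness n Y σ'.mem i (numSamples d))
    (by norm_num) (by norm_num) (by omega) (by omega)
    (fun k σ' h => ⟨h.2.1, (h.1 3 (by norm_num)).trans hE.r3⟩) ?_ ?_
  · exact hloop.weaken (Nat.add_le_add_right (Nat.mul_le_mul_left _ (by omega)) 13) (by simp)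
      fun σ' h => ⟨h.1, h.2.2.1, h.2.2.2⟩
  · rintro k σ' hk ⟨h1, h2, h3, h4⟩
    refine (det_nodeWitness hF (hT.congr h1 h3) h2 hk).weaken le_rfl le_rfl ?_
    rintro σ'' ⟨g1, g2, g3⟩
    refine ⟨(g1 43 (by norm_num)).trans h2, fun ρ hρ => ?_, by simp, fun a ha => ?_, ?_⟩
    · rw [St.set_reg, if_neg (by omega), g1 ρ (by omega), h1 ρ hρ]
    · rw [St.set_mem, g2 a (by omega), h3 a ha]
    · intro i hi
      rw [St.set_mem]
      rcases Nat.lt_succ_iff_lt_or_eq.1 hi with h | rfl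
      · exact (h4 i h).congr (by omega) (fun a _ ha => g2 a (by omega)) (g2 _ (by omega))
      · exact g3
  · exact ⟨(Same.refl _ _).set _ (by norm_num), by simp, fun _ _ => rfl, fun i hi => by omega⟩

end DTTest

namespace DTTest
variable {n : ℕ} {M : Oracle n}

/-! ### The whole program -/

theorem Spec.seq_bounds {α : Type} {P Q : Prog} {σ : St} {T q T' q' : ℕ} {A : PMF α}
    {post : α → St → Prop} {Φ : St → ℝ≥0∞} {ψ : α → ℝ≥0∞} (h : Spec M P σ T q A post)
    (h' : ∀ a σ', post a σ' → Bounds M Q σ' T' q' Φ (ψ a)) :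
    Bounds M (.seq P Q) σ (T + T' + 1) (q + q') Φ (expect A ψ) := by
  refine Bounds.seq (Φ := fun σ' => ⨆ a : {a // post a σ'}, ψ a)
    (h _ _ fun a σ' ha => le_iSup (fun a : {a // post a σ'} => ψ a.1) ⟨a, ha⟩) ?_
  intro σ' s K k G hr hs hG hK
  exact iSup_le fun a => h' a.1 σ' a.2 s K k G hr hs hG hK

theorem Det.seq_bounds {P Q : Prog} {σ : St} {T q T' q' : ℕ}
    {post : St → Prop} {Φ : St → ℝ≥0∞} {v : ℝ≥0∞} (h : Det M P σ T q post)
    (h' : ∀ σ', post σ' → Bounds M Q σ' T' q' Φ v) :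
    Bounds M (.seq P Q) σ (T + T' + 1) (q + q') Φ v := by
  have := Spec.seq_bounds (ψ := fun _ => v) h fun _ => h'
  simpa using this

/-- A complete tree that is consistent with the samples, together with witness rows. -/
structure Consistent {d : ℕ} (f : (Fin n → Bool) → Bool) (B : Fin n → Fin (numBlocks d))
    (Y : Fin (numSamples d) → Fin (numBlocks d) → Bool) (tree : ℕ → ℕ)
    (wit : ℕ → Fin (numSamples d)) : Prop where
  label : ∀ i < 2 ^ d, tree i < numBlocks d
  leaf : ∀ i, 2 ^ d ≤ i → i < 2 * 2 ^ d → tree i ≤ 1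
  fits : ∀ s, treeValue d tree (extend (Y s)) = (f fun t => Y s (B t)).toNat
  wit : ∀ i < 2 ^ d, (∃ s, Sensitive d tree (extend (Y s)) (tree i)) →
    Sensitive d tree (extend (Y (wit i))) (tree i)

def verify : Prog := block [findWitnesses, assign 30 (.const 0), roundsLoop,
  assign 0 (.const 1 - .var 30)]

def learnAndTest : Prog := .seq search
  (cond (.bin .eq (.var 41) (.const 2)) verify (assign 0 (.const 0)))

/-- The testing algorithm. -/
def tester : Prog := cond (.var 0) (.seq setup (.seq partition (.seq drawSamples learnAndTest)))
  (assign 0 (.const 1))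

/-- The time of `verify`. -/
def verifyTime (n d m : ℕ) : ℕ := 2 ^ d * (numSamples d * (d * 160 + 220) + 60) +
  numRounds d m * (2 ^ d * (2000 * n + 2020) + d * (300 * n + 320) + n + 220) + 80

/-- The number of queries of `verify`. -/
def verifyQueries (d m : ℕ) : ℕ := numRounds d m * (1 + 2 ^ d * 8 + d * 2)

section
variable {d m : ℕ} {B : Fin n → Fin (numBlocks d)}
  {Y : Fin (numSamples d) → Fin (numBlocks d) → Bool} {σ : St}

theorem HasTree.learned (hF : Fits M d m) (h : HasTree n m B Y σ)
    (hw : ∀ i < 2 ^ d, HasWitness n Y σ.mem i (numSamples d)) : Learned M B σ.mem := by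
  refine ⟨h.part, h.label, fun i h1 h2 => h.leaf i h2 h1, fun i hi => ?_, fun i hi => ?_⟩
  · obtain ⟨w, hw, -⟩ := hw i hi
    rw [hw, rowAddr]
    omega
  · obtain ⟨w, hw, -⟩ := hw i hi
    rw [hw]
    exact rowAddr_lt hF w.2

/-- The tree found by the search is not tracked any further: the bound `v` is required for all
consistent trees, all witnesses and all node functions that fit them. -/
theorem bounds_verify (hF : Fits M d m) (hT : HasTree n m B Y σ) {φ : Bool → ℝ≥0∞} {v : ℝ≥0∞}
    (hfits : ∀ s, treeValue d (fun i => σ.mem (9 * n + i)) (extend (Y s)) =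
      (M.f fun t => Y s (B t)).toNat)
    (hv : ∀ tree wit h, Consistent M.f B Y tree wit →
      (∀ i < 2 ^ d, h i = blockFun M.f B (tree i) (Y (wit i))) →
      v ≤ expect (roundsPMF M.f M.D d h tree (numRounds d m)) φ) :
    Bounds M verify σ (verifyTime n d m) (verifyQueries d m)
      (fun σ' => φ (decide (σ'.reg 0 ≠ 0))) v := by
  have hF' := hF
  unfold Fits at hF'
  refine (Det.seq_bounds (T' := numRounds d m *
    (2 ^ d * (2000 * n + 2020) + d * (300 * n + 320) + n + 220) + 66)
    (q' := numRounds d m * (1 + 2 ^ d * 8 + d * 2))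
    (det_findWitnesses hF hT) ?_).weaken (by unfold verifyTime; omega)
    (by unfold verifyQueries; omega) (fun _ => le_rfl) le_rfl
  rintro σ₁ ⟨h1, h2, h3⟩
  have hT₁ := hT.congr h1 h2
  have : Nonempty (Fin (numSamples d)) := ⟨⟨0, numSamples_pos d⟩⟩
  choose! wit hwit using h3
  set tree := fun i => σ₁.mem (9 * n + i) with htree
  have hL := hT₁.learned hF fun i hi => ⟨wit i, hwit i hi⟩
  have hcons : Consistent M.f B Y tree wit := by
    refine ⟨hT₁.label, hT₁.leaf, fun s => ?_, fun i hi ⟨s, hs⟩ => (hwit i hi).2 ⟨s, s.2, hs⟩⟩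
    rw [← hfits s]
    have he : ∀ i < 2 * 2 ^ d, tree i = σ.mem (9 * n + i) := fun i hi => h2 _ (by omega)
    unfold treeValue
    rw [treeWalk_congr_lt (tree := fun i => σ.mem (9 * n + i)) fun c hc => he c (by omega),
      he _ (treeWalk_bounds _ _ _).2]
  have hnode : ∀ i < 2 ^ d, nodeFun M B σ₁.mem i = blockFun M.f B (tree i) (Y (wit i)) := by
    intro i hi
    rw [nodeFun, (hwit i hi).1]
    congr 1
    funext j
    rw [readBits, hT₁.row]
    cases Y (wit i) j <;> simp
  refine Bounds.weaken (Spec.assign_cons (T := numRounds d m *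
    (2 ^ d * (2000 * n + 2020) + d * (300 * n + 320) + n + 220) + 60) (by norm_num)
    (by simp; omega) (by simp; omega)
    (A := roundsPMF M.f M.D d (nodeFun M B σ₁.mem) tree (numRounds d m))
    (post := fun ok σ' => σ'.reg 0 = ok.toNat) ?_
    (fun σ' => φ (decide (σ'.reg 0 ≠ 0))) φ fun ok σ' h => ?_) (by simp) le_rfl (fun _ => le_rfl)
    (hv tree wit _ hcons hnode)
  · refine (Spec.seq_det (T' := 20) (q' := 0) (spec_roundsLoop (hT₁.env.of_same (k := 30)
      ((Same.refl _ _).set _ (by norm_num)) (by norm_num)) hF hL (by simp))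
      fun ok σ' h => ?_).weaken (by omega) le_rfl fun _ _ h => h
    have hb := Bool.toNat_le (!ok)
    refine (Spec.assign_cons (T := 1) (by norm_num)
      (by simp [h]; omega) (by simp [h]; omega) (Spec.nil ?_)).weaken (by simp) le_rfl
      fun _ _ h => h
    simp [h]
    cases ok <;> rfl
  · rw [h]
    cases ok <;> simp

theorem bounds_learnAndTest (hF : Fits M d m) (hR : Ready M d m B Y σ) {φ : Bool → ℝ≥0∞} {v : ℝ≥0∞}
    (hv : ∀ tree wit h, Consistent M.f B Y tree wit →
      (∀ i < 2 ^ d, h i = blockFun M.f B (tree i) (Y (wit i))) →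
      v ≤ expect (roundsPMF M.f M.D d h tree (numRounds d m)) φ)
    (hv' : ∀ Y' L, (∀ (s : Fin (numSamples d)) (j : Fin (numBlocks d)), Y' s j = Y s j) →
      (∀ s : Fin (numSamples d), L s = (M.f fun t => Y s (B t)).toNat) →
      ¬ Separable Y' L (numBlocks d) d (fun s => s < numSamples d) → v ≤ φ false) :
    Bounds M learnAndTest σ (searchTime d d + verifyTime n d m + 200) (verifyQueries d m)
      (fun σ' => φ (decide (σ'.reg 0 ≠ 0))) v := by
  have hF' := hF
  unfold Fits at hF'
  have hD : HasSamples n d σ.mem := by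
    refine ⟨fun s hs j hj => ?_, fun s hs => ?_⟩
    · have := hR.row ⟨s, hs⟩ ⟨j, hj⟩
      simp only at this
      rw [this]
      exact Bool.toNat_le _
    · have := hR.label ⟨s, hs⟩
      simp only at this
      rw [sampleLabel, this]
      exact Bool.toNat_le _
  have hrow : ∀ (s : Fin (numSamples d)) (j : Fin (numBlocks d)),
      sampleRow n d σ.mem s j = Y s j := fun s j => by
    rw [sampleRow, rowVal, if_neg j.2.ne, hR.row]
    cases Y s j <;> simp
  refine (Det.seq_bounds (T' := verifyTime n d m + 10) (q' := verifyQueries d m)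
    (det_search hR.env hF hD hR.zero) ?_).weaken (by omega) (by omega) (fun _ => le_rfl) le_rfl
  rintro σ₁ ⟨h1, h2, h3, h4⟩
  refine (bounds_cond (T := verifyTime n d m) (q := verifyQueries d m) (by simp; omega)
    (fun hc => ?_) fun hc => ?_).weaken (by simp) le_rfl (fun _ => le_rfl) le_rfl
  · obtain ⟨g1, g2, g3⟩ := h4.resolve_right fun h => by simp [St.eval, h.1] at hc
    have hT : HasTree n m B Y σ₁ := by
      refine ⟨hR.env.of_same h1 (by norm_num), fun t => ?_, fun s j => ?_, g3, h3⟩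
      · rw [h2 _ (by omega), hR.part t]
      · rw [h2 _ (by unfold rowAddr; omega), hR.row]
    refine bounds_verify hF hT (fun s => ?_) hv
    have hg := g2 s s.2
    rw [sampleLabel, hR.label s] at hg
    rw [← hg, treeValue]
    congr 2
    refine treeWalk_congr_val fun c hc => ?_
    have := hrow s ⟨_, g3 c hc⟩
    simp only at this
    rw [this, extend, dif_pos (g3 c hc)]
  · obtain ⟨g1, g2⟩ := h4.resolve_left fun h => by simp [St.eval, h.1] at hc
    have hdet : Det M (assign 0 (.const 0)) σ₁ (verifyTime n d m) (verifyQueries d m) fun σ' =>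
        σ' = σ₁.set 0 0 := (det_assign (by norm_num) (by simp; omega) (by simp; omega)).weaken
      (by simp [verifyTime]) (by omega) fun _ h => h
    refine det_iff.1 hdet _ _ ?_
    rintro _ rfl
    simpa using hv' _ _ hrow (fun s => hR.label s) g2

end

/-- The time of the algorithm. -/
def testerTime (n d m : ℕ) : ℕ := 30 * d + n * (80 * d + 180) +
  numSamples d * (numBlocks d * 35 + 60 * n + 220) + searchTime d d + verifyTime n d m + 1000

/-- The number of queries of the algorithm. -/
def testerQueries (d m : ℕ) : ℕ := numSamples d + verifyQueries d m

/-- The target `v` may depend on the random partition and rows, so that completeness can put it to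
`0` outside the good event; soundness takes it constant. -/
theorem bounds_tester {d m : ℕ} (hF : Fits M d m) (hw : 1000 < wordCap M.w) (hn : 0 < n)
    (hR : 300 * (d + 1) < wordCap M.w) {σ : St} (h0 : σ.reg 0 = n) (h1 : σ.reg 1 = d)
    (h2 : σ.reg 2 = m) (hmem : ∀ a, σ.mem a = 0) {φ : Bool → ℝ≥0∞}
    {v : (Fin n → Fin (numBlocks d)) → (Fin (numSamples d) → Fin (numBlocks d) → Bool) → ℝ≥0∞}
    (hv : ∀ B Y tree wit h, Consistent M.f B Y tree wit →
      (∀ i < 2 ^ d, h i = blockFun M.f B (tree i) (Y (wit i))) →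
      v B Y ≤ expect (roundsPMF M.f M.D d h tree (numRounds d m)) φ)
    (hv' : ∀ B Y Y' L, (∀ (s : Fin (numSamples d)) (j : Fin (numBlocks d)), Y' s j = Y s j) →
      (∀ s : Fin (numSamples d), L s = (M.f fun t => Y s (B t)).toNat) →
      ¬ Separable Y' L (numBlocks d) d (fun s => s < numSamples d) → v B Y ≤ φ false) :
    Bounds M tester σ (testerTime n d m) (testerQueries d m)
      (fun σ' => φ (decide (σ'.reg 0 ≠ 0)))
      (expect (PMF.uniformOfFintype (Fin n → Fin (numBlocks d))) fun B =>
        expect (PMF.uniformOfFintype (Fin (numSamples d) → Fin (numBlocks d) → Bool)) (v B)) := by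
  have hF' := hF
  unfold Fits at hF'
  refine (bounds_cond (T := testerTime n d m - 10) (q := testerQueries d m) (by simp)
    (fun hc => ?_) fun hc => ?_).weaken (by simp [testerTime]) le_rfl (fun _ => le_rfl) le_rfl
  swap
  · simp [St.eval, h0] at hc
    omega
  refine (Det.seq_bounds (T' := n * (80 * d + 180) +
      numSamples d * (numBlocks d * 35 + 60 * n + 220) + searchTime d d + verifyTime n d m + 300)
    (q' := testerQueries d m) (det_setup hF hw h0 h1 h2 hR) ?_).weaken
    (by unfold testerTime; omega) (by omega) (fun _ => le_rfl) le_rfl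
  rintro σ₁ ⟨hE, hm₁⟩
  refine (Spec.seq_bounds (T' :=
      numSamples d * (numBlocks d * 35 + 60 * n + 220) + searchTime d d + verifyTime n d m + 250)
    (q' := testerQueries d m) (spec_partition hE hF) ?_).weaken
    (by omega) (by omega) (fun _ => le_rfl) le_rfl
  rintro B σ₂ ⟨h21, h22, h23⟩
  refine (Spec.seq_bounds (T' := searchTime d d + verifyTime n d m + 200) (q' := verifyQueries d m)
    (spec_drawSamples (hE.of_same h21 (by norm_num)) hF h22 fun c hc => ?_) ?_).weaken
    (by omega) le_rfl (fun _ => le_rfl) le_rfl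
  · rw [h23 _ (by omega), hm₁, hmem]
  · intro Y σ₃ h₃
    exact bounds_learnAndTest hF h₃ (hv B Y) (hv' B Y)

end DTTest

/-! ### Analysis of the rounds for functions far from the class -/

namespace DTTest
variable {n : ℕ}

/-! ### Indicators -/

/-- The indicator of a Boolean. -/
noncomputable def ind (b : Bool) : ℝ≥0∞ := if b then 1 else 0

@[simp] theorem ind_true : ind true = 1 := rfl
@[simp] theorem ind_false : ind false = 0 := rfl

theorem ind_le_one (b : Bool) : ind b ≤ 1 := by cases b <;> simp

theorem ind_xor_le (a b c : Bool) : ind (a ^^ b) ≤ ind (a ^^ c) + ind (b ^^ c) := by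
  cases a <;> cases b <;> cases c <;> simp

theorem expect_ind_not {α : Type} (A : PMF α) (p : α → Bool) :
    (expect A fun a => ind (p a)) + (expect A fun a => ind (!p a)) = 1 := by
  rw [← expect_add, ← expect_const A 1]
  congr 1
  funext a
  cases p a <;> simp

theorem exists_le_expect {α : Type} [Finite α] [Nonempty α] (A : PMF α) {φ : α → ℝ≥0∞} {c : ℝ≥0∞}
    (h : expect A φ ≤ c) : ∃ a, φ a ≤ c := by
  obtain ⟨a, ha⟩ := Finite.exists_min φ
  exact ⟨a, ((expect_const A (φ a)).symm.le.trans (expect_mono A ha)).trans h⟩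

/-! ### Self-correction -/

/-- The uniform distribution on bit vectors. -/
noncomputable abbrev unif (n : ℕ) : PMF (Fin n → Bool) := PMF.uniformOfFintype (Fin n → Bool)

theorem xorVec_self_left (u p : Fin n → Bool) : xorVec u (xorVec u p) = p := by
  funext t; simp [xorVec]

theorem xorVec_comm (u p : Fin n → Bool) : xorVec u p = xorVec p u := by
  funext t; simp [xorVec, Bool.xor_comm]

theorem xorVec_assoc (u p q : Fin n → Bool) : xorVec (xorVec u p) q = xorVec u (xorVec p q) := by
  funext t; simp [xorVec]

theorem expect_unif_xorVec (x : Fin n → Bool) (φ : (Fin n → Bool) → ℝ≥0∞) :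
    (expect (unif n) fun u => φ (xorVec x u)) = expect (unif n) φ := by
  let e : (Fin n → Bool) ≃ (Fin n → Bool) :=
    ⟨xorVec x, xorVec x, xorVec_self_left x, xorVec_self_left x⟩
  have := congrArg (fun A => expect A φ) (uniform_map_equiv e)
  rw [expect_map] at this
  exact this

theorem expect_unif_xorVec' (x : Fin n → Bool) (φ : (Fin n → Bool) → ℝ≥0∞) :
    (expect (unif n) fun u => φ (xorVec u x)) = expect (unif n) φ := by
  simp only [xorVec_comm _ x, expect_unif_xorVec]

/-- The failure probability of the test of `h`. -/
noncomputable def failure (h : (Fin n → Bool) → Bool) : ℝ≥0∞ := expect (testPMF h) fun b => ind (!b)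

/-- The failure probability as an iterated expectation over the points and the reads. -/
theorem failure_eq (h : (Fin n → Bool) → Bool) : failure h =
    expect (unif n) fun z₁ => expect (unif n) fun z₂ => expect (unif n) fun z₃ =>
    expect (readPMF h z₁) fun a₁ => expect (readPMF h z₂) fun a₂ => expect (readPMF h z₃) fun a₃ =>
    expect (readPMF h (combineVec z₁ z₂ z₃)) fun a₄ => ind (a₄ ^^ ((a₁ && a₂) ^^ a₃)) := by
  simp only [failure, testPMF, expect_bind, expect_map]
  congr! 14 with z₁ z₂ z₃ a₁ a₂ a₃ a₄

theorem combineVec_eq (u v p : Fin n → Bool) :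
    combineVec u v p = xorVec (fun t => u t && v t) p := rfl

/-- Two reads at the same point rarely differ. -/
theorem collision_le (h : (Fin n → Bool) → Bool) (x : Fin n → Bool) :
    (expect (unif n) fun u' => expect (unif n) fun u =>
      ind ((h u ^^ h (xorVec u x)) ^^ (h u' ^^ h (xorVec u' x)))) ≤ 2 * failure h := by
  -- Substituting `u' = u ⊕ w` regroups the four values: the exclusive or of two reads at `x`
  -- becomes that of two reads at the uniform point `w`, with shifts `u` and `u ⊕ x`.
  have h1 : (expect (unif n) fun u' => expect (unif n) fun u =>
      ind ((h u ^^ h (xorVec u x)) ^^ (h u' ^^ h (xorVec u' x)))) =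
      expect (unif n) fun w => expect (unif n) fun u =>
        ind ((h u ^^ h (xorVec u w)) ^^ (h (xorVec u x) ^^ h (xorVec (xorVec u x) w))) := by
    rw [expect_comm, expect_comm (unif n) (unif n)
      (fun w u => ind ((h u ^^ h (xorVec u w)) ^^ (h (xorVec u x) ^^ h (xorVec (xorVec u x) w))))]
    congr 1
    funext u
    rw [← expect_unif_xorVec u]
    congr 1
    funext w
    have e : xorVec (xorVec u w) x = xorVec (xorVec u x) w := by
      rw [xorVec_assoc, xorVec_comm w, ← xorVec_assoc]
    rw [e]
    congr 1
    cases h u <;> cases h (xorVec u x) <;> cases h (xorVec u w) <;>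
      cases h (xorVec (xorVec u x) w) <;> rfl
  -- If two reads differ, one of them differs from `c`, whatever `c` is; and both shifts are
  -- uniform.
  have h2 : ∀ (w : Fin n → Bool) (c : Bool), (expect (unif n) fun u =>
      ind ((h u ^^ h (xorVec u w)) ^^ (h (xorVec u x) ^^ h (xorVec (xorVec u x) w)))) ≤
      2 * expect (readPMF h w) fun a => ind (a ^^ c) := by
    intro w c
    refine (expect_mono _ fun u => ind_xor_le _ _ c).trans ?_
    rw [expect_add, two_mul, readPMF, expect_map]
    refine add_le_add le_rfl (le_of_eq ?_)
    exact expect_unif_xorVec' x fun u => ind ((h u ^^ h (xorVec u w)) ^^ c)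
  rw [h1]
  set G : (Fin n → Bool) → ℝ≥0∞ := fun w => expect (unif n) fun u =>
    ind ((h u ^^ h (xorVec u w)) ^^ (h (xorVec u x) ^^ h (xorVec (xorVec u x) w))) with hG
  -- The test point `(z₁ ∧ z₂) ⊕ z₃` is uniform for fixed `z₁`, `z₂`, so `w` may be replaced by it;
  -- afterwards `c` is chosen as the value that the test expects there.
  have h3 : expect (unif n) G =
      expect (unif n) fun z₁ => expect (unif n) fun z₂ => expect (unif n) fun z₃ =>
      expect (readPMF h z₁) fun _ => expect (readPMF h z₂) fun _ => expect (readPMF h z₃) fun _ =>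
      G (combineVec z₁ z₂ z₃) := by
    have : ∀ z₁ z₂, (expect (unif n) fun z₃ => G (combineVec z₁ z₂ z₃)) = expect (unif n) G :=
      fun z₁ z₂ => expect_unif_xorVec _ G
    simp only [expect_const, this]
  rw [h3, failure_eq]
  simp only [← expect_mul_left]
  refine expect_mono _ fun z₁ => expect_mono _ fun z₂ => expect_mono _ fun z₃ =>
    expect_mono _ fun a₁ => expect_mono _ fun a₂ => expect_mono _ fun a₃ => ?_
  rw [expect_mul_left]
  exact h2 _ _

/-- The reads agree with a function up to a small error. -/
def Corrects (h g : (Fin n → Bool) → Bool) : Prop :=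
  ∀ x, (expect (readPMF h x) fun a => ind (a ^^ g x)) ≤ 2 * failure h

/-- By averaging in the collision bound, some fixed shift at `x` gives a bit with which a random
read at `x` rarely disagrees. That bit is the corrected value. -/
theorem exists_corrects (h : (Fin n → Bool) → Bool) : ∃ g, Corrects h g := by
  have : ∀ x, ∃ b, (expect (readPMF h x) fun a => ind (a ^^ b)) ≤ 2 * failure h := fun x => by
    obtain ⟨u', hu'⟩ := exists_le_expect _ (collision_le h x)
    exact ⟨_, by rw [readPMF, expect_map]; exact hu'⟩
  choose g hg using this
  exact ⟨g, hg⟩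

/-- Read `x` with shift `u`, `y` with shift `u ⊕ x` and `x ⊕ y` with shift `u`: the values of `h`
telescope. The expected number of wrong reads is at most six times the failure probability, hence
below one, so some `u` makes all three right. -/
theorem Corrects.linear {h g : (Fin n → Bool) → Bool} (hg : Corrects h g)
    (hf : 36 * failure h < 1) (x y : Fin n → Bool) : g (xorVec x y) = (g x ^^ g y) := by
  have e1 := hg x
  have e2 := hg y
  have e3 := hg (xorVec x y)
  rw [readPMF, expect_map] at e1 e2 e3
  rw [← expect_unif_xorVec' x] at e2
  have hlt : (expect (unif n) fun u => ind ((h u ^^ h (xorVec u x)) ^^ g x) +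
      ind ((h (xorVec u x) ^^ h (xorVec (xorVec u x) y)) ^^ g y) +
      ind ((h u ^^ h (xorVec u (xorVec x y))) ^^ g (xorVec x y))) < 1 := by
    rw [expect_add, expect_add]
    refine (add_le_add (add_le_add e1 e2) e3).trans_lt (lt_of_le_of_lt ?_ hf)
    rw [← add_mul, ← add_mul]
    gcongr
    norm_num
  obtain ⟨u, hu⟩ := exists_le_of_expect _ hlt
  rw [xorVec_assoc] at hu
  revert hu
  cases h u <;> cases h (xorVec u x) <;> cases h (xorVec u (xorVec x y)) <;> cases g x <;>
    cases g y <;> cases g (xorVec x y) <;> simp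

/-- The pointwise conjunction. -/
def andVec (u v : Fin n → Bool) : Fin n → Bool := fun t => u t && v t

/-- If the corrected values violate the identity, then some read is wrong or the reads violate it
themselves. -/
theorem ind_chain_le (a₁ a₂ a₃ a₄ g₁ g₂ g₃ g₄ : Bool) : ind (g₄ ^^ ((g₁ && g₂) ^^ g₃)) ≤
    ind (a₁ ^^ g₁) + ind (a₂ ^^ g₂) + ind (a₃ ^^ g₃) + ind (a₄ ^^ g₄) +
      ind (a₄ ^^ ((a₁ && a₂) ^^ a₃)) := by
  by_cases h₁ : a₁ = g₁
  · by_cases h₂ : a₂ = g₂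
    · by_cases h₃ : a₃ = g₃
      · by_cases h₄ : a₄ = g₄
        · subst h₁ h₂ h₃ h₄
          simp
        · have : ind (a₄ ^^ g₄) = 1 := by revert h₄; cases a₄ <;> cases g₄ <;> simp
          rw [this]
          exact (ind_le_one _).trans ((self_le_add_left _ _).trans (self_le_add_right _ _))
      · have : ind (a₃ ^^ g₃) = 1 := by revert h₃; cases a₃ <;> cases g₃ <;> simp
        rw [this]
        exact (ind_le_one _).trans ((self_le_add_left _ _).trans
          ((self_le_add_right _ _).trans (self_le_add_right _ _)))
    · have : ind (a₂ ^^ g₂) = 1 := by revert h₂; cases a₂ <;> cases g₂ <;> simp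
      rw [this]
      exact (ind_le_one _).trans ((self_le_add_left _ _).trans ((self_le_add_right _ _).trans
        ((self_le_add_right _ _).trans (self_le_add_right _ _))))
  · have : ind (a₁ ^^ g₁) = 1 := by revert h₁; cases a₁ <;> cases g₁ <;> simp
    rw [this]
    exact (ind_le_one _).trans ((self_le_add_right _ _).trans ((self_le_add_right _ _).trans
        ((self_le_add_right _ _).trans (self_le_add_right _ _))))

/-- Linearity removes the mask `z₃` from the test. The constant is four reads with error twice the
failure probability each, plus the failure of the test. -/
theorem Corrects.and_le {h g : (Fin n → Bool) → Bool} (hg : Corrects h g)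
    (hf : 36 * failure h < 1) : (expect (unif n) fun z₁ => expect (unif n) fun z₂ =>
      ind (g (andVec z₁ z₂) ^^ (g z₁ && g z₂))) ≤ 9 * failure h := by
  have h1 : (expect (unif n) fun z₁ => expect (unif n) fun z₂ =>
      ind (g (andVec z₁ z₂) ^^ (g z₁ && g z₂))) =
      expect (unif n) fun z₁ => expect (unif n) fun z₂ => expect (unif n) fun z₃ =>
        ind (g (combineVec z₁ z₂ z₃) ^^ ((g z₁ && g z₂) ^^ g z₃)) := by
    have : ∀ z₁ z₂ z₃, (g (combineVec z₁ z₂ z₃) ^^ ((g z₁ && g z₂) ^^ g z₃)) =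
        (g (andVec z₁ z₂) ^^ (g z₁ && g z₂)) := fun z₁ z₂ z₃ => by
      rw [combineVec_eq, hg.linear hf]
      change (g (andVec z₁ z₂) ^^ g z₃ ^^ _) = _
      cases g (andVec z₁ z₂) <;> cases g z₃ <;> cases (g z₁ && g z₂) <;> rfl
    simp only [this, expect_const]
  rw [h1, show 9 * failure h = 2 * failure h + 2 * failure h + 2 * failure h + 2 * failure h +
    failure h by ring]
  refine le_trans (b := expect (unif n) fun z₁ => expect (unif n) fun z₂ => expect (unif n) fun z₃ =>
    2 * failure h + 2 * failure h + 2 * failure h + 2 * failure h +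
    expect (readPMF h z₁) fun a₁ => expect (readPMF h z₂) fun a₂ => expect (readPMF h z₃) fun a₃ =>
    expect (readPMF h (combineVec z₁ z₂ z₃)) fun a₄ => ind (a₄ ^^ ((a₁ && a₂) ^^ a₃)))
    (expect_mono _ fun z₁ => expect_mono _ fun z₂ => expect_mono _ fun z₃ => ?_)
    (le_of_eq (by simp only [expect_add, expect_const, ← failure_eq]))
  calc ind (g (combineVec z₁ z₂ z₃) ^^ ((g z₁ && g z₂) ^^ g z₃))
      = expect (readPMF h z₁) fun a₁ => expect (readPMF h z₂) fun a₂ =>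
          expect (readPMF h z₃) fun a₃ => expect (readPMF h (combineVec z₁ z₂ z₃)) fun a₄ =>
            ind (g (combineVec z₁ z₂ z₃) ^^ ((g z₁ && g z₂) ^^ g z₃)) := by simp only [expect_const]
    _ ≤ expect (readPMF h z₁) fun a₁ => expect (readPMF h z₂) fun a₂ =>
          expect (readPMF h z₃) fun a₃ => expect (readPMF h (combineVec z₁ z₂ z₃)) fun a₄ =>
            ind (a₁ ^^ g z₁) + ind (a₂ ^^ g z₂) + ind (a₃ ^^ g z₃) +
              ind (a₄ ^^ g (combineVec z₁ z₂ z₃)) + ind (a₄ ^^ ((a₁ && a₂) ^^ a₃)) :=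
        expect_mono _ fun a₁ => expect_mono _ fun a₂ => expect_mono _ fun a₃ =>
          expect_mono _ fun a₄ => ind_chain_le _ _ _ _ _ _ _ _
    _ ≤ _ := by
        simp only [expect_add, expect_const]
        gcongr
        exacts [hg _, hg _, hg _, hg _]

/-- Random self-reduction of a bilinear identity: `x ∧ y` is recovered from the conjunctions at the
four pairs formed by `z₁` or `x ⊕ z₁` with `z₂` or `y ⊕ z₂`. Every pair is uniform and errs with at
most nine times the failure probability, whence the constant `36`. As the total is below one, some
`z₁`, `z₂` are good for all four pairs. -/
theorem Corrects.mul {h g : (Fin n → Bool) → Bool} (hg : Corrects h g)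
    (hf : 36 * failure h < 1) (x y : Fin n → Bool) : g (andVec x y) = (g x && g y) := by
  have e := hg.and_le hf
  set bad : (Fin n → Bool) → (Fin n → Bool) → ℝ≥0∞ := fun z₁ z₂ =>
    ind (g (andVec z₁ z₂) ^^ (g z₁ && g z₂)) with hbad
  have e1 : (expect (unif n) fun z₁ => expect (unif n) fun z₂ => bad (xorVec x z₁) z₂) ≤
      9 * failure h := by
    rw [expect_unif_xorVec x fun z₁ => expect (unif n) fun z₂ => bad z₁ z₂]; exact e
  have e2 : (expect (unif n) fun z₁ => expect (unif n) fun z₂ => bad z₁ (xorVec y z₂)) ≤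
      9 * failure h := by
    simp only [expect_unif_xorVec]; exact e
  have e3 : (expect (unif n) fun z₁ => expect (unif n) fun z₂ => bad (xorVec x z₁) (xorVec y z₂)) ≤
      9 * failure h := by
    simp only [expect_unif_xorVec]; exact e1
  have hlt : (expect (unif n) fun z₁ => expect (unif n) fun z₂ => bad z₁ z₂ + bad (xorVec x z₁) z₂ +
      bad z₁ (xorVec y z₂) + bad (xorVec x z₁) (xorVec y z₂)) < 1 := by
    simp only [expect_add]
    refine (add_le_add (add_le_add (add_le_add e e1) e2) e3).trans_lt (lt_of_le_of_lt ?_ hf)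
    rw [← add_mul, ← add_mul, ← add_mul]
    gcongr
    norm_num
  obtain ⟨z₁, hz₁⟩ := exists_le_of_expect _ hlt
  obtain ⟨z₂, hz₂⟩ := exists_le_of_expect _ hz₁
  simp only [hbad] at hz₂
  have hexp : andVec (xorVec x z₁) (xorVec y z₂) = xorVec (xorVec (andVec x y) (andVec z₁ z₂))
      (xorVec (andVec x z₂) (andVec z₁ y)) := by
    funext t
    simp only [andVec, xorVec]
    cases x t <;> cases y t <;> cases z₁ t <;> cases z₂ t <;> rfl
  have hexp1 : andVec (xorVec x z₁) z₂ = xorVec (andVec x z₂) (andVec z₁ z₂) := by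
    funext t
    simp only [andVec, xorVec]
    cases x t <;> cases z₁ t <;> cases z₂ t <;> rfl
  have hexp2 : andVec z₁ (xorVec y z₂) = xorVec (andVec z₁ y) (andVec z₁ z₂) := by
    funext t
    simp only [andVec, xorVec]
    cases y t <;> cases z₁ t <;> cases z₂ t <;> rfl
  rw [hexp, hexp1, hexp2] at hz₂
  simp only [hg.linear hf] at hz₂
  generalize g (andVec z₁ z₂) = p at hz₂
  generalize g (andVec x z₂) = q at hz₂
  generalize g (andVec z₁ y) = r at hz₂
  revert hz₂
  cases p <;> cases q <;> cases r <;> cases g (andVec x y) <;> cases g x <;> cases g y <;>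
    cases g z₁ <;> cases g z₂ <;> simp

/-- A linear and multiplicative function of bit vectors is a coordinate or zero. -/
theorem coordinate_or_zero {g : (Fin n → Bool) → Bool}
    (hl : ∀ x y, g (xorVec x y) = (g x ^^ g y)) (hm : ∀ x y, g (andVec x y) = (g x && g y)) :
    (∀ x, g x = false) ∨ ∃ τ, ∀ x, g x = x τ := by
  have h0 : g (fun _ => false) = false := by
    have := hl (fun _ => false) (fun _ => false)
    rw [Bool.xor_self] at this
    exact this
  by_cases h1 : ∃ τ, g (fun t => decide (t = τ)) = true
  · obtain ⟨τ, hτ⟩ := h1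
    refine Or.inr ⟨τ, fun x => ?_⟩
    -- If the unit vector at `τ` has value one, then `g x = g (x ∧ e_τ)`, and `x ∧ e_τ` is the unit
    -- vector or zero according to `x τ`.
    have hx := hm x fun t => decide (t = τ)
    rw [hτ, Bool.and_true] at hx
    rw [← hx]
    cases hb : x τ with
    | false =>
      have : andVec x (fun t => decide (t = τ)) = fun _ => false := by
        funext t
        by_cases h : t = τ
        · simp [andVec, h, hb]
        · simp [andVec, h]
      rw [this, h0]
    | true =>
      have : andVec x (fun t => decide (t = τ)) = fun t => decide (t = τ) := by
        funext t
        by_cases h : t = τ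
        · simp [andVec, h, hb]
        · simp [andVec, h]
      rw [this, hτ]
  · left
    push Not at h1
    have h1' : ∀ τ, g (fun t => decide (t = τ)) = false := fun τ => by simpa using h1 τ
    -- If all unit vectors have value zero, linearity makes `g` vanish on all their sums.
    have key : ∀ s : Finset (Fin n), g (fun t => decide (t ∈ s)) = false := by
      intro s
      induction s using Finset.induction_on with
      | empty =>
        simpa using h0
      | insert a s ha ih =>
        have : (fun t => decide (t ∈ insert a s)) =
            xorVec (fun t => decide (t = a)) fun t => decide (t ∈ s) := by
          funext t
          by_cases h : t = a
          · subst h; simp [xorVec, ha]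
          · simp [xorVec, h]
        rw [this, hl, h1' a, ih]
        rfl
    intro x
    have := key (Finset.univ.filter fun t => x t = true)
    simpa using this

theorem exists_coordinate (h : (Fin n → Bool) → Bool) (hf : 36 * failure h < 1) :
    ∃ g, Corrects h g ∧ ((∀ x, g x = false) ∨ ∃ τ, ∀ x, g x = x τ) := by
  obtain ⟨g, hg⟩ := exists_corrects h
  exact ⟨g, hg, coordinate_or_zero (hg.linear hf) (hg.mul hf)⟩

end DTTest

namespace DTTest
variable {n : ℕ}

/-! ### Soundness -/

/-- The node reached from node `j` in `k` steps when the values of the nodes at `x` are given by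
`g`. -/
def detWalk (g : ℕ → (Fin n → Bool) → Bool) (x : Fin n → Bool) : ℕ → ℕ → ℕ
  | 0, j => j
  | k + 1, j => detWalk g x k (2 * j + (g j x).toNat)

/-- A node whose function is the coordinate `τ` queries `x_τ`; a node whose function is zero always
goes left and is replaced by its left subtree. -/
theorem detWalk_mem_DT {g : ℕ → (Fin n → Bool) → Bool} {d : ℕ} (leaf : ℕ → ℕ)
    (hg : ∀ i < 2 ^ d, (∀ x, g i x = false) ∨ ∃ τ, ∀ x, g i x = x τ) :
    ∀ k i j, i + k = d → j < 2 ^ (i + 1) →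
      (fun x => decide (leaf (detWalk g x k j) = 1)) ∈ DT n k := by
  intro k
  induction k with
  | zero => exact fun i j _ _ => ⟨.leaf (decide (leaf j = 1)), le_rfl, fun x => rfl⟩
  | succ k ih =>
    intro i j hi hj
    have hp : 2 ^ (i + 1) ≤ 2 ^ d := Nat.pow_le_pow_right (by norm_num) (by omega)
    obtain ⟨T₀, hT₀, h₀⟩ := ih (i + 1) (2 * j) (by omega) (by rw [pow_succ]; omega)
    obtain ⟨T₁, hT₁, h₁⟩ := ih (i + 1) (2 * j + 1) (by omega) (by rw [pow_succ]; omega)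
    rcases hg j (by omega) with h | ⟨τ, h⟩
    · refine ⟨T₀, by omega, fun x => ?_⟩
      simp only [h₀, detWalk, h]
      rfl
    · refine ⟨.node τ T₀ T₁, by simp [DTree.depth]; omega, fun x => ?_⟩
      simp only [DTree.eval, h₀, h₁, detWalk, h]
      cases x τ <;> rfl

/-- Union bound along the path: while the reads agree with `g`, the random walk follows the
deterministic one, and each of the `k` reads is wrong with probability at most `2 * κ`. -/
theorem walk_error {h g : ℕ → (Fin n → Bool) → Bool} {d : ℕ} {κ : ℝ≥0∞}
    (hg : ∀ i < 2 ^ d, Corrects (h i) (g i)) (hκ : ∀ i < 2 ^ d, failure (h i) ≤ κ)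
    (x : Fin n → Bool) : ∀ k s i j, i + k = d → j < 2 ^ (i + 1) →
      (expect (iter (fun _ j => (readPMF (h j) x).map fun b => 2 * j + b.toNat) s k j) fun j' =>
        if j' = detWalk g x k j then 0 else 1) ≤ k * (2 * κ) := by
  intro k
  induction k with
  | zero => intro s i j _ _; simp [iter, detWalk]
  | succ k ih =>
    intro s i j hi hj
    have hp : 2 ^ (i + 1) ≤ 2 ^ d := Nat.pow_le_pow_right (by norm_num) (by omega)
    rw [iter, expect_bind, expect_map]
    refine le_trans (b := expect (readPMF (h j) x) fun a => ind (a ^^ g j x) + k * (2 * κ))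
      (expect_mono _ fun a => ?_) ?_
    · rw [detWalk]
      by_cases ha : a = g j x
      · subst ha
        rw [Bool.xor_self, ind_false, zero_add]
        refine ih (s + 1) (i + 1) _ (by omega) ?_
        have := Bool.toNat_le (g j x)
        rw [pow_succ]
        omega
      · have : ind (a ^^ g j x) = 1 := by revert ha; cases a <;> cases g j x <;> simp
        rw [this]
        refine le_trans (expect_le_of_forall_le _ fun j' => ?_) (self_le_add_right _ _)
        split_ifs <;> simp
    · rw [expect_add, expect_const, Nat.cast_succ, add_mul, one_mul, add_comm]
      gcongr
      exact (hg j (by omega) x).trans (mul_le_mul_right (hκ j (by omega)) _)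

/-- A failure is never forgotten: the flag stays `false`, so the conjunction of all tests fails at
least as often as the test of any single node. The first part is needed for the induction. -/
theorem tests_error (h : ℕ → (Fin n → Bool) → Bool) : ∀ k s ok,
    (ok = false → (expect (iter (fun i ok => (testPMF (h i)).map fun b => ok && b) s k ok)
      fun b => ind (!b)) = 1) ∧
    ∀ i, s ≤ i → i < s + k → failure (h i) ≤
      expect (iter (fun i ok => (testPMF (h i)).map fun b => ok && b) s k ok) fun b => ind (!b) := by
  intro k
  induction k with
  | zero => exact fun s ok => ⟨by rintro rfl; simp [iter], fun i h1 h2 => by omega⟩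
  | succ k ih =>
    intro s ok
    have h1 : ok = false → (expect (iter (fun i ok => (testPMF (h i)).map fun b => ok && b) s (k + 1)
        ok) fun b => ind (!b)) = 1 := by
      rintro rfl
      rw [iter, expect_bind, expect_map]
      simp only [Bool.false_and, (ih (s + 1) false).1 rfl, expect_const]
    refine ⟨h1, fun i hi hi' => ?_⟩
    rw [iter, expect_bind, expect_map]
    rcases hi.lt_or_eq with hlt | rfl
    · refine (expect_const (testPMF (h s)) _).symm.le.trans (expect_mono _ fun b => ?_)
      exact (ih (s + 1) (ok && b)).2 i hlt (by omega)
    · refine expect_mono _ fun b => ?_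
      cases b with
      | false => rw [Bool.and_false, (ih (s + 1) false).1 rfl]; exact ind_le_one _
      | true => simp

section
variable (f : (Fin n → Bool) → Bool) (D : PMF (Fin n → Bool)) (d : ℕ)
  (h : ℕ → (Fin n → Bool) → Bool) (leaf : ℕ → ℕ)

/-- The probability that a round rejects. -/
noncomputable def roundReject : ℝ≥0∞ := expect (roundPMF f D d h leaf) fun b => ind (!b)

theorem failure_le_roundReject {i : ℕ} (hi : i < 2 ^ d) :
    failure (h i) ≤ roundReject f D d h leaf := by
  simp only [roundReject, roundPMF, expect_bind, expect_map]
  refine ((tests_error h (2 ^ d) 0 true).2 i (by omega) (by omega)).trans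
    ((expect_const D _).symm.le.trans (expect_mono _ fun x => expect_mono _ fun ok => ?_))
  rw [← expect_const (walkPMF h x d 1) (ind (!ok))]
  refine expect_mono _ fun j => ?_
  cases ok
  · simp
  · simp

/-- For a fixed example, either the random walk ends at the leaf of the deterministic one, and then
a wrong leaf makes the round reject, or the walk has erred. -/
theorem disagreement_le {g : ℕ → (Fin n → Bool) → Bool} {κ : ℝ≥0∞}
    (hg : ∀ i < 2 ^ d, Corrects (h i) (g i)) (hκ : ∀ i < 2 ^ d, failure (h i) ≤ κ) :
    D.toOuterMeasure {x | decide (leaf (detWalk g x d 1) = 1) ≠ f x} ≤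
      roundReject f D d h leaf + d * (2 * κ) := by
  classical
  rw [toOuterMeasure_eq_expect]
  simp only [roundReject, roundPMF, expect_bind, expect_map]
  rw [← expect_const D (d * (2 * κ)), ← expect_add]
  refine expect_mono _ fun x => ?_
  refine le_trans ?_ (add_le_add_right (walk_error hg hκ x d 0 0 1 (by omega) (by norm_num)) _)
  rw [← expect_const (testsPMF h (2 ^ d))
    (expect (iter _ 0 d 1) _), ← expect_add, ← expect_const (testsPMF h (2 ^ d)) (ite _ _ _)]
  refine expect_mono _ fun ok => ?_
  rw [walkPMF, ← expect_add, ← expect_const (iter _ 0 d 1) (ite _ _ _)]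
  refine expect_mono _ fun j => ?_
  by_cases hj : j = detWalk g x d 1
  · subst hj
    simp only [Set.mem_ofPred_eq, if_true, add_zero]
    split_ifs with hne
    · have : leaf (detWalk g x d 1) ≠ (f x).toNat := by
        intro he
        rw [he] at hne
        revert hne
        cases f x <;> simp
      simp [this]
    · exact zero_le
  · simp only [if_neg hj]
    refine le_trans ?_ (self_le_add_left _ _)
    split_ifs <;> simp

theorem rounds_accept (k : ℕ) : ∀ s ok,
    (expect (iter (fun _ ok => (roundPMF f D d h leaf).map fun b => ok && b) s k ok) ind) =
      ind ok * (expect (roundPMF f D d h leaf) ind) ^ k := by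
  induction k with
  | zero => intro s ok; simp [iter]
  | succ k ih =>
    intro s ok
    rw [iter, expect_bind, expect_map]
    simp only [ih]
    have : ∀ b, ind (ok && b) * expect (roundPMF f D d h leaf) ind ^ k =
        (ind ok * expect (roundPMF f D d h leaf) ind ^ k) * ind b := fun b => by
      cases ok <;> cases b <;> simp
    simp only [this, expect_mul_left]
    ring

end

/-- Bernoulli gives `1 + k η ≤ (1 + η) ^ k`, and `α (1 + η) ≤ α + η ≤ 1`. This serves instead of
exponentials, both for repeated rounds and for random samples. -/
theorem pow_mul_one_add_le {α η : ℝ≥0∞} (h : α + η ≤ 1) (k : ℕ) : α ^ k * (1 + k * η) ≤ 1 := by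
  have hα : α ≤ 1 := (self_le_add_right _ _).trans h
  have hb : 1 + k * η ≤ (1 + η) ^ k := by
    induction k with
    | zero => simp
    | succ k ih =>
      rw [pow_succ]
      calc 1 + ((k + 1 : ℕ) : ℝ≥0∞) * η ≤ (1 + k * η) * (1 + η) := by
            calc 1 + ((k + 1 : ℕ) : ℝ≥0∞) * η ≤ 1 + ((k + 1 : ℕ) : ℝ≥0∞) * η + k * η * η :=
                  self_le_add_right _ _
              _ = _ := by push_cast; ring
        _ ≤ _ := mul_le_mul_left ih _
  calc α ^ k * (1 + k * η) ≤ α ^ k * (1 + η) ^ k := mul_le_mul_right hb _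
    _ = (α + α * η) ^ k := by rw [← mul_pow]; ring
    _ ≤ 1 := pow_le_one' ((add_le_add_right (mul_le_of_le_one_left' hα) _).trans h) k

/-- Were a round to reject with probability below `η`, every node test would fail with probability
at most `η < 1/36`. The corrected walk would then be a tree of depth at most `d` at distance at most
`(2 d + 1) η ≤ 1 / m ≤ ε`, against the assumption that `f` is far. -/
theorem roundReject_ge {f : (Fin n → Bool) → Bool} {D : PMF (Fin n → Bool)} {d m : ℕ} {ε : ℝ}
    (hm : 0 < m) (hε : 1 / (m : ℝ) ≤ ε) (hf : IsFar D ε f (DT n d))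
    (h : ℕ → (Fin n → Bool) → Bool) (leaf : ℕ → ℕ) :
    ENNReal.ofReal (1 / (150 * (d + 1) * m)) ≤ roundReject f D d h leaf := by
  by_contra hlt
  rw [not_le] at hlt
  set η : ℝ := 1 / (150 * (d + 1) * m) with hη
  have hm' : (1 : ℝ) ≤ m := by exact_mod_cast hm
  have hd0 : (0 : ℝ) ≤ d := Nat.cast_nonneg d
  have hη0 : 0 ≤ η := by positivity
  have hηm : (150 * (d + 1) * m) * η = 1 := mul_one_div_cancel (by positivity)
  have hκ : ∀ i < 2 ^ d, failure (h i) ≤ ENNReal.ofReal η := fun i hi =>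
    (failure_le_roundReject f D d h leaf hi).trans hlt.le
  have h36 : ∀ i < 2 ^ d, 36 * failure (h i) < 1 := fun i hi => by
    refine (mul_le_mul_right (hκ i hi) 36).trans_lt ?_
    rw [show (36 : ℝ≥0∞) = ENNReal.ofReal 36 by simp, ← ENNReal.ofReal_mul (by norm_num),
      ← ENNReal.ofReal_one, ENNReal.ofReal_lt_ofReal_iff one_pos, hη, mul_one_div, div_lt_one
      (by positivity)]
    nlinarith
  have : ∀ i, ∃ g, i < 2 ^ d → Corrects (h i) g ∧ ((∀ x, g x = false) ∨ ∃ τ, ∀ x, g x = x τ) :=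
    fun i => by
      by_cases hi : i < 2 ^ d
      · obtain ⟨g, hg⟩ := exists_coordinate (h i) (h36 i hi)
        exact ⟨g, fun _ => hg⟩
      · exact ⟨fun _ => false, fun h => absurd h hi⟩
  choose g hg using this
  have hDT := detWalk_mem_DT leaf (fun i hi => (hg i hi).2) d 0 1 (by omega) (by norm_num)
  have h1 := (hf _ hDT).trans_le (disagreement_le f D d h leaf (fun i hi => (hg i hi).1) hκ)
  have h2 : roundReject f D d h leaf + d * (2 * ENNReal.ofReal η) ≤ ENNReal.ofReal ε := by
    calc _ ≤ ENNReal.ofReal η + ENNReal.ofReal (d * (2 * η)) := by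
          refine add_le_add hlt.le (le_of_eq ?_)
          rw [ENNReal.ofReal_mul hd0, ENNReal.ofReal_mul (by norm_num), ENNReal.ofReal_natCast]
          simp
      _ = ENNReal.ofReal (η + d * (2 * η)) := (ENNReal.ofReal_add hη0 (by positivity)).symm
      _ ≤ ENNReal.ofReal ε := by
          refine ENNReal.ofReal_le_ofReal (le_trans ?_ hε)
          rw [le_div_iff₀ (by positivity)]
          nlinarith [mul_nonneg hd0 (mul_nonneg hη0 (Nat.cast_nonneg (α := ℝ) m)),
            mul_nonneg hη0 (Nat.cast_nonneg (α := ℝ) m)]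
  exact absurd h1 (not_lt.2 h2)

/-- If `f` is far from the decision trees, then the rounds reject with probability `2/3`. -/
theorem soundness {f : (Fin n → Bool) → Bool} {D : PMF (Fin n → Bool)} {d m : ℕ} {ε : ℝ}
    (hm : 0 < m) (hε : 1 / (m : ℝ) ≤ ε) (hf : IsFar D ε f (DT n d))
    (h : ℕ → (Fin n → Bool) → Bool) (leaf : ℕ → ℕ) :
    2 / 3 ≤ expect (roundsPMF f D d h leaf (numRounds d m)) fun b => ind (!b) := by
  have h1 := roundReject_ge hm hε hf h leaf
  have hα : expect (roundPMF f D d h leaf) ind + ENNReal.ofReal (1 / (150 * (d + 1) * m)) ≤ 1 := by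
    refine (add_le_add_right h1 _).trans (le_of_eq ?_)
    exact expect_ind_not _ fun b => b
  have h2 := pow_mul_one_add_le hα (numRounds d m)
  -- The number of rounds is twice `150 * (d + 1) * m`, so the probability that all rounds accept is
  -- at most `1 / 3`.
  have h3 : 1 + (numRounds d m : ℝ≥0∞) * ENNReal.ofReal (1 / (150 * (d + 1) * m)) = 3 := by
    rw [← ENNReal.ofReal_natCast, ← ENNReal.ofReal_mul (Nat.cast_nonneg _)]
    have hm' : (0 : ℝ) < m := by exact_mod_cast hm
    have : (numRounds d m : ℝ) * (1 / (150 * (d + 1) * m)) = 2 := by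
      rw [numRounds]
      push_cast
      field_simp
      norm_num
    rw [this]
    simp
    norm_num
  rw [h3] at h2
  have h4 := rounds_accept f D d h leaf (numRounds d m) 0 true
  rw [ind_true, one_mul] at h4
  have h5 := expect_ind_not (roundsPMF f D d h leaf (numRounds d m)) fun b => b
  change expect (roundsPMF f D d h leaf (numRounds d m)) ind + _ = 1 at h5
  rw [roundsPMF, h4] at h5
  rw [roundsPMF]
  generalize expect (roundPMF f D d h leaf) ind ^ numRounds d m = a at *
  generalize (expect (iter _ 0 (numRounds d m) true) fun b => ind (!b)) = b at *
  have ha : a ≤ 1 / 3 := by rwa [ENNReal.le_div_iff_mul_le (by simp) (by simp)]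
  have h6 : (2 / 3 : ℝ≥0∞) + 1 / 3 = 1 := by
    rw [← ENNReal.add_div, show (2 + 1 : ℝ≥0∞) = 3 by norm_num]
    exact ENNReal.div_self (by simp) (by simp)
  have h7 : (2 / 3 : ℝ≥0∞) + 1 / 3 ≤ b + 1 / 3 := by
    rw [h6]
    exact h5.symm.le.trans (by rw [add_comm]; exact add_le_add_right ha _)
  exact (ENNReal.add_le_add_iff_right (by simp)).1 h7

end DTTest

/-! ### Analysis of the learning phase for functions in the class -/

namespace DTTest

/-! ### Polynomials of low degree -/

/-- `G` is a polynomial over the field with two elements of degree less than `k`. -/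
def DegLT : ∀ r : ℕ, ℕ → ((Fin r → Bool) → Bool) → Prop
  | _, 0, G => ∀ y, G y = false
  | 0, _ + 1, _ => True
  -- This is the expansion $G = G_0 + y_0\,(G_0 + G_1)$ in the first variable: the coefficient of
  -- $y_0$ has degree smaller by one.
  | r + 1, k + 1, G => DegLT r (k + 1) (fun y => G (Fin.cons false y)) ∧
      DegLT r k fun y => G (Fin.cons false y) ^^ G (Fin.cons true y)

namespace DegLT
variable {r : ℕ}

theorem zero (r k : ℕ) : DegLT r k fun _ => false := by
  induction r generalizing k with
  | zero => cases k <;> simp [DegLT]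
  | succ r ih => cases k with
    | zero => simp [DegLT]
    | succ k => exact ⟨ih _, by simpa using ih _⟩

theorem xor {k : ℕ} {G H : (Fin r → Bool) → Bool} (hG : DegLT r k G) (hH : DegLT r k H) :
    DegLT r k fun y => G y ^^ H y := by
  induction r generalizing k with
  | zero => cases k with
    | zero => simp only [DegLT] at *; simp [hG, hH]
    | succ k => trivial
  | succ r ih => cases k with
    | zero => simp only [DegLT] at *; simp [hG, hH]
    | succ k =>
      refine ⟨ih hG.1 hH.1, ?_⟩
      have := ih hG.2 hH.2
      convert this using 2 with y
      beta_reduce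
      cases G (Fin.cons false y) <;> cases H (Fin.cons false y) <;> cases G (Fin.cons true y) <;>
        cases H (Fin.cons true y) <;> rfl

theorem succ {k : ℕ} {G : (Fin r → Bool) → Bool} (hG : DegLT r k G) : DegLT r (k + 1) G := by
  induction r generalizing k with
  | zero => trivial
  | succ r ih => cases k with
    | zero =>
      have : G = fun _ => false := funext hG
      rw [this]
      exact zero _ _
    | succ k => exact ⟨ih hG.1, ih hG.2⟩

theorem const (r k : ℕ) (b : Bool) : DegLT r (k + 1) fun _ => b := by
  induction r with
  | zero => trivial
  | succ r ih => exact ⟨ih, by simpa using zero _ _⟩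

theorem cons_true {k : ℕ} {G : (Fin (r + 1) → Bool) → Bool} (hG : DegLT (r + 1) (k + 1) G) :
    DegLT r (k + 1) fun y => G (Fin.cons true y) := by
  have := hG.1.xor hG.2.succ
  convert this using 2 with y
  cases G (Fin.cons false y) <;> cases G (Fin.cons true y) <;> rfl

theorem mul {k : ℕ} {G : (Fin r → Bool) → Bool} (hG : DegLT r k G) (l : Fin r) :
    DegLT r (k + 1) fun y => y l && G y := by
  induction r generalizing k with
  | zero => trivial
  | succ r ih => cases k with
    | zero =>
      have : G = fun _ => false := funext hG
      simpa [this] using zero _ _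
    | succ k =>
      refine Fin.cases ?_ (fun l => ?_) l
      -- The product with the first variable vanishes where that variable is `0`, so its coefficient
      -- of the first variable is `G` restricted to `1`.
      · exact ⟨by simpa using zero _ _, by simpa using hG.cons_true⟩
      · refine ⟨by simpa using ih hG.1 l, ?_⟩
        have := ih hG.2 l
        convert this using 2 with y
        simp only [Fin.cons_succ]
        cases y l <;> simp

theorem update {k : ℕ} {G : (Fin r → Bool) → Bool} (hG : DegLT r k G) (l : Fin r) (b : Bool) :
    DegLT r k fun y => G (Function.update y l b) := by
  induction r generalizing k with
  | zero => exact l.elim0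
  | succ r ih => cases k with
    | zero => exact fun y => hG _
    | succ k =>
      refine Fin.cases ?_ (fun l => ?_) l
      · simp only [DegLT, Fin.update_cons_zero]
        refine ⟨?_, by simpa using zero _ _⟩
        cases b
        · exact hG.1
        · exact hG.cons_true
      · simp only [DegLT, ← Fin.cons_update]
        exact ⟨ih hG.1 l, ih hG.2 l⟩

/-- A tree with root `i` computes $L + y_i\,(L + R)$, so each level raises the degree by at most
one. -/
theorem of_tree (T : DTree r) {k : ℕ} (h : T.depth ≤ k) : DegLT r (k + 1) T.eval := by
  induction T generalizing k with
  | leaf b => exact const r k b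
  | node i L R ihL ihR =>
    rw [DTree.depth] at h
    obtain ⟨k, rfl⟩ : ∃ k', k = k' + 1 := ⟨k - 1, by omega⟩
    have hL := ihL (k := k) (by omega)
    have hR := ihR (k := k) (by omega)
    have := ((hL.xor hR).mul i).xor hL.succ
    convert this using 2 with y
    rw [DTree.eval]
    cases y i <;> cases L.eval y <;> cases R.eval y <;> rfl

theorem of_mem_DT {k : ℕ} {G : (Fin r → Bool) → Bool} (h : G ∈ DT r k) : DegLT r (k + 1) G := by
  obtain ⟨T, hT, h⟩ := h
  rw [← funext h]
  exact of_tree T hT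

end DegLT

theorem expect_unif_bool (φ : Bool → ℝ≥0∞) :
    expect (PMF.uniformOfFintype Bool) φ = 2⁻¹ * (φ false + φ true) := by
  simp [expect, mul_add, add_comm]

theorem expect_unif_cons (r : ℕ) (φ : (Fin (r + 1) → Bool) → ℝ≥0∞) :
    expect (unif (r + 1)) φ = 2⁻¹ * ((expect (unif r) fun y => φ (Fin.cons false y)) +
      expect (unif r) fun y => φ (Fin.cons true y)) := by
  have := congrArg (fun A => expect A φ) (uniform_fin_succ (γ := Bool) r)
  simp only [expect_bind, expect_map, expect_unif_bool] at this
  exact this.symm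

/-- A nonzero polynomial of degree at most `k` is nonzero at a fraction `2 ^ (-k)` of the points. -/
theorem DegLT.density {r k : ℕ} {G : (Fin r → Bool) → Bool} (hG : DegLT r (k + 1) G)
    (h : ∃ y, G y = true) : 2⁻¹ ^ k ≤ expect (unif r) fun y => ind (G y) := by
  have half : (2⁻¹ : ℝ≥0∞) ≤ 1 := by simp
  induction r generalizing k with
  | zero =>
    obtain ⟨y, hy⟩ := h
    have : ∀ y', G y' = true := fun y' => by rw [Subsingleton.elim y' y, hy]
    simp only [this, ind_true, expect_const]
    exact pow_le_one' half k
  | succ r ih =>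
    rw [expect_unif_cons]
    -- If $G_0 + G_1$ is not zero, it has smaller degree, and wherever it is nonzero one of the
    -- halves is nonzero; this costs a factor of one half. If it is zero, both halves agree and
    -- nothing is lost.
    by_cases hD : ∃ y, (G (Fin.cons false y) ^^ G (Fin.cons true y)) = true
    · cases k with
      | zero =>
        obtain ⟨y, hy⟩ := hD
        have h2 : ∀ y, (G (Fin.cons false y) ^^ G (Fin.cons true y)) = false := by
          simpa only [DegLT] using hG.2
        rw [h2 y] at hy
        exact absurd hy (by simp)
      | succ k =>
        rw [pow_succ']
        refine mul_le_mul_right ((ih hG.2 hD).trans ?_) _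
        rw [← expect_add]
        refine expect_mono _ fun y => ?_
        cases G (Fin.cons false y) <;> cases G (Fin.cons true y) <;> simp
    · push Not at hD
      have he : ∀ y, G (Fin.cons true y) = G (Fin.cons false y) := fun y => by
        have := hD y
        revert this
        cases G (Fin.cons false y) <;> cases G (Fin.cons true y) <;> simp
      have h0 : ∃ y, G (Fin.cons false y) = true := by
        obtain ⟨y, hy⟩ := h
        rw [← Fin.cons_self_tail y] at hy
        refine ⟨Fin.tail y, ?_⟩
        cases hb : y 0
        · rwa [hb] at hy
        · rwa [hb, he] at hy
      simp only [he]
      rw [← two_mul, ← mul_assoc, ENNReal.inv_mul_cancel (by simp) (by simp), one_mul]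
      exact ih hG.1 h0

/-! ### Random samples -/

theorem expect_unif_pow {γ : Type} [Fintype γ] [Nonempty γ] (a : γ → ℝ≥0∞) (S : ℕ) :
    (expect (PMF.uniformOfFintype (Fin S → γ)) fun Y => ∏ s, a (Y s)) =
      expect (PMF.uniformOfFintype γ) a ^ S := by
  induction S with
  | zero => simp
  | succ S ih =>
    rw [← uniform_fin_succ]
    simp only [expect_bind, expect_map, Fin.prod_univ_succ, Fin.cons_zero, Fin.cons_succ,
      expect_mul_left, ih]
    rw [pow_succ, ← expect_mul_left]
    simp only [mul_comm]

theorem expect_sum {α ι : Type} (A : PMF α) (s : Finset ι) (φ : ι → α → ℝ≥0∞) :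
    (expect A fun a => ∑ i ∈ s, φ i a) = ∑ i ∈ s, expect A (φ i) := by
  classical
  induction s using Finset.induction_on with
  | empty => simp
  | insert i s hi ih => simp only [Finset.sum_insert hi, expect_add, ih]

/-- Random samples hit the support of a nonzero polynomial of degree at most `d`. -/
theorem miss_le {d r : ℕ} {G : (Fin r → Bool) → Bool} (hG : DegLT r (d + 1) G)
    (h : ∃ y, G y = true) :
    (expect (PMF.uniformOfFintype (Fin (numSamples d) → Fin r → Bool)) fun Y =>
      ∏ s, ind (!G (Y s))) ≤ 2⁻¹ ^ (2 ^ d * (2 * d + 8)) := by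
  rw [expect_unif_pow (fun y => ind (!G y)), numSamples, mul_assoc, pow_mul]
  gcongr
  have h1 := hG.density h
  have h2 : (expect (unif r) fun y => ind (!G y)) + 2⁻¹ ^ d ≤ 1 := by
    rw [← expect_ind_not (unif r) G, add_comm]
    exact add_le_add_left h1 _
  -- With `k = 2 ^ d` and `η = 2 ^ (-d)` the second factor is `2`: a group of `2 ^ d` samples misses
  -- with probability at most one half, and there are `2 ^ d * (2 * d + 8)` groups.
  have h3 := pow_mul_one_add_le h2 (2 ^ d)
  have h4 : ((2 ^ d : ℕ) : ℝ≥0∞) * 2⁻¹ ^ d = 1 := by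
    rw [Nat.cast_pow, ← mul_pow, Nat.cast_ofNat, ENNReal.mul_inv_cancel (by simp) (by simp), one_pow]
  rw [h4, one_add_one_eq_two] at h3
  rwa [← one_div, ENNReal.le_div_iff_mul_le (by simp) (by simp)]

end DTTest

namespace DTTest
variable {n : ℕ}

/-! ### Decision trees and partitions of the variables -/

/-- The variables that occur in a tree. -/
def DTree.vars : DTree n → Finset (Fin n)
  | .leaf _ => ∅
  | .node i L R => insert i (L.vars ∪ R.vars)

theorem DTree.card_vars_lt (T : DTree n) : T.vars.card < 2 ^ T.depth := by
  induction T with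
  | leaf b => simp [vars, depth]
  | node i L R ihL ihR =>
    have h1 := Finset.card_insert_le i (L.vars ∪ R.vars)
    have h2 := Finset.card_union_le L.vars R.vars
    have h3 : 2 ^ L.depth ≤ 2 ^ max L.depth R.depth := Nat.pow_le_pow_right (by norm_num) (le_max_left _ _)
    have h4 : 2 ^ R.depth ≤ 2 ^ max L.depth R.depth := Nat.pow_le_pow_right (by norm_num) (le_max_right _ _)
    rw [vars, depth, pow_succ]
    omega

theorem DTree.eval_congr (T : DTree n) {x y : Fin n → Bool} (h : ∀ i ∈ T.vars, x i = y i) :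
    T.eval x = T.eval y := by
  induction T with
  | leaf b => rfl
  | node i L R ihL ihR =>
    simp only [vars, Finset.mem_insert, Finset.mem_union] at h
    simp only [eval, h i (.inl rfl), ihL fun j hj => h j (.inr (.inl hj)),
      ihR fun j hj => h j (.inr (.inr hj))]

theorem mem_DT_comp {r d : ℕ} (B : Fin n → Fin r) {f : (Fin n → Bool) → Bool} (hf : f ∈ DT n d) :
    (fun y : Fin r → Bool => f fun t => y (B t)) ∈ DT r d := by
  obtain ⟨T, hT, hf⟩ := hf
  have key : ∀ T : DTree n, ∃ T' : DTree r, T'.depth = T.depth ∧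
      ∀ y, T'.eval y = T.eval fun t => y (B t) := by
    intro T
    induction T with
    | leaf b => exact ⟨.leaf b, rfl, fun y => rfl⟩
    | node i L R ihL ihR =>
      obtain ⟨L', hL, hL'⟩ := ihL
      obtain ⟨R', hR, hR'⟩ := ihR
      exact ⟨.node (B i) L' R', by simp [DTree.depth, hL, hR],
        fun y => by simp [DTree.eval, hL', hR']⟩
  obtain ⟨T', h1, h2⟩ := key T
  exact ⟨T', by omega, fun y => by rw [h2, hf]⟩

/-- The search only considers complete trees, so a leaf above the bottom level is padded with dummy
queries of block `0`; hence the need for at least one block. -/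
theorem separable_of_tree {r : ℕ} (hr : 0 < r) {Y : ℕ → ℕ → Bool} {L : ℕ → ℕ} (k : ℕ) :
    ∀ (T : DTree r) (A : ℕ → Prop), T.depth ≤ k →
      (∀ s, A s → L s = (T.eval fun j => Y s j).toNat) → Separable Y L r k A := by
  induction k with
  | zero =>
    intro T A hT h
    cases T with
    | leaf b => exact ⟨b.toNat, h⟩
    | node i L R => simp [DTree.depth] at hT
  | succ k ih =>
    intro T A hT h
    cases T with
    | leaf b =>
      exact ⟨0, hr, ih (.leaf b) _ (Nat.zero_le _) fun s hs => h s hs.1,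
        ih (.leaf b) _ (Nat.zero_le _) fun s hs => h s hs.1⟩
    | node i L R =>
      simp only [DTree.depth] at hT
      refine ⟨i, i.2, ih L _ (by omega) fun s hs => ?_, ih R _ (by omega) fun s hs => ?_⟩
      · rw [h s hs.1, DTree.eval, if_neg (by simp [hs.2])]
      · rw [h s hs.1, DTree.eval, if_pos hs.2]

theorem expect_uniform_equiv {γ : Type} [Fintype γ] [Nonempty γ] (e : γ ≃ γ) (φ : γ → ℝ≥0∞) :
    (expect (PMF.uniformOfFintype γ) fun a => φ (e a)) = expect (PMF.uniformOfFintype γ) φ := by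
  have := congrArg (fun A => expect A φ) (uniform_map_equiv e)
  rwa [expect_map] at this

/-- Two variables meet in a block with probability one over the number of blocks. -/
theorem same_block {r : ℕ} [NeZero r] {a b : Fin n} (hab : a ≠ b) :
    (r : ℝ≥0∞) * (expect (PMF.uniformOfFintype (Fin n → Fin r)) fun B => ind (decide (B a = B b))) =
      1 := by
  -- Translating the block of `a` by `v` preserves the uniform distribution, so all `r` shifts have
  -- equal probability; for each partition exactly one shift makes the blocks meet.
  have key : ∀ v : Fin r, (expect (PMF.uniformOfFintype (Fin n → Fin r)) fun B =>
      ind (decide (B a + v = B b))) =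
      expect (PMF.uniformOfFintype (Fin n → Fin r)) fun B => ind (decide (B a = B b)) := by
    intro v
    rw [← expect_uniform_equiv (Equiv.addRight (Function.update (0 : Fin n → Fin r) a (-v)))]
    congr! 3 with B
    simp [Function.update_of_ne hab.symm]
  calc _ = ∑ v : Fin r, expect (PMF.uniformOfFintype (Fin n → Fin r)) fun B =>
        ind (decide (B a + v = B b)) := by simp [key]
    _ = expect (PMF.uniformOfFintype (Fin n → Fin r)) fun B => ∑ v : Fin r,
        ind (decide (B a + v = B b)) := (expect_sum _ _ _).symm
    _ = 1 := by
      rw [← expect_const (PMF.uniformOfFintype (Fin n → Fin r)) 1]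
      congr 1
      funext B
      rw [Finset.sum_eq_single (B b - B a)]
      · simp
      · intro v _ hv
        have : ¬ B a + v = B b := fun h => hv (by rw [← h]; simp)
        simp [this]
      · simp

open Classical in
/-- Most partitions separate a small set of variables. -/
theorem injOn_probability {d : ℕ} (V : Finset (Fin n)) (hV : V.card ≤ 2 ^ d) :
    7 / 8 ≤ expect (PMF.uniformOfFintype (Fin n → Fin (numBlocks d))) fun B =>
      if Set.InjOn B V then 1 else 0 := by
  have hr : ((numBlocks d : ℕ) : ℝ≥0∞) ≠ 0 := by simp [NeZero.ne]
  have hr' : ((numBlocks d : ℕ) : ℝ≥0∞) ≠ ⊤ := by simp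
  have h1 : 1 ≤ (expect (PMF.uniformOfFintype (Fin n → Fin (numBlocks d))) fun B =>
      if Set.InjOn B V then 1 else 0) + ∑ p ∈ V.offDiag,
      expect (PMF.uniformOfFintype (Fin n → Fin (numBlocks d))) fun B =>
        ind (decide (B p.1 = B p.2)) := by
    rw [← expect_sum, ← expect_add]
    refine (expect_const (PMF.uniformOfFintype (Fin n → Fin (numBlocks d))) 1).symm.le.trans
      (expect_mono _ fun B => ?_)
    split_ifs with h
    · exact self_le_add_right _ _
    · rw [Set.InjOn] at h
      push Not at h
      obtain ⟨a, ha, b, hb, he, hne⟩ := h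
      refine le_trans ?_ (self_le_add_left _ _)
      refine le_trans ?_ (Finset.single_le_sum (fun _ _ => zero_le)
        (Finset.mem_offDiag.2 ⟨ha, hb, hne⟩ : (a, b) ∈ V.offDiag))
      simp [he]
  have h2 : ∀ p ∈ V.offDiag, (expect (PMF.uniformOfFintype (Fin n → Fin (numBlocks d))) fun B =>
      ind (decide (B p.1 = B p.2))) = (numBlocks d : ℝ≥0∞)⁻¹ := fun p hp =>
    ENNReal.eq_inv_of_mul_eq_one_left ((mul_comm _ _).trans
      (same_block (Finset.mem_offDiag.1 hp).2.2))
  have h3 : (V.offDiag.card : ℝ≥0∞) * (numBlocks d : ℝ≥0∞)⁻¹ ≤ 8⁻¹ := by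
    rw [← div_eq_mul_inv, ENNReal.div_le_iff hr hr', ← ENNReal.div_eq_inv_mul,
      ENNReal.le_div_iff_mul_le (by simp) (by simp)]
    -- There are at most `4 ^ d` ordered pairs of distinct variables and `8 * 4 ^ d` blocks.
    have : V.offDiag.card * 8 ≤ numBlocks d := by
      rw [Finset.offDiag_card, numBlocks_eq]
      have := Nat.mul_le_mul hV hV
      calc _ ≤ (V.card * V.card) * 8 := Nat.mul_le_mul_right _ (Nat.sub_le _ _)
        _ ≤ (2 ^ d * 2 ^ d) * 8 := Nat.mul_le_mul_right _ this
        _ = _ := by ring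
    exact_mod_cast this
  rw [Finset.sum_congr rfl h2, Finset.sum_const, nsmul_eq_mul] at h1
  have h4 := h1.trans (add_le_add_right h3 _)
  refine ENNReal.le_of_add_le_add_right (a := 8⁻¹) (by simp) (le_trans ?_ h4)
  rw [div_eq_mul_inv, ← add_one_mul, show (7 : ℝ≥0∞) + 1 = 8 by norm_num,
    ENNReal.mul_inv_cancel (by simp) (by simp)]

/-! ### Good samples -/

open Classical in
/-- Random samples hit the supports of a moderate number of polynomials of low degree. -/
theorem hit_probability {ι : Type} [Fintype ι] {d r : ℕ} (G : ι → (Fin r → Bool) → Bool)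
    (hG : ∀ i, DegLT r (d + 1) (G i)) (hι : Fintype.card ι ≤ 2 * 2 ^ (2 ^ d * (2 * d + 4))) :
    7 / 8 ≤ expect (PMF.uniformOfFintype (Fin (numSamples d) → Fin r → Bool)) fun Y =>
      if ∀ i, (∃ y, G i y = true) → ∃ s, G i (Y s) = true then 1 else 0 := by
  have h1 : 1 ≤ (expect (PMF.uniformOfFintype (Fin (numSamples d) → Fin r → Bool)) fun Y =>
      if ∀ i, (∃ y, G i y = true) → ∃ s, G i (Y s) = true then 1 else 0) + ∑ i : ι,
      expect (PMF.uniformOfFintype (Fin (numSamples d) → Fin r → Bool)) fun Y =>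
        if ∃ y, G i y = true then ∏ s, ind (!G i (Y s)) else 0 := by
    rw [← expect_sum, ← expect_add]
    refine (expect_const (PMF.uniformOfFintype (Fin (numSamples d) → Fin r → Bool)) 1).symm.le.trans
      (expect_mono _ fun Y => ?_)
    split_ifs with h
    · exact self_le_add_right _ _
    · push Not at h
      obtain ⟨i, hi, h⟩ := h
      refine le_trans ?_ (self_le_add_left _ _)
      refine le_trans ?_ (Finset.single_le_sum (fun _ _ => zero_le) (Finset.mem_univ i))
      simp [hi, Bool.eq_false_of_not_eq_true (h _)]
  have h2 : ∀ i ∈ Finset.univ,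
      (expect (PMF.uniformOfFintype (Fin (numSamples d) → Fin r → Bool)) fun Y =>
      if ∃ y, G i y = true then ∏ s, ind (!G i (Y s)) else 0) ≤ 2⁻¹ ^ (2 ^ d * (2 * d + 8)) := by
    intro i _
    split_ifs with h
    · exact miss_le (hG i) h
    · simp
  have h3 : (Fintype.card ι : ℝ≥0∞) * 2⁻¹ ^ (2 ^ d * (2 * d + 8)) ≤ 8⁻¹ := by
    rw [← ENNReal.inv_pow, ← div_eq_mul_inv, ENNReal.div_le_iff (by simp) (by simp),
      ← ENNReal.div_eq_inv_mul, ENNReal.le_div_iff_mul_le (by simp) (by simp)]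
    -- The slack between `2 * d + 4` and `2 * d + 8` in the exponent pays for the factor `2` in the
    -- cardinality and the target `1 / 8`.
    have h4 : 16 ≤ 2 ^ (2 ^ d * 4) := by
      calc 16 = 2 ^ (1 * 4) := by norm_num
        _ ≤ _ := Nat.pow_le_pow_right (by norm_num) (Nat.mul_le_mul_right _ Nat.one_le_two_pow)
    have : Fintype.card ι * 8 ≤ 2 ^ (2 ^ d * (2 * d + 8)) := by
      calc _ ≤ (2 * 2 ^ (2 ^ d * (2 * d + 4))) * 8 := Nat.mul_le_mul_right _ hι
        _ = 2 ^ (2 ^ d * (2 * d + 4)) * 16 := by ring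
        _ ≤ 2 ^ (2 ^ d * (2 * d + 4)) * 2 ^ (2 ^ d * 4) := Nat.mul_le_mul_left _ h4
        _ = _ := by rw [← pow_add]; ring_nf
    exact_mod_cast this
  have h4 := h1.trans (add_le_add_right ((Finset.sum_le_sum h2).trans
    ((by rw [Finset.sum_const, nsmul_eq_mul, Finset.card_univ] : _ = _).le.trans h3)) _)
  refine ENNReal.le_of_add_le_add_right (a := 8⁻¹) (by simp) (le_trans ?_ h4)
  rw [div_eq_mul_inv, ← add_one_mul, show (7 : ℝ≥0∞) + 1 = 8 by norm_num,
    ENNReal.mul_inv_cancel (by simp) (by simp)]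

theorem detWalk_treeWalk {g : ℕ → (Fin n → Bool) → Bool} {x : Fin n → Bool} {tree : ℕ → ℕ}
    {y : ℕ → Bool} (k : ℕ) : ∀ j, (∀ i < 2 ^ (j + k), g i x = y (tree i)) →
      detWalk g x k (treeWalk tree y j) = treeWalk tree y (j + k) := by
  induction k with
  | zero => exact fun j _ => rfl
  | succ k ih =>
    intro j h
    have h1 := (treeWalk_bounds tree y j).2
    have h2 : 2 ^ (j + 1) ≤ 2 ^ (j + (k + 1)) := Nat.pow_le_pow_right (by norm_num) (by omega)
    rw [pow_succ] at h2
    rw [detWalk, h _ (by omega)]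
    have := ih (j + 1) fun i hi => h i (by rwa [Nat.add_right_comm, Nat.add_assoc] at hi)
    rw [treeWalk] at this
    rw [this, Nat.add_right_comm, Nat.add_assoc]

theorem treeValue_mem_DT {d r : ℕ} {tree : ℕ → ℕ} (h : ∀ i < 2 ^ d, tree i < r) :
    (fun y : Fin r → Bool => decide (treeValue d tree (extend y) = 1)) ∈ DT r d := by
  have := detWalk_mem_DT (n := r) (d := d) (g := fun i y => extend y (tree i)) tree
    (fun i hi => .inr ⟨⟨tree i, h i hi⟩, fun y => by simp [extend, h i hi]⟩) d 0 1 (by omega)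
    (by norm_num)
  convert this using 5 with y
  have := detWalk_treeWalk (g := fun i y => extend y (tree i)) (x := y) (tree := tree)
    (y := extend y) d 0 fun i _ => rfl
  rw [zero_add] at this
  exact congrArg tree this.symm

/-- A complete tree with labels below `r` and leaves `0` and `1`. -/
def IsTree (d r : ℕ) (tree : ℕ → ℕ) : Prop :=
  (∀ i < 2 ^ d, tree i < r) ∧ ∀ i, 2 ^ d ≤ i → i < 2 * 2 ^ d → tree i ≤ 1

/-- The tree with given labels and leaves. -/
def treeOf {d r : ℕ} (p : (Fin (2 ^ d) → Fin r) × (Fin (2 ^ d) → Bool)) (i : ℕ) : ℕ :=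
  if h : i < 2 ^ d then p.1 ⟨i, h⟩ else if h : i - 2 ^ d < 2 ^ d then (p.2 ⟨i - 2 ^ d, h⟩).toNat else 0

theorem IsTree.exists_treeOf {d r : ℕ} {tree : ℕ → ℕ} (h : IsTree d r tree) :
    ∃ p : (Fin (2 ^ d) → Fin r) × (Fin (2 ^ d) → Bool), ∀ i < 2 * 2 ^ d, treeOf p i = tree i := by
  refine ⟨(fun i => ⟨tree i, h.1 i i.2⟩, fun i => decide (tree (i + 2 ^ d) = 1)), fun i hi => ?_⟩
  unfold treeOf
  split_ifs with h1 h2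
  · rfl
  · have := h.2 i (by omega) hi
    simp only [Nat.sub_add_cancel (not_lt.1 h1)]
    interval_cases tree i <;> rfl
  · omega

theorem treeValue_congr {d : ℕ} {tree tree' : ℕ → ℕ} (h : ∀ i < 2 * 2 ^ d, tree' i = tree i)
    (y : ℕ → Bool) : treeValue d tree' y = treeValue d tree y := by
  rw [treeValue, treeValue, treeWalk_congr_lt fun c hc => h c (by omega)]
  exact h _ (treeWalk_bounds tree y d).2

/-- The samples determine the function `F` among the complete trees and reveal the coordinates to
which it is sensitive. -/
structure GoodSamples (d : ℕ) {r : ℕ} (F : (Fin r → Bool) → Bool)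
    (Y : Fin (numSamples d) → Fin r → Bool) : Prop where
  fits : ∀ tree, IsTree d r tree → (∀ s, treeValue d tree (extend (Y s)) = (F (Y s)).toNat) →
    ∀ y, treeValue d tree (extend y) = (F y).toNat
  sensitive : ∀ l, (∃ y, F (Function.update y l false) ≠ F (Function.update y l true)) →
    ∃ s, F (Function.update (Y s) l false) ≠ F (Function.update (Y s) l true)

-- Two kinds of polynomials of degree at most `d` must be hit when nonzero: the difference between a
-- candidate tree and `F`, whose support refutes the tree, and the derivative of `F` in a block,
-- whose support consists of its witnesses. Candidate trees form a finite family thanks to `treeOf`.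
open Classical in
theorem goodSamples_probability {d : ℕ} {F : (Fin (numBlocks d) → Bool) → Bool}
    (hF : F ∈ DT (numBlocks d) d) :
    7 / 8 ≤ expect (PMF.uniformOfFintype (Fin (numSamples d) → Fin (numBlocks d) → Bool)) fun Y =>
      if GoodSamples d F Y then 1 else 0 := by
  have hF' := DegLT.of_mem_DT hF
  let G : ((Fin (2 ^ d) → Fin (numBlocks d)) × (Fin (2 ^ d) → Bool)) ⊕ Fin (numBlocks d) →
      (Fin (numBlocks d) → Bool) → Bool :=
    Sum.elim (fun p y => decide (treeValue d (treeOf p) (extend y) = 1) ^^ F y)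
      fun l y => F (Function.update y l false) ^^ F (Function.update y l true)
  refine (hit_probability G ?_ ?_).trans (expect_mono _ fun Y => ?_)
  · rintro (p | l)
    · exact (DegLT.of_mem_DT (treeValue_mem_DT fun i hi => by simp [treeOf, hi])).xor hF'
    · exact (hF'.update l false).xor (hF'.update l true)
  · have e : numBlocks d ^ 2 ^ d * 2 ^ 2 ^ d = 2 ^ (2 ^ d * (2 * d + 4)) := by
      rw [numBlocks, ← pow_mul, ← pow_add]
      ring_nf
    have e' : numBlocks d ≤ 2 ^ (2 ^ d * (2 * d + 4)) := by
      refine Nat.pow_le_pow_right (by norm_num) ?_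
      nlinarith [Nat.one_le_two_pow (n := d)]
    simp only [Fintype.card_sum, Fintype.card_prod, Fintype.card_fun, Fintype.card_fin,
      Fintype.card_bool, e]
    omega
  · split_ifs with h1 h2 h2
    · exact le_rfl
    · refine absurd ⟨fun tree ht hs y => ?_, fun l ⟨y, hy⟩ => ?_⟩ h2
      · obtain ⟨p, hp⟩ := ht.exists_treeOf
        have hv : ∀ y, treeValue d tree y ≤ 1 := fun y =>
          ht.2 _ (treeWalk_bounds tree y d).1 (treeWalk_bounds tree y d).2
        by_contra hy
        have hG : ∀ y, G (.inl p) y = true ↔ treeValue d tree (extend y) ≠ (F y).toNat := by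
          intro y
          have := hv (extend y)
          simp only [G, Sum.elim_inl, treeValue_congr hp]
          interval_cases treeValue d tree (extend y) <;> cases F y <;> simp
        obtain ⟨s, hs'⟩ := h1 (.inl p) ⟨y, (hG y).2 hy⟩
        exact (hG _).1 hs' (hs s)
      · obtain ⟨s, hs⟩ := h1 (.inr l) ⟨y, by simpa [G] using hy⟩
        exact ⟨s, by simpa [G] using hs⟩
    · exact zero_le
    · exact le_rfl

end DTTest

namespace DTTest
variable {n : ℕ}

/-! ### Completeness -/

theorem readPMF_eq_pure {h : (Fin n → Bool) → Bool} {p : Fin n → Bool} {b : Bool}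
    (hb : ∀ u, (h u ^^ h (xorVec u p)) = b) : readPMF h p = PMF.pure b := by
  rw [readPMF, funext hb]
  exact PMF.map_const _ _

theorem testPMF_eq_pure {h g : (Fin n → Bool) → Bool} (hg : ∀ p, readPMF h p = PMF.pure (g p))
    (hg' : (∃ τ, ∀ p, g p = p τ) ∨ ∀ p, g p = false) : testPMF h = PMF.pure true := by
  have key : ∀ u v p, (g (combineVec u v p) == ((g u && g v) ^^ g p)) = true := by
    intro u v p
    rcases hg' with ⟨τ, h⟩ | h <;> simp [h, combineVec]
  simp only [testPMF, hg, PMF.pure_bind, PMF.pure_map, key, PMF.bind_const]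

section
variable {h g : ℕ → (Fin n → Bool) → Bool} {d : ℕ}
  (hg : ∀ i < 2 ^ d, ∀ p, readPMF (h i) p = PMF.pure (g i p))
include hg

theorem walkPMF_eq_pure (x : Fin n → Bool) : walkPMF h x d 1 = PMF.pure (detWalk g x d 1) := by
  have key : ∀ k s i j, i + k = d → j < 2 ^ (i + 1) →
      iter (fun _ j => (readPMF (h j) x).map fun b => 2 * j + b.toNat) s k j =
        PMF.pure (detWalk g x k j) := by
    intro k
    induction k with
    | zero => exact fun s i j _ _ => rfl
    | succ k ih =>
      intro s i j hi hj
      have hp : 2 ^ (i + 1) ≤ 2 ^ d := Nat.pow_le_pow_right (by norm_num) (by omega)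
      have := Bool.toNat_le (g j x)
      rw [iter, hg j (by omega), PMF.pure_map, PMF.pure_bind,
        ih _ (i + 1) _ (by omega) (by rw [pow_succ]; omega), detWalk]
  exact key d 0 0 1 (by omega) (by norm_num)

theorem testsPMF_eq_pure (hg' : ∀ i < 2 ^ d, (∃ τ, ∀ p, g i p = p τ) ∨ ∀ p, g i p = false) :
    testsPMF h (2 ^ d) = PMF.pure true := by
  have key : ∀ k s, s + k ≤ 2 ^ d →
      iter (fun i ok => (testPMF (h i)).map fun b => ok && b) s k true = PMF.pure true := by
    intro k
    induction k with
    | zero => exact fun s _ => rfl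
    | succ k ih =>
      intro s hs
      rw [iter, testPMF_eq_pure (hg s (by omega)) (hg' s (by omega)), PMF.pure_map, PMF.pure_bind,
        Bool.and_true, ih _ (by omega)]
  exact key _ 0 (by omega)

theorem expect_roundsPMF {f : (Fin n → Bool) → Bool} {D : PMF (Fin n → Bool)} {leaf : ℕ → ℕ}
    (hg' : ∀ i < 2 ^ d, (∃ τ, ∀ p, g i p = p τ) ∨ ∀ p, g i p = false)
    (hf : ∀ x, leaf (detWalk g x d 1) = (f x).toNat) (k : ℕ) :
    expect (roundsPMF f D d h leaf k) ind = 1 := by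
  have : roundPMF f D d h leaf = PMF.pure true := by
    simp only [roundPMF, testsPMF_eq_pure hg hg', walkPMF_eq_pure hg, PMF.pure_bind, PMF.pure_map,
      hf, decide_true, Bool.and_true, PMF.bind_const]
  rw [roundsPMF, rounds_accept, this]
  simp

end

/-- Some change of the coordinate `l` changes the value of `F`. -/
def DependsOn {r : ℕ} (F : (Fin r → Bool) → Bool) (l : Fin r) : Prop :=
  ∃ y, F (Function.update y l false) ≠ F (Function.update y l true)

/-- The coordinates are switched from `y'` to `y` one at a time; a relevant coordinate does not
change, an irrelevant one does not matter. -/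
theorem eq_of_dependsOn {r : ℕ} {F : (Fin r → Bool) → Bool} {y y' : Fin r → Bool}
    (h : ∀ l, DependsOn F l → y l = y' l) : F y = F y' := by
  have key : ∀ s : Finset (Fin r), F (fun l => if l ∈ s then y l else y' l) = F y' := by
    intro s
    induction s using Finset.induction_on with
    | empty => simp
    | insert l s hl ih =>
      rw [← ih]
      have e : (fun k => if k ∈ insert l s then y k else y' k) =
          Function.update (fun k => if k ∈ s then y k else y' k) l (y l) := by
        funext k
        rcases eq_or_ne k l with rfl | hk
        · simp
        · simp [hk]
      by_cases hd : DependsOn F l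
      · rw [e, h l hd]
        congr 1
        refine Function.update_eq_self_iff.2 ?_
        simp [hl]
      · have hd' : ∀ z b, F (Function.update z l b) = F z := by
          intro z b
          have := not_exists.1 hd z
          rw [not_not] at this
          have h2 := Function.update_eq_self l z
          cases b <;> cases hz : z l <;> rw [hz] at h2 <;> (conv_rhs => rw [← h2]) <;> simp [this]
        rw [e, hd']
  simpa using key Finset.univ

theorem sensitive_iff {d r : ℕ} {tree : ℕ → ℕ} {F : (Fin r → Bool) → Bool}
    (hF : ∀ y, treeValue d tree (extend y) = (F y).toNat) (y : Fin r → Bool) (l : Fin r) :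
    Sensitive d tree (extend y) l ↔
      F (Function.update y l false) ≠ F (Function.update y l true) := by
  have h : ∀ b, Function.update (extend y) (l : ℕ) b = extend (Function.update y l b) := by
    intro b
    funext j
    by_cases hj : j < r
    · rcases eq_or_ne j l with rfl | hne
      · simp [extend]
      · have : (⟨j, hj⟩ : Fin r) ≠ l := fun h => hne (by rw [← h])
        simp [extend, hj, hne, this]
    · have hne : j ≠ l := fun h => hj (h ▸ l.2)
      simp [extend, hj, hne]
  rw [Sensitive, h, h, hF, hF]
  cases F (Function.update y l false) <;> cases F (Function.update y l true) <;> simp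

section
variable {f : (Fin n → Bool) → Bool} {T : DTree n} (hT : ∀ x, T.eval x = f x) {r : ℕ}
  {B : Fin n → Fin r} (hB : Set.InjOn B T.vars)
include hT hB

open Classical in
/-- A vector of block values that gives `f x`. -/
noncomputable def blockValues (f : (Fin n → Bool) → Bool) (T : DTree n) {r : ℕ} (B : Fin n → Fin r)
    (x : Fin n → Bool) (l : Fin r) : Bool :=
  decide (DependsOn (fun y => f fun t => y (B t)) l ∧ ∃ τ ∈ T.vars, B τ = l ∧ x τ = true)

/-- A relevant block receives the value of `x` at its only tree variable. The zeros put on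
irrelevant blocks do not change `f`; they are chosen because they are what a read returns there. -/
theorem eval_blockValues (x : Fin n → Bool) : (f fun t => blockValues f T B x (B t)) = f x := by
  classical
  have h1 := eq_of_dependsOn (F := fun y : Fin r → Bool => f fun t => y (B t))
    (y := blockValues f T B x) (y' := fun l => decide (∃ τ ∈ T.vars, B τ = l ∧ x τ = true))
    fun l hl => by simp [blockValues, hl]
  refine h1.trans ?_
  simp only [← hT]
  refine T.eval_congr fun i hi => ?_
  cases hx : x i
  · simp only [decide_eq_false_iff_not]
    rintro ⟨τ, hτ, he, h⟩
    rw [hB hτ hi he, hx] at h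
    cases h
  · simp only [decide_eq_true_eq]
    exact ⟨i, hi, rfl, hx⟩

/-- By injectivity a block contains at most one variable of the tree. If it contains one, the hybrid
acts as changing a single block value; if not, neither `z` nor the value of the block matters. -/
theorem hybrid_cases (l : Fin r) :
    (∃ τ ∈ T.vars, B τ = l ∧ ∀ y z, f (hybrid B l y z) =
      f fun t => Function.update y l (z τ) (B t)) ∨
    ((∀ y z, f (hybrid B l y z) = f fun t => y (B t)) ∧
      ¬ DependsOn (fun y => f fun t => y (B t)) l) := by
  simp only [← hT]
  by_cases h : ∃ τ ∈ T.vars, B τ = l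
  · obtain ⟨τ, hτ, rfl⟩ := h
    refine .inl ⟨τ, hτ, rfl, fun y z => T.eval_congr fun t ht => ?_⟩
    by_cases he : B t = B τ
    · rw [he, Function.update_self, hybrid, if_pos (by rw [he]), hB ht hτ he]
    · rw [Function.update_of_ne he, hybrid, if_neg fun h => he (Fin.ext h)]
  · push Not at h
    refine .inr ⟨fun y z => T.eval_congr fun t ht => ?_, fun ⟨y, hy⟩ => hy ?_⟩
    · rw [hybrid, if_neg fun h' => h t ht (Fin.ext h')]
    · refine T.eval_congr fun t ht => ?_
      rw [Function.update_of_ne (h t ht), Function.update_of_ne (h t ht)]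

/-- At a row sensitive to a relevant block, the restricted function is a coordinate or its negation,
and the negation cancels between the two queries, for every shift `u`. For an irrelevant block the
restricted function is constant and the read is zero. -/
theorem read_blockFun {l : Fin r} {y : Fin r → Bool}
    (hy : DependsOn (fun y => f fun t => y (B t)) l →
      (f fun t => Function.update y l false (B t)) ≠ f fun t => Function.update y l true (B t))
    (p u : Fin n → Bool) :
    (blockFun f B l y u ^^ blockFun f B l y (xorVec u p)) = blockValues f T B p l := by
  unfold blockFun
  rcases hybrid_cases hT hB l with ⟨τ, hτ, hBτ, h⟩ | ⟨h, hd⟩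
  · simp only [h]
    by_cases hd : DependsOn (fun y => f fun t => y (B t)) l
    · have e : blockValues f T B p l = p τ := by
        simp only [blockValues, hd, true_and]
        cases hp : p τ
        · simp only [decide_eq_false_iff_not]
          rintro ⟨τ', hτ', he, h'⟩
          rw [hB hτ' hτ (he.trans hBτ.symm), hp] at h'
          cases h'
        · simp only [decide_eq_true_eq]
          exact ⟨τ, hτ, hBτ, hp⟩
      have := hy hd
      have h2 : ∀ b, (f fun t => Function.update y l b (B t)) =
          (b ^^ f fun t => Function.update y l false (B t)) := by
        intro b
        revert this
        cases b
        · simp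
        · cases f fun t => Function.update y l false (B t) <;>
            cases f fun t => Function.update y l true (B t) <;> simp
      rw [e, h2 (u τ), h2 (xorVec u p τ), xorVec]
      cases u τ <;> cases p τ <;> cases f fun t => Function.update y l false (B t) <;> rfl
    · have := not_not.1 (not_exists.1 hd y)
      simp only at this
      have h2 : ∀ b, (f fun t => Function.update y l b (B t)) =
          f fun t => Function.update y l true (B t) := fun b => by cases b <;> simp [this]
      rw [h2 (u τ), h2 (xorVec u p τ)]
      simp [blockValues, hd]
  · rw [h, h]
    simp [blockValues, hd]

omit hT in
theorem blockValues_cases (l : Fin r) :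
    (∃ τ, ∀ p, blockValues f T B p l = p τ) ∨ ∀ p, blockValues f T B p l = false := by
  by_cases h : DependsOn (fun y => f fun t => y (B t)) l ∧ ∃ τ ∈ T.vars, B τ = l
  · obtain ⟨hd, τ, hτ, hBτ⟩ := h
    refine .inl ⟨τ, fun p => ?_⟩
    simp only [blockValues, hd, true_and]
    cases hp : p τ
    · simp only [decide_eq_false_iff_not]
      rintro ⟨τ', hτ', he, h'⟩
      rw [hB hτ' hτ (he.trans hBτ.symm), hp] at h'
      cases h'
    · simp only [decide_eq_true_eq]
      exact ⟨τ, hτ, hBτ, hp⟩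
  · refine .inr fun p => ?_
    simp only [blockValues, decide_eq_false_iff_not]
    rintro ⟨hd, τ, hτ, hBτ, -⟩
    exact h ⟨hd, τ, hτ, hBτ⟩

end

/-- With a good partition and good samples, all rounds accept. -/
theorem expect_rounds_of_good {d : ℕ} {f : (Fin n → Bool) → Bool} {D : PMF (Fin n → Bool)}
    {T : DTree n} (hT : ∀ x, T.eval x = f x) {B : Fin n → Fin (numBlocks d)}
    (hB : Set.InjOn B T.vars) {Y : Fin (numSamples d) → Fin (numBlocks d) → Bool}
    (hY : GoodSamples d (fun y => f fun t => y (B t)) Y) {tree : ℕ → ℕ}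
    {wit : ℕ → Fin (numSamples d)} (hc : Consistent f B Y tree wit)
    {h : ℕ → (Fin n → Bool) → Bool} (hh : ∀ i < 2 ^ d, h i = blockFun f B (tree i) (Y (wit i)))
    (k : ℕ) : expect (roundsPMF f D d h tree k) ind = 1 := by
  have hF := hY.fits tree ⟨hc.label, hc.leaf⟩ hc.fits
  have hs := sensitive_iff hF
  refine expect_roundsPMF (g := fun i p => extend (blockValues f T B p) (tree i))
    (fun i hi p => readPMF_eq_pure fun u => ?_) (fun i hi => ?_) (fun x => ?_) k
  · have hl := hc.label i hi
    simp only [hh i hi, extend, hl, dif_pos]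
    refine read_blockFun hT hB (l := ⟨tree i, hl⟩) (fun hd => ?_) p u
    obtain ⟨s, h'⟩ := hY.sensitive _ hd
    -- Since the tree computes `F`, sensitivity of the tree is sensitivity of `F`; a good sample
    -- array contains a sensitive row, so the stored witness is one.
    exact (hs _ ⟨tree i, hl⟩).1 (hc.wit i hi ⟨s, (hs _ ⟨tree i, hl⟩).2 h'⟩)
  · have hl := hc.label i hi
    simp only [extend, hl, dif_pos]
    exact blockValues_cases hB _
  -- The exact reads follow the tree on the block values of `x`, where `F` takes the value `f x`.
  · have := detWalk_treeWalk (g := fun i p => extend (blockValues f T B p) (tree i)) (x := x)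
      (tree := tree) (y := extend (blockValues f T B x)) d 0 fun i _ => rfl
    rw [zero_add] at this
    have h2 := hF (blockValues f T B x)
    rw [eval_blockValues hT hB] at h2
    exact (congrArg tree this).trans h2

end DTTest

namespace DTTest
variable {n : ℕ} {M : Oracle n}

/-! ### The resource bounds -/

theorem succ_le_two_pow (d : ℕ) : d + 1 ≤ 2 ^ d := Nat.lt_two_pow_self

theorem numSamples_le (d : ℕ) : numSamples d ≤ 8 * (d + 1) * (2 ^ d * 2 ^ d) := by
  unfold numSamples
  nlinarith [Nat.zero_le (2 ^ d * 2 ^ d * d)]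

theorem numSamples_le' (d : ℕ) : numSamples d ≤ 8 * (2 ^ d) ^ 3 := by
  refine (numSamples_le d).trans ?_
  calc 8 * (d + 1) * (2 ^ d * 2 ^ d) ≤ 8 * 2 ^ d * (2 ^ d * 2 ^ d) := by
        gcongr; exact succ_le_two_pow d
    _ = _ := by ring

/-- All quantities are at most a constant times `b ^ 5`, where `b` is the two-power of the summed
sizes and `b ≥ 4`. The tenth power of `b` leaves room for the constants. -/
theorem fits_wordLength {d m : ℕ} (hm : 0 < m) (hw : M.w = wordLength 10 n d m) :
    Fits M d m ∧ 1000 < wordCap M.w ∧ 300 * (d + 1) < wordCap M.w := by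
  set b := 2 ^ (Nat.size n + d + Nat.size m + 1) with hb
  have hcap : wordCap M.w = b ^ 10 := by
    rw [wordCap, hw, wordLength, hb, ← pow_mul, mul_comm]
  have hbn : n ≤ b := (Nat.lt_size_self n).le.trans (Nat.pow_le_pow_right (by norm_num) (by omega))
  have hbm : m ≤ b := (Nat.lt_size_self m).le.trans (Nat.pow_le_pow_right (by norm_num) (by omega))
  have hbD : 2 ^ d ≤ b := Nat.pow_le_pow_right (by norm_num) (by omega)
  have hbd : d + 1 ≤ b := (succ_le_two_pow d).trans hbD
  have hb4 : 4 ≤ b := by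
    have : 0 < Nat.size m := Nat.size_pos.2 hm
    calc 4 = 2 ^ 2 := by norm_num
      _ ≤ b := Nat.pow_le_pow_right (by norm_num) (by omega)
  have h5 : ∀ k ≤ 5, b ^ k ≤ b ^ 5 := fun k hk => Nat.pow_le_pow_right (by omega) hk
  have hb5 : 1024 ≤ b ^ 5 := (by norm_num : 1024 = 4 ^ 5).le.trans (Nat.pow_le_pow_left hb4 5)
  have hlt : 1000 * b ^ 5 < b ^ 10 := by
    rw [show b ^ 10 = b ^ 5 * b ^ 5 by ring]
    exact Nat.mul_lt_mul_of_pos_right (by omega) (by omega)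
  have hS : numSamples d ≤ 8 * b ^ 3 := (numSamples_le' d).trans (by gcongr)
  have hr : numBlocks d ≤ 8 * b ^ 2 := by
    rw [numBlocks_eq, mul_assoc, sq]
    gcongr
  have hSr : numSamples d * numBlocks d ≤ 64 * b ^ 5 :=
    (Nat.mul_le_mul hS hr).trans (by ring_nf; exact le_rfl)
  have hR : numRounds d m ≤ 300 * b ^ 2 := by
    rw [numRounds, mul_assoc, sq]
    gcongr
  have h1 := h5 1 (by norm_num)
  rw [pow_one] at h1
  have h2 := h5 2 (by norm_num)
  have h3 := h5 3 (by norm_num)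
  rw [Fits, hcap]
  omega

/-- With `8 * (2 ^ d) ^ 2` labels and two children each, a level multiplies the time by `16 * (2 ^
d) ^ 2`; doubling this factor absorbs the additive terms, because the time is at least `1110`. -/
theorem searchTime_le (d k : ℕ) :
    searchTime d k ≤ 1110 * (2 ^ d) ^ 4 * (32 * (2 ^ d) ^ 2) ^ k := by
  have hD : 1 ≤ 2 ^ d := Nat.one_le_two_pow
  induction k with
  | zero =>
    rw [searchTime, leafCheckTime, pow_zero, mul_one]
    have h1 : d * 80 + 120 ≤ 120 * 2 ^ d := by have := succ_le_two_pow d; omega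
    have h2 := Nat.mul_le_mul (numSamples_le' d) h1
    have h3 : 1 ≤ (2 ^ d) ^ 4 := Nat.one_le_pow _ _ hD
    rw [show 8 * (2 ^ d) ^ 3 * (120 * 2 ^ d) = 960 * (2 ^ d) ^ 4 by ring] at h2
    omega
  | succ k ih =>
    rw [searchTime, numBlocks_eq]
    set t := 1110 * (2 ^ d) ^ 4 * (32 * (2 ^ d) ^ 2) ^ k
    have ht : 1110 ≤ t := by
      have h1 : 1 ≤ (2 ^ d) ^ 4 := Nat.one_le_pow _ _ hD
      have h2 : 1 ≤ (32 * (2 ^ d) ^ 2) ^ k := Nat.one_le_pow _ _ (by positivity)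
      calc 1110 = 1110 * 1 * 1 := by norm_num
        _ ≤ t := Nat.mul_le_mul (Nat.mul_le_mul_left _ h1) h2
    have e : 1110 * (2 ^ d) ^ 4 * (32 * (2 ^ d) ^ 2) ^ (k + 1) = 32 * (2 ^ d) ^ 2 * t := by
      rw [pow_succ]; ring
    rw [e, show 8 * 2 ^ d * 2 ^ d = 8 * (2 ^ d) ^ 2 by ring]
    have h1 : 1 ≤ (2 ^ d) ^ 2 := Nat.one_le_pow _ _ hD
    nlinarith [Nat.mul_le_mul_left ((2 ^ d) ^ 2) ih, Nat.mul_le_mul_left ((2 ^ d) ^ 2) ht]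

theorem testerQueries_le (d m : ℕ) :
    testerQueries d m ≤ (d + 1) * (8 * (2 ^ d * 2 ^ d) + 3300 * (m * 2 ^ d)) := by
  have h1 := numSamples_le d
  have h2 : 1 + 2 ^ d * 8 + d * 2 ≤ 11 * 2 ^ d := by have := succ_le_two_pow d; omega
  have h3 := Nat.mul_le_mul_left (numRounds d m) h2
  rw [testerQueries, verifyQueries]
  refine (add_le_add h1 h3).trans (le_of_eq ?_)
  rw [numRounds]
  ring

/-- Rounds have overhead that does not scale with `n`; as `m` may not enter the first summand, this
overhead is charged to the second one, which requires `n` to be positive. The exponent of the search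
is `2 d ^ 2 + 9 d ≤ 11 d ^ 2`. -/
theorem testerTime_le (d m : ℕ) (hn : 0 < n) :
    testerTime n d m ≤ 10000 * 2 ^ (11 * d ^ 2) +
      n * ((d + 1) * (700 * (2 ^ d * 2 ^ d) + 1500000 * (m * 2 ^ d))) := by
  have hd := succ_le_two_pow d
  have hD : 1 ≤ 2 ^ d := Nat.one_le_two_pow
  have hS := numSamples_le d
  have hS' := numSamples_le' d
  have hdd : d ≤ d ^ 2 := by nlinarith [Nat.zero_le d, sq d, Nat.le_self_pow two_ne_zero d]
  have hE : 2 ^ (11 * d) ≤ 2 ^ (11 * d ^ 2) := Nat.pow_le_pow_right (by norm_num) (by omega)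
  have h5 : (2 ^ d) ^ 5 ≤ 2 ^ (11 * d ^ 2) := by
    rw [← pow_mul]
    exact Nat.pow_le_pow_right (by norm_num) (by omega)
  have hsearch : searchTime d d ≤ 1110 * 2 ^ (11 * d ^ 2) := by
    refine (searchTime_le d d).trans ?_
    have : (2 ^ d) ^ 4 * (32 * (2 ^ d) ^ 2) ^ d = 2 ^ (d * 4 + 5 * d + d * 2 * d) := by
      rw [show 32 = 2 ^ 5 by norm_num, mul_pow, pow_add, pow_add, pow_mul, pow_mul, pow_mul, pow_mul,
        mul_assoc]
    rw [mul_assoc, this]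
    refine Nat.mul_le_mul_left _ (Nat.pow_le_pow_right (by norm_num) ?_)
    nlinarith
  have hpow : ∀ k ≤ 5, (2 ^ d) ^ k ≤ (2 ^ d) ^ 5 := fun k hk => Nat.pow_le_pow_right hD hk
  have a1 : numSamples d * (numBlocks d * 35) ≤ 2240 * (2 ^ d) ^ 5 := by
    rw [numBlocks_eq]
    exact (Nat.mul_le_mul_right _ hS').trans (by ring_nf; exact le_rfl)
  have a2 : numSamples d * 220 ≤ 1760 * (2 ^ d) ^ 5 := by
    have := hpow 3 (by norm_num)
    omega
  have a3 : 2 ^ d * (numSamples d * (d * 160 + 220)) ≤ 1760 * (2 ^ d) ^ 5 := by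
    have : d * 160 + 220 ≤ 220 * 2 ^ d := by omega
    exact (Nat.mul_le_mul_left _ (Nat.mul_le_mul hS' this)).trans (by ring_nf; exact le_rfl)
  have a4 : 2 ^ d ≤ (2 ^ d) ^ 5 := by simpa using hpow 1 (by norm_num)
  have b1 : n * (80 * d + 180) ≤ n * ((d + 1) * (180 * (2 ^ d * 2 ^ d))) := by
    refine Nat.mul_le_mul_left _ ?_
    calc 80 * d + 180 ≤ (d + 1) * (180 * (1 * 1)) := by omega
      _ ≤ _ := by gcongr
  have b2 : numSamples d * (60 * n) ≤ n * ((d + 1) * (480 * (2 ^ d * 2 ^ d))) :=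
    (Nat.mul_le_mul_right _ hS).trans (by ring_nf; exact le_rfl)
  have b3 : numRounds d m * (2 ^ d * (2000 * n + 2020) + d * (300 * n + 320) + n + 220) ≤
      n * ((d + 1) * (1500000 * (m * 2 ^ d))) := by
    have c1 : 2 ^ d * (2000 * n + 2020) ≤ 2 ^ d * (4020 * n) := by gcongr; omega
    have c2 : d * (300 * n + 320) ≤ 2 ^ d * (620 * n) := by gcongr <;> omega
    have c3 : n + 220 ≤ 2 ^ d * (221 * n) := by nlinarith
    have c : 2 ^ d * (2000 * n + 2020) + d * (300 * n + 320) + n + 220 ≤ 5000 * (2 ^ d * n) := by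
      nlinarith
    refine (Nat.mul_le_mul_left _ c).trans (le_of_eq ?_)
    rw [numRounds]
    ring
  have e1 : numSamples d * (numBlocks d * 35 + 60 * n + 220) = numSamples d * (numBlocks d * 35) +
    numSamples d * (60 * n) + numSamples d * 220 := by ring
  have e2 : 2 ^ d * (numSamples d * (d * 160 + 220) + 60) =
    2 ^ d * (numSamples d * (d * 160 + 220)) + 60 * 2 ^ d := by ring
  have e3 : n * ((d + 1) * (700 * (2 ^ d * 2 ^ d) + 1500000 * (m * 2 ^ d))) =
    n * ((d + 1) * (180 * (2 ^ d * 2 ^ d))) + n * ((d + 1) * (480 * (2 ^ d * 2 ^ d))) +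
    n * ((d + 1) * (40 * (2 ^ d * 2 ^ d))) + n * ((d + 1) * (1500000 * (m * 2 ^ d))) := by ring
  rw [testerTime, verifyTime, e1, e2, e3]
  omega

/-- Since `X ≥ 4 ^ d` and `log 4 ≥ 1`, one factor `1 + log X` absorbs the factor `d + 1`; the
rounding in `m` costs at most `2 ^ d ≤ 4 ^ d`. -/
theorem softBound_ge {C d a b m : ℕ} {ε : ℝ} (hε : 0 < ε) (hm : (m : ℝ) ≤ 1 / ε + 1)
    (hC : a + b ≤ C) (hC' : C ≠ 0) :
    (((d + 1) * (a * (2 ^ d * 2 ^ d) + b * (m * 2 ^ d)) : ℕ) : ℝ) ≤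
      softBound C (2 ^ (2 * d) + 2 ^ d / ε) := by
  set X : ℝ := 2 ^ (2 * d) + 2 ^ d / ε with hX
  have hD : (1 : ℝ) ≤ 2 ^ d := one_le_pow₀ (by norm_num)
  have hsq : (2 : ℝ) ^ (2 * d) = 2 ^ d * 2 ^ d := by rw [two_mul, pow_add]
  have hpos : 0 ≤ 2 ^ d / ε := by positivity
  have hX1 : (2 : ℝ) ^ d * 2 ^ d ≤ X := by rw [hX, hsq]; linarith
  have hX2 : (m : ℝ) * 2 ^ d ≤ X := by
    calc (m : ℝ) * 2 ^ d ≤ (1 / ε + 1) * 2 ^ d := by gcongr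
      _ = 2 ^ d / ε + 2 ^ d := by ring
      _ ≤ X := by rw [hX, hsq]; nlinarith
  have hXpos : 0 < X := lt_of_lt_of_le (by positivity) hX1
  have hlog : (d : ℝ) ≤ Real.log X := by
    have h1 : Real.log (2 ^ d * 2 ^ d) ≤ Real.log X := Real.log_le_log (by positivity) hX1
    rw [Real.log_mul (by positivity) (by positivity), Real.log_pow] at h1
    have h2 := Real.log_two_gt_d9
    have h3 : (d : ℝ) * (1 / 2) ≤ d * Real.log 2 := by gcongr; linarith
    linarith
  have hd0 : (0 : ℝ) ≤ d := Nat.cast_nonneg d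
  have hpow : (d : ℝ) + 1 ≤ (1 + Real.log X) ^ C :=
    (by linarith : (d : ℝ) + 1 ≤ 1 + Real.log X).trans (le_self_pow₀ (by linarith) hC')
  have hC2 : (a : ℝ) + b ≤ C := by exact_mod_cast hC
  push_cast
  calc ((d : ℝ) + 1) * (a * (2 ^ d * 2 ^ d) + b * (m * 2 ^ d))
      ≤ (d + 1) * (a * X + b * X) := by gcongr
    _ = ((a + b) * X) * (d + 1) := by ring
    _ ≤ (C * X) * (1 + Real.log X) ^ C := by gcongr
    _ = _ := rfl

/-! ### The main theorem -/

/-- The reward one with value one shows that, after `T` steps, a halted configuration within the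
resources is reached with probability one, hence everywhere on the support. The other two bounds are
applied to the indicators of acceptance and rejection. -/
theorem testsWithin_of_bounds {P : Prog} {w n d : ℕ} {ε : ℝ} {f : (Fin n → Bool) → Bool}
    {D : PMF (Fin n → Bool)} {q T : ℕ} {q' T' : ℝ} (hq : (q : ℝ) ≤ q') (hT : (T : ℝ) ≤ T') {σ : St}
    (hσ : Rep (initConfig P n d ⌈1 / ε⌉₊) σ) (h1 : Bounds ⟨w, f, D⟩ P σ T q (fun _ => 1) 1)
    (h2 : f ∈ DT n d → Bounds ⟨w, f, D⟩ P σ T q (fun σ' => ind (decide (σ'.reg 0 ≠ 0))) (2 / 3))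
    (h3 : IsFar D ε f (DT n d) →
      Bounds ⟨w, f, D⟩ P σ T q (fun σ' => ind (!decide (σ'.reg 0 ≠ 0))) (2 / 3)) :
    TestsWithin P w n d ε f D q' T' := by
  classical
  set s₀ := initConfig P n d ⌈1 / ε⌉₊
  have key : ∀ (S : Set Config) (Φ : St → ℝ≥0∞) (v : ℝ≥0∞), (∀ s ∈ S, s.ctrl = []) →
      (∀ s' σ', Rep s' σ' → s'.ctrl = [] → s'.time ≤ T → s'.queries ≤ q →
        Φ σ' ≤ if s' ∈ S then 1 else 0) → Bounds ⟨w, f, D⟩ P σ T q Φ v →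
      v ≤ (run w f D s₀ T).toOuterMeasure S := by
    intro S Φ v hS hΦ hB
    rw [toOuterMeasure_eq_expect, expect_run ⟨w, f, D⟩]
    have := hB s₀ [] 0 (fun s => if s ∈ S then 1 else 0) hσ rfl
      (fun s hs => if_neg fun h => hs (hS s h)) fun s' σ' hr hc ht hq' =>
        hΦ s' σ' hr hc (by simpa [s₀, initConfig] using ht) (by simpa [s₀, initConfig] using hq')
    rwa [zero_add] at this
  refine ⟨T, ?_, fun hf => ?_, fun hf => ?_⟩
  · have h := key {s | s.ctrl = [] ∧ s.queries ≤ q ∧ s.time ≤ T} _ _ (fun s hs => hs.1)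
      (fun s' σ' _ hc ht hq' => by
        rw [if_pos (show s' ∈ {s : Config | s.ctrl = [] ∧ s.queries ≤ q ∧ s.time ≤ T} from
          ⟨hc, hq', ht⟩)]) h1
    have h' := (PMF.toOuterMeasure_apply_eq_one_iff _ _).1
      (le_antisymm (by
      rw [toOuterMeasure_eq_expect]
      exact expect_le_of_forall_le _ fun s => by split_ifs <;> simp) h)
    intro s hs
    obtain ⟨g1, g2, g3⟩ := h' hs
    exact ⟨g1, le_trans (by exact_mod_cast g2) hq, le_trans (by exact_mod_cast g3) hT⟩
  · refine key {s | s.Accepts} _ _ (fun s hs => hs.1) (fun s' σ' hr hc _ _ => ?_) (h2 hf)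
    rw [← hr.1 0 (by norm_num)]
    by_cases h : s'.reg 0 = 0 <;> simp [Config.Accepts, Config.Halted, hc, h]
  · refine key {s | s.Rejects} _ _ (fun s hs => hs.1) (fun s' σ' hr hc _ _ => ?_) (h3 hf)
    rw [← hr.1 0 (by norm_num)]
    by_cases h : s'.reg 0 = 0 <;> simp [Config.Rejects, Config.Halted, hc, h]

end DTTest

/-! ### Assembly of correctness and resource bounds -/

namespace DTTest
variable {n : ℕ} {M : Oracle n}

/-- For `n = 0` the time bound does not depend on `ε`, so no rounds are affordable; none are needed,
since every function on a single point is a leaf. -/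
theorem bounds_tester_zero {σ : St} (hw : 1000 < wordCap M.w) (h0 : σ.reg 0 = 0)
    (φ : Bool → ℝ≥0∞) :
    Bounds M tester σ 20 0 (fun σ' => φ (decide (σ'.reg 0 ≠ 0))) (φ true) := by
  have ha : Det M (assign 0 (.const 1)) σ ((Expr.const 1).cost + 4) 0 fun σ' =>
      σ' = σ.set 0 (σ.eval (.const 1)) := det_assign (by norm_num) (by simp; omega)
        (by simp [St.eval]; omega)
  refine (bounds_cond (T := 10) (q := 0) (v := φ true) (by simp) (fun hc => ?_) fun _ => ?_).weaken
    (by simp) le_rfl (fun _ => le_rfl) le_rfl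
  · simp [St.eval, h0] at hc
  · have := ha (fun σ' => φ (decide (σ'.reg 0 ≠ 0))) (fun _ => φ true) (by
      rintro _ _ rfl
      simp [St.eval])
    rw [expect_const] at this
    exact this.weaken (by simp) le_rfl (fun _ => le_rfl) le_rfl

theorem two_thirds_le : (2 / 3 : ℝ≥0∞) ≤ 7 / 8 * (7 / 8) := by
  rw [ENNReal.div_le_iff (by simp) (by simp)]
  have : (7 / 8 * (7 / 8) * 3 : ℝ≥0∞) = 147 / 64 := by
    rw [div_eq_mul_inv, div_eq_mul_inv, show (7 * 8⁻¹ * (7 * 8⁻¹) * 3 : ℝ≥0∞) =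
      (7 * 7 * 3) * (8⁻¹ * 8⁻¹) by ring, ← ENNReal.mul_inv (by simp) (by simp)]
    norm_num
  rw [this, ENNReal.le_div_iff_mul_le (by simp) (by simp)]
  norm_num

theorem bounds_tester_complete {d m : ℕ} (hF : Fits M d m) (hw : 1000 < wordCap M.w) (hn : 0 < n)
    (hR : 300 * (d + 1) < wordCap M.w) {σ : St} (h0 : σ.reg 0 = n) (h1 : σ.reg 1 = d)
    (h2 : σ.reg 2 = m) (hmem : ∀ a, σ.mem a = 0) (hf : M.f ∈ DT n d) :
    Bounds M tester σ (testerTime n d m) (testerQueries d m)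
      (fun σ' => ind (decide (σ'.reg 0 ≠ 0))) (2 / 3) := by
  classical
  obtain ⟨T, hTd, hT⟩ := hf
  -- On the good event acceptance is certain; elsewhere the claimed bound is zero.
  refine (bounds_tester hF hw hn hR h0 h1 h2 hmem (φ := ind) (v := fun B Y =>
    if Set.InjOn B T.vars ∧ GoodSamples d (fun y => M.f fun t => y (B t)) Y then 1 else 0)
    (fun B Y tree wit h hc hh => ?_) fun B Y Y' L hY hL hs => ?_).weaken le_rfl le_rfl
    (fun _ => le_rfl) ?_
  · split_ifs with hg
    · exact (expect_rounds_of_good hT hg.1 hg.2 hc hh _).ge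
    · exact zero_le
  -- The search cannot fail here: the tree of `f`, relabelled by blocks, is consistent with all
  -- samples.
  · refine absurd ?_ hs
    obtain ⟨T', hT'd, hT'⟩ := mem_DT_comp B ⟨T, hTd, hT⟩
    refine separable_of_tree (numBlocks_pos d) d T' _ hT'd fun s hs => ?_
    rw [hL ⟨s, hs⟩, hT']
    simp only [← hY ⟨s, hs⟩]
  · refine two_thirds_le.trans ?_
    have hV : T.vars.card ≤ 2 ^ d :=
      T.card_vars_lt.le.trans (Nat.pow_le_pow_right (by norm_num) hTd)
    refine (mul_le_mul_right (injOn_probability T.vars hV) _).trans ?_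
    rw [← expect_mul_left]
    refine expect_mono _ fun B => ?_
    by_cases hB : Set.InjOn B T.vars
    · simp only [hB, if_true, true_and, mul_one]
      exact goodSamples_probability (mem_DT_comp B ⟨T, hTd, hT⟩)
    · simp [hB]

theorem bounds_tester_sound {d m : ℕ} (hF : Fits M d m) (hw : 1000 < wordCap M.w) (hn : 0 < n)
    (hR : 300 * (d + 1) < wordCap M.w) {σ : St} (h0 : σ.reg 0 = n) (h1 : σ.reg 1 = d)
    (h2 : σ.reg 2 = m) (hmem : ∀ a, σ.mem a = 0) {ε : ℝ} (hm : 0 < m) (hε : 1 / (m : ℝ) ≤ ε)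
    (hf : IsFar M.D ε M.f (DT n d)) :
    Bounds M tester σ (testerTime n d m) (testerQueries d m)
      (fun σ' => ind (!decide (σ'.reg 0 ≠ 0))) (2 / 3) := by
  refine (bounds_tester hF hw hn hR h0 h1 h2 hmem (φ := fun b => ind (!b)) (v := fun _ _ => 2 / 3)
    (fun B Y tree wit h _ _ => soundness hm hε hf h tree) fun _ _ _ _ _ _ _ => ?_).weaken
    le_rfl le_rfl (fun _ => le_rfl) (by simp)
  rw [Bool.not_false, ind_true]
  exact ENNReal.div_le_of_le_mul (by norm_num)

theorem bounds_tester_halts {d m : ℕ} (hF : Fits M d m) (hw : 1000 < wordCap M.w) (hn : 0 < n)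
    (hR : 300 * (d + 1) < wordCap M.w) {σ : St} (h0 : σ.reg 0 = n) (h1 : σ.reg 1 = d)
    (h2 : σ.reg 2 = m) (hmem : ∀ a, σ.mem a = 0) :
    Bounds M tester σ (testerTime n d m) (testerQueries d m) (fun _ => 1) 1 :=
  (bounds_tester hF hw hn hR h0 h1 h2 hmem (φ := fun _ => 1) (v := fun _ _ => 1)
    (fun _ _ _ _ _ _ _ => by simp) fun _ _ _ _ _ _ _ => le_rfl).weaken
    le_rfl le_rfl (fun _ => le_rfl) (by simp)

theorem testsWithin_tester {C : ℕ} (hC : 2000000 ≤ C) {d : ℕ} {ε : ℝ} (hε : 0 < ε)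
    (f : (Fin n → Bool) → Bool) (D : PMF (Fin n → Bool)) :
    TestsWithin tester (wordLength 10 n d ⌈1 / ε⌉₊) n d ε f D
      (softBound C (2 ^ (2 * d) + 2 ^ d / ε))
      (C * 2 ^ (C * d ^ 2) + n * softBound C (2 ^ (2 * d) + 2 ^ d / ε)) := by
  set m := ⌈1 / ε⌉₊ with hm
  have hm0 : 0 < m := Nat.ceil_pos.2 (by positivity)
  have hm1 : (m : ℝ) ≤ 1 / ε + 1 := (Nat.ceil_lt_add_one (by positivity)).le
  have hm2 : 1 / (m : ℝ) ≤ ε := (one_div_le (by positivity) hε).2 (Nat.le_ceil _)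
  obtain ⟨hF, hw, hR⟩ := fits_wordLength (M := ⟨wordLength 10 n d m, f, D⟩) hm0 rfl
  have hsoft : 0 ≤ softBound C (2 ^ (2 * d) + 2 ^ d / ε) := by
    have := softBound_ge (a := 0) (b := 0) hε hm1 (by omega : 0 + 0 ≤ C) (by omega) (d := d)
    simpa using this
  have hrep : Rep (initConfig tester n d m)
      ⟨(initConfig tester n d m).reg, (initConfig tester n d m).mem⟩ := ⟨fun _ _ => rfl, rfl⟩
  rcases Nat.eq_zero_or_pos n with rfl | hn
  · refine testsWithin_of_bounds (q := 0) (T := 20) (by simpa using hsoft) ?_ hrep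
      (bounds_tester_zero hw rfl fun _ => 1) (fun _ => ?_) fun hf => ?_
    · have : (1 : ℝ) ≤ 2 ^ (C * d ^ 2) := one_le_pow₀ (by norm_num)
      have hC' : ((20 : ℕ) : ℝ) ≤ C := Nat.cast_le.2 (by omega)
      rw [Nat.cast_zero, zero_mul, add_zero]
      exact hC'.trans (le_mul_of_one_le_right (Nat.cast_nonneg C) this)
    · refine (bounds_tester_zero hw rfl ind).weaken le_rfl le_rfl (fun _ => le_rfl) ?_
      exact ENNReal.div_le_of_le_mul (by norm_num)
    -- No function of zero variables is far from the class, as it is itself a leaf.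
    · have := hf f ⟨.leaf (f default), Nat.zero_le _, fun x => by
        rw [Subsingleton.elim x default]; rfl⟩
      simp at this
  · refine testsWithin_of_bounds (q := testerQueries d m) (T := testerTime n d m) ?_ ?_ hrep
      (bounds_tester_halts hF hw hn hR rfl rfl rfl fun _ => rfl)
      (bounds_tester_complete hF hw hn hR rfl rfl rfl fun _ => rfl)
      (bounds_tester_sound hF hw hn hR rfl rfl rfl (fun _ => rfl) hm0 hm2)
    · exact (Nat.cast_le.2 (testerQueries_le d m)).trans
        (softBound_ge hε hm1 (by omega) (by omega))
    · refine (Nat.cast_le.2 (testerTime_le d m hn)).trans ?_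
      rw [Nat.cast_add, Nat.cast_mul n]
      refine add_le_add ?_ (mul_le_mul_of_nonneg_left
        (softBound_ge hε hm1 (by omega) (by omega)) (Nat.cast_nonneg n))
      push_cast
      gcongr
      · exact_mod_cast (by omega : 10000 ≤ C)
      · norm_num
      · omega

end DTTest

theorem mainTheorem11 :
    ∃ (P : DTTest.Prog) (c C : ℕ), 0 < c ∧
      ∀ (n d : ℕ) (ε : ℝ), 0 < ε →
        ∀ (f : (Fin n → Bool) → Bool) (D : PMF (Fin n → Bool)),
          DTTest.TestsWithin P (DTTest.wordLength c n d ⌈1 / ε⌉₊) n d ε f D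
            (DTTest.softBound C (2 ^ (2 * d) + 2 ^ d / ε))
            (C * 2 ^ (C * d ^ 2) + n * DTTest.softBound C (2 ^ (2 * d) + 2 ^ d / ε)) := by
  -- Only the lower bound is used; the constant dominates the factors `1500000` and `700` of the
  -- time bound and is kept abstract so that powers of it are never evaluated.
  obtain ⟨C, hC⟩ : ∃ C : ℕ, 2000000 ≤ C := ⟨_, le_rfl⟩
  exact ⟨DTTest.tester, 10, C, by norm_num, fun n d ε hε f D =>
    DTTest.testsWithin_tester hC hε f D⟩
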